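/- **Conventions.** Manifolds are connected, Hausdorff, second countable and without boundary; manifolds, mappings, distributions, connections and tensor fields are $C^\infty$; pseudo-Riemannian metrics may have any signature, and bundle projections are locally trivial. A distribution $\mathcal P$ is parallel for a connection $\nabla$ if $\nabla_a X$ is tangent to $\mathcal P$ for every local section $X$ of $\mathcal P$ and every vector $a$; it is null for $g$ if $g=0$ on $\mathcal P\times\mathcal P$. A local leaf space of an integrable distribution $\mathcal V$ on $M$ is the base $B$ of a bundle projection $f:U\to B$, with $U\subseteq M$ open, whose fibres are the leaves of $\mathcal V$ restricted to $U$. A vector field $X$ on an open set $U'$ is $\mathcal V$-projectable if, for every such $f:U\to B$ with $U\subseteq U'$, there is a vector field $Y$ on $B$ with $df_x(X_x)=Y_{f(x)}$ for all $x\in U$. A torsion-free connection $\nabla$ on $M$ is projectable along $\mathcal V$ if $\nabla_XY$ is $\mathcal V$-projectable whenever $X,Y$ are $\mathcal V$-projectable vector fields on an open subset of $M$. We say that $\nabla$ projects under $f:U\to B$ onto a connection $D$ on $B$ if, on open subsets of $U$, $\nabla_XY$ projects under $f$ onto $D_{X'}Y'$ whenever $X,Y$ project under $f$ onto $X',Y'$.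 **Bundles of cotangent-principal bundles.** Such a bundle consists of a bundle projection $q:Q\to\Sigma$ and an affine bundle $p:M\to Q$ with associated vector bundle $q^*T^*\Sigma$. Set $\pi=q\circ p$, $\mathcal P=\mathrm{Ker}\,dp$, $\mathcal V=\mathrm{Ker}\,d\pi$; thus $\mathcal P_x=T^*_{\pi(x)}\Sigma$ canonically. A section $\omega$ of $q^*T^*\Sigma$ acts as a diffeomorphism $\omega:M\to M$, by the translation by $\omega_z$ in $p^{-1}(z)$, $z\in Q$. Let $D$ be a torsion-free connection on $\Sigma$. The Killing operator sends $\omega$ to the symmetric tensor field $\mathcal L\omega$ on $Q$ with $(\mathcal L\omega)(a,b)=(D_a\omega)(dq\,b)+(D_b\omega)(dq\,a)$, where $D$ also denotes the connection in $q^*T^*\Sigma$ that is the $q$-pullback of the dual of $D$. Let $h$ be a vertical metric on $Q$, that is, a pseudo-Riemannian fibre metric in $\mathrm{Ker}\,dq$; it consists of metrics $h_y$ on the fibres $Q_y=q^{-1}(y)$. A *Riemann pullback-extension* for $D,Q,h$ is a pseudo-Riemannian metric $g$ on $M$ such that (i) $g_x(\xi,w)=\xi(d\pi_x w)$ for all $x\in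 M$, $\xi\in\mathcal P_x=T^*_{\pi(x)}\Sigma$ and $w\in T_xM$; (ii) $\omega^*g=g+p^*\mathcal L\omega$ for all sections $\omega$ of $q^*T^*\Sigma$; (iii) $g$ restricted to each fibre $\pi^{-1}(y)$, $y\in\Sigma$, equals $p^*h_y$. **Theorem 8.2.** (1) Let $g$ be a Riemann pullback-extension for $D,Q,h$ as above, with Levi-Civita connection $\nabla$. Then $\mathcal P$ and $\mathcal V$ are each other's $g$-orthogonal complements, $\mathcal P$ is $g$-null and $\nabla$-parallel, $\nabla$ is projectable along both $\mathcal P$ and $\mathcal V$, it projects under $\pi$ onto $D$, and $h$ arises from $g$: for each $y\in\Sigma$, $h_y$ is the unique metric on $Q_y$ whose $p$-pullback is the restriction of $g$ to $\pi^{-1}(y)$. (2) Conversely, let the Levi-Civita connection $\nabla$ of a pseudo-Riemannian metric $g$ on an $n$-dimensional manifold $N$ be projectable along a null parallel distribution $\mathcal P$ of dimension $r$, and let $\mathcal V=\mathcal P^\perp$. Then, for every $x\in N$, there exist a bundle of cotangent-principal bundles $M\to Q\to\Sigma$ with $\dim M=n$, $\dim Q=n-r$, $\dim\Sigma=r$,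 a torsion-free connection $D$ on $\Sigma$, a vertical metric $h$ on $Q$, a Riemann pullback-extension $\hat g$ for $D,Q,h$, and a diffeomorphism $\Phi$ of a neighborhood $U$ of $x$ in $N$ onto an open subset of $M$ such that, on $U$, $g=\Phi^*\hat g$ and $\mathcal P$ corresponds under $\Phi$ to $\mathrm{Ker}\,dp$; moreover, $p\circ\Phi:U\to Q$ and $\pi\circ\Phi:U\to\Sigma$ are bundle projections having as their fibres the leaves of $\mathcal P$ and, respectively, $\mathcal V$ restricted to $U$; $\nabla$ projects under $\pi\circ\Phi$ onto $D$; and $h$ arises from $g$, so that, for each $y\in\Sigma$, $h_y$ is the unique metric on $Q_y$ whose pullback under $p\circ\Phi$ is the restriction of $g$ to the leaf $(\pi\circ\Phi)^{-1}(y)$ of $\mathcal V$. -/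

import Mathlib

open Bundle Set
open scoped Manifold ContDiff Topology

universe u v w

/-- An `n`-dimensional smooth manifold: Hausdorff, second countable, without boundary and
connected. -/
structure Mfd (n : ℕ) where
  carrier : Type u
  [top : TopologicalSpace carrier]
  [charted : ChartedSpace (EuclideanSpace ℝ (Fin n)) carrier]
  [smooth : IsManifold (𝓡 n) ∞ carrier]
  [hausdorff : T2Space carrier]
  [secondCountable : SecondCountableTopology carrier]
  [connected : ConnectedSpace carrier]

instance (n : ℕ) : CoeSort (Mfd.{u} n) (Type u) := ⟨Mfd.carrier⟩

attribute [instance] Mfd.top Mfd.charted Mfd.smooth Mfd.hausdorff Mfd.secondCountable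
  Mfd.connected

noncomputable section

/-! ### Vector fields, distributions, metrics and connections -/

section Basic

variable {n : ℕ} {M : Mfd.{u} n}

/-- Vector fields (smoothness is imposed separately, on the open set where it is wanted). -/
abbrev VField (M : Mfd.{u} n) := Π x : M, TangentSpace (𝓡 n) x

/-- The cotangent space at `y`. -/
abbrev Cotangent (M : Mfd.{u} n) (y : M) := TangentSpace (𝓡 n) y →L[ℝ] ℝ

/-- The vector field `X` is smooth on `U`. -/
def SmoothFieldOn (X : VField M) (U : Set M) : Prop :=
  ContMDiffOn (𝓡 n) (𝓡 n).tangent ∞ (fun x => (⟨x, X x⟩ : TangentBundle (𝓡 n) M)) U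

/-- A field of tangent subspaces. -/
abbrev SubspaceField (M : Mfd.{u} n) := Π x : M, Submodule ℝ (TangentSpace (𝓡 n) x)

/-- `P` is a smooth distribution of dimension `r`. -/
def IsDistribution (P : SubspaceField M) (r : ℕ) : Prop :=
  ∀ x : M, ∃ U : Set M, IsOpen U ∧ x ∈ U ∧ ∃ X : Fin r → VField M,
    (∀ i, SmoothFieldOn (X i) U) ∧
    ∀ y ∈ U, LinearIndependent ℝ (fun i => X i y) ∧
      P y = Submodule.span ℝ (Set.range fun i => X i y)

/-- Involutivity (equivalently, integrability) of a distribution. -/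
def IsInvolutive (P : SubspaceField M) : Prop :=
  ∀ (U : Set M) (X Y : VField M), IsOpen U → SmoothFieldOn X U → SmoothFieldOn Y U →
    (∀ x ∈ U, X x ∈ P x) → (∀ x ∈ U, Y x ∈ P x) →
    ∀ x ∈ U, VectorField.mlieBracket (𝓡 n) X Y x ∈ P x

/-- A pseudo-Riemannian metric: a smooth symmetric nondegenerate twice-covariant tensor field,
of any signature. -/
structure PseudoRiemannianMetric (M : Mfd.{u} n) where
  form (x : M) : TangentSpace (𝓡 n) x →L[ℝ] TangentSpace (𝓡 n) x →L[ℝ] ℝ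
  symm (x : M) (a b : TangentSpace (𝓡 n) x) : form x a b = form x b a
  nondegenerate (x : M) (a : TangentSpace (𝓡 n) x) : (∀ b, form x a b = 0) → a = 0
  contMDiff : ContMDiff (𝓡 n)
    ((𝓡 n).prod 𝓘(ℝ, EuclideanSpace ℝ (Fin n) →L[ℝ] EuclideanSpace ℝ (Fin n) →L[ℝ] ℝ)) ∞
    (fun x => TotalSpace.mk' (EuclideanSpace ℝ (Fin n) →L[ℝ] EuclideanSpace ℝ (Fin n) →L[ℝ] ℝ)
      x (form x))

/-- The `g`-orthogonal complement of a field of subspaces. -/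
def orthComplement (g : PseudoRiemannianMetric M) (P : SubspaceField M) : SubspaceField M := fun x =>
  { carrier := {a | ∀ b ∈ P x, g.form x a b = 0}
    add_mem' := fun {a a'} ha ha' b hb => by
      have h₁ : g.form x a b = 0 := ha b hb
      have h₂ : g.form x a' b = 0 := ha' b hb
      simp [h₁, h₂]
    zero_mem' := fun b _ => by simp
    smul_mem' := fun c a ha b hb => by
      have h₁ : g.form x a b = 0 := ha b hb
      simp [h₁] }

/-- `P` is `g`-null. -/
def IsNull (g : PseudoRiemannianMetric M) (P : SubspaceField M) : Prop :=
  ∀ x : M, ∀ a ∈ P x, ∀ b ∈ P x, g.form x a b = 0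

/-- Affine connections on `M`; `∇_a X` at `x` is `nabla X x a`. -/
abbrev Connection (M : Mfd.{u} n) :=
  CovariantDerivative (𝓡 n) (EuclideanSpace ℝ (Fin n)) (TangentSpace (𝓡 n) : M → Type)

/-- A smooth torsion-free connection. -/
structure IsTorsionFreeConnection (D : Connection M) : Prop where
  smooth : CovariantDerivative.ContMDiffCovariantDerivative D ∞
  torsion_eq_zero : D.torsion = 0

/-- `nabla` is the Levi-Civita connection of `g`. -/
structure IsLeviCivita (g : PseudoRiemannianMetric M) (nabla : Connection M) : Prop where
  torsionFree : IsTorsionFreeConnection nabla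
  metric (x : M) (X Y : VField M) (a : TangentSpace (𝓡 n) x) :
    MDifferentiableAt (𝓡 n) (𝓡 n).tangent (fun y => (⟨y, X y⟩ : TangentBundle (𝓡 n) M)) x →
    MDifferentiableAt (𝓡 n) (𝓡 n).tangent (fun y => (⟨y, Y y⟩ : TangentBundle (𝓡 n) M)) x →
    mvfderiv (𝓡 n) (fun y => g.form y (X y) (Y y)) x a =
      g.form x (nabla X x a) (Y x) + g.form x (X x) (nabla Y x a)

/-- `P` is parallel: covariant derivatives of local sections of `P` are sections of `P`. -/
def IsParallel (nabla : Connection M) (P : SubspaceField M) : Prop :=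
  ∀ (U : Set M) (X : VField M), IsOpen U → SmoothFieldOn X U → (∀ x ∈ U, X x ∈ P x) →
    ∀ x ∈ U, ∀ a : TangentSpace (𝓡 n) x, nabla X x a ∈ P x

end Basic

/-! ### Bundle projections, local leaf spaces and projectability -/

section Projectability

variable {n k : ℕ} {M : Mfd.{u} n} {B : Mfd.{v} k}

/-- The restriction of `f` to the open set `U` is a smooth locally trivial fibre bundle over `B`.
(The fibres embed in `M`, so having the typical fibre `F` in the lowest universe is no
restriction.) -/
structure IsBundleProjectionOn (f : M → B) (U : Set M) : Prop where
  isOpen : IsOpen U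
  contMDiffOn : ContMDiffOn (𝓡 n) (𝓡 k) ∞ f U
  surjOn : SurjOn f U univ
  locallyTrivial : ∀ b : B, ∃ W : Set B, IsOpen W ∧ b ∈ W ∧
    ∃ (l : ℕ) (F : Type) (_ : TopologicalSpace F)
      (_ : ChartedSpace (EuclideanSpace ℝ (Fin l)) F) (_ : IsManifold (𝓡 l) ∞ F)
      (e : OpenPartialHomeomorph M (B × F)),
      e.source = U ∩ f ⁻¹' W ∧ e.target = W ×ˢ univ ∧ (∀ x ∈ e.source, (e x).1 = f x) ∧
      ContMDiffOn (𝓡 n) ((𝓡 k).prod (𝓡 l)) ∞ e e.source ∧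
      ContMDiffOn ((𝓡 k).prod (𝓡 l)) (𝓡 n) ∞ e.symm e.target

/-- The vertical distribution of a mapping, `Ker df`. -/
def vertical (f : M → B) : SubspaceField M := fun x =>
  LinearMap.ker (mfderiv (𝓡 n) (𝓡 k) f x).toLinearMap

/-- The leaves of `V` restricted to the open set `U` are the fibres of the bundle projection
`f : U → B`: the fibres are connected and tangent to `V`. -/
structure IsLocalLeafSpace (V : SubspaceField M) (U : Set M) (f : M → B) : Prop where
  bundle : IsBundleProjectionOn f U
  ker_eq : ∀ x ∈ U, vertical f x = V x
  connected : ∀ b : B, IsConnected (U ∩ f ⁻¹' {b})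

/-- The vector field `X` on the open set `U` is `V`-projectable, that is, projectable under every
bundle projection `f : U' → B` with `U' ⊆ U` having the leaves of `V` restricted to `U'` as its
fibres. (Every manifold is diffeomorphic to one in the lowest universe.) -/
def IsProjectableField (V : SubspaceField M) (U : Set M) (X : VField M) : Prop :=
  ∀ (k : ℕ) (B : Mfd.{0} k) (U' : Set M) (f : M → B), U' ⊆ U → IsLocalLeafSpace V U' f →
    ∃ Y : VField B, SmoothFieldOn Y univ ∧ ∀ x ∈ U', mfderiv (𝓡 n) (𝓡 k) f x (X x) = Y (f x)

/-- The connection `nabla` is projectable along the integrable distribution `V`. -/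
structure IsProjectableAlong (nabla : Connection M) (V : SubspaceField M) : Prop where
  involutive : IsInvolutive V
  projectable : ∀ (U : Set M) (X Y : VField M), IsOpen U → SmoothFieldOn X U →
    SmoothFieldOn Y U → IsProjectableField V U X → IsProjectableField V U Y →
    IsProjectableField V U (fun x => nabla Y x (X x))

/-- `nabla`, on the open set `U`, projects under `f` onto the connection `D` on `B`: if vector
fields `X, Y` on an open subset of `U` project onto `X', Y'`, then `∇_X Y` projects
onto `D_{X'} Y'`. -/
def ProjectsOnto (nabla : Connection M) (U : Set M) (f : M → B) (D : Connection B) : Prop :=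
  ∀ (U' : Set M) (O : Set B) (X Y : VField M) (X' Y' : VField B),
    IsOpen U' → U' ⊆ U → IsOpen O → MapsTo f U' O →
    SmoothFieldOn X U' → SmoothFieldOn Y U' → SmoothFieldOn X' O → SmoothFieldOn Y' O →
    (∀ x ∈ U', mfderiv (𝓡 n) (𝓡 k) f x (X x) = X' (f x)) →
    (∀ x ∈ U', mfderiv (𝓡 n) (𝓡 k) f x (Y x) = Y' (f x)) →
    ∀ x ∈ U', mfderiv (𝓡 n) (𝓡 k) f x (nabla Y x (X x)) = D Y' (f x) (X' (f x))

end Projectability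

/-! ### Vertical metrics -/

section VerticalMetrics

variable {n m r : ℕ} {M : Mfd.{u} n} {Q : Mfd.{v} m} {S : Mfd.{w} r}

/-- A vertical metric on `Q`: a smooth pseudo-Riemannian fibre metric in the vertical distribution
of `q : Q → S`. -/
structure VerticalMetric (q : Q → S) where
  form (z : Q) : LinearMap.BilinForm ℝ (vertical q z)
  symm (z : Q) (a b : vertical q z) : form z a b = form z b a
  nondegenerate (z : Q) (a : vertical q z) : (∀ b, form z a b = 0) → a = 0
  smooth (O : Set Q) (X Y : Π z : Q, vertical q z) : IsOpen O →
    SmoothFieldOn (fun z => (X z : TangentSpace (𝓡 m) z)) O →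
    SmoothFieldOn (fun z => (Y z : TangentSpace (𝓡 m) z)) O →
    ContMDiffOn (𝓡 m) 𝓘(ℝ, ℝ) ∞ (fun z => form z (X z) (Y z)) O

/-- At points of `U`, the restriction of `g` to each fibre of `q ∘ p` is the `p`-pullback of the
family `h` of bilinear forms in the vertical spaces of `q`. (A vector is tangent to the fibre of
`q ∘ p` if and only if its `p`-image is vertical for `q`.) -/
def RestrictsToPullback (g : PseudoRiemannianMetric M) (U : Set M) (p : M → Q) (q : Q → S)
    (h : Π z : Q, LinearMap.BilinForm ℝ (vertical q z)) : Prop :=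
  ∀ x ∈ U, ∀ (a b : TangentSpace (𝓡 n) x)
    (ha : mfderiv (𝓡 n) (𝓡 m) p x a ∈ vertical q (p x))
    (hb : mfderiv (𝓡 n) (𝓡 m) p x b ∈ vertical q (p x)),
    g.form x a b = h (p x) ⟨mfderiv (𝓡 n) (𝓡 m) p x a, ha⟩ ⟨mfderiv (𝓡 n) (𝓡 m) p x b, hb⟩

/-- The vertical metric `h` arises from `g` on `U`: it is the unique one whose `p`-pullback is the
restriction of `g` to the fibres of `q ∘ p`. -/
structure ArisesFrom (g : PseudoRiemannianMetric M) (U : Set M) (p : M → Q) (q : Q → S)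
    (h : VerticalMetric q) : Prop where
  restricts : RestrictsToPullback g U p q h.form
  unique (h' : Π z : Q, LinearMap.BilinForm ℝ (vertical q z)) :
    RestrictsToPullback g U p q h' → ∀ x ∈ U, h' (p x) = h.form (p x)

end VerticalMetrics

/-! ### Bundles of cotangent-principal bundles and Riemann pullback-extensions -/

section Extensions

variable {n m r : ℕ} {M : Mfd.{u} n} {Q : Mfd.{v} m} {S : Mfd.{w} r}

/-- `M` is a bundle of cotangent-principal bundles over `S`: a bundle projection `q : Q → S`, and
an affine bundle `p : M → Q` with the associated vector bundle `q^*(T^*S)`. Local triviality of the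
affine bundle: over a neighbourhood `O` of any point of `Q` there is a section `s` for which
`(z, ξ) ↦ s z + ξ` is a diffeomorphism of `q^*(T^*S)` over `O` onto `p⁻¹(O)`. -/
structure CotangentPrincipalBundle (M : Mfd.{u} n) (Q : Mfd.{v} m) (S : Mfd.{w} r) where
  p : M → Q
  q : C^∞⟮𝓡 m, Q; 𝓡 r, S⟯
  p_smooth : ContMDiff (𝓡 n) (𝓡 m) ∞ p
  q_bundle : IsBundleProjectionOn (q : Q → S) univ
  /-- the affine-space structure of each fibre -/
  affine (z : Q) : AddTorsor (Cotangent S (q z)) (p ⁻¹' {z})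
  locallyTrivial : ∀ z₀ : Q, ∃ O : Set Q, IsOpen O ∧ z₀ ∈ O ∧ ∃ s : Π z : Q, p ⁻¹' {z},
    ContMDiffOn ((𝓡 m).prod 𝓘(ℝ, EuclideanSpace ℝ (Fin r) →L[ℝ] ℝ)) (𝓡 n) ∞
      (fun ζ : TotalSpace (EuclideanSpace ℝ (Fin r) →L[ℝ] ℝ)
          ((q : Q → S) *ᵖ (fun y : S => TangentSpace (𝓡 r) y →L[ℝ] ℝ)) =>
        ((show Cotangent S (q ζ.1) from ζ.2) +ᵥ s ζ.1).1)
      (TotalSpace.proj ⁻¹' O) ∧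
    ContMDiffOn (𝓡 n) ((𝓡 m).prod 𝓘(ℝ, EuclideanSpace ℝ (Fin r) →L[ℝ] ℝ)) ∞
      (fun x : M => (⟨p x, show Cotangent S (q (p x)) from (⟨x, rfl⟩ : p ⁻¹' {p x}) -ᵥ s (p x)⟩ :
        TotalSpace (EuclideanSpace ℝ (Fin r) →L[ℝ] ℝ)
          ((q : Q → S) *ᵖ (fun y : S => TangentSpace (𝓡 r) y →L[ℝ] ℝ))))
      (p ⁻¹' O)

attribute [instance] CotangentPrincipalBundle.affine

namespace CotangentPrincipalBundle

variable (C : CotangentPrincipalBundle M Q S)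

/-- The projection `π = q ∘ p : M → S`. -/
def proj : M → S := fun x => C.q (C.p x)

/-- The point `x + ξ` of the fibre of `p` through `x`. -/
def translate (x : M) (ξ : Cotangent S (C.q (C.p x))) : M :=
  (ξ +ᵥ (⟨x, rfl⟩ : C.p ⁻¹' {C.p x})).1

/-- The vector at `x`, tangent to the fibre of `p`, that corresponds to `ξ` under the
identification of the tangent space of an affine space with its translation vector space:
the velocity of `t ↦ x + tξ` at `t = 0`. -/
def fibreVector (x : M) (ξ : Cotangent S (C.q (C.p x))) : TangentSpace (𝓡 n) x :=
  mfderiv 𝓘(ℝ, ℝ) (𝓡 n) (fun t : ℝ => C.translate x (t • ξ)) 0 (1 : ℝ)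

/-- Sections of `q^*(T^*S)` over `Q`. -/
abbrev PullbackForm := Π z : Q, Cotangent S (C.q z)

/-- Smoothness of a section of `q^*(T^*S)`, treated as a cotangent-valued mapping along `q`. -/
def SmoothForm (α : C.PullbackForm) : Prop :=
  ContMDiff (𝓡 m) ((𝓡 r).prod 𝓘(ℝ, EuclideanSpace ℝ (Fin r) →L[ℝ] ℝ)) ∞
    (fun z : Q => (TotalSpace.mk' (EuclideanSpace ℝ (Fin r) →L[ℝ] ℝ) (C.q z) (α z) :
      TotalSpace (EuclideanSpace ℝ (Fin r) →L[ℝ] ℝ)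
        (fun y : S => TangentSpace (𝓡 r) y →L[ℝ] ℝ)))

/-- The mapping `M → M` that acts by the translation by `α z` in the fibre over each `z`. -/
def translation (α : C.PullbackForm) : M → M := fun x => C.translate x (α (C.p x))

/-- `(D_a α)(η)` for the `q`-pullback of the connection in `T^*S` dual to `D`, by the product rule
`(D_a α)(Y) = d_a [α(Y ∘ q)] - α(D_{dq a} Y)`, with `Y` the vector field on `S`, smooth near `q z`,
that extends `η`. -/
def formDeriv (D : Connection S) (α : C.PullbackForm) (z : Q) (a : TangentSpace (𝓡 m) z)
    (η : TangentSpace (𝓡 r) (C.q z)) : ℝ :=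
  mvfderiv (𝓡 m)
    (fun z' : Q => α z' (FiberBundle.extend (EuclideanSpace ℝ (Fin r)) η (C.q z'))) z a -
  α z (D (FiberBundle.extend (EuclideanSpace ℝ (Fin r)) η) (C.q z)
    (mfderiv (𝓡 m) (𝓡 r) C.q z a))

/-- The Killing operator: twice the symmetrization of `Dα`, a twice-covariant tensor on `Q`. -/
def killing (D : Connection S) (α : C.PullbackForm) (z : Q) (a b : TangentSpace (𝓡 m) z) : ℝ :=
  C.formDeriv D α z a (mfderiv (𝓡 m) (𝓡 r) C.q z b) +
    C.formDeriv D α z b (mfderiv (𝓡 m) (𝓡 r) C.q z a)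

end CotangentPrincipalBundle

/-- `g` is a Riemann pullback-extension for `D`, `Q` and `h`. -/
structure IsRiemannPullbackExtension (C : CotangentPrincipalBundle M Q S) (D : Connection S)
    (h : VerticalMetric (C.q : Q → S)) (g : PseudoRiemannianMetric M) : Prop where
  standardType (x : M) (ξ : Cotangent S (C.q (C.p x))) (a : TangentSpace (𝓡 n) x) :
    g.form x (C.fibreVector x ξ) a = ξ (mfderiv (𝓡 n) (𝓡 r) C.proj x a)
  transformation (α : C.PullbackForm) : C.SmoothForm α →
    ∀ (x : M) (a b : TangentSpace (𝓡 n) x),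
      g.form (C.translation α x) (mfderiv (𝓡 n) (𝓡 n) (C.translation α) x a)
          (mfderiv (𝓡 n) (𝓡 n) (C.translation α) x b) =
        g.form x a b + C.killing D α (C.p x) (mfderiv (𝓡 n) (𝓡 m) C.p x a)
          (mfderiv (𝓡 n) (𝓡 m) C.p x b)
  restricts : RestrictsToPullback g univ C.p C.q h.form

end Extensions

end

/-!
Everything is local, so both halves are proved in charts with values in normed spaces
(`SmoothChart`), where a metric is its Gram form `gram` and a connection its Christoffel symbols
`christoffel`; the two are linked by the Koszul formula `SmoothChart.koszul`. Coordinates are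
written `((y, z), ξ)` in `(ℝʳ × ℝˡ) × (ℝʳ)*`, with `p` forgetting `ξ` and `π` keeping only `y`.

*From a pullback-extension to its Levi-Civita connection.* Charts of this form exist, and the
fibres of `p` are translated by adding covectors to `ξ` (`exists_adaptedChart`). The
transformation law, applied to a form that is constant near a point, says that the metric is
affine along the fibres of `p`, with slope `-2 Γ`, where `Γ` are the Christoffel symbols of the
base (`AdaptedChart.gram_add`), while `g((0, η), b) = η(dy b)` (`AdaptedChart.gram_vertical`). By
the Koszul formula the Christoffel symbols of `g` then have the base component `Γ` and descend to
the quotients by `Ker dp` and by `Ker dπ` (`AdaptedChart.christoffel_proj`,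
`invariant_vertical_p`, `invariant_vertical_proj`). Descending to the quotient in such charts is
projectability (`isProjectableAlong_of_charts`, `projectsOnto_of_charts`): a field projects
exactly if its derivatives along the distribution are tangent to the distribution.

*From the Levi-Civita connection to a pullback-extension.* The complement of a null parallel
distribution `P` is involutive, so it consists of the tangent spaces to the fibres of a submersion
`y` (`exists_submersion_of_involutive`). The metric duals of the differentials of the components
of `y` span `P` and commute, as their covariant derivatives in the directions of `P` vanish
(`exists_dual_frame`). Straightening them simultaneously (`exists_straightening`, by a fixed point
argument for integral curves in `C([0, 1], E)`) gives coordinates with `g((0, η), b) = η(dy b)`,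
and after a change of coordinates also a domain that is a bundle of open balls in covector spaces
(`exists_nullBox`). In such a box the first components of the Christoffel symbols are the
derivatives of the metric along `P`, up to the factor `-2`. Projectability along `P` says that the
Christoffel symbols are constant along `P` modulo `P`; the Koszul formula, differentiated along
`P`, turns this into the statement that their first components are constant along the complement
of `P` (`fderiv_christoffel_kerProj`), hence come from a connection on `ℝʳ`
(`christoffel_eq_base`). The metric is therefore affine along `P`, with the slope given by this
connection (`gram_eq_base`), and this affine expression, extended from the box to all covectors,
is a pullback-extension over vector spaces (`isRiemannPullbackExtension_modelMetric`).
-/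

noncomputable section

/-! ### Inverse functions and flows in normed spaces -/

section InverseFunction

variable {E F : Type*} [NormedAddCommGroup E] [NormedSpace ℝ E] [CompleteSpace E]
  [NormedAddCommGroup F] [NormedSpace ℝ F]

/-- The smooth inverse function theorem, with smoothness of both maps on whole open sets. -/
theorem exists_openPartialHomeomorph_of_contDiffOn {f : E → F} {U : Set E} {x₀ : E}
    (hU : IsOpen U) (hx : x₀ ∈ U) (hf : ContDiffOn ℝ ∞ f U)
    (e : E ≃L[ℝ] F) (he : fderiv ℝ f x₀ = e) :
    ∃ θ : OpenPartialHomeomorph E F, x₀ ∈ θ.source ∧ θ.source ⊆ U ∧ (∀ x, θ x = f x) ∧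
      ContDiffOn ℝ ∞ θ θ.source ∧ ContDiffOn ℝ ∞ θ.symm θ.target := by
  have hfa : ∀ x ∈ U, ContDiffAt ℝ ∞ f x := fun x hx => hf.contDiffAt (hU.mem_nhds hx)
  have hd : HasFDerivAt f (e : E →L[ℝ] F) x₀ := by
    rw [← he]; exact ((hfa x₀ hx).differentiableAt (by simp)).hasFDerivAt
  let θ₀ := (hfa x₀ hx).toOpenPartialHomeomorph f hd (by simp)
  have hcont : ContinuousOn (fderiv ℝ f) U := hf.continuousOn_fderiv_of_isOpen hU (by simp)
  have hV : IsOpen (U ∩ fderiv ℝ f ⁻¹' range ((↑) : (E ≃L[ℝ] F) → E →L[ℝ] F)) :=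
    hcont.isOpen_inter_preimage hU ContinuousLinearEquiv.isOpen
  let θ := θ₀.restrOpen _ hV
  have hθf : ∀ x, θ x = f x := fun x => rfl
  have hsrc : θ.source ⊆ U ∩ fderiv ℝ f ⁻¹' range ((↑) : (E ≃L[ℝ] F) → E →L[ℝ] F) :=
    fun x hx => hx.2
  refine ⟨θ, ⟨(hfa x₀ hx).mem_toOpenPartialHomeomorph_source hd (by simp), hx, e, he.symm⟩,
    fun x hx => (hsrc hx).1, hθf, hf.mono fun x hx => (hsrc hx).1, fun y hy => ?_⟩
  have hy' := hsrc (θ.map_target hy)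
  obtain ⟨e', he'⟩ := hy'.2
  refine (θ.contDiffAt_symm (f₀' := e') hy ?_ (hfa _ hy'.1)).contDiffWithinAt
  rw [he']
  exact ((hfa _ hy'.1).differentiableAt (by simp)).hasFDerivAt

end InverseFunction

section Superposition

set_option synthInstance.maxHeartbeats 200000

variable {I : Type*} [TopologicalSpace I] [CompactSpace I]

/-- A continuous bilinear map, acting pointwise on continuous functions. -/
def pointwiseCLM (I : Type*) [TopologicalSpace I] [CompactSpace I]
    {G E F : Type*} [NormedAddCommGroup G] [NormedSpace ℝ G] [NormedAddCommGroup E]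
    [NormedSpace ℝ E] [NormedAddCommGroup F] [NormedSpace ℝ F] (B : G →L[ℝ] E →L[ℝ] F) :
    C(I, G) →L[ℝ] C(I, E) →L[ℝ] C(I, F) :=
  LinearMap.mkContinuous₂
    (LinearMap.mk₂ ℝ (fun (A : C(I, G)) (h : C(I, E)) =>
      (⟨fun t => B (A t) (h t), by fun_prop⟩ : C(I, F)))
      (fun A B h => by ext; simp) (fun c A h => by ext; simp)
      (fun A h k => by ext; simp) (fun c A h => by ext; simp)) ‖B‖
    (fun A h => by
      rw [ContinuousMap.norm_le _ (by positivity)]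
      intro t
      refine (B.le_opNorm₂ (A t) (h t)).trans ?_
      gcongr
      · exact A.norm_coe_le_norm t
      · exact h.norm_coe_le_norm t)

@[simp] theorem pointwiseCLM_apply {G E F : Type*} [NormedAddCommGroup G] [NormedSpace ℝ G]
    [NormedAddCommGroup E] [NormedSpace ℝ E]
    [NormedAddCommGroup F] [NormedSpace ℝ F] (B : G →L[ℝ] E →L[ℝ] F) (A : C(I, G)) (h : C(I, E))
    (t : I) : pointwiseCLM I B A h t = B (A t) (h t) := rfl

theorem hasFDerivAt_continuousMap_comp {E F : Type*} [NormedAddCommGroup E] [NormedSpace ℝ E]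
    [NormedAddCommGroup F] [NormedSpace ℝ F] (f : C(E, F)) (f' : C(E, E →L[ℝ] F))
    (hf : ∀ x, HasFDerivAt f (f' x) x) (γ : C(I, E)) :
    HasFDerivAt (fun γ : C(I, E) => f.comp γ)
      (pointwiseCLM I (.id ℝ (E →L[ℝ] F)) (f'.comp γ)) γ := by
  rw [hasFDerivAt_iff_isLittleO_nhds_zero, Asymptotics.isLittleO_iff]
  intro ε hε
  have hc : Continuous fun γ : C(I, E) => f'.comp γ := f'.continuous_postcomp
  obtain ⟨δ, hδ, h⟩ := (Metric.continuous_iff (α := C(I, E)) (β := C(I, E →L[ℝ] F))).1 hc γ ε hε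
  filter_upwards [Metric.ball_mem_nhds (0 : C(I, E)) hδ] with k hk
  rw [mem_ball_zero_iff] at hk
  rw [ContinuousMap.norm_le _ (by positivity)]
  intro t
  have key : ∀ z ∈ segment ℝ (γ t) (γ t + k t), ‖f' z - f' (γ t)‖ ≤ ε := by
    intro z hz
    rw [segment_eq_image'] at hz
    obtain ⟨s, hs, rfl⟩ := hz
    have h1 : dist (γ + s • k) γ < δ := by
      rw [dist_eq_norm, add_sub_cancel_left, norm_smul, Real.norm_of_nonneg hs.1]
      exact (mul_le_of_le_one_left (norm_nonneg _) hs.2).trans_lt hk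
    have h2 := (ContinuousMap.dist_apply_le_dist (f := f'.comp (γ + s • k))
      (g := f'.comp γ) t).trans (h _ h1).le
    simpa [dist_eq_norm] using h2
  have := (convex_segment (𝕜 := ℝ) (γ t) (γ t + k t)).norm_image_sub_le_of_norm_hasFDerivWithin_le'
    (f := f) (f' := f') (φ := f' (γ t)) (C := ε)
    (fun z _ => (hf z).hasFDerivWithinAt) key (left_mem_segment ℝ _ _) (right_mem_segment ℝ _ _)
  simp only [ContinuousMap.coe_sub, Pi.sub_apply, ContinuousMap.comp_apply, ContinuousMap.add_apply,
    pointwiseCLM_apply]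
  refine le_trans (by simpa using this) ?_
  gcongr
  exact k.norm_coe_le_norm t

/-- Superposition with a smooth map is a smooth map of spaces of continuous functions. -/
theorem contDiff_continuousMap_comp_nat {E : Type u} [NormedAddCommGroup E] [NormedSpace ℝ E]
    (k : ℕ) : ∀ {F : Type u} [NormedAddCommGroup F] [NormedSpace ℝ F] (f : C(E, F)),
    ContDiff ℝ ∞ f → ContDiff ℝ k (fun γ : C(I, E) => f.comp γ) := by
  induction k with
  | zero =>
    intro F _ _ f hf
    exact contDiff_zero.2 f.continuous_postcomp
  | succ k ih =>
    intro F _ _ f hf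
    have hf' : ContDiff ℝ ∞ (fderiv ℝ f) := hf.fderiv_right (by simp)
    let f' : C(E, E →L[ℝ] F) := ⟨fderiv ℝ f, hf'.continuous⟩
    have := ih f' hf'
    rw [Nat.cast_succ, contDiff_succ_iff_hasFDerivAt]
    exact ⟨_, (pointwiseCLM I (.id ℝ (E →L[ℝ] F))).contDiff.comp this,
      hasFDerivAt_continuousMap_comp f f' fun x => (hf.differentiable (by simp) x).hasFDerivAt⟩

theorem contDiff_continuousMap_comp {E F : Type u} [NormedAddCommGroup E] [NormedSpace ℝ E]
    [NormedAddCommGroup F] [NormedSpace ℝ F] (f : C(E, F)) (hf : ContDiff ℝ ∞ f) :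
    ContDiff ℝ ∞ (fun γ : C(I, E) => f.comp γ) :=
  contDiff_infty.2 fun k => contDiff_continuousMap_comp_nat k f hf

end Superposition

section FixedPoint

variable {E F : Type*} [NormedAddCommGroup E] [NormedSpace ℝ E] [CompleteSpace E]
  [NormedAddCommGroup F] [NormedSpace ℝ F] [CompleteSpace F]

/-- A smooth fixed point problem `y = G (x, y)` whose linearization at a solution does not involve
`y` is smoothly solvable nearby; the linearized problem has no kernel at the solutions. -/
theorem exists_contDiffOn_fixedPoint {G : E × F → F} (hG : ContDiff ℝ ∞ G) {x₀ : E} {y₀ : F}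
    (h₀ : G (x₀, y₀) = y₀) (hd : ∀ h : F, fderiv ℝ G (x₀, y₀) (0, h) = 0) :
    ∃ (N : Set E) (ψ : E → F), IsOpen N ∧ x₀ ∈ N ∧ ψ x₀ = y₀ ∧ ContDiffOn ℝ ∞ ψ N ∧
      ∀ x ∈ N, G (x, ψ x) = ψ x ∧ ∀ h : F, fderiv ℝ G (x, ψ x) (0, h) = h → h = 0 := by
  -- the inverse function theorem for `(x, y) ↦ (x, y - G (x, y))`, whose derivative at the solution
  -- is triangular with identity blocks
  let H : E × F → E × F := fun p => (p.1, p.2 - G p)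
  have hH : ContDiff ℝ ∞ H := contDiff_fst.prodMk (contDiff_snd.sub hG)
  have hG' : ∀ p, HasFDerivAt G (fderiv ℝ G p) p := fun p =>
    (hG.differentiable (by simp) p).hasFDerivAt
  have hH' : ∀ p, HasFDerivAt H ((ContinuousLinearMap.fst ℝ E F).prod
      (ContinuousLinearMap.snd ℝ E F - fderiv ℝ G p)) p := fun p =>
    hasFDerivAt_fst.prodMk (hasFDerivAt_snd.sub (hG' p))
  let e : (E × F) ≃L[ℝ] (E × F) := (ContinuousLinearEquiv.refl ℝ E).skewProd
    (ContinuousLinearEquiv.refl ℝ F) (-(fderiv ℝ G (x₀, y₀)).comp (ContinuousLinearMap.inl ℝ E F))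
  have he : fderiv ℝ H (x₀, y₀) = e := by
    rw [(hH' _).fderiv]
    refine ContinuousLinearMap.ext fun ⟨a, b⟩ => ?_
    have : fderiv ℝ G (x₀, y₀) (a, b) = fderiv ℝ G (x₀, y₀) (a, 0) := by
      rw [← sub_eq_zero, ← map_sub]; simpa using hd b
    simp [e, this, sub_eq_add_neg]
  obtain ⟨θ, hθ0, -, hθ, hs, hs'⟩ := exists_openPartialHomeomorph_of_contDiffOn isOpen_univ
    (mem_univ (x₀, y₀)) hH.contDiffOn e he
  have hfst : ∀ p ∈ θ.target, (θ.symm p).1 = p.1 ∧ (θ.symm p).2 - G (θ.symm p) = p.2 := by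
    intro p hp
    have := θ.right_inv hp
    rw [hθ] at this
    have h1 : (H (θ.symm p)).1 = p.1 := by rw [this]
    have h2 : (H (θ.symm p)).2 = p.2 := by rw [this]
    exact ⟨h1, h2⟩
  have hval : θ (x₀, y₀) = (x₀, 0) := by rw [hθ]; simp [H, h₀]
  refine ⟨(fun x => (x, (0 : F))) ⁻¹' θ.target, fun x => (θ.symm (x, 0)).2,
    θ.open_target.preimage (by fun_prop), ?_, ?_, ?_, ?_⟩
  · show (x₀, (0 : F)) ∈ θ.target
    rw [← hval]; exact θ.map_source hθ0
  · show (θ.symm (x₀, 0)).2 = y₀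
    rw [← hval, θ.left_inv hθ0]
  · exact contDiff_snd.comp_contDiffOn (hs'.comp (by fun_prop) fun x hx => hx)
  · intro x hx
    have h1 := hfst _ hx
    have h2 : (x, (θ.symm (x, 0)).2) = θ.symm (x, 0) := Prod.ext h1.1.symm rfl
    refine ⟨?_, fun h hh => ?_⟩
    · rw [h2]; exact (sub_eq_zero.1 h1.2).symm
    · rw [h2] at hh
      have hdiff : DifferentiableAt ℝ θ.symm (x, 0) :=
        (hs'.contDiffAt (θ.open_target.mem_nhds hx)).differentiableAt (by simp)
      have hq : θ.symm (x, 0) ∈ θ.source := θ.map_target hx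
      -- `(0, h)` is in the kernel of the derivative of the local diffeomorphism `θ`
      have hcomp : HasFDerivAt (θ.symm ∘ θ) _ (θ.symm (x, 0)) :=
        HasFDerivAt.comp (θ.symm (x, 0)) (g := θ.symm)
          (by rw [θ.right_inv hx]; exact hdiff.hasFDerivAt)
          ((hH' (θ.symm (x, 0))).congr_of_eventuallyEq (Filter.Eventually.of_forall hθ))
      have hid : HasFDerivAt (θ.symm ∘ θ) (ContinuousLinearMap.id ℝ (E × F)) (θ.symm (x, 0)) :=
        (hasFDerivAt_id _).congr_of_eventuallyEq (by
          filter_upwards [θ.open_source.mem_nhds hq] with z hz using θ.left_inv hz)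
      have := congrArg (fun T : E × F →L[ℝ] E × F => T (0, h)) (hcomp.unique hid)
      simp only [ContinuousLinearMap.comp_apply, ContinuousLinearMap.prod_apply,
        _root_.sub_apply, ContinuousLinearMap.coe_fst', ContinuousLinearMap.coe_snd',
        hh, sub_self, ContinuousLinearMap.coe_id', id_eq] at this
      rw [Prod.mk_zero_zero, map_zero] at this
      exact (congrArg Prod.snd this).symm

end FixedPoint

section Flow

open unitInterval

set_option synthInstance.maxHeartbeats 200000

variable {E K : Type u} [NormedAddCommGroup E] [NormedSpace ℝ E]
  [NormedAddCommGroup K] [NormedSpace ℝ K]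

/-- Constant functions. -/
def constCLM (J : Type*) [TopologicalSpace J] [CompactSpace J] (E : Type*) [NormedAddCommGroup E]
    [NormedSpace ℝ E] : E →L[ℝ] C(J, E) :=
  LinearMap.mkContinuous
    { toFun := fun c => ContinuousMap.const J c
      map_add' := fun _ _ => rfl
      map_smul' := fun _ _ => rfl } 1
    (fun c => by
      rw [ContinuousMap.norm_le _ (by positivity)]
      intro t
      exact (one_mul ‖c‖).ge)

@[simp] theorem constCLM_apply (J : Type*) [TopologicalSpace J] [CompactSpace J]
    (E : Type*) [NormedAddCommGroup E]
    [NormedSpace ℝ E] (c : E) (t : J) : constCLM J E c t = c := rfl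

/-- The primitive on `[0, 1]` of a continuous function, vanishing at `0`. -/
def primitiveCLM (E : Type*) [NormedAddCommGroup E] [NormedSpace ℝ E] : C(I, E) →L[ℝ] C(I, E) :=
  LinearMap.mkContinuous
    { toFun := fun γ => ⟨fun t => ∫ s in (0 : ℝ)..t, γ (projIcc 0 1 zero_le_one s),
        (intervalIntegral.continuous_primitive (fun a b =>
          (γ.continuous.comp continuous_projIcc).intervalIntegrable a b) 0).comp
            continuous_subtype_val⟩
      map_add' := fun γ η => by
        ext t
        exact intervalIntegral.integral_add
          ((γ.continuous.comp continuous_projIcc).intervalIntegrable _ _)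
          ((η.continuous.comp continuous_projIcc).intervalIntegrable _ _)
      map_smul' := fun c γ => by
        ext t
        exact intervalIntegral.integral_smul c _ } 1
    (fun γ => by
      rw [ContinuousMap.norm_le _ (by positivity)]
      intro t
      refine (intervalIntegral.norm_integral_le_of_norm_le_const (C := ‖γ‖)
        fun s _ => γ.norm_coe_le_norm _).trans ?_
      rw [sub_zero, abs_of_nonneg t.2.1, one_mul]
      exact mul_le_of_le_one_right (norm_nonneg _) t.2.2)

theorem primitiveCLM_apply (γ : C(I, E)) (t : I) :
    primitiveCLM E γ t = ∫ s in (0 : ℝ)..t, γ (projIcc 0 1 zero_le_one s) := rfl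

/-- The right-hand side of the integral equation `γ(t) = c + ∫₀ᵗ L(γ(s)) w ds`, whose fixed points
are the integral curves of the field `x ↦ L(x) w` on `[0, 1]`; `p` stands for `((w, c), γ)`. Since
the parameter `w` scales time, short times correspond to small `w`. -/
def flowOperator (L : C(E, K →L[ℝ] E)) (p : (K × E) × C(I, E)) : C(I, E) :=
  constCLM I E p.1.2 + primitiveCLM E
    (pointwiseCLM I (.id ℝ (K →L[ℝ] E)) (L.comp p.2) (constCLM I K p.1.1))

theorem contDiff_flowOperator (L : C(E, K →L[ℝ] E)) (hL : ContDiff ℝ ∞ L) :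
    ContDiff ℝ ∞ (flowOperator L) := by
  have h1 : ContDiff ℝ ∞ fun p : (K × E) × C(I, E) => L.comp p.2 :=
    (contDiff_continuousMap_comp L hL).comp contDiff_snd
  have h2 : ContDiff ℝ ∞ fun p : (K × E) × C(I, E) => constCLM I K p.1.1 :=
    (constCLM I K).contDiff.comp (contDiff_fst.comp contDiff_fst)
  have h3 : ContDiff ℝ ∞ fun p : (K × E) × C(I, E) => constCLM I E p.1.2 :=
    (constCLM I E).contDiff.comp (contDiff_snd.comp contDiff_fst)
  have h4 := ((pointwiseCLM I (.id ℝ (K →L[ℝ] E))).contDiff.comp h1).clm_apply h2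
  exact h3.add ((primitiveCLM E).contDiff.comp h4)

theorem fderiv_flowOperator_apply (L : C(E, K →L[ℝ] E)) (hL : ContDiff ℝ ∞ L) (w : K) (c : E)
    (γ : C(I, E)) (w' : K) (c' : E) (h : C(I, E)) :
    fderiv ℝ (flowOperator L) ((w, c), γ) ((w', c'), h) = constCLM I E c' + primitiveCLM E
      ⟨fun t => fderiv ℝ L (γ t) (h t) w + L (γ t) w', by
        have := hL.continuous_fderiv (by simp)
        fun_prop⟩ := by
  let L' : C(E, E →L[ℝ] K →L[ℝ] E) := ⟨fderiv ℝ L, hL.continuous_fderiv (by simp)⟩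
  have h1 : HasFDerivAt (fun p : (K × E) × C(I, E) => L.comp p.2) _ ((w, c), γ) :=
    HasFDerivAt.comp ((w, c), γ) (f := fun p : (K × E) × C(I, E) => p.2)
      (g := fun γ : C(I, E) => L.comp γ) (hasFDerivAt_continuousMap_comp L L'
        (fun x => (hL.differentiable (by simp) x).hasFDerivAt) γ) hasFDerivAt_snd
  have h2 : HasFDerivAt (fun p : (K × E) × C(I, E) => constCLM I K p.1.1) _ ((w, c), γ) :=
    (constCLM I K).hasFDerivAt.comp ((w, c), γ) (hasFDerivAt_fst.comp ((w, c), γ) hasFDerivAt_fst)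
  have h3 : HasFDerivAt (fun p : (K × E) × C(I, E) => constCLM I E p.1.2) _ ((w, c), γ) :=
    (constCLM I E).hasFDerivAt.comp ((w, c), γ) (hasFDerivAt_snd.comp ((w, c), γ) hasFDerivAt_fst)
  have h0 : HasFDerivAt (fun p : (K × E) × C(I, E) =>
      pointwiseCLM I (.id ℝ (K →L[ℝ] E)) (L.comp p.2)) _ ((w, c), γ) :=
    HasFDerivAt.comp ((w, c), γ) (f := fun p : (K × E) × C(I, E) => L.comp p.2)
      (g := pointwiseCLM I (.id ℝ (K →L[ℝ] E)))
      (pointwiseCLM I (.id ℝ (K →L[ℝ] E))).hasFDerivAt h1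
  have h4 := h0.clm_apply h2
  have h5 := h3.add ((primitiveCLM E).hasFDerivAt.comp ((w, c), γ) h4)
  have h6 : fderiv ℝ (flowOperator L) ((w, c), γ) = _ := h5.fderiv
  rw [h6]
  simp only [_root_.add_apply, ContinuousLinearMap.comp_apply]
  congr 2
  ext t
  simp [L', add_comm]

/-- Along the integral curve `γ` of `L w`, the field `t ↦ t L(γ(t)) δ` solves the linearized flow
equation in the direction `δ`, since `L w` and `L δ` commute. -/
theorem primitiveCLM_linearized (L : C(E, K →L[ℝ] E)) (hL : ContDiff ℝ ∞ L) [CompleteSpace E]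
    {w δ : K} {c : E} {γ : C(I, E)} (hγ : flowOperator L ((w, c), γ) = γ)
    (hcomm : ∀ t, fderiv ℝ L (γ t) (L (γ t) w) δ = fderiv ℝ L (γ t) (L (γ t) δ) w) :
    primitiveCLM E ⟨fun t => fderiv ℝ L (γ t) ((t : ℝ) • L (γ t) δ) w + L (γ t) δ, by
        have := hL.continuous_fderiv (by simp)
        fun_prop⟩ = ⟨fun t : I => (t : ℝ) • L (γ t) δ, by fun_prop⟩ := by
  have hcf := hL.continuous_fderiv (by simp)
  let γ' : ℝ → E := fun t => γ (projIcc 0 1 zero_le_one t)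
  have hγ'c : Continuous γ' := γ.continuous.comp continuous_projIcc
  -- a primitive on the whole line, which removes one-sided derivatives at the ends of `[0, 1]`
  let η : ℝ → E := fun t => c + ∫ s in (0 : ℝ)..t, L (γ' s) w
  have hη : ∀ t, HasDerivAt η (L (γ' t) w) t := fun t => by
    have hc : Continuous fun s => L (γ' s) w := by fun_prop
    exact (intervalIntegral.integral_hasDerivAt_right (hc.intervalIntegrable _ _)
      (hc.stronglyMeasurableAtFilter _ _) hc.continuousAt).const_add c
  have hηγ : ∀ t ∈ Icc (0 : ℝ) 1, η t = γ' t := fun t ht => by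
    have := congrArg (fun f : C(I, E) => f ⟨t, ht⟩) hγ
    simp only [flowOperator, ContinuousMap.add_apply, constCLM_apply, primitiveCLM_apply] at this
    simp only [γ', projIcc_of_mem _ ht]
    exact this
  ext t
  rw [primitiveCLM_apply]
  have hsub : uIcc (0 : ℝ) t ⊆ Icc (0 : ℝ) 1 := by
    rw [uIcc_of_le t.2.1]; exact Icc_subset_Icc_right t.2.2
  have hint : ∀ s ∈ uIcc (0 : ℝ) t, HasDerivAt (fun s => s • L (η s) δ)
      (s • fderiv ℝ L (γ' s) (L (γ' s) δ) w + L (γ' s) δ) s := by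
    intro s hs
    have h1 := ((hL.differentiable (by simp) (η s)).hasFDerivAt.comp_hasDerivAt s (hη s))
    have h2 := (hasDerivAt_id s).smul (h1.clm_apply (hasDerivAt_const s δ))
    have h3 := hcomm (projIcc 0 1 zero_le_one s)
    refine h2.congr_deriv ?_
    simp only [Function.comp_apply, id, one_smul, map_zero, add_zero]
    rw [hηγ s (hsub hs)]
    change s • fderiv ℝ L (γ' s) (L (γ' s) w) δ + _ = _
    rw [show fderiv ℝ L (γ' s) (L (γ' s) w) δ = _ from h3]
  rw [intervalIntegral.integral_congr (g := fun s => s • fderiv ℝ L (γ' s) (L (γ' s) δ) w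
      + L (γ' s) δ), intervalIntegral.integral_eq_sub_of_hasDerivAt hint]
  · simp [hηγ t t.2, γ']
  · refine Continuous.intervalIntegrable ?_ _ _
    fun_prop
  · intro s hs
    simp [γ', projIcc_of_mem _ (hsub hs)]

end Flow

section Straightening

open unitInterval

set_option synthInstance.maxHeartbeats 200000

variable {E K C : Type u} [NormedAddCommGroup E] [NormedSpace ℝ E] [FiniteDimensional ℝ E]
  [NormedAddCommGroup K] [NormedSpace ℝ K] [FiniteDimensional ℝ K]
  [NormedAddCommGroup C] [NormedSpace ℝ C] [FiniteDimensional ℝ C]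

/-- A smooth map on an open set agrees near each point with a globally smooth one. -/
theorem exists_contDiff_eqOn_of_contDiffOn {F : Type*} [NormedAddCommGroup F] [NormedSpace ℝ F]
    {f : E → F} {U : Set E} {x₀ : E} (hU : IsOpen U) (hx : x₀ ∈ U) (hf : ContDiffOn ℝ ∞ f U) :
    ∃ (g : E → F) (B : Set E), IsOpen B ∧ x₀ ∈ B ∧ B ⊆ U ∧ ContDiff ℝ ∞ g ∧ EqOn g f B := by
  obtain ⟨ε, hε, hball⟩ := Metric.isOpen_iff.1 hU x₀ hx
  let χ : ContDiffBump x₀ := ⟨ε / 4, ε / 2, by positivity, by linarith⟩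
  refine ⟨fun x => χ x • f x, Metric.ball x₀ (ε / 4), Metric.isOpen_ball,
    Metric.mem_ball_self (by positivity), (Metric.ball_subset_ball (by linarith)).trans hball, ?_,
    fun x hx => ?_⟩
  · rw [contDiff_iff_contDiffAt]
    intro x
    by_cases hxU : x ∈ U
    · exact χ.contDiff.contDiffAt.smul (hf.contDiffAt (hU.mem_nhds hxU))
    · have hxs : x ∉ tsupport χ := by
        rw [χ.tsupport_eq]
        refine fun h => hxU (hball (Metric.closedBall_subset_ball ?_ h))
        show ε / 2 < ε
        linarith
      refine contDiffAt_const (c := (0 : F)) |>.congr_of_eventuallyEq ?_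
      filter_upwards [(isClosed_tsupport _).isOpen_compl.mem_nhds hxs] with y hy
      simp [image_eq_zero_of_notMem_tsupport hy]
  · have : χ x = 1 := χ.one_of_mem_closedBall (Metric.ball_subset_closedBall hx)
    simp [this]

/-- Commuting vector fields that are linearly independent at a point (the fields `x ↦ L x w`, for
vectors `w` of the parameter space `K`) are the constant fields `(0, w)` in suitable coordinates
with values in `C × K`. The inverse coordinate map sends `(c, w)` to the value at time `1` of the
integral curve of `L w` that starts at `x₀ + c`, where `C` is a complement of the fields at `x₀`. -/
theorem exists_straightening {L : E → K →L[ℝ] E} {U : Set E} {x₀ : E} (hU : IsOpen U)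
    (hx : x₀ ∈ U) (hL : ContDiffOn ℝ ∞ L U)
    (hcomm : ∀ x ∈ U, ∀ v w, fderiv ℝ L x (L x v) w = fderiv ℝ L x (L x w) v)
    (e : (C × K) ≃L[ℝ] E) (he : ∀ w, e (0, w) = L x₀ w) :
    ∃ θ : OpenPartialHomeomorph E (C × K), x₀ ∈ θ.source ∧ θ.source ⊆ U ∧ θ x₀ = 0 ∧
      ContDiffOn ℝ ∞ θ θ.source ∧ ContDiffOn ℝ ∞ θ.symm θ.target ∧
      ∀ x ∈ θ.source, ∀ w, fderiv ℝ θ x (L x w) = (0, w) := by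
  have : CompleteSpace E := FiniteDimensional.complete ℝ E
  have : CompleteSpace K := FiniteDimensional.complete ℝ K
  have : CompleteSpace C := FiniteDimensional.complete ℝ C
  -- `L₁` is globally smooth and agrees with `L` on `B`; curves are kept inside `B`
  obtain ⟨L₁, B, hB, hxB, hBU, hL₁, hLB⟩ := exists_contDiff_eqOn_of_contDiffOn hU hx hL
  let L' : C(E, K →L[ℝ] E) := ⟨L₁, hL₁.continuous⟩
  have hL' : ContDiff ℝ ∞ L' := hL₁
  have hfd : ∀ x ∈ B, fderiv ℝ L' x = fderiv ℝ L x := fun x hx =>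
    Filter.EventuallyEq.fderiv_eq (by filter_upwards [hB.mem_nhds hx] with y hy using hLB hy)
  have hcomm' : ∀ x ∈ B, ∀ v w, fderiv ℝ L' x (L' x v) w = fderiv ℝ L' x (L' x w) v := by
    intro x hx v w
    rw [hfd x hx, show L' x = L x from hLB hx]
    exact hcomm x (hBU hx) v w
  have hG := contDiff_flowOperator L' hL'
  -- for `w = 0` the integral curves are constant, and the linearization vanishes
  obtain ⟨N, ψ, hN, h0N, hψ0, hψ, hψN⟩ := exists_contDiffOn_fixedPoint hG
    (x₀ := ((0 : K), x₀)) (y₀ := constCLM I E x₀)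
    (by ext t; simp [flowOperator])
    (by
      intro h
      rw [show ((0 : K × E), h) = (((0 : K), (0 : E)), h) from rfl,
        fderiv_flowOperator_apply L' hL']
      ext t
      simp [primitiveCLM_apply])
  -- the linearized fixed point equation determines the derivative of the solution
  have hψd : ∀ p ∈ N, ∀ v, ∀ k, fderiv ℝ (flowOperator L') (p, ψ p) (v, k) = k →
      fderiv ℝ ψ p v = k := by
    intro p hp v k hk
    have hd : DifferentiableAt ℝ ψ p :=
      (hψ.contDiffAt (hN.mem_nhds hp)).differentiableAt (by simp)
    have h1 : HasFDerivAt (fun p => flowOperator L' (p, ψ p)) _ p :=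
      HasFDerivAt.comp p (f := fun p => (p, ψ p))
        ((hG.differentiable (by simp) (p, ψ p)).hasFDerivAt)
        ((hasFDerivAt_id p).prodMk hd.hasFDerivAt)
    have h2 : HasFDerivAt (fun p => flowOperator L' (p, ψ p)) (fderiv ℝ ψ p) p :=
      hd.hasFDerivAt.congr_of_eventuallyEq (by
        filter_upwards [hN.mem_nhds hp] with q hq using (hψN q hq).1)
    have h3 : fderiv ℝ (flowOperator L') (p, ψ p) (v, fderiv ℝ ψ p v) = fderiv ℝ ψ p v :=
      congrArg (fun T : K × E →L[ℝ] C(I, E) => T v) (h1.unique h2)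
    refine sub_eq_zero.1 ((hψN p hp).2 _ ?_)
    rw [show ((0 : K × E), fderiv ℝ ψ p v - k) = (v, fderiv ℝ ψ p v) - (v, k) by simp, map_sub,
      h3, hk]
  let A : C × K →L[ℝ] K × E := (ContinuousLinearMap.snd ℝ C K).prod
    ((e : C × K →L[ℝ] E).comp ((ContinuousLinearMap.inl ℝ C K).comp
      (ContinuousLinearMap.fst ℝ C K)))
  have hA : ∀ q : C × K, A q = (q.2, e (q.1, 0)) := fun q => rfl
  let a : C × K → K × E := fun q => (0, x₀) + A q
  have ha : ∀ q, HasFDerivAt a A q := fun q => A.hasFDerivAt.const_add _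
  have hac : ContDiff ℝ ∞ a := contDiff_const.add A.contDiff
  let ev : C(I, E) →L[ℝ] E := ContinuousMap.evalCLM ℝ (1 : I)
  let N' : Set (C × K) := a ⁻¹' (N ∩ ψ ⁻¹' {γ | ∀ t, γ t ∈ B})
  have hγB : IsOpen {γ : C(I, E) | ∀ t, γ t ∈ B} := by
    have := ContinuousMap.isOpen_setOfPred_mapsTo (X := I) (isCompact_univ) hB
    simpa [MapsTo] using this
  have hN' : IsOpen N' := (hψ.continuousOn.isOpen_inter_preimage hN hγB).preimage hac.continuous
  let Ψ : C × K → E := fun q => ev (ψ (a q))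
  have hΨ : ContDiffOn ℝ ∞ Ψ N' :=
    ev.contDiff.comp_contDiffOn (hψ.comp hac.contDiffOn fun q hq => hq.1)
  have ha0 : a 0 = (0, x₀) := by simp [a]
  have h0N' : (0 : C × K) ∈ N' := by
    show a 0 ∈ N ∩ ψ ⁻¹' _
    rw [ha0]
    refine ⟨h0N, ?_⟩
    show ∀ t, ψ (0, x₀) t ∈ B
    rw [hψ0]
    exact fun t => hxB
  have hΨd : ∀ q ∈ N', HasFDerivAt Ψ (ev.comp ((fderiv ℝ ψ (a q)).comp A)) q := by
    intro q hq
    have hd : DifferentiableAt ℝ ψ (a q) :=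
      (hψ.contDiffAt (hN.mem_nhds hq.1)).differentiableAt (by simp)
    exact ev.hasFDerivAt.comp q (hd.hasFDerivAt.comp q (ha q))
  -- this is where commutativity is used: the variation of the curve in the direction of `w` is
  -- `t ↦ t L(γ(t)) w`
  have hΨL : ∀ q ∈ N', ∀ w, fderiv ℝ Ψ q (0, w) = L (Ψ q) w := by
    intro q hq w
    have hsol := (hψN _ hq.1).1
    have hlin := primitiveCLM_linearized L' hL' (w := (a q).1) (δ := w) (c := (a q).2)
      (γ := ψ (a q)) hsol (fun t => hcomm' _ (hq.2 t) _ _)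
    rw [(hΨd q hq).fderiv]
    have : fderiv ℝ ψ (a q) (w, 0) = ⟨fun t : I => (t : ℝ) • L' (ψ (a q) t) w, by fun_prop⟩ := by
      refine hψd _ hq.1 _ _ ?_
      rw [show (a q, ψ (a q)) = (((a q).1, (a q).2), ψ (a q)) from rfl,
        fderiv_flowOperator_apply L' hL', map_zero, zero_add]
      exact hlin
    have h0 : A (0, w) = (w, 0) := by
      rw [hA]
      exact Prod.ext rfl (map_zero e)
    rw [ContinuousLinearMap.comp_apply, ContinuousLinearMap.comp_apply, h0, this]
    show ((1 : I) : ℝ) • L' (ψ (a q) 1) w = L (ψ (a q) 1) w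
    rw [Icc.coe_one, one_smul]
    exact congrArg (fun T : K →L[ℝ] E => T w) (hLB (hq.2 1))
  have hΨ0 : Ψ 0 = x₀ := by
    show ψ (a 0) 1 = x₀
    rw [ha0, hψ0, constCLM_apply]
  have hΨe : fderiv ℝ Ψ 0 = e := by
    have hC : ∀ c : C, fderiv ℝ Ψ 0 (c, 0) = e (c, 0) := by
      intro c
      rw [(hΨd 0 h0N').fderiv]
      have : fderiv ℝ ψ (a 0) (0, e (c, 0)) = constCLM I E (e (c, 0)) := by
        refine hψd _ h0N'.1 _ _ ?_
        rw [show (a 0, ψ (a 0)) = (((0 : K), x₀), ψ (a 0)) by rw [ha0],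
          fderiv_flowOperator_apply L' hL']
        ext t
        simp [primitiveCLM_apply]
      rw [ContinuousLinearMap.comp_apply, ContinuousLinearMap.comp_apply, hA, this]
      rfl
    refine ContinuousLinearMap.ext fun ⟨c, w⟩ => ?_
    have h1 : ((c, w) : C × K) = (c, 0) + (0, w) := by simp
    rw [h1, map_add, hC, hΨL 0 h0N', hΨ0, ← he]
    exact (map_add e _ _).symm
  obtain ⟨θ, hθ0, hθN, hθ, hs, hs'⟩ := exists_openPartialHomeomorph_of_contDiffOn hN' h0N' hΨ e hΨe
  have hB' : ∀ q ∈ θ.source, Ψ q ∈ B := fun q hq => (hθN hq).2 1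
  refine ⟨θ.symm, ?_, ?_, ?_, hs', ?_, ?_⟩
  · have := θ.map_source hθ0
    rwa [hθ, hΨ0] at this
  · intro x hx
    have h1 := hB' _ (θ.map_target hx)
    rw [← hθ, θ.right_inv hx] at h1
    exact hBU h1
  · have := θ.left_inv hθ0
    rwa [hθ, hΨ0] at this
  · simpa using hs
  · intro x hx w
    have hq : θ.symm x ∈ θ.source := θ.map_target hx
    have hx' : Ψ (θ.symm x) = x := by rw [← hθ]; exact θ.right_inv hx
    have hd : DifferentiableAt ℝ θ.symm x :=
      (hs'.contDiffAt (θ.open_target.mem_nhds hx)).differentiableAt (by simp)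
    have h1 : HasFDerivAt (θ.symm ∘ θ) _ (θ.symm x) :=
      HasFDerivAt.comp (θ.symm x) (g := θ.symm)
        (by rw [θ.right_inv hx]; exact hd.hasFDerivAt)
        ((hΨd _ (hθN hq)).congr_of_eventuallyEq (Filter.Eventually.of_forall hθ))
    have h2 : HasFDerivAt (θ.symm ∘ θ) (ContinuousLinearMap.id ℝ (C × K)) (θ.symm x) :=
      (hasFDerivAt_id _).congr_of_eventuallyEq (by
        filter_upwards [θ.open_source.mem_nhds hq] with z hz using θ.left_inv hz)
    have h3 := congrArg (fun T : C × K →L[ℝ] C × K => T (0, w)) (h1.unique h2)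
    rw [← (hΨd _ (hθN hq)).fderiv] at h3
    have h4 := hΨL _ (hθN hq) w
    rw [hx'] at h4
    rw [← h4]
    exact h3

end Straightening

/-! ### Charts with values in normed spaces -/

section TangentMaps

variable {E E' E'' H H' H'' : Type*} [NormedAddCommGroup E] [NormedSpace ℝ E] [TopologicalSpace H]
  {I : ModelWithCorners ℝ E H}
  [NormedAddCommGroup E'] [NormedSpace ℝ E'] [TopologicalSpace H'] {I' : ModelWithCorners ℝ E' H'}
  [NormedAddCommGroup E''] [NormedSpace ℝ E''] [TopologicalSpace H'']
  {J : ModelWithCorners ℝ E'' H''}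
  {M M' A : Type*} [TopologicalSpace M] [ChartedSpace H M] [IsManifold I ∞ M]
  [TopologicalSpace M'] [ChartedSpace H' M'] [IsManifold I' ∞ M']
  [TopologicalSpace A] [ChartedSpace H'' A]

/-- The derivative of a smooth map, applied to a smooth family of tangent vectors. -/
theorem contMDiffOn_tangentMap_comp {f : M → M'} {U : Set M} (hU : IsOpen U)
    (hf : ContMDiffOn I I' ∞ f U) {S : Set A} {σ : A → TangentBundle I M}
    (hσ : ContMDiffOn J I.tangent ∞ σ S) (hS : ∀ a ∈ S, (σ a).1 ∈ U) :
    ContMDiffOn J I'.tangent ∞ (fun a => tangentMap I I' f (σ a)) S := by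
  have h1 := hf.contMDiffOn_tangentMapWithin (m := ∞) (by simp) hU.uniqueMDiffOn
  refine (h1.comp hσ hS).congr fun a ha => ?_
  simp only [Function.comp_apply, tangentMap, tangentMapWithin,
    mfderivWithin_of_isOpen hU (hS a ha)]

theorem mdifferentiableAt_tangentMap_comp {f : M → M'} {U : Set M} (hU : IsOpen U)
    (hf : ContMDiffOn I I' ∞ f U) {a : A} {σ : A → TangentBundle I M}
    (hσ : MDifferentiableAt J I.tangent σ a) (ha : (σ a).1 ∈ U) :
    MDifferentiableAt J I'.tangent (fun a => tangentMap I I' f (σ a)) a := by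
  have h1 := contMDiffOn_tangentMap_comp (J := I.tangent) hU hf
    (σ := (id : TangentBundle I M → TangentBundle I M)) (S := TotalSpace.proj ⁻¹' U)
    contMDiffOn_id fun p hp => hp
  have hopen : IsOpen (TotalSpace.proj ⁻¹' U : Set (TangentBundle I M)) :=
    hU.preimage (FiberBundle.continuous_proj E (TangentSpace I : M → Type _))
  exact ((h1.contMDiffAt (hopen.mem_nhds ha)).mdifferentiableAt (by simp)).comp a hσ

end TangentMaps

/-- A chart of a manifold, with values in a normed space. -/
structure SmoothChart {n : ℕ} (M : Mfd.{u} n) (E : Type v) [NormedAddCommGroup E]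
    [NormedSpace ℝ E] extends OpenPartialHomeomorph M E where
  contMDiffOn : ContMDiffOn (𝓡 n) 𝓘(ℝ, E) ∞ toOpenPartialHomeomorph source
  contMDiffOn_symm : ContMDiffOn 𝓘(ℝ, E) (𝓡 n) ∞ toOpenPartialHomeomorph.symm target

namespace SmoothChart

instance {n : ℕ} {M : Mfd.{u} n} {E : Type v} [NormedAddCommGroup E] [NormedSpace ℝ E] :
    CoeFun (SmoothChart M E) fun _ => M → E := ⟨fun κ => κ.toOpenPartialHomeomorph⟩

variable {n : ℕ} {M : Mfd.{u} n} {E : Type v} [NormedAddCommGroup E] [NormedSpace ℝ E]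
  (κ : SmoothChart M E)

/-- The derivative of a chart, as a map to the model space. -/
def d (x : M) : TangentSpace (𝓡 n) x →L[ℝ] E :=
  mfderiv (𝓡 n) 𝓘(ℝ, E) κ x

/-- The derivative of the inverse of a chart. -/
def dsymm (x : M) : E →L[ℝ] TangentSpace (𝓡 n) x :=
  mfderiv 𝓘(ℝ, E) (𝓡 n) κ.symm (κ x)

/-- A vector field in a chart. -/
def rep (X : VField M) (u : E) : E :=
  κ.d (κ.symm u) (X (κ.symm u))

variable {κ}

theorem mdiffAt {x : M} (hx : x ∈ κ.source) :
    MDifferentiableAt (𝓡 n) 𝓘(ℝ, E) κ x :=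
  (κ.contMDiffOn.contMDiffAt (κ.open_source.mem_nhds hx)).mdifferentiableAt (by simp)

theorem mdiffAt_symm {u : E} (hu : u ∈ κ.target) :
    MDifferentiableAt 𝓘(ℝ, E) (𝓡 n) κ.symm u :=
  (κ.contMDiffOn_symm.contMDiffAt (κ.open_target.mem_nhds hu)).mdifferentiableAt (by simp)

@[simp] theorem d_dsymm {x : M} (hx : x ∈ κ.source) (b : E) : κ.d x (κ.dsymm x b) = b := by
  have hu := κ.map_source hx
  have h1 : HasMFDerivAt 𝓘(ℝ, E) 𝓘(ℝ, E)
      ((κ : M → E) ∘ κ.symm) (κ x)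
      ((mfderiv (𝓡 n) 𝓘(ℝ, E) κ x).comp
        (mfderiv 𝓘(ℝ, E) (𝓡 n) κ.symm (κ x))) := by
    refine HasMFDerivAt.comp _ ?_ (mdiffAt_symm hu).hasMFDerivAt
    rw [κ.left_inv hx]
    exact (mdiffAt hx).hasMFDerivAt
  have h2 : HasMFDerivAt 𝓘(ℝ, E) 𝓘(ℝ, E)
      ((κ : M → E) ∘ κ.symm) (κ x)
      (ContinuousLinearMap.id ℝ E) :=
    (hasMFDerivAt_id _).congr_of_eventuallyEq (by
      filter_upwards [κ.open_target.mem_nhds hu] with z hz using κ.right_inv hz)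
  exact congrArg (fun T : E →L[ℝ] E => T b) (hasMFDerivAt_unique h1 h2)

@[simp] theorem dsymm_d {x : M} (hx : x ∈ κ.source) (a : TangentSpace (𝓡 n) x) :
    κ.dsymm x (κ.d x a) = a := by
  have hu := κ.map_source hx
  have h1 : HasMFDerivAt (𝓡 n) (𝓡 n)
      (κ.symm ∘ (κ : M → E)) x
      ((mfderiv 𝓘(ℝ, E) (𝓡 n) κ.symm (κ x)).comp
      (mfderiv (𝓡 n) 𝓘(ℝ, E) κ x)) :=
    HasMFDerivAt.comp _ (mdiffAt_symm hu).hasMFDerivAt (mdiffAt hx).hasMFDerivAt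
  have h2 : HasMFDerivAt (𝓡 n) (𝓡 n)
      (κ.symm ∘ (κ : M → E)) x
      (ContinuousLinearMap.id ℝ (TangentSpace (𝓡 n) x)) :=
    (hasMFDerivAt_id _).congr_of_eventuallyEq (by
      filter_upwards [κ.open_source.mem_nhds hx] with z hz using κ.left_inv hz)
  exact congrArg (fun T : EuclideanSpace ℝ (Fin n) →L[ℝ] EuclideanSpace ℝ (Fin n) => T a)
    (hasMFDerivAt_unique h1 h2)

theorem rep_apply {X : VField M} {x : M} (hx : x ∈ κ.source) :
    κ.rep X (κ x) = κ.d x (X x) := by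
  unfold rep
  rw [κ.left_inv hx]

theorem dsymm_rep {X : VField M} {x : M} (hx : x ∈ κ.source) :
    κ.dsymm x (κ.rep X (κ x)) = X x := by
  rw [rep_apply hx, dsymm_d hx]

variable (κ)

theorem contDiffOn_rep {X : VField M} {U : Set M} (hX : SmoothFieldOn X U) :
    ContDiffOn ℝ ∞ (κ.rep X) (κ.target ∩ κ.symm ⁻¹' U) := by
  rw [← contMDiffOn_iff_contDiffOn]
  have h1 : ContMDiffOn 𝓘(ℝ, E) (𝓡 n).tangent ∞
      (fun u => (⟨κ.symm u, X (κ.symm u)⟩ :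
        TangentBundle (𝓡 n) M)) (κ.target ∩ κ.symm ⁻¹' U) :=
    hX.comp (κ.contMDiffOn_symm.mono inter_subset_left) fun u hu => hu.2
  have h2 := contMDiffOn_tangentMap_comp κ.open_source κ.contMDiffOn h1
    fun u hu => κ.map_target hu.1
  exact (contMDiff_snd_tangentBundle_modelSpace E 𝓘(ℝ, E)).comp_contMDiffOn h2

theorem differentiableAt_rep {X : VField M} {x : M} (hx : x ∈ κ.source)
    (hX : MDifferentiableAt (𝓡 n) (𝓡 n).tangent (fun y => (⟨y, X y⟩ : TangentBundle (𝓡 n) M)) x) :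
    DifferentiableAt ℝ (κ.rep X) (κ x) := by
  rw [← mdifferentiableAt_iff_differentiableAt]
  have hu := κ.map_source hx
  have h1 : MDifferentiableAt 𝓘(ℝ, E) (𝓡 n).tangent
      (fun u => (⟨κ.symm u, X (κ.symm u)⟩ :
        TangentBundle (𝓡 n) M)) (κ x) := by
    refine MDifferentiableAt.comp _
      (g := fun y => (⟨y, X y⟩ : TangentBundle (𝓡 n) M)) ?_ (mdiffAt_symm hu)
    rwa [κ.left_inv hx]
  have h2 := mdifferentiableAt_tangentMap_comp κ.open_source κ.contMDiffOn h1
    (κ.map_target hu)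
  exact ((contMDiff_snd_tangentBundle_modelSpace (n := 1) E 𝓘(ℝ, E)).mdifferentiable
    one_ne_zero _).comp _ h2

/-- The vector field with a given expression in a chart. -/
def ofRep (v : E → E) : VField M := fun x => κ.dsymm x (v (κ x))

theorem rep_ofRep {v : E → E} {u : E} (hu : u ∈ κ.target) : κ.rep (κ.ofRep v) u = v u := by
  unfold rep ofRep
  rw [d_dsymm (κ.map_target hu), κ.right_inv hu]

theorem smoothFieldOn_ofRep {v : E → E} {W : Set E} (hv : ContDiffOn ℝ ∞ v W)  :
    SmoothFieldOn (κ.ofRep v) (κ.source ∩ (κ : M → E) ⁻¹' W) := by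
  have h0 : ContMDiffOn 𝓘(ℝ, E) 𝓘(ℝ, E).tangent ∞
      (fun u => (⟨u, v u⟩ : TangentBundle 𝓘(ℝ, E) E)) W :=
    contMDiffOn_vectorSpace_iff_contDiffOn.2 hv
  have h1 := h0.comp (κ.contMDiffOn.mono inter_subset_left) (fun x hx => hx.2)
  have h2 := contMDiffOn_tangentMap_comp κ.open_target κ.contMDiffOn_symm h1
    fun u hu => κ.map_source hu.1
  refine h2.congr fun x hx => ?_
  refine TotalSpace.ext (κ.left_inv hx.1).symm ?_
  exact heq_of_eq rfl

theorem smoothFieldOn_ofRep_const (b : E) : SmoothFieldOn (κ.ofRep fun _ => b) κ.source :=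
  (κ.smoothFieldOn_ofRep (contDiffOn_const (s := univ))).mono fun _ hx => ⟨hx, trivial⟩

/-- A chart restricted to an open set. -/
def restr (U : Set M) (hU : IsOpen U) : SmoothChart M E where
  toOpenPartialHomeomorph := κ.toOpenPartialHomeomorph.restrOpen U hU
  contMDiffOn := κ.contMDiffOn.mono fun _ hx => hx.1
  contMDiffOn_symm := κ.contMDiffOn_symm.mono fun _ hx => hx.1

end SmoothChart

/-! ### Connections in charts -/

section ChristoffelSymbols

variable {n : ℕ} {M : Mfd.{u} n} {E : Type v} [NormedAddCommGroup E] [NormedSpace ℝ E]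

/-- A vector field that is smooth on an open set agrees near each point of it with a globally
smooth one. -/
theorem exists_smoothFieldOn_univ_eventuallyEq {X : VField M} {U : Set M} (hU : IsOpen U)
    (hX : SmoothFieldOn X U) {x : M} (hx : x ∈ U) :
    ∃ Y : VField M, SmoothFieldOn Y univ ∧ ∀ᶠ y in 𝓝 x, Y y = X y := by
  obtain ⟨f, -, hf⟩ :=
    (SmoothBumpFunction.nhds_basis_tsupport (I := 𝓡 n) x).mem_iff.1 (hU.mem_nhds hx)
  refine ⟨fun y => f y • X y, ?_, ?_⟩
  · exact (ContMDiffOn.smul_section_of_tsupport f.contMDiff.contMDiffOn hU hf hX).contMDiffOn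
  · filter_upwards [f.eventuallyEq_one] with y hy
    simp [hy]

theorem SmoothFieldOn.mdifferentiableAt {X : VField M} {U : Set M} (hX : SmoothFieldOn X U)
    (hU : IsOpen U) {x : M} (hx : x ∈ U) :
    MDifferentiableAt (𝓡 n) (𝓡 n).tangent (fun y => (⟨y, X y⟩ : TangentBundle (𝓡 n) M)) x :=
  (hX.contMDiffAt (hU.mem_nhds hx)).mdifferentiableAt (by simp)

/-- The bilinear map `(a, b) ↦ p (B (s b) (s a))`. -/
def conjBilin {T E : Type*} [NormedAddCommGroup T] [NormedSpace ℝ T] [NormedAddCommGroup E]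
    [NormedSpace ℝ E] (p : T →L[ℝ] E) (s : E →L[ℝ] T) (B : T →L[ℝ] T →L[ℝ] T) :
    E →L[ℝ] E →L[ℝ] E :=
  (ContinuousLinearMap.compL ℝ E T E p).comp (B.flip.bilinearComp s s)

namespace SmoothChart

variable (κ : SmoothChart M E)

theorem mdifferentiableAt_ofRep_const (b : E) {x : M} (hx : x ∈ κ.source) :
    MDifferentiableAt (𝓡 n) (𝓡 n).tangent
      (fun y => (⟨y, κ.ofRep (fun _ => b) y⟩ : TangentBundle (𝓡 n) M)) x :=
  (κ.smoothFieldOn_ofRep_const b).mdifferentiableAt κ.open_source hx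

theorem mvfderiv_eq {F : Type*} [NormedAddCommGroup F] [NormedSpace ℝ F] {g : M → F} {x : M}
    (hx : x ∈ κ.source) (hg : MDifferentiableAt (𝓡 n) 𝓘(ℝ, F) g x)
    (a : TangentSpace (𝓡 n) x) :
    mvfderiv (𝓡 n) g x a = fderiv ℝ (g ∘ κ.symm) (κ x) (κ.d x a) := by
  have hu := κ.map_source hx
  have h1 : HasMFDerivAt 𝓘(ℝ, E) 𝓘(ℝ, F) (g ∘ κ.symm) (κ x)
      ((mfderiv (𝓡 n) 𝓘(ℝ, F) g x).comp (κ.dsymm x)) := by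
    refine HasMFDerivAt.comp (κ x) (g := g) (g' := mfderiv (𝓡 n) 𝓘(ℝ, F) g x) ?_
      (mdiffAt_symm hu).hasMFDerivAt
    have := hg.hasMFDerivAt
    rw [κ.left_inv hx]
    exact this
  have h2 : fderiv ℝ (g ∘ κ.symm) (κ x) = (mfderiv (𝓡 n) 𝓘(ℝ, F) g x).comp (κ.dsymm x) := by
    rw [← mfderiv_eq_fderiv]
    exact h1.mfderiv
  rw [h2]
  show _ = (mfderiv (𝓡 n) 𝓘(ℝ, F) g x) (κ.dsymm x (κ.d x a))
  rw [dsymm_d hx]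
  rfl

theorem differentiableAt_comp_symm {F : Type*} [NormedAddCommGroup F] [NormedSpace ℝ F]
    {g : M → F} {x : M} (hx : x ∈ κ.source) (hg : MDifferentiableAt (𝓡 n) 𝓘(ℝ, F) g x) :
    DifferentiableAt ℝ (g ∘ κ.symm) (κ x) := by
  rw [← mdifferentiableAt_iff_differentiableAt]
  refine MDifferentiableAt.comp (κ x) (g := g) ?_ (mdiffAt_symm (κ.map_source hx))
  rwa [κ.left_inv hx]

/-- The flat connection of a chart. -/
def flat (X : VField M) (x : M) : TangentSpace (𝓡 n) x →L[ℝ] TangentSpace (𝓡 n) x :=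
  (κ.dsymm x).comp ((fderiv ℝ (κ.rep X) (κ x)).comp (κ.d x))

theorem isCovariantDerivativeOn_flat :
    IsCovariantDerivativeOn (EuclideanSpace ℝ (Fin n)) κ.flat κ.source where
  add {X Y x} hX hY hx := by
    have : κ.rep (X + Y) = κ.rep X + κ.rep Y := by
      ext u
      simp [rep]
    ext1 a
    simp only [flat, ContinuousLinearMap.comp_apply, _root_.add_apply]
    rw [this, fderiv_add (κ.differentiableAt_rep hx hX) (κ.differentiableAt_rep hx hY)]
    simp
  leibniz {X g x} hX hg hx := by
    have : κ.rep (g • X) = (g ∘ κ.symm) • κ.rep X := by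
      ext u
      simp [rep]
    ext1 a
    simp only [flat, ContinuousLinearMap.comp_apply, _root_.add_apply, _root_.smul_apply,
      ContinuousLinearMap.smulRight_apply]
    rw [this, fderiv_smul (κ.differentiableAt_comp_symm hx hg) (κ.differentiableAt_rep hx hX),
      κ.mvfderiv_eq hx hg]
    simp only [_root_.add_apply, _root_.smul_apply, ContinuousLinearMap.smulRight_apply,
      map_add, map_smul, Function.comp_apply, κ.left_inv hx, dsymm_rep hx]

/-- The Christoffel symbols of a connection in a chart; the first argument is the direction of
differentiation. -/
def christoffel (nabla : Connection M) (u : E) : E →L[ℝ] E →L[ℝ] E :=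
  conjBilin (T := EuclideanSpace ℝ (Fin n)) (κ.d (κ.symm u)) (κ.dsymm (κ.symm u))
    (IsCovariantDerivativeOn.difference (nabla.isCovariantDerivativeOn (s := κ.source))
      κ.isCovariantDerivativeOn_flat (κ.symm u))

theorem christoffel_apply (nabla : Connection M) (u a b : E) :
    κ.christoffel nabla u a b = κ.d (κ.symm u) ((IsCovariantDerivativeOn.difference
      (nabla.isCovariantDerivativeOn (s := κ.source)) κ.isCovariantDerivativeOn_flat (κ.symm u))
        (κ.dsymm (κ.symm u) b) (κ.dsymm (κ.symm u) a)) := rfl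

theorem d_connection_apply (nabla : Connection M) {X : VField M} {x : M} (hx : x ∈ κ.source)
    (hX : MDifferentiableAt (𝓡 n) (𝓡 n).tangent (fun y => (⟨y, X y⟩ : TangentBundle (𝓡 n) M)) x)
    (a : TangentSpace (𝓡 n) x) :
    κ.d x (nabla X x a) = fderiv ℝ (κ.rep X) (κ x) (κ.d x a) +
      κ.christoffel nabla (κ x) (κ.d x a) (κ.rep X (κ x)) := by
  have h1 : κ.christoffel nabla (κ x) (κ.d x a) (κ.rep X (κ x)) =
      κ.d x ((IsCovariantDerivativeOn.difference (nabla.isCovariantDerivativeOn (s := κ.source))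
      κ.isCovariantDerivativeOn_flat x) (X x) a) := by
    rw [christoffel_apply, κ.left_inv hx, dsymm_d hx, dsymm_rep hx]
  rw [h1, IsCovariantDerivativeOn.difference_apply _ _ hx hX]
  simp [flat, d_dsymm hx]

theorem fderiv_rep_ofRep_const (b : E) {u : E} (hu : u ∈ κ.target) :
    fderiv ℝ (κ.rep (κ.ofRep fun _ => b)) u = 0 := by
  have : κ.rep (κ.ofRep fun _ => b) =ᶠ[𝓝 u] fun _ => b := by
    filter_upwards [κ.open_target.mem_nhds hu] with z hz using κ.rep_ofRep hz
  rw [this.fderiv_eq]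
  simp

theorem christoffel_eq (nabla : Connection M) {x : M} (hx : x ∈ κ.source)
    (a b : E) :
    κ.christoffel nabla (κ x) a b = κ.d x (nabla (κ.ofRep fun _ => b) x (κ.dsymm x a)) := by
  rw [κ.d_connection_apply nabla hx (κ.mdifferentiableAt_ofRep_const b hx),
    κ.fderiv_rep_ofRep_const b (κ.map_source hx), κ.rep_ofRep (κ.map_source hx), d_dsymm hx]
  simp

theorem contDiffOn_christoffel [FiniteDimensional ℝ E] {nabla : Connection M}
    (h : CovariantDerivative.ContMDiffCovariantDerivative nabla ∞) :
    ContDiffOn ℝ ∞ (κ.christoffel nabla) κ.target := by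
  rw [contDiffOn_clm_apply]
  intro a
  rw [contDiffOn_clm_apply]
  intro b u hu
  have hx := κ.map_target hu
  obtain ⟨Y, hY, hYe⟩ := exists_smoothFieldOn_univ_eventuallyEq κ.open_source
    (κ.smoothFieldOn_ofRep_const b) hx
  have h1 := h.contMDiff.contMDiff (σ := Y) (by exact hY)
  have h2 : SmoothFieldOn (fun x => nabla Y x (κ.ofRep (fun _ => a) x)) κ.source :=
    (h1.mono (subset_univ _)).clm_bundle_apply (κ.smoothFieldOn_ofRep_const a)
  have h3 := κ.contDiffOn_rep h2
  have hopen : IsOpen (κ.target ∩ κ.symm ⁻¹' κ.source) :=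
    κ.symm.isOpen_inter_preimage κ.open_source
  have h4 := h3.contDiffAt (hopen.mem_nhds ⟨hu, hx⟩)
  refine (h4.congr_of_eventuallyEq ?_).contDiffWithinAt
  have hYe' : ∀ᶠ v in 𝓝 u, ∀ᶠ y in 𝓝 (κ.symm v), Y y = κ.ofRep (fun _ => b) y :=
    (κ.symm.continuousAt hu).eventually hYe.eventually_nhds
  filter_upwards [κ.open_target.mem_nhds hu, hYe'] with v hv hYv
  have hxv := κ.map_target hv
  have h5 := κ.christoffel_eq nabla hxv a b
  rw [κ.right_inv hv] at h5
  rw [h5]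
  unfold rep
  congr 1
  have h6 : nabla Y (κ.symm v) = nabla (κ.ofRep fun _ => b) (κ.symm v) :=
    nabla.isCovariantDerivativeOnUniv.congr_of_eventuallyEq
      (hY.mdifferentiableAt isOpen_univ (mem_univ _)) (κ.mdifferentiableAt_ofRep_const b hxv)
      Filter.univ_mem hYv
  show _ = nabla Y (κ.symm v) (κ.ofRep (fun x => a) (κ.symm v))
  rw [h6]
  unfold ofRep
  rw [κ.right_inv hv]

end SmoothChart
end ChristoffelSymbols

section MetricsInCharts

variable {n : ℕ} {M : Mfd.{u} n} {E : Type v} [NormedAddCommGroup E] [NormedSpace ℝ E]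

/-- The bilinear form `(a, b) ↦ B (s a) (s b)`. -/
def pullBilin {T E : Type*} [NormedAddCommGroup T] [NormedSpace ℝ T] [NormedAddCommGroup E]
    [NormedSpace ℝ E] (s : E →L[ℝ] T) (B : T →L[ℝ] T →L[ℝ] ℝ) : E →L[ℝ] E →L[ℝ] ℝ :=
  B.bilinearComp s s

theorem mlieBracket_vectorSpace {E : Type*} [NormedAddCommGroup E] [NormedSpace ℝ E]
    (V W : Π x : E, TangentSpace 𝓘(ℝ, E) x) (u : E) :
    VectorField.mlieBracket 𝓘(ℝ, E) V W u = VectorField.lieBracket (E := E) ℝ V W u := by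
  rw [← VectorField.mlieBracketWithin_univ, VectorField.mlieBracketWithin_eq_lieBracketWithin]
  exact congrFun (VectorField.lieBracketWithin_univ (E := E)) u

namespace SmoothChart

variable (κ : SmoothChart M E)

theorem d_mlieBracket [CompleteSpace E] {X Y : VField M} {x : M} (hx : x ∈ κ.source)
    (hX : MDifferentiableAt (𝓡 n) (𝓡 n).tangent (fun y => (⟨y, X y⟩ : TangentBundle (𝓡 n) M)) x)
    (hY : MDifferentiableAt (𝓡 n) (𝓡 n).tangent (fun y => (⟨y, Y y⟩ : TangentBundle (𝓡 n) M)) x) :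
    κ.d x (VectorField.mlieBracket (𝓡 n) X Y x) =
      VectorField.lieBracket ℝ (κ.rep X) (κ.rep Y) (κ x) := by
  have hu := κ.map_source hx
  have hpull : ∀ Z : VField M, ∀ u ∈ κ.target,
      VectorField.mpullback 𝓘(ℝ, E) (𝓡 n) κ.symm Z u = κ.rep Z u := by
    intro Z u hu
    have h1 := κ.map_target hu
    let e : E ≃L[ℝ] TangentSpace (𝓡 n) (κ.symm u) := ContinuousLinearEquiv.equivOfInverse
      (κ.dsymm (κ.symm u)) (κ.d (κ.symm u)) (fun b => d_dsymm h1 b) (fun a => dsymm_d h1 a)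
    have h2 : mfderiv 𝓘(ℝ, E) (𝓡 n) κ.symm u = (e : E →L[ℝ] TangentSpace (𝓡 n) (κ.symm u)) := by
      show _ = κ.dsymm (κ.symm u)
      unfold dsymm
      rw [κ.right_inv hu]
    rw [VectorField.mpullback_apply, h2]
    exact congrArg (fun T : TangentSpace (𝓡 n) (κ.symm u) →L[ℝ] E => T (Z (κ.symm u)))
      (ContinuousLinearMap.inverse_equiv e)
  have h2 : (2 : ℕ∞ω) ≤ ∞ := WithTop.coe_le_coe.2 (le_top : (2 : ℕ∞) ≤ ⊤)
  have : IsManifold (𝓡 n) (minSmoothness ℝ 2) M := IsManifold.of_le (n := ∞) (by simpa using h2)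
  have key := VectorField.mpullback_mlieBracket (I := 𝓘(ℝ, E)) (I' := 𝓡 n) (f := κ.symm)
    (x₀ := κ x) (V := X) (W := Y) (n := ∞) (by rwa [κ.left_inv hx]) (by rwa [κ.left_inv hx])
    (κ.contMDiffOn_symm.contMDiffAt (κ.open_target.mem_nhds hu)) (by simpa using h2)
  rw [hpull _ _ hu, rep_apply hx] at key
  rw [key, mlieBracket_vectorSpace]
  refine Filter.EventuallyEq.lieBracket_vectorField_eq (E := E) ?_ ?_
  · filter_upwards [κ.open_target.mem_nhds hu] with v hv using hpull X v hv
  · filter_upwards [κ.open_target.mem_nhds hu] with v hv using hpull Y v hv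

theorem christoffel_symm [CompleteSpace E] {nabla : Connection M} (h : nabla.torsion = 0)
    {u : E} (hu : u ∈ κ.target) (a b : E) :
    κ.christoffel nabla u a b = κ.christoffel nabla u b a := by
  obtain ⟨x, hx, rfl⟩ : ∃ x ∈ κ.source, κ x = u := ⟨κ.symm u, κ.map_target hu, κ.right_inv hu⟩
  have ha := κ.mdifferentiableAt_ofRep_const a hx
  have hb := κ.mdifferentiableAt_ofRep_const b hx
  have h1 := nabla.torsion_eq_zero_iff.1 h ha hb
  have h2 := κ.d_mlieBracket hx ha hb
  rw [← h1, map_sub, VectorField.lieBracket, κ.fderiv_rep_ofRep_const _ hu,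
    κ.fderiv_rep_ofRep_const _ hu] at h2
  rw [κ.christoffel_eq nabla hx, κ.christoffel_eq nabla hx]
  simp only [_root_.zero_apply, sub_zero] at h2
  exact sub_eq_zero.1 h2

/-- A metric in a chart. -/
def gram (g : PseudoRiemannianMetric M) (u : E) : E →L[ℝ] E →L[ℝ] ℝ :=
  pullBilin (T := EuclideanSpace ℝ (Fin n)) (κ.dsymm (κ.symm u)) (g.form (κ.symm u))

theorem gram_apply (g : PseudoRiemannianMetric M) (u a b : E) :
    κ.gram g u a b = g.form (κ.symm u) (κ.dsymm (κ.symm u) a) (κ.dsymm (κ.symm u) b) := rfl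

theorem gram_d (g : PseudoRiemannianMetric M) {x : M} (hx : x ∈ κ.source)
    (a b : TangentSpace (𝓡 n) x) : κ.gram g (κ x) (κ.d x a) (κ.d x b) = g.form x a b := by
  rw [gram_apply, κ.left_inv hx, dsymm_d hx, dsymm_d hx]

theorem gram_eq (g : PseudoRiemannianMetric M) {x : M} (hx : x ∈ κ.source) (a b : E) :
    κ.gram g (κ x) a b = g.form x (κ.ofRep (fun _ => a) x) (κ.ofRep (fun _ => b) x) := by
  rw [gram_apply, κ.left_inv hx]
  rfl

theorem gram_symm (g : PseudoRiemannianMetric M) (u a b : E) : κ.gram g u a b = κ.gram g u b a :=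
  g.symm _ _ _

theorem gram_nondegenerate (g : PseudoRiemannianMetric M) {u : E} (hu : u ∈ κ.target) {a : E}
    (h : ∀ b, κ.gram g u a b = 0) : a = 0 := by
  obtain ⟨x, hx, rfl⟩ : ∃ x ∈ κ.source, κ x = u := ⟨κ.symm u, κ.map_target hu, κ.right_inv hu⟩
  have : κ.dsymm x a = 0 := g.nondegenerate x _ fun b => by
    rw [← κ.gram_d g hx, d_dsymm hx]
    exact h _
  rw [← d_dsymm hx a, this, map_zero]

theorem _root_.PseudoRiemannianMetric.contMDiffOn_apply (g : PseudoRiemannianMetric M)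
    {X Y : VField M} {U : Set M}
    (hX : SmoothFieldOn X U) (hY : SmoothFieldOn Y U) :
    ContMDiffOn (𝓡 n) 𝓘(ℝ, ℝ) ∞ (fun x => g.form x (X x) (Y x)) U := by
  have h1 : ContMDiffOn (𝓡 n) ((𝓡 n).prod 𝓘(ℝ, ℝ)) ∞
      (fun x => (TotalSpace.mk' ℝ x (g.form x (X x) (Y x)) :
        TotalSpace ℝ (Bundle.Trivial M ℝ))) U :=
    ContMDiffOn.clm_bundle_apply₂ (F₁ := EuclideanSpace ℝ (Fin n))
      (F₂ := EuclideanSpace ℝ (Fin n)) (E₃ := Bundle.Trivial M ℝ)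
      (g.contMDiff.contMDiffOn (s := U)) hX hY
  intro x hx
  exact (contMDiffWithinAt_totalSpace.1 (h1 x hx)).2

theorem contDiffOn_gram [FiniteDimensional ℝ E] (g : PseudoRiemannianMetric M) :
    ContDiffOn ℝ ∞ (κ.gram g) κ.target := by
  rw [contDiffOn_clm_apply]
  intro a
  rw [contDiffOn_clm_apply]
  intro b
  have h1 := (g.contMDiffOn_apply (κ.smoothFieldOn_ofRep_const a)
    (κ.smoothFieldOn_ofRep_const b)).comp κ.contMDiffOn_symm fun u hu => κ.map_target hu
  rw [contMDiffOn_iff_contDiffOn] at h1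
  refine h1.congr fun u hu => ?_
  have := κ.gram_eq g (κ.map_target hu) a b
  rw [κ.right_inv hu] at this
  exact this

theorem fderiv_gram [FiniteDimensional ℝ E] {g : PseudoRiemannianMetric M} {nabla : Connection M}
    (h : IsLeviCivita g nabla) {u : E} (hu : u ∈ κ.target) (c a b : E) :
    fderiv ℝ (κ.gram g) u c a b =
      κ.gram g u (κ.christoffel nabla u c a) b + κ.gram g u a (κ.christoffel nabla u c b) := by
  obtain ⟨x, hx, rfl⟩ : ∃ x ∈ κ.source, κ x = u := ⟨κ.symm u, κ.map_target hu, κ.right_inv hu⟩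
  have ha := κ.mdifferentiableAt_ofRep_const a hx
  have hb := κ.mdifferentiableAt_ofRep_const b hx
  have hd : DifferentiableAt ℝ (κ.gram g) (κ x) :=
    ((κ.contDiffOn_gram g).contDiffAt (κ.open_target.mem_nhds hu)).differentiableAt (by simp)
  have hsm : MDifferentiableAt (𝓡 n) 𝓘(ℝ, ℝ)
      (fun y => g.form y (κ.ofRep (fun _ => a) y) (κ.ofRep (fun _ => b) y)) x :=
    ((g.contMDiffOn_apply (κ.smoothFieldOn_ofRep_const a)
      (κ.smoothFieldOn_ofRep_const b)).contMDiffAt (κ.open_source.mem_nhds hx)).mdifferentiableAt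
        (by simp)
  have h1 := h.metric x _ _ (κ.dsymm x c) ha hb
  rw [κ.mvfderiv_eq hx hsm, d_dsymm hx, ← κ.gram_d g hx, ← κ.gram_d g hx,
    ← κ.christoffel_eq nabla hx, ← κ.christoffel_eq nabla hx] at h1
  have h2 : (fun y => g.form y (κ.ofRep (fun _ => a) y) (κ.ofRep (fun _ => b) y)) ∘ κ.symm
      =ᶠ[𝓝 (κ x)] fun v => κ.gram g v a b := by
    filter_upwards [κ.open_target.mem_nhds hu] with v hv
    have := κ.gram_eq g (κ.map_target hv) a b
    rw [κ.right_inv hv] at this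
    exact this.symm
  rw [h2.fderiv_eq] at h1
  have h3 : fderiv ℝ (fun v => κ.gram g v a b) (κ x) c = fderiv ℝ (κ.gram g) (κ x) c a b := by
    have := ((hd.hasFDerivAt.clm_apply (hasFDerivAt_const a _)).clm_apply
      (hasFDerivAt_const b _)).fderiv
    rw [this]
    simp
  rw [h3] at h1
  simpa [ofRep, d_dsymm hx] using h1

end SmoothChart
end MetricsInCharts

/-! ### Projectability in adapted charts -/

section FlatProjectability

variable {E G : Type*} [NormedAddCommGroup E] [NormedSpace ℝ E]
  [NormedAddCommGroup G] [NormedSpace ℝ G]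

theorem exists_clm_eq_zero_iff_mem [FiniteDimensional ℝ E] (V : Submodule ℝ E) :
    ∃ q : E →L[ℝ] E, ∀ v, q v = 0 ↔ v ∈ V := by
  obtain ⟨C, hC⟩ := V.exists_isCompl
  refine ⟨LinearMap.toContinuousLinearMap (C.subtype ∘ₗ C.projectionOnto V hC.symm), fun v => ?_⟩
  simp

/-- A derivative of a map with values in a subspace has values in the subspace. -/
theorem fderiv_apply_mem [FiniteDimensional ℝ E] {f : G → E} {V : Submodule ℝ E} {u : G}
    (hf : DifferentiableAt ℝ f u) (h : ∀ᶠ w in 𝓝 u, f w ∈ V) (a : G) : fderiv ℝ f u a ∈ V := by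
  obtain ⟨q, hq⟩ := exists_clm_eq_zero_iff_mem V
  rw [← hq]
  have h1 : (fun w => q (f w)) =ᶠ[𝓝 u] fun _ => 0 := by
    filter_upwards [h] with w hw using (hq _).2 hw
  have h2 : HasFDerivAt (fun w => q (f w)) (q.comp (fderiv ℝ f u)) u :=
    q.hasFDerivAt.comp u hf.hasFDerivAt
  have h3 := h2.fderiv
  rw [h1.fderiv_eq] at h3
  have := congrArg (fun T : G →L[ℝ] E => T a) h3
  simpa using this.symm

theorem fderiv_fderiv_comm {f : E → G} {u : E} {N : Set E} (hN : IsOpen N)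
    (hf : ContDiffOn ℝ ∞ f N) (hu : u ∈ N) (a b : E) :
    fderiv ℝ (fderiv ℝ f) u a b = fderiv ℝ (fderiv ℝ f) u b a := by
  have h2 : (2 : ℕ∞ω) ≤ ∞ := WithTop.coe_le_coe.2 (le_top : (2 : ℕ∞) ≤ ⊤)
  exact ((hf.contDiffAt (hN.mem_nhds hu)).isSymmSndFDerivAt (by simpa using h2)).eq a b

theorem differentiableAt_fderiv {f : E → G} {u : E} {N : Set E} (hN : IsOpen N)
    (hf : ContDiffOn ℝ ∞ f N) (hu : u ∈ N) : DifferentiableAt ℝ (fderiv ℝ f) u :=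
  ((hf.fderiv_of_isOpen (m := ∞) hN (by simp)).contDiffAt (hN.mem_nhds hu)).differentiableAt
    (by simp)

theorem fderiv_fderiv_apply {f : E → G} {u : E} {N : Set E} (hN : IsOpen N)
    (hf : ContDiffOn ℝ ∞ f N) (hu : u ∈ N) (a b : E) :
    fderiv ℝ (fun w => fderiv ℝ f w b) u a = fderiv ℝ (fderiv ℝ f) u a b := by
  rw [((differentiableAt_fderiv hN hf hu).hasFDerivAt.clm_apply (hasFDerivAt_const b u)).fderiv]
  simp

variable {f : E → G} {W : E → E} {N : Set E} {V : Submodule ℝ E}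

/-- Differentiating `Df(W)` in the direction of a vector in the common kernel of all the `Df`. -/
theorem fderiv_fderiv_comp_apply (hN : IsOpen N) (hf : ContDiffOn ℝ ∞ f N)
    (hV : ∀ u ∈ N, ∀ v, fderiv ℝ f u v = 0 ↔ v ∈ V) (hW : ContDiffOn ℝ ∞ W N) {u : E}
    (hu : u ∈ N) {v : E} (hv : v ∈ V) :
    fderiv ℝ (fun w => fderiv ℝ f w (W w)) u v = fderiv ℝ f u (fderiv ℝ W u v) := by
  have hWd : DifferentiableAt ℝ W u := (hW.contDiffAt (hN.mem_nhds hu)).differentiableAt (by simp)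
  rw [((differentiableAt_fderiv hN hf hu).hasFDerivAt.clm_apply hWd.hasFDerivAt).fderiv]
  have h1 : (fun w => fderiv ℝ f w v) =ᶠ[𝓝 u] fun _ => 0 := by
    filter_upwards [hN.mem_nhds hu] with w hw using (hV w hw v).2 hv
  have h2 : fderiv ℝ (fderiv ℝ f) u v (W u) = 0 := by
    rw [fderiv_fderiv_comm hN hf hu, ← fderiv_fderiv_apply hN hf hu, h1.fderiv_eq]
    simp
  simp [h2]

/-- A smooth vector field that projects under `f` is differentiated into the kernel by vectors of
the kernel. -/
theorem fderiv_mem_of_projects (hN : IsOpen N) (hf : ContDiffOn ℝ ∞ f N)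
    (hV : ∀ u ∈ N, ∀ v, fderiv ℝ f u v = 0 ↔ v ∈ V) (hW : ContDiffOn ℝ ∞ W N) {Y : G → G} {u : E}
    (hu : u ∈ N) (hY : DifferentiableAt ℝ Y (f u)) (h : ∀ w ∈ N, fderiv ℝ f w (W w) = Y (f w))
    {v : E} (hv : v ∈ V) : fderiv ℝ W u v ∈ V := by
  rw [← hV u hu, ← fderiv_fderiv_comp_apply hN hf hV hW hu hv]
  have h1 : (fun w => fderiv ℝ f w (W w)) =ᶠ[𝓝 u] fun w => Y (f w) := by
    filter_upwards [hN.mem_nhds hu] with w hw using h w hw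
  have hfd : DifferentiableAt ℝ f u := (hf.contDiffAt (hN.mem_nhds hu)).differentiableAt (by simp)
  have h2 : HasFDerivAt (fun w => Y (f w)) ((fderiv ℝ Y (f u)).comp (fderiv ℝ f u)) u :=
    hY.hasFDerivAt.comp u hfd.hasFDerivAt
  rw [h1.fderiv_eq, h2.fderiv]
  simp [(hV u hu v).2 hv]

/-- Conversely, if kernel vectors differentiate `W` into the kernel, then `Df(W)` is locally
constant along the fibres of `f`. -/
theorem eventually_fderiv_apply_eq [FiniteDimensional ℝ E] (hN : IsOpen N) (hf : ContDiffOn ℝ ∞ f N)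
    (hV : ∀ u ∈ N, ∀ v, fderiv ℝ f u v = 0 ↔ v ∈ V) (hW : ContDiffOn ℝ ∞ W N)
    (h : ∀ u ∈ N, ∀ v ∈ V, fderiv ℝ W u v ∈ V) {u₀ : E} (hu₀ : u₀ ∈ N) :
    ∀ᶠ u in 𝓝 u₀, f u = f u₀ → fderiv ℝ f u (W u) = fderiv ℝ f u₀ (W u₀) := by
  obtain ⟨ε, hε, hball⟩ := Metric.isOpen_iff.1 hN u₀ hu₀
  obtain ⟨q, hq⟩ := exists_clm_eq_zero_iff_mem V
  -- functions whose derivative kills `V` are constant along `V` in the ball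
  have const : ∀ (F : E → G), (∀ u ∈ N, DifferentiableAt ℝ F u) →
      (∀ u ∈ N, ∀ v ∈ V, fderiv ℝ F u v = 0) → ∀ u ∈ Metric.ball u₀ ε,
      ∀ u' ∈ Metric.ball u₀ ε, u' - u ∈ V → F u' = F u := by
    intro F hF hF' u hu u' hu' huu
    have hseg : ∀ t ∈ Icc (0 : ℝ) 1, u + t • (u' - u) ∈ N := fun t ht =>
      hball ((convex_ball u₀ ε).add_smul_sub_mem hu hu' ht)
    have hd : ∀ t ∈ Icc (0 : ℝ) 1, HasDerivAt (fun t : ℝ => F (u + t • (u' - u))) 0 t := by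
      intro t ht
      have h1 : HasDerivAt (fun t : ℝ => u + t • (u' - u)) (u' - u) t := by
        simpa using ((hasDerivAt_id t).smul_const (u' - u)).const_add u
      have h2 := (hF _ (hseg t ht)).hasFDerivAt.comp_hasDerivAt t h1
      rwa [hF' _ (hseg t ht) _ huu] at h2
    have := constant_of_has_deriv_right_zero (f := fun t : ℝ => F (u + t • (u' - u))) (a := 0)
      (b := 1) (fun t ht => (hd t ht).continuousAt.continuousWithinAt)
      (fun t ht => (hd t ⟨ht.1, ht.2.le⟩).hasDerivWithinAt) 1 (right_mem_Icc.2 zero_le_one)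
    simpa using this
  have hfN : ∀ u ∈ N, DifferentiableAt ℝ f u := fun u hu =>
    (hf.contDiffAt (hN.mem_nhds hu)).differentiableAt (by simp)
  have hconstf := const f hfN fun u hu v hv => (hV u hu v).2 hv
  have hconstW := const (fun w => fderiv ℝ f w (W w)) (fun u hu =>
      (differentiableAt_fderiv hN hf hu).clm_apply
        ((hW.contDiffAt (hN.mem_nhds hu)).differentiableAt (by simp)))
    fun u hu v hv => by
      rw [fderiv_fderiv_comp_apply hN hf hV hW hu hv]
      exact (hV u hu _).2 (h u hu v hv)
  -- near `u₀`, a point `u` with `f u = f u₀` is in `u₀ + V`: the point `s u` of `u₀ + V` with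
  -- `u - s u ∈ C` has the same value of `f`, while `Df(u₀)` is bounded below on the complement `C`
  obtain ⟨C, hC⟩ := V.exists_isCompl
  let p : E →L[ℝ] E := LinearMap.toContinuousLinearMap (V.subtype ∘ₗ V.projectionOnto C hC)
  have hpV : ∀ v, p v ∈ V := fun v => Subtype.property _
  have hpC : ∀ v, v - p v ∈ C := fun v => by
    have := Submodule.projection_add_projection_eq_self hC v
    have h2 : v - p v = C.projectionOnto V hC.symm v := by
      rw [sub_eq_iff_eq_add, add_comm]
      exact this.symm
    rw [h2]
    exact Subtype.property _
  have hinj : LinearMap.ker ((fderiv ℝ f u₀).comp C.subtypeL).toLinearMap = ⊥ := by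
    rw [LinearMap.ker_eq_bot']
    intro c hc
    have h1 : (c : E) ∈ V := (hV u₀ hu₀ c).1 hc
    have h2 := hC.disjoint.le_bot ⟨h1, c.2⟩
    exact Subtype.ext h2
  obtain ⟨K, hK, hanti⟩ := LinearMap.exists_antilipschitzWith
    ((fderiv ℝ f u₀).comp C.subtypeL).toLinearMap hinj
  have hstrict : HasStrictFDerivAt f (fderiv ℝ f u₀) u₀ :=
    (hf.contDiffAt (hN.mem_nhds hu₀)).hasStrictFDerivAt (by simp)
  have hsmall := hstrict.isLittleO.def (c := (1 / (2 * K) : ℝ)) (by positivity)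
  let s : E → E := fun u => u₀ + p (u - u₀)
  have hs : Filter.Tendsto s (𝓝 u₀) (𝓝 u₀) := by
    have : Continuous s := by fun_prop
    simpa [s] using this.tendsto u₀
  have hpair : Filter.Tendsto (fun u => (u, s u)) (𝓝 u₀) (𝓝 (u₀, u₀)) := by
    rw [nhds_prod_eq]
    exact Filter.tendsto_id.prodMk hs
  filter_upwards [hpair.eventually hsmall, Metric.ball_mem_nhds u₀ hε,
    hs.eventually (Metric.ball_mem_nhds u₀ hε)] with u hsm hu hsu hfu
  have hsV : s u - u₀ ∈ V := by
    simp only [s, add_sub_cancel_left]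
    exact hpV _
  have hfs : f (s u) = f u₀ := hconstf u₀ (Metric.mem_ball_self hε) _ hsu hsV
  have hcC : u - s u ∈ C := by
    have := hpC (u - u₀)
    rwa [show u - u₀ - p (u - u₀) = u - s u by simp only [s]; abel] at this
  have h1 : ‖u - s u‖ ≤ K * ‖fderiv ℝ f u₀ (u - s u)‖ := by
    have := hanti.le_mul_dist ⟨u - s u, hcC⟩ 0
    simpa [dist_eq_norm] using this
  simp only [hfs, hfu, sub_self, zero_sub, norm_neg] at hsm
  have hKpos : (0 : ℝ) < K := hK
  have h2 : ‖u - s u‖ ≤ 1 / 2 * ‖u - s u‖ := by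
    calc ‖u - s u‖ ≤ K * ‖fderiv ℝ f u₀ (u - s u)‖ := h1
      _ ≤ K * (1 / (2 * K) * ‖u - s u‖) := by gcongr
      _ = 1 / 2 * ‖u - s u‖ := by field_simp
  have h3 : u = s u := by
    rw [← sub_eq_zero, ← norm_le_zero_iff]
    linarith
  refine hconstW u₀ (Metric.mem_ball_self hε) u hu ?_
  rw [h3]
  exact hsV

end FlatProjectability

section ManifoldProjectability

variable {n : ℕ} {M : Mfd.{u} n} {E : Type v} [NormedAddCommGroup E] [NormedSpace ℝ E]

namespace SmoothChart

/-- The preferred chart at a point. -/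
def at' (x : M) : SmoothChart M (EuclideanSpace ℝ (Fin n)) where
  toOpenPartialHomeomorph := chartAt (EuclideanSpace ℝ (Fin n)) x
  contMDiffOn := contMDiffOn_chart
  contMDiffOn_symm := contMDiffOn_chart_symm

theorem mem_source_at' (x : M) : x ∈ (at' x).source := mem_chart_source _ x

variable (κ : SmoothChart M E)

/-- In the chart, the field of subspaces `V` is the constant subspace `V₀`. -/
def Straightens (V : SubspaceField M) (V₀ : Submodule ℝ E) : Prop :=
  ∀ x ∈ κ.source, ∀ a : TangentSpace (𝓡 n) x, a ∈ V x ↔ κ.d x a ∈ V₀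

variable {k : ℕ} {B : Mfd.{w} k} {G : Type*} [NormedAddCommGroup G] [NormedSpace ℝ G]
  (χ : SmoothChart B G)

/-- The derivative of a map between manifolds in charts. -/
theorem fderiv_comp_charts {f : M → B} {U : Set M} (hU : IsOpen U)
    (hf : ContMDiffOn (𝓡 n) (𝓡 k) ∞ f U) {x : M} (hx : x ∈ κ.source) (hxU : x ∈ U)
    (hfx : f x ∈ χ.source) (b : E) :
    fderiv ℝ (χ ∘ f ∘ κ.symm) (κ x) b =
      χ.d (f x) (mfderiv (𝓡 n) (𝓡 k) f x (κ.dsymm x b)) := by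
  have hfd : MDifferentiableAt (𝓡 n) (𝓡 k) f x :=
    (hf.contMDiffAt (hU.mem_nhds hxU)).mdifferentiableAt (by simp)
  have h1 : HasMFDerivAt (𝓡 n) 𝓘(ℝ, G) (χ ∘ f) x
      ((mfderiv (𝓡 k) 𝓘(ℝ, G) χ (f x)).comp (mfderiv (𝓡 n) (𝓡 k) f x)) :=
    HasMFDerivAt.comp x (mdiffAt hfx).hasMFDerivAt hfd.hasMFDerivAt
  have h2 := κ.mvfderiv_eq hx h1.mdifferentiableAt (κ.dsymm x b)
  rw [d_dsymm hx] at h2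
  rw [show (χ : B → G) ∘ f ∘ κ.symm = (χ ∘ f) ∘ κ.symm from rfl, ← h2]
  show (mfderiv (𝓡 n) 𝓘(ℝ, G) (χ ∘ f) x) (κ.dsymm x b) = _
  rw [h1.mfderiv]
  rfl

theorem contDiffOn_comp_charts {f : M → B} {U : Set M}
    (hf : ContMDiffOn (𝓡 n) (𝓡 k) ∞ f U) :
    ContDiffOn ℝ ∞ (χ ∘ f ∘ κ.symm)
      (κ.target ∩ κ.symm ⁻¹' (U ∩ f ⁻¹' χ.source)) := by
  rw [← contMDiffOn_iff_contDiffOn]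
  exact χ.contMDiffOn.comp (hf.comp (κ.contMDiffOn_symm.mono inter_subset_left)
    fun u hu => hu.2.1) fun u hu => hu.2.2

theorem isOpen_comp_charts {f : M → B} {U : Set M} (hU : IsOpen U)
    (hf : ContMDiffOn (𝓡 n) (𝓡 k) ∞ f U) :
    IsOpen (κ.target ∩ κ.symm ⁻¹' (U ∩ f ⁻¹' χ.source)) :=
  κ.symm.isOpen_inter_preimage (hf.continuousOn.isOpen_inter_preimage hU χ.open_source)

theorem injective_d {x : B} (hx : x ∈ χ.source) {a b : TangentSpace (𝓡 k) x}
    (h : χ.d x a = χ.d x b) : a = b := by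
  rw [← dsymm_d hx a, h, dsymm_d hx]

variable {κ}

theorem fderiv_comp_charts_eq_zero_iff {V : SubspaceField M} {V₀ : Submodule ℝ E}
    (hκ : κ.Straightens V V₀) {f : M → B} {U : Set M} (hU : IsOpen U)
    (hf : ContMDiffOn (𝓡 n) (𝓡 k) ∞ f U) (hV : ∀ x ∈ U, vertical f x = V x) {u : E}
    (hu : u ∈ κ.target ∩ κ.symm ⁻¹' (U ∩ f ⁻¹' χ.source)) (v : E) :
    fderiv ℝ (χ ∘ f ∘ κ.symm) u v = 0 ↔ v ∈ V₀ := by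
  have hx := κ.map_target hu.1
  have h1 := κ.fderiv_comp_charts χ hU hf hx hu.2.1 hu.2.2 v
  rw [κ.right_inv hu.1] at h1
  have h2 := hκ _ hx (κ.dsymm _ v)
  rw [d_dsymm hx, ← hV _ hu.2.1] at h2
  rw [h1, ← h2]
  constructor
  · intro h
    exact injective_d χ hu.2.2 (h.trans (map_zero _).symm)
  · intro h
    rw [show mfderiv (𝓡 n) (𝓡 k) f (κ.symm u) (κ.dsymm (κ.symm u) v) = 0 from h, map_zero]

theorem fderiv_comp_charts_rep {f : M → B} {U : Set M} (hU : IsOpen U)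
    (hf : ContMDiffOn (𝓡 n) (𝓡 k) ∞ f U) {u : E} (X : VField M)
    (hu : u ∈ κ.target ∩ κ.symm ⁻¹' (U ∩ f ⁻¹' χ.source)) :
    fderiv ℝ (χ ∘ f ∘ κ.symm) u (κ.rep X u) = χ.d (f (κ.symm u))
      (mfderiv (𝓡 n) (𝓡 k) f (κ.symm u) (X (κ.symm u))) := by
  have hx := κ.map_target hu.1
  have h1 := κ.fderiv_comp_charts χ hU hf hx hu.2.1 hu.2.2 (κ.rep X u)
  rw [κ.right_inv hu.1] at h1
  rw [h1]
  unfold rep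
  rw [dsymm_d hx]

/-- In an adapted chart, vectors of the distribution differentiate a projectable field into the
distribution. -/
theorem fderiv_rep_mem_of_projects {V : SubspaceField M} {V₀ : Submodule ℝ E}
    (hκ : κ.Straightens V V₀) {f : M → B} {U : Set M} (hU : IsOpen U)
    (hf : ContMDiffOn (𝓡 n) (𝓡 k) ∞ f U) (hV : ∀ x ∈ U, vertical f x = V x)
    {X : VField M} (hX : SmoothFieldOn X U) {Y : VField B} (hY : SmoothFieldOn Y univ)
    (h : ∀ x ∈ U, mfderiv (𝓡 n) (𝓡 k) f x (X x) = Y (f x)) {u : E}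
    (hu : u ∈ κ.target ∩ κ.symm ⁻¹' U) {v : E} (hv : v ∈ V₀) : fderiv ℝ (κ.rep X) u v ∈ V₀ := by
  let χ := at' (f (κ.symm u))
  have hfu : f (κ.symm u) ∈ χ.source := mem_source_at' _
  have hmem : u ∈ κ.target ∩ κ.symm ⁻¹' (U ∩ f ⁻¹' χ.source) := ⟨hu.1, hu.2, hfu⟩
  refine fderiv_mem_of_projects (κ.isOpen_comp_charts χ hU hf) (κ.contDiffOn_comp_charts χ hf)
    (fun u hu v => fderiv_comp_charts_eq_zero_iff χ hκ hU hf hV hu v)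
    ((κ.contDiffOn_rep hX).mono fun u hu => ⟨hu.1, hu.2.1⟩) (Y := χ.rep Y) hmem ?_ ?_ hv
  · exact χ.differentiableAt_rep hfu (hY.mdifferentiableAt isOpen_univ (mem_univ _))
  · intro w hw
    rw [fderiv_comp_charts_rep χ hU hf X hw, h _ hw.2.1]
    exact (rep_apply hw.2.2).symm

end SmoothChart

/-- A vector field that is infinitesimally projectable in adapted charts projects under every
bundle projection having the leaves as its fibres. -/
theorem exists_projects_of_charts {V : SubspaceField M} {k : ℕ} {B : Mfd.{w} k} {f : M → B}
    {U : Set M} (hf : IsLocalLeafSpace V U f) {X : VField M} (hX : SmoothFieldOn X U)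
    (h : ∀ x ∈ U, ∃ (E : Type) (_ : NormedAddCommGroup E) (_ : NormedSpace ℝ E)
      (_ : FiniteDimensional ℝ E) (κ : SmoothChart M E) (V₀ : Submodule ℝ E), x ∈ κ.source ∧
      κ.Straightens V V₀ ∧ ∀ u ∈ κ.target ∩ κ.symm ⁻¹' U, ∀ v ∈ V₀,
        fderiv ℝ (κ.rep X) u v ∈ V₀) :
    ∃ Y : VField B, SmoothFieldOn Y univ ∧ ∀ x ∈ U, mfderiv (𝓡 n) (𝓡 k) f x (X x) = Y (f x) := by
  have hU := hf.bundle.isOpen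
  have hfs := hf.bundle.contMDiffOn
  let φ : M → EuclideanSpace ℝ (Fin k) := fun x => mfderiv (𝓡 n) (𝓡 k) f x (X x)
  -- local, hence global, constancy of `df X` along the fibres
  have hconst : ∀ x ∈ U, ∀ y ∈ U, f x = f y → φ x = φ y := by
    intro x hx y hy hxy
    have hpre := (hf.connected (f y)).isPreconnected
    refine hpre.induction₂ (fun x y => φ x = φ y) ?_ (fun x y z _ _ _ h1 h2 => h1.trans h2)
      (fun x y _ _ h => h.symm) ⟨hx, hxy⟩ ⟨hy, rfl⟩
    rintro z ⟨hzU, hzy⟩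
    obtain ⟨E, _, _, _, κ, V₀, hzκ, hκ, hXκ⟩ := h z hzU
    let χ := SmoothChart.at' (f z)
    have hfz : f z ∈ χ.source := SmoothChart.mem_source_at' _
    have hmem : κ z ∈ κ.target ∩ κ.symm ⁻¹' (U ∩ f ⁻¹' χ.source) := by
      refine ⟨κ.map_source hzκ, ?_⟩
      show κ.symm (κ z) ∈ U ∩ f ⁻¹' χ.source
      rw [κ.left_inv hzκ]
      exact ⟨hzU, hfz⟩
    have hloc := eventually_fderiv_apply_eq (κ.isOpen_comp_charts χ hU hfs)
      (κ.contDiffOn_comp_charts χ hfs)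
      (fun u hu v => SmoothChart.fderiv_comp_charts_eq_zero_iff χ hκ hU hfs hf.ker_eq hu v)
      ((κ.contDiffOn_rep hX).mono fun u hu => ⟨hu.1, hu.2.1⟩)
      (fun u hu v hv => hXκ u ⟨hu.1, hu.2.1⟩ v hv) hmem
    have hloc' := (κ.continuousAt hzκ).eventually hloc
    have hN : ∀ᶠ y in 𝓝 z, κ y ∈ κ.target ∩ κ.symm ⁻¹' (U ∩ f ⁻¹' χ.source) :=
      (κ.continuousAt hzκ).eventually ((κ.isOpen_comp_charts χ hU hfs).mem_nhds hmem)
    rw [eventually_nhdsWithin_iff]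
    filter_upwards [hloc', hN, κ.open_source.mem_nhds hzκ] with y hy1 hy2 hyκ hyK
    have hfy : f y = f z := hyK.2.trans hzy.symm
    have h1 := hy1 (by simp [κ.left_inv hyκ, κ.left_inv hzκ, hfy])
    rw [SmoothChart.fderiv_comp_charts_rep χ hU hfs X hy2,
      SmoothChart.fderiv_comp_charts_rep χ hU hfs X hmem, κ.left_inv hyκ, κ.left_inv hzκ] at h1
    have h2 : χ.d (f z) (φ y) = χ.d (f z) (φ z) := by
      rw [← h1, ← hfy]
    exact (SmoothChart.injective_d χ hfz h2).symm
  -- `Y b` is the common value of `df X` on the fibre over `b`; a local section shows that it is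
  -- smooth
  choose s hsU hs using fun b => hf.bundle.surjOn (mem_univ b)
  refine ⟨fun b => φ (s b), ?_, fun x hx => hconst x hx _ (hsU _) (hs _).symm⟩
  intro b _
  obtain ⟨W, hW, hbW, l, F, _, _, _, e, hes, het, hef, -, hesm⟩ := hf.bundle.locallyTrivial b
  let t₀ : F := (e (s b)).2
  let σ : B → M := fun b' => e.symm (b', t₀)
  have hmemt : ∀ b' ∈ W, (b', t₀) ∈ e.target := fun b' hb' => by
    rw [het]; exact ⟨hb', mem_univ _⟩
  have hσs : ∀ b' ∈ W, σ b' ∈ e.source := fun b' hb' => e.map_target (hmemt b' hb')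
  have hσU : ∀ b' ∈ W, σ b' ∈ U := fun b' hb' => by
    have := hσs b' hb'
    rw [hes] at this
    exact this.1
  have hfσ : ∀ b' ∈ W, f (σ b') = b' := fun b' hb' => by
    rw [← hef _ (hσs b' hb'), e.right_inv (hmemt b' hb')]
  have hσ : ContMDiffOn (𝓡 k) (𝓡 n) ∞ σ W :=
    hesm.comp (contMDiff_id.prodMk contMDiff_const).contMDiffOn hmemt
  have hXσ : ContMDiffOn (𝓡 k) (𝓡 n).tangent ∞
      (fun b' => (⟨σ b', X (σ b')⟩ : TangentBundle (𝓡 n) M)) W := hX.comp hσ hσU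
  have h3 := contMDiffOn_tangentMap_comp hU hfs hXσ hσU
  refine ((h3.congr fun b' hb' => ?_).contMDiffAt (hW.mem_nhds hbW)).contMDiffWithinAt
  refine TotalSpace.ext (hfσ b' hb').symm ?_
  refine heq_of_eq ?_
  exact hconst _ (hsU _) _ (hσU b' hb') ((hs b').trans (hfσ b' hb').symm)

end ManifoldProjectability

section Criterion

variable {n : ℕ} {M : Mfd.{u} n} {E : Type v} [NormedAddCommGroup E] [NormedSpace ℝ E]

namespace SmoothChart

variable (κ : SmoothChart M E)

theorem isOpen_preimage {U : Set M} (hU : IsOpen U) : IsOpen (κ.target ∩ κ.symm ⁻¹' U) :=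
  κ.symm.isOpen_inter_preimage hU

/-- The expression of `∇_X Y` in a chart. -/
theorem rep_connection (nabla : Connection M) {U : Set M} (hU : IsOpen U) {X Y : VField M}
    (hY : SmoothFieldOn Y U) {u : E} (hu : u ∈ κ.target ∩ κ.symm ⁻¹' U) :
    κ.rep (fun x => nabla Y x (X x)) u = fderiv ℝ (κ.rep Y) u (κ.rep X u) +
      κ.christoffel nabla u (κ.rep X u) (κ.rep Y u) := by
  have hx := κ.map_target hu.1
  have h1 := κ.d_connection_apply nabla hx (hY.mdifferentiableAt hU hu.2) (X (κ.symm u))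
  rw [κ.right_inv hu.1] at h1
  exact h1

theorem _root_.smoothFieldOn_of_rep {X : VField M} {U : Set M}
    (h : ContDiffOn ℝ ∞ (κ.rep X) (κ.target ∩ κ.symm ⁻¹' U)) :
    SmoothFieldOn X (κ.source ∩ U) := by
  refine ((κ.smoothFieldOn_ofRep h).mono fun x hx => ?_).congr fun x hx => ?_
  · refine ⟨hx.1, κ.map_source hx.1, ?_⟩
    show κ.symm (κ x) ∈ U
    rw [κ.left_inv hx.1]
    exact hx.2
  · refine TotalSpace.ext rfl (heq_of_eq ?_)
    exact (dsymm_rep hx.1).symm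

theorem contDiffOn_rep_connection [FiniteDimensional ℝ E] {nabla : Connection M}
    (h : CovariantDerivative.ContMDiffCovariantDerivative nabla ∞) {U : Set M} (hU : IsOpen U)
    {X Y : VField M} (hX : SmoothFieldOn X U) (hY : SmoothFieldOn Y U) :
    ContDiffOn ℝ ∞ (κ.rep fun x => nabla Y x (X x)) (κ.target ∩ κ.symm ⁻¹' U) := by
  have hX' := κ.contDiffOn_rep hX
  have hY' := κ.contDiffOn_rep hY
  have hΓ := (κ.contDiffOn_christoffel h).mono (inter_subset_left (t := κ.symm ⁻¹' U))
  refine ContDiffOn.congr (f := fun u => fderiv ℝ (κ.rep Y) u (κ.rep X u) +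
      κ.christoffel nabla u (κ.rep X u) (κ.rep Y u)) ?_
    fun u hu => κ.rep_connection nabla hU hY hu
  exact ((hY'.fderiv_of_isOpen (κ.isOpen_preimage hU) (by simp)).clm_apply hX').add
    ((hΓ.clm_apply hX').clm_apply hY')

theorem _root_.SmoothFieldOn.connection {nabla : Connection M}
    (h : CovariantDerivative.ContMDiffCovariantDerivative nabla ∞) {U : Set M} (hU : IsOpen U)
    {X Y : VField M} (hX : SmoothFieldOn X U) (hY : SmoothFieldOn Y U) :
    SmoothFieldOn (fun x => nabla Y x (X x)) U := by
  intro x hx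
  have h1 := smoothFieldOn_of_rep (at' x) ((at' x).contDiffOn_rep_connection h hU hX hY)
  have hm : (at' x).source ∩ U ∈ 𝓝 x :=
    Filter.inter_mem ((at' x).open_source.mem_nhds (mem_source_at' x)) (hU.mem_nhds hx)
  exact (h1.contMDiffAt hm).contMDiffWithinAt

/-- In the chart the distribution `V` is constant, and `Γ` descends to the quotient by it: it sends
`V` into `V` and is, modulo `V`, constant along `V`. -/
structure Invariant (nabla : Connection M) (V : SubspaceField M) (V₀ : Submodule ℝ E) : Prop where
  straightens : κ.Straightens V V₀
  christoffel_mem : ∀ u ∈ κ.target, ∀ v ∈ V₀, ∀ b, κ.christoffel nabla u v b ∈ V₀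
  fderiv_christoffel_mem : ∀ u ∈ κ.target, ∀ v ∈ V₀, ∀ a b,
    fderiv ℝ (κ.christoffel nabla) u v a b ∈ V₀

variable {κ}

theorem Straightens.rep_mem {V : SubspaceField M} {V₀ : Submodule ℝ E} (h : κ.Straightens V V₀)
    {X : VField M} {U : Set M} (hX : ∀ x ∈ U, X x ∈ V x) {u : E}
    (hu : u ∈ κ.target ∩ κ.symm ⁻¹' U) : κ.rep X u ∈ V₀ :=
  (h _ (κ.map_target hu.1) _).1 (hX _ hu.2)

theorem isParallel_of_charts {nabla : Connection M} (ht : IsTorsionFreeConnection nabla)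
    {V : SubspaceField M}
    (h : ∀ x : M, ∃ (E : Type) (_ : NormedAddCommGroup E) (_ : NormedSpace ℝ E)
      (_ : FiniteDimensional ℝ E) (κ : SmoothChart M E) (V₀ : Submodule ℝ E), x ∈ κ.source ∧
      κ.Straightens V V₀ ∧ ∀ u ∈ κ.target, ∀ v ∈ V₀, ∀ b, κ.christoffel nabla u v b ∈ V₀) :
    IsParallel nabla V := by
  intro U X hU hX hXV x hx a
  obtain ⟨E, _, _, _, κ, V₀, hxκ, hκ, hΓ⟩ := h x
  rw [hκ x hxκ, κ.d_connection_apply nabla hxκ (hX.mdifferentiableAt hU hx)]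
  have hmem : κ x ∈ κ.target ∩ κ.symm ⁻¹' U := by
    refine ⟨κ.map_source hxκ, ?_⟩
    show κ.symm (κ x) ∈ U
    rwa [κ.left_inv hxκ]
  refine V₀.add_mem ?_ ?_
  · refine fderiv_apply_mem (κ.differentiableAt_rep hxκ (hX.mdifferentiableAt hU hx)) ?_ _
    filter_upwards [(κ.isOpen_preimage hU).mem_nhds hmem] with w hw
    exact hκ.rep_mem hXV hw
  · rw [κ.christoffel_symm ht.torsion_eq_zero (κ.map_source hxκ)]
    exact hΓ _ (κ.map_source hxκ) _ (hκ.rep_mem hXV hmem) _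

theorem _root_.IsParallel.isInvolutive {nabla : Connection M} (ht : IsTorsionFreeConnection nabla)
    {V : SubspaceField M} (h : IsParallel nabla V) : IsInvolutive V := by
  intro U X Y hU hX hY hXV hYV x hx
  have h1 := nabla.torsion_eq_zero_iff.1 ht.torsion_eq_zero (hX.mdifferentiableAt hU hx)
    (hY.mdifferentiableAt hU hx)
  rw [← h1]
  exact (V x).sub_mem (h U Y hU hY hYV x hx _) (h U X hU hX hXV x hx _)

/-- Projectability of a connection, tested in adapted charts. -/
theorem isProjectableAlong_of_charts {nabla : Connection M} (ht : IsTorsionFreeConnection nabla)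
    {V : SubspaceField M}
    (h : ∀ x : M, ∃ (E : Type) (_ : NormedAddCommGroup E) (_ : NormedSpace ℝ E)
      (_ : FiniteDimensional ℝ E) (κ : SmoothChart M E) (V₀ : Submodule ℝ E), x ∈ κ.source ∧
      κ.Invariant nabla V V₀) :
    IsProjectableAlong nabla V := by
  refine ⟨(isParallel_of_charts ht fun x => ?_).isInvolutive ht, ?_⟩
  · obtain ⟨E, i1, i2, i3, κ, V₀, hx, hκ⟩ := h x
    exact ⟨E, i1, i2, i3, κ, V₀, hx, hκ.straightens, hκ.christoffel_mem⟩
  intro U X Y hU hX hY hXp hYp k B U' f hU' hf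
  obtain ⟨X', hX's, hX'⟩ := hXp k B U' f hU' hf
  obtain ⟨Y', hY's, hY'⟩ := hYp k B U' f hU' hf
  have hUo' := hf.bundle.isOpen
  have hX1 : SmoothFieldOn X U' := hX.mono hU'
  have hY1 : SmoothFieldOn Y U' := hY.mono hU'
  refine exists_projects_of_charts hf (hX1.connection ht.smooth hUo' hY1) fun x hx => ?_
  obtain ⟨E, i1, i2, i3, κ, V₀, hxκ, hκ⟩ := h x
  refine ⟨E, i1, i2, i3, κ, V₀, hxκ, hκ.straightens, fun u hu v hv => ?_⟩
  have hO := κ.isOpen_preimage hUo'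
  have hXd : fderiv ℝ (κ.rep X) u v ∈ V₀ :=
    fderiv_rep_mem_of_projects hκ.straightens hUo' hf.bundle.contMDiffOn hf.ker_eq hX1 hX's hX'
      hu hv
  have hYd : ∀ w ∈ κ.target ∩ κ.symm ⁻¹' U', ∀ v ∈ V₀, fderiv ℝ (κ.rep Y) w v ∈ V₀ :=
    fun w hw v hv => fderiv_rep_mem_of_projects hκ.straightens hUo' hf.bundle.contMDiffOn
      hf.ker_eq hY1 hY's hY' hw hv
  have hev : κ.rep (fun x => nabla Y x (X x)) =ᶠ[𝓝 u] fun u =>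
      fderiv ℝ (κ.rep Y) u (κ.rep X u) + κ.christoffel nabla u (κ.rep X u) (κ.rep Y u) := by
    filter_upwards [hO.mem_nhds hu] with w hw using κ.rep_connection nabla hUo' hY1 hw
  have cX := κ.contDiffOn_rep hX1
  have cY := κ.contDiffOn_rep hY1
  have dX : DifferentiableAt ℝ (κ.rep X) u := (cX.contDiffAt (hO.mem_nhds hu)).differentiableAt
    (by simp)
  have dY : DifferentiableAt ℝ (κ.rep Y) u := (cY.contDiffAt (hO.mem_nhds hu)).differentiableAt
    (by simp)
  have dΓ : DifferentiableAt ℝ (κ.christoffel nabla) u :=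
    ((κ.contDiffOn_christoffel ht.smooth).contDiffAt (κ.open_target.mem_nhds hu.1)).differentiableAt
    (by simp)
  have hder := (((differentiableAt_fderiv hO cY hu).hasFDerivAt.clm_apply
    dX.hasFDerivAt).add ((dΓ.hasFDerivAt.clm_apply dX.hasFDerivAt).clm_apply
    dY.hasFDerivAt)).congr_of_eventuallyEq hev
  rw [hder.fderiv]
  simp only [_root_.add_apply, ContinuousLinearMap.comp_apply, ContinuousLinearMap.flip_apply]
  refine V₀.add_mem (V₀.add_mem (hYd u hu _ hXd) ?_) (V₀.add_mem ?_ (V₀.add_mem ?_ ?_))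
  · -- by the symmetry of the second derivative, `D²Y(v, X) = D_X(D_v Y)`
    rw [fderiv_fderiv_comm hO cY hu, ← fderiv_fderiv_apply hO cY hu]
    refine fderiv_apply_mem ((differentiableAt_fderiv hO cY hu).clm_apply
      (differentiableAt_const _)) ?_ _
    filter_upwards [hO.mem_nhds hu] with w hw using hYd w hw v hv
  · rw [κ.christoffel_symm ht.torsion_eq_zero hu.1]
    exact hκ.christoffel_mem u hu.1 _ (hYd u hu v hv) _
  · exact hκ.christoffel_mem u hu.1 _ hXd _
  · exact hκ.fderiv_christoffel_mem u hu.1 v hv _ _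

end SmoothChart

end Criterion

/-! ### Adapted charts of bundles of cotangent-principal bundles -/

section CotangentBundle

variable {r m : ℕ} {S : Mfd.{w} r} {Q : Mfd.{v} m}
  {EN : Type*} [NormedAddCommGroup EN] [NormedSpace ℝ EN] {HN : Type*} [TopologicalSpace HN]
  {IN : ModelWithCorners ℝ EN HN} {N : Type*} [TopologicalSpace N] [ChartedSpace HN N]

/-- A covector in a chart. -/
def SmoothChart.cot {G : Type*} [NormedAddCommGroup G] [NormedSpace ℝ G] (χ : SmoothChart S G)
    (y : S) (ξ : Cotangent S y) : G →L[ℝ] ℝ :=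
  ContinuousLinearMap.comp (M₂ := EuclideanSpace ℝ (Fin r)) ξ (χ.dsymm y)

theorem SmoothChart.cot_apply {G : Type*} [NormedAddCommGroup G] [NormedSpace ℝ G]
    (χ : SmoothChart S G) (y : S) (ξ : Cotangent S y) (b : G) :
    χ.cot y ξ b = ξ (χ.dsymm y b) := rfl

theorem trivializationAt_cotangent (y₀ : S) {y : S} (hy : y ∈ (SmoothChart.at' y₀).source)
    (ξ : Cotangent S y) :
    (trivializationAt (EuclideanSpace ℝ (Fin r) →L[ℝ] ℝ)
      (fun y : S => TangentSpace (𝓡 r) y →L[ℝ] ℝ) y₀ ⟨y, ξ⟩).2 =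
      (SmoothChart.at' y₀).cot y ξ := by
  rw [hom_trivializationAt_apply]
  refine ContinuousLinearMap.ext fun b => ?_
  show (trivializationAt ℝ (Bundle.Trivial S ℝ) y₀).continuousLinearMapAt ℝ y
    (ξ ((trivializationAt (EuclideanSpace ℝ (Fin r)) (TangentSpace (𝓡 r)) y₀).symmL ℝ y b)) = _
  rw [TangentBundle.symmL_trivializationAt hy]
  have h1 : mfderivWithin 𝓘(ℝ, EuclideanSpace ℝ (Fin r)) (𝓡 r) (extChartAt (𝓡 r) y₀).symm
      (range (𝓡 r)) (extChartAt (𝓡 r) y₀ y) = (SmoothChart.at' y₀).dsymm y := by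
    rw [ModelWithCorners.Boundaryless.range_eq_univ, mfderivWithin_univ]
    rfl
  rw [h1]
  simp [SmoothChart.cot_apply]

theorem contMDiffOn_cotangent_iff (y₀ : S) {f : N → S} {ξ : Π x, Cotangent S (f x)} {U : Set N}
    (hU : ∀ x ∈ U, f x ∈ (SmoothChart.at' y₀).source) :
    ContMDiffOn IN ((𝓡 r).prod 𝓘(ℝ, EuclideanSpace ℝ (Fin r) →L[ℝ] ℝ)) ∞
      (fun x => (TotalSpace.mk' (EuclideanSpace ℝ (Fin r) →L[ℝ] ℝ) (f x) (ξ x) :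
        TotalSpace (EuclideanSpace ℝ (Fin r) →L[ℝ] ℝ)
          (fun y : S => TangentSpace (𝓡 r) y →L[ℝ] ℝ))) U ↔
    ContMDiffOn IN (𝓡 r) ∞ f U ∧ ContMDiffOn IN 𝓘(ℝ, EuclideanSpace ℝ (Fin r) →L[ℝ] ℝ) ∞
      (fun x => (SmoothChart.at' y₀).cot (f x) (ξ x)) U := by
  rw [(trivializationAt (EuclideanSpace ℝ (Fin r) →L[ℝ] ℝ)
      (fun y : S => TangentSpace (𝓡 r) y →L[ℝ] ℝ) y₀).contMDiffOn_iff]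
  · refine and_congr Iff.rfl (contMDiffOn_congr fun x hx => ?_)
    exact trivializationAt_cotangent y₀ (hU x hx) _
  · intro x hx
    rw [Trivialization.mem_source]
    exact ⟨hU x hx, trivial⟩

theorem contMDiffOn_pullback_cotangent_iff (q : C^∞⟮𝓡 m, Q; 𝓡 r, S⟯) (z₀ : Q) {f : N → Q}
    {ξ : Π x, Cotangent S (q (f x))} {U : Set N}
    (hU : ∀ x ∈ U, q (f x) ∈ (SmoothChart.at' (q z₀)).source) :
    ContMDiffOn IN ((𝓡 m).prod 𝓘(ℝ, EuclideanSpace ℝ (Fin r) →L[ℝ] ℝ)) ∞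
      (fun x => (⟨f x, ξ x⟩ :
        TotalSpace (EuclideanSpace ℝ (Fin r) →L[ℝ] ℝ)
          ((q : Q → S) *ᵖ (fun y : S => TangentSpace (𝓡 r) y →L[ℝ] ℝ)))) U ↔
    ContMDiffOn IN (𝓡 m) ∞ f U ∧ ContMDiffOn IN 𝓘(ℝ, EuclideanSpace ℝ (Fin r) →L[ℝ] ℝ) ∞
      (fun x => (SmoothChart.at' (q z₀)).cot (q (f x)) (ξ x)) U := by
  rw [(trivializationAt (EuclideanSpace ℝ (Fin r) →L[ℝ] ℝ)
      ((q : Q → S) *ᵖ (fun y : S => TangentSpace (𝓡 r) y →L[ℝ] ℝ)) z₀).contMDiffOn_iff]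
  · refine and_congr Iff.rfl (contMDiffOn_congr fun x hx => ?_)
    exact trivializationAt_cotangent (q z₀) (hU x hx) _
  · intro x hx
    rw [Trivialization.mem_source]
    exact ⟨hU x hx, trivial⟩

end CotangentBundle

section AdaptedCharts

variable {n m r : ℕ} {M : Mfd.{u} n} {Q : Mfd.{v} m} {S : Mfd.{w} r}

namespace CotangentPrincipalBundle

variable (C : CotangentPrincipalBundle M Q S)

/-- Charts of `M`, `Q` and `S` in which `p` and `q` are linear projections and the affine structure
of the fibres of `p` is the standard one. The chart of `S` is the preferred chart at `center`, and
the domain of the chart of `M` is a union of whole fibres of `p`. -/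
structure AdaptedChart (l : ℕ) where
  center : S
  middle : SmoothChart Q (EuclideanSpace ℝ (Fin r) × EuclideanSpace ℝ (Fin l))
  top : SmoothChart M ((EuclideanSpace ℝ (Fin r) × EuclideanSpace ℝ (Fin l)) ×
    (EuclideanSpace ℝ (Fin r) →L[ℝ] ℝ))
  q_mem (z : Q) : z ∈ middle.source → C.q z ∈ (SmoothChart.at' center).source
  q_eq (z : Q) : z ∈ middle.source → SmoothChart.at' center (C.q z) = (middle z).1
  p_mem (x : M) : x ∈ top.source → C.p x ∈ middle.source
  p_eq (x : M) : x ∈ top.source → middle (C.p x) = (top x).1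
  translate_mem (x : M) (ξ : Cotangent S (C.q (C.p x))) :
    x ∈ top.source → C.translate x ξ ∈ top.source
  translate_eq (x : M) (ξ : Cotangent S (C.q (C.p x))) : x ∈ top.source →
    top (C.translate x ξ) = ((top x).1, (top x).2 + (SmoothChart.at' center).cot _ ξ)

theorem p_translate (x : M) (ξ : Cotangent S (C.q (C.p x))) : C.p (C.translate x ξ) = C.p x :=
  (ξ +ᵥ (⟨x, rfl⟩ : C.p ⁻¹' {C.p x})).2

/-- A chart of `Q` in which `q` is a linear projection. -/
theorem exists_chart_linear_proj (z₀ : Q) : ∃ (l : ℕ)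
    (κ : SmoothChart Q (EuclideanSpace ℝ (Fin r) × EuclideanSpace ℝ (Fin l))), z₀ ∈ κ.source ∧
    (∀ z ∈ κ.source, C.q z ∈ (SmoothChart.at' (C.q z₀)).source) ∧
    ∀ z ∈ κ.source, SmoothChart.at' (C.q z₀) (C.q z) = (κ z).1 := by
  obtain ⟨W, hW, hzW, l, F, _, _, _, e, hes, het, hef, hesm, hesm'⟩ :=
    C.q_bundle.locallyTrivial (C.q z₀)
  let χ := SmoothChart.at' (C.q z₀)
  let φ := chartAt (EuclideanSpace ℝ (Fin l)) (e z₀).2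
  have hz₀ : z₀ ∈ e.source := by rw [hes]; exact ⟨trivial, hzW⟩
  let κ₀ : OpenPartialHomeomorph Q (EuclideanSpace ℝ (Fin r) × EuclideanSpace ℝ (Fin l)) :=
    e.trans (χ.toOpenPartialHomeomorph.prod φ)
  refine ⟨l, ⟨κ₀, ?_, ?_⟩, ?_, ?_, ?_⟩
  · refine ContMDiffOn.prodMk_space ?_ ?_
    · exact χ.contMDiffOn.comp (contMDiff_fst.comp_contMDiffOn
        (hesm.mono inter_subset_left)) fun z hz => hz.2.1
    · exact contMDiffOn_chart.comp (contMDiff_snd.comp_contMDiffOn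
        (hesm.mono inter_subset_left)) fun z hz => hz.2.2
  · have h1 : ContMDiffOn 𝓘(ℝ, EuclideanSpace ℝ (Fin r) × EuclideanSpace ℝ (Fin l)) (𝓡 r) ∞
        (fun a => χ.symm a.1) κ₀.target :=
      χ.contMDiffOn_symm.comp contDiff_fst.contMDiff.contMDiffOn fun a ha => ha.1.1
    have h2 : ContMDiffOn 𝓘(ℝ, EuclideanSpace ℝ (Fin r) × EuclideanSpace ℝ (Fin l)) (𝓡 l) ∞
        (fun a => φ.symm a.2) κ₀.target :=
      contMDiffOn_chart_symm.comp contDiff_snd.contMDiff.contMDiffOn fun a ha => ha.1.2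
    exact hesm'.comp (h1.prodMk h2) fun a ha => ha.2
  · refine ⟨hz₀, ?_, mem_chart_source _ _⟩
    show (e z₀).1 ∈ χ.source
    rw [hef _ hz₀]
    exact SmoothChart.mem_source_at' _
  · intro z hz
    have : (e z).1 ∈ χ.source := hz.2.1
    rwa [hef _ hz.1] at this
  · intro z hz
    show χ (C.q z) = χ (e z).1
    rw [hef _ hz.1]

/-- Equal base points may be exchanged in the difference with a section, although the two sides are
covectors in formally different cotangent spaces. -/
theorem cot_vsub_congr {E : Type*} [NormedAddCommGroup E] [NormedSpace ℝ E] (χ : SmoothChart S E)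
    (s : Π z : Q, C.p ⁻¹' {z}) {x : M} {z : Q} (h : C.p x = z) :
    χ.cot (C.q (C.p x)) ((⟨x, rfl⟩ : C.p ⁻¹' {C.p x}) -ᵥ s (C.p x)) =
      χ.cot (C.q z) ((⟨x, h⟩ : C.p ⁻¹' {z}) -ᵥ s z) := by
  subst h
  rfl

/-- Adapted charts exist around every point. -/
theorem exists_adaptedChart (x₀ : M) : ∃ (l : ℕ) (A : C.AdaptedChart l), x₀ ∈ A.top.source := by
  obtain ⟨O, hO, hxO, s, hs1, hs2⟩ := C.locallyTrivial (C.p x₀)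
  obtain ⟨l, κ, hxκ, hκ1, hκ2⟩ := C.exists_chart_linear_proj (C.p x₀)
  let κ' := κ.restr O hO
  let χ := SmoothChart.at' (C.q (C.p x₀))
  have hsub : κ'.source ⊆ κ.source := fun z hz => hz.1
  -- the fibre coordinate is the difference with a local section `s`, read in the chart `χ` of the
  -- base
  let f : M → (EuclideanSpace ℝ (Fin r) × EuclideanSpace ℝ (Fin l)) ×
      (EuclideanSpace ℝ (Fin r) →L[ℝ] ℝ) := fun x =>
    (κ' (C.p x), χ.cot (C.q (C.p x)) ((⟨x, rfl⟩ : C.p ⁻¹' {C.p x}) -ᵥ s (C.p x)))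
  let σ : (EuclideanSpace ℝ (Fin r) × EuclideanSpace ℝ (Fin l)) ×
      (EuclideanSpace ℝ (Fin r) →L[ℝ] ℝ) → Π z : Q, Cotangent S (C.q z) := fun w z =>
    (w.2.comp (χ.d (C.q z)))
  let g : (EuclideanSpace ℝ (Fin r) × EuclideanSpace ℝ (Fin l)) ×
      (EuclideanSpace ℝ (Fin r) →L[ℝ] ℝ) → M := fun w =>
    (σ w (κ'.symm w.1) +ᵥ s (κ'.symm w.1)).1
  have hpg : ∀ w, C.p (g w) = κ'.symm w.1 := fun w =>
    (σ w (κ'.symm w.1) +ᵥ s (κ'.symm w.1)).2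
  have hcotσ : ∀ w, ∀ z ∈ κ'.source, χ.cot (C.q z) (σ w z) = w.2 := by
    intro w z hz
    refine ContinuousLinearMap.ext fun b => ?_
    show w.2 (χ.d (C.q z) (χ.dsymm (C.q z) b)) = w.2 b
    rw [SmoothChart.d_dsymm (hκ1 _ (hsub hz))]
  have hfs : ContMDiffOn (𝓡 n) 𝓘(ℝ, (EuclideanSpace ℝ (Fin r) × EuclideanSpace ℝ (Fin l)) ×
      (EuclideanSpace ℝ (Fin r) →L[ℝ] ℝ)) ∞ f (C.p ⁻¹' κ'.source) := by
    refine ContMDiffOn.prodMk_space ?_ ?_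
    · exact κ'.contMDiffOn.comp C.p_smooth.contMDiffOn fun x hx => hx
    · exact ((contMDiffOn_pullback_cotangent_iff C.q (C.p x₀) (f := C.p)
        (ξ := fun x => (⟨x, rfl⟩ : C.p ⁻¹' {C.p x}) -ᵥ s (C.p x))
        fun x hx => hκ1 _ (hsub hx)).1 (hs2.mono fun x hx => hx.2)).2
  have hgs : ContMDiffOn 𝓘(ℝ, (EuclideanSpace ℝ (Fin r) × EuclideanSpace ℝ (Fin l)) ×
      (EuclideanSpace ℝ (Fin r) →L[ℝ] ℝ)) (𝓡 n) ∞ g (κ'.target ×ˢ univ) := by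
    have h1 := (contMDiffOn_pullback_cotangent_iff C.q (C.p x₀)
      (f := fun w : (EuclideanSpace ℝ (Fin r) × EuclideanSpace ℝ (Fin l)) ×
        (EuclideanSpace ℝ (Fin r) →L[ℝ] ℝ) => κ'.symm w.1)
      (ξ := fun w => σ w (κ'.symm w.1)) (U := κ'.target ×ˢ univ)
      (IN := 𝓘(ℝ, (EuclideanSpace ℝ (Fin r) × EuclideanSpace ℝ (Fin l)) ×
        (EuclideanSpace ℝ (Fin r) →L[ℝ] ℝ)))
      fun w hw => hκ1 _ (hsub (κ'.map_target hw.1))).2 ⟨?_, ?_⟩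
    · exact hs1.comp h1 fun w hw => (κ'.map_target hw.1).2
    · exact κ'.contMDiffOn_symm.comp contDiff_fst.contMDiff.contMDiffOn fun w hw => hw.1
    · exact contDiff_snd.contMDiff.contMDiffOn.congr
        fun w hw => hcotσ w _ (κ'.map_target hw.1)
  let top₀ : OpenPartialHomeomorph M ((EuclideanSpace ℝ (Fin r) × EuclideanSpace ℝ (Fin l)) ×
      (EuclideanSpace ℝ (Fin r) →L[ℝ] ℝ)) :=
    { toFun := f
      invFun := g
      source := C.p ⁻¹' κ'.source
      target := κ'.target ×ˢ univ
      map_source' := fun x hx => ⟨κ'.map_source hx, trivial⟩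
      map_target' := fun w hw => by
        show C.p (g w) ∈ κ'.source
        rw [hpg]
        exact κ'.map_target hw.1
      left_inv' := fun x hx => by
        have h1 : κ'.symm (f x).1 = C.p x := κ'.left_inv hx
        have h2 : ∀ z (h : C.p x = z), σ (f x) z = (⟨x, h⟩ : C.p ⁻¹' {z}) -ᵥ s z := by
          rintro z rfl
          refine ContinuousLinearMap.ext fun b => ?_
          show ((⟨x, rfl⟩ : C.p ⁻¹' {C.p x}) -ᵥ s (C.p x))
            (χ.dsymm (C.q (C.p x)) (χ.d (C.q (C.p x)) b)) = _
          rw [SmoothChart.dsymm_d (hκ1 _ (hsub hx))]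
        show (σ (f x) (κ'.symm (f x).1) +ᵥ s (κ'.symm (f x).1)).1 = x
        rw [h2 _ h1.symm, vsub_vadd]
      right_inv' := fun w hw => by
        refine Prod.ext ?_ ?_
        · show κ' (C.p (g w)) = w.1
          rw [hpg, κ'.right_inv hw.1]
        · show χ.cot (C.q (C.p (g w))) ((⟨g w, rfl⟩ : C.p ⁻¹' {C.p (g w)}) -ᵥ s (C.p (g w))) = w.2
          rw [C.cot_vsub_congr χ s (hpg w)]
          show χ.cot _ ((σ w (κ'.symm w.1) +ᵥ s (κ'.symm w.1)) -ᵥ s (κ'.symm w.1)) = w.2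
          rw [vadd_vsub, hcotσ w _ (κ'.map_target hw.1)]
      open_source := κ'.open_source.preimage C.p_smooth.continuous
      open_target := κ'.open_target.prod isOpen_univ
      continuousOn_toFun := hfs.continuousOn
      continuousOn_invFun := hgs.continuousOn }
  refine ⟨l, ⟨C.q (C.p x₀), κ', ⟨top₀, hfs, hgs⟩, fun z hz => hκ1 z (hsub hz),
    fun z hz => hκ2 z (hsub hz), fun x hx => hx, fun x hx => rfl, ?_, ?_⟩, ?_⟩
  · intro x ξ hx
    show C.p (C.translate x ξ) ∈ κ'.source
    rw [p_translate]
    exact hx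
  · intro x ξ hx
    refine Prod.ext ?_ ?_
    · show κ' (C.p (C.translate x ξ)) = κ' (C.p x)
      rw [p_translate]
    · show χ.cot (C.q (C.p (C.translate x ξ))) ((⟨C.translate x ξ, rfl⟩ :
        C.p ⁻¹' {C.p (C.translate x ξ)}) -ᵥ s (C.p (C.translate x ξ))) = _
      rw [C.cot_vsub_congr χ s (C.p_translate x ξ)]
      show χ.cot _ ((ξ +ᵥ (⟨x, rfl⟩ : C.p ⁻¹' {C.p x})) -ᵥ s (C.p x)) = _
      rw [vadd_vsub_assoc, add_comm]
      rfl
  · exact ⟨hxκ, hxO⟩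

end CotangentPrincipalBundle

end AdaptedCharts

section ChartDerivatives

variable {n k : ℕ} {M : Mfd.{u} n} {B : Mfd.{v} k}
  {E G : Type*} [NormedAddCommGroup E] [NormedSpace ℝ E] [NormedAddCommGroup G] [NormedSpace ℝ G]

namespace SmoothChart

variable (κ : SmoothChart M E) (χ : SmoothChart B G)

/-- The derivative of a map with a known expression in charts. -/
theorem d_mfderiv {f : M → B} {F : E → G} {F' : E →L[ℝ] G} {x : M}
    (hf : MDifferentiableAt (𝓡 n) (𝓡 k) f x) (hx : x ∈ κ.source) (hfx : f x ∈ χ.source)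
    (hF : HasFDerivAt F F' (κ x)) (h : ∀ᶠ y in 𝓝 x, χ (f y) = F (κ y))
    (a : TangentSpace (𝓡 n) x) :
    χ.d (f x) (mfderiv (𝓡 n) (𝓡 k) f x a) = F' (κ.d x a) := by
  have h1 : HasMFDerivAt (𝓡 n) 𝓘(ℝ, G) (χ ∘ f) x
      ((mfderiv (𝓡 k) 𝓘(ℝ, G) χ (f x)).comp (mfderiv (𝓡 n) (𝓡 k) f x)) :=
    HasMFDerivAt.comp x (mdiffAt hfx).hasMFDerivAt hf.hasMFDerivAt
  have h2 : HasMFDerivAt (𝓡 n) 𝓘(ℝ, G) (F ∘ κ) x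
      (F'.comp (mfderiv (𝓡 n) 𝓘(ℝ, E) κ x)) :=
    HasMFDerivAt.comp x hF.hasMFDerivAt (mdiffAt hx).hasMFDerivAt
  have h3 := h2.congr_of_eventuallyEq (f₁ := χ ∘ f) h
  exact congrArg (fun T : EuclideanSpace ℝ (Fin n) →L[ℝ] G => T a) (hasMFDerivAt_unique h1 h3)

theorem surjective_d {x : M} (hx : x ∈ κ.source) : Function.Surjective (κ.d x) := fun b =>
  ⟨κ.dsymm x b, d_dsymm hx b⟩

end SmoothChart

end ChartDerivatives

section AdaptedDerivatives

variable {n m r : ℕ} {M : Mfd.{u} n} {Q : Mfd.{v} m} {S : Mfd.{w} r}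

namespace CotangentPrincipalBundle

variable (C : CotangentPrincipalBundle M Q S)

theorem contMDiff_proj : ContMDiff (𝓡 n) (𝓡 r) ∞ C.proj := C.q.contMDiff.comp C.p_smooth

theorem mfderiv_proj (x : M) (a : TangentSpace (𝓡 n) x) :
    mfderiv (𝓡 n) (𝓡 r) C.proj x a =
      mfderiv (𝓡 m) (𝓡 r) C.q (C.p x) (mfderiv (𝓡 n) (𝓡 m) C.p x a) := by
  have h1 := mfderiv_comp (I := 𝓡 n) (I' := 𝓡 m) (I'' := 𝓡 r) x
    (g := (C.q : Q → S)) (f := C.p)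
    (C.q.contMDiff.mdifferentiableAt (by simp)) (C.p_smooth.mdifferentiableAt (by simp))
  exact congrArg (fun T : EuclideanSpace ℝ (Fin n) →L[ℝ] EuclideanSpace ℝ (Fin r) => T a) h1

namespace AdaptedChart

variable {C} {l : ℕ} (A : C.AdaptedChart l)

/-- The chart of the base underlying an adapted chart. -/
abbrev base : SmoothChart S (EuclideanSpace ℝ (Fin r)) := SmoothChart.at' A.center

theorem d_p {x : M} (hx : x ∈ A.top.source) (a : TangentSpace (𝓡 n) x) :
    A.middle.d (C.p x) (mfderiv (𝓡 n) (𝓡 m) C.p x a) = (A.top.d x a).1 := by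
  refine A.top.d_mfderiv A.middle (C.p_smooth.mdifferentiableAt (by simp)) hx (A.p_mem x hx)
    (hasFDerivAt_fst) ?_ a
  filter_upwards [A.top.open_source.mem_nhds hx] with y hy using A.p_eq y hy

theorem d_q {z : Q} (hz : z ∈ A.middle.source) (b : TangentSpace (𝓡 m) z) :
    A.base.d (C.q z) (mfderiv (𝓡 m) (𝓡 r) C.q z b) = (A.middle.d z b).1 := by
  refine A.middle.d_mfderiv A.base (C.q.contMDiff.mdifferentiableAt (by simp)) hz (A.q_mem z hz)
    (hasFDerivAt_fst) ?_ b
  filter_upwards [A.middle.open_source.mem_nhds hz] with y hy using A.q_eq y hy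

theorem proj_mem {x : M} (hx : x ∈ A.top.source) : C.proj x ∈ A.base.source :=
  A.q_mem _ (A.p_mem x hx)

theorem proj_eq {x : M} (hx : x ∈ A.top.source) : A.base (C.proj x) = (A.top x).1.1 := by
  rw [← A.p_eq x hx, ← A.q_eq _ (A.p_mem x hx)]
  rfl

theorem d_proj {x : M} (hx : x ∈ A.top.source) (a : TangentSpace (𝓡 n) x) :
    A.base.d (C.proj x) (mfderiv (𝓡 n) (𝓡 r) C.proj x a) = (A.top.d x a).1.1 := by
  rw [C.mfderiv_proj]
  exact (A.d_q (A.p_mem x hx) _).trans (congrArg Prod.fst (A.d_p hx a))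

theorem mem_vertical_p {x : M} (hx : x ∈ A.top.source) (a : TangentSpace (𝓡 n) x) :
    a ∈ vertical C.p x ↔ (A.top.d x a).1 = 0 := by
  rw [← A.d_p hx]
  constructor
  · intro h
    rw [show mfderiv (𝓡 n) (𝓡 m) C.p x a = 0 from h, map_zero]
  · intro h
    exact A.middle.injective_d (A.p_mem x hx) (h.trans (map_zero _).symm)

theorem mem_vertical_proj {x : M} (hx : x ∈ A.top.source) (a : TangentSpace (𝓡 n) x) :
    a ∈ vertical C.proj x ↔ (A.top.d x a).1.1 = 0 := by
  rw [← A.d_proj hx]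
  constructor
  · intro h
    rw [show mfderiv (𝓡 n) (𝓡 r) C.proj x a = 0 from h, map_zero]
  · intro h
    exact A.base.injective_d (A.proj_mem hx) (h.trans (map_zero _).symm)

theorem surjective_mfderiv_p {x : M} (hx : x ∈ A.top.source) :
    Function.Surjective (mfderiv (𝓡 n) (𝓡 m) C.p x) := by
  intro b
  refine ⟨A.top.dsymm x (A.middle.d _ b, 0), A.middle.injective_d (A.p_mem x hx) ?_⟩
  rw [A.d_p hx, SmoothChart.d_dsymm hx]

theorem d_fibreVector {x : M} (hx : x ∈ A.top.source) (ξ : Cotangent S (C.q (C.p x))) :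
    A.top.d x (C.fibreVector x ξ) = (0, A.base.cot _ ξ) := by
  have hcot : ∀ t : ℝ, A.base.cot _ (t • ξ) = t • A.base.cot _ ξ := fun t => rfl
  have h0 : C.translate x ((0 : ℝ) • ξ) = x := by
    unfold translate
    rw [zero_smul, zero_vadd]
  -- in the chart, the curve that defines the fibre vector is a straight line
  have htr : ∀ t : ℝ, C.translate x (t • ξ) =
      A.top.symm ((A.top x).1, (A.top x).2 + t • A.base.cot _ ξ) := by
    intro t
    rw [← hcot, ← A.translate_eq x (t • ξ) hx, A.top.left_inv (A.translate_mem x _ hx)]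
  let L : ℝ →L[ℝ] (EuclideanSpace ℝ (Fin r) × EuclideanSpace ℝ (Fin l)) ×
      (EuclideanSpace ℝ (Fin r) →L[ℝ] ℝ) :=
    (0 : ℝ →L[ℝ] _).prod ((ContinuousLinearMap.id ℝ ℝ).smulRight (A.base.cot _ ξ))
  have hline : HasFDerivAt (fun t : ℝ => ((A.top x).1, (A.top x).2 + t • A.base.cot _ ξ)) L 0 := by
    refine HasFDerivAt.prodMk (hasFDerivAt_const _ _) ?_
    exact ((hasFDerivAt_id (𝕜 := ℝ) (0 : ℝ)).smul_const _).const_add _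
  have hmem : ((A.top x).1, (A.top x).2 + (0 : ℝ) • A.base.cot _ ξ) = A.top x := by simp
  let T : ℝ →L[ℝ] EuclideanSpace ℝ (Fin n) :=
    ContinuousLinearMap.comp (M₃ := EuclideanSpace ℝ (Fin n)) (A.top.dsymm x) L
  have h1 : HasMFDerivAt 𝓘(ℝ, ℝ) (𝓡 n) (fun t : ℝ => C.translate x (t • ξ)) 0 T := by
    have h2 : HasMFDerivAt 𝓘(ℝ, (EuclideanSpace ℝ (Fin r) × EuclideanSpace ℝ (Fin l)) ×
        (EuclideanSpace ℝ (Fin r) →L[ℝ] ℝ)) (𝓡 n) A.top.symm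
        ((A.top x).1, (A.top x).2 + (0 : ℝ) • A.base.cot _ ξ)
        (A.top.dsymm x) := by
      rw [hmem]
      exact (SmoothChart.mdiffAt_symm (A.top.map_source hx)).hasMFDerivAt
    exact (HasMFDerivAt.comp (0 : ℝ) h2 hline.hasMFDerivAt).congr_of_eventuallyEq
      (Filter.Eventually.of_forall htr)
  have h3 : C.fibreVector x ξ = A.top.dsymm x (0, A.base.cot _ ξ) := by
    have h4 : C.fibreVector x ξ = T 1 :=
      congrArg (fun T : ℝ →L[ℝ] EuclideanSpace ℝ (Fin n) => T 1) h1.mfderiv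
    rw [h4]
    show A.top.dsymm x (L 1) = _
    congr 1
    exact Prod.ext rfl (one_smul ℝ _)
  rw [h3, SmoothChart.d_dsymm hx]

theorem exists_fibreVector {x : M} (hx : x ∈ A.top.source) {a : TangentSpace (𝓡 n) x}
    (ha : a ∈ vertical C.p x) : ∃ ξ, C.fibreVector x ξ = a := by
  rw [A.mem_vertical_p hx] at ha
  refine ⟨ContinuousLinearMap.comp (M₂ := EuclideanSpace ℝ (Fin r)) (A.top.d x a).2
    (A.base.d _), A.top.injective_d hx ?_⟩
  rw [A.d_fibreVector hx]
  refine Prod.ext ha.symm (ContinuousLinearMap.ext fun b => ?_)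
  show (A.top.d x a).2 (A.base.d _ (A.base.dsymm _ b)) = _
  rw [SmoothChart.d_dsymm (A.q_mem _ (A.p_mem x hx))]

end AdaptedChart

end CotangentPrincipalBundle

end AdaptedDerivatives

/-! ### The Killing operator in charts -/

section ConstantForms

variable {n m r : ℕ} {M : Mfd.{u} n} {Q : Mfd.{v} m} {S : Mfd.{w} r}

theorem exists_smooth_bump {U : Set Q} (hU : IsOpen U) {z : Q} (hz : z ∈ U) :
    ∃ φ : Q → ℝ, ContMDiff (𝓡 m) 𝓘(ℝ, ℝ) ∞ φ ∧ tsupport φ ⊆ U ∧ ∀ᶠ y in 𝓝 z, φ y = 1 := by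
  obtain ⟨f, -, hf⟩ :=
    (SmoothBumpFunction.nhds_basis_tsupport (I := 𝓡 m) z).mem_iff.1 (hU.mem_nhds hz)
  exact ⟨f, f.contMDiff, hf, f.eventuallyEq_one⟩

namespace CotangentPrincipalBundle

variable {C : CotangentPrincipalBundle M Q S}

/-- The covariant derivative of a section of `q^*T^*S` in charts. -/
theorem formDeriv_eq (C : CotangentPrincipalBundle M Q S) {E G : Type*} [NormedAddCommGroup E]
    [NormedSpace ℝ E] [NormedAddCommGroup G] [NormedSpace ℝ G] (D : Connection S)
    (κ : SmoothChart Q E) (χ : SmoothChart S G) {α : C.PullbackForm} {β : E → G →L[ℝ] ℝ} {z : Q}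
    (hz : z ∈ κ.source) (hqz : C.q z ∈ χ.source) (hβ : DifferentiableAt ℝ β (κ z))
    (hα : ∀ᶠ y in 𝓝 z, ∀ b, α y b = β (κ y) (χ.d (C.q y) b)) (a : TangentSpace (𝓡 m) z)
    (b : TangentSpace (𝓡 r) (C.q z)) :
    C.formDeriv D α z a b = fderiv ℝ β (κ z) (κ.d z a) (χ.d (C.q z) b) -
      β (κ z) (χ.christoffel D (χ (C.q z)) (χ.d (C.q z) (mfderiv (𝓡 m) (𝓡 r) C.q z a))
        (χ.d (C.q z) b)) := by
  let W : VField S := FiberBundle.extend (EuclideanSpace ℝ (Fin r)) b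
  have hW : W (C.q z) = b := FiberBundle.extend_apply_self _ _
  have hWd : MDifferentiableAt (𝓡 r) (𝓡 r).tangent
      (fun y => (⟨y, W y⟩ : TangentBundle (𝓡 r) S)) (C.q z) :=
    FiberBundle.mdifferentiableAt_extend ..
  have hrep := χ.differentiableAt_rep hqz hWd
  have hqd : DifferentiableAt ℝ (χ ∘ C.q ∘ κ.symm) (κ z) := by
    refine ((κ.contDiffOn_comp_charts χ (f := C.q) (U := univ)
      C.q.contMDiff.contMDiffOn).contDiffAt ((κ.isOpen_comp_charts χ (f := C.q) isOpen_univ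
      C.q.contMDiff.contMDiffOn).mem_nhds ?_)).differentiableAt (by simp)
    refine ⟨κ.map_source hz, trivial, ?_⟩
    show C.q (κ.symm (κ z)) ∈ χ.source
    rwa [κ.left_inv hz]
  have hq' : (χ ∘ C.q ∘ κ.symm) (κ z) = χ (C.q z) := by
    show χ (C.q (κ.symm (κ z))) = _
    rw [κ.left_inv hz]
  let F : E → ℝ := fun w => β w (χ.rep W ((χ ∘ C.q ∘ κ.symm) w))
  have hrep' : HasFDerivAt (χ.rep W) (fderiv ℝ (χ.rep W) (χ (C.q z)))
      ((χ ∘ C.q ∘ κ.symm) (κ z)) := by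
    rw [hq']
    exact hrep.hasFDerivAt
  have hF : HasFDerivAt F _ (κ z) := hβ.hasFDerivAt.clm_apply (hrep'.comp (κ z) hqd.hasFDerivAt)
  let g : Q → ℝ := fun z' => α z' (W (C.q z'))
  have hgF : g =ᶠ[𝓝 z] F ∘ κ := by
    filter_upwards [hα, κ.open_source.mem_nhds hz,
      C.q.contMDiff.continuous.continuousAt.preimage_mem_nhds (χ.open_source.mem_nhds hqz)]
      with y hy hyκ hyχ
    show α y (W (C.q y)) = β (κ y) (χ.rep W (χ (C.q (κ.symm (κ y)))))
    rw [hy, κ.left_inv hyκ, SmoothChart.rep_apply hyχ]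
  have hgF' : g ∘ κ.symm =ᶠ[𝓝 (κ z)] F := by
    have hu := κ.map_source hz
    have h1 : Filter.Tendsto κ.symm (𝓝 (κ z)) (𝓝 z) := by
      have := κ.symm.continuousAt hu
      unfold ContinuousAt at this
      rwa [κ.left_inv hz] at this
    filter_upwards [h1.eventually hgF, κ.open_target.mem_nhds hu] with w hw hwt
    show g (κ.symm w) = F w
    rw [hw]
    show F (κ (κ.symm w)) = F w
    rw [κ.right_inv hwt]
  have hgd : MDifferentiableAt (𝓡 m) 𝓘(ℝ, ℝ) g z :=
    (MDifferentiableAt.comp z hF.differentiableAt.mdifferentiableAt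
      (SmoothChart.mdiffAt hz)).congr_of_eventuallyEq hgF
  have h1 := κ.mvfderiv_eq hz hgd a
  rw [hgF'.fderiv_eq, hF.fderiv] at h1
  have h2 := χ.d_connection_apply D hqz hWd (mfderiv (𝓡 m) (𝓡 r) C.q z a)
  have h3 := κ.fderiv_comp_charts χ isOpen_univ (C.q.contMDiff.contMDiffOn) hz (mem_univ z) hqz
    (κ.d z a)
  rw [SmoothChart.dsymm_d hz] at h3
  have h4 : χ.rep W (χ (C.q z)) = χ.d (C.q z) b := by
    rw [SmoothChart.rep_apply hqz, hW]
  have h5 := hα.self_of_nhds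
  show mvfderiv (𝓡 m) g z a - α z (D W (C.q z) (mfderiv (𝓡 m) (𝓡 r) C.q z a)) = _
  rw [h1, h5, h2]
  simp only [_root_.add_apply, ContinuousLinearMap.comp_apply, ContinuousLinearMap.flip_apply,
    Function.comp_apply, map_add]
  have h6 : fderiv ℝ (χ ∘ C.q ∘ κ.symm) (κ z) (κ.d z a) =
    χ.d (C.q z) (mfderiv (𝓡 m) (𝓡 r) C.q z a) := h3
  rw [h6, κ.left_inv hz, h4]
  ring

namespace AdaptedChart

variable {l : ℕ} (A : C.AdaptedChart l)

/-- The section of `q^*T^*S` that equals the function `φ` times the constant covector `η` in the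
chart of the base. -/
def constForm (φ : Q → ℝ) (η : EuclideanSpace ℝ (Fin r) →L[ℝ] ℝ) : C.PullbackForm := fun z =>
  φ z • ContinuousLinearMap.comp (M₂ := EuclideanSpace ℝ (Fin r)) η (A.base.d (C.q z))

theorem constForm_apply (φ : Q → ℝ) (η : EuclideanSpace ℝ (Fin r) →L[ℝ] ℝ) (z : Q)
    (b : TangentSpace (𝓡 r) (C.q z)) :
    A.constForm φ η z b = φ z * η (A.base.d (C.q z) b) := rfl

theorem cot_constForm (φ : Q → ℝ) (η : EuclideanSpace ℝ (Fin r) →L[ℝ] ℝ) {z : Q}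
    (hz : z ∈ A.middle.source) : A.base.cot (C.q z) (A.constForm φ η z) = φ z • η := by
  refine ContinuousLinearMap.ext fun b => ?_
  show φ z * η (A.base.d _ (A.base.dsymm _ b)) = φ z * η b
  rw [SmoothChart.d_dsymm (A.q_mem z hz)]

theorem smoothForm_constForm {φ : Q → ℝ} (hφ : ContMDiff (𝓡 m) 𝓘(ℝ, ℝ) ∞ φ)
    (hs : tsupport φ ⊆ A.middle.source) (η : EuclideanSpace ℝ (Fin r) →L[ℝ] ℝ) :
    C.SmoothForm (A.constForm φ η) := by
  intro z
  by_cases hz : z ∈ A.middle.source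
  · refine ContMDiffOn.contMDiffAt (s := A.middle.source) ?_ (A.middle.open_source.mem_nhds hz)
    refine (contMDiffOn_cotangent_iff A.center (f := C.q) (ξ := A.constForm φ η)
      fun z hz => A.q_mem z hz).2 ⟨C.q.contMDiff.contMDiffOn, ?_⟩
    exact (hφ.smul contMDiff_const).contMDiffOn.congr fun z hz => A.cot_constForm φ η hz
  · let U : Set Q := (tsupport φ)ᶜ ∩ C.q ⁻¹' (SmoothChart.at' (C.q z)).source
    have hU : IsOpen U := (isClosed_tsupport φ).isOpen_compl.inter
      ((SmoothChart.at' (C.q z)).open_source.preimage C.q.contMDiff.continuous)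
    have hzU : z ∈ U := ⟨fun h => hz (hs h), SmoothChart.mem_source_at' _⟩
    refine ContMDiffOn.contMDiffAt (s := U) ?_ (hU.mem_nhds hzU)
    refine (contMDiffOn_cotangent_iff (C.q z) (f := C.q) (ξ := A.constForm φ η)
      fun z hz => hz.2).2 ⟨C.q.contMDiff.contMDiffOn, ?_⟩
    refine (contMDiffOn_const (c := (0 : EuclideanSpace ℝ (Fin r) →L[ℝ] ℝ))).congr fun z hz => ?_
    refine ContinuousLinearMap.ext fun b => ?_
    rw [SmoothChart.cot_apply, constForm_apply, image_eq_zero_of_notMem_tsupport hz.1, zero_mul]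
    rfl

/-- The covariant derivative of a form that is constant in the chart. -/
theorem formDeriv_constForm (D : Connection S) {φ : Q → ℝ} {z : Q}
    (hz : z ∈ A.middle.source) (h1 : ∀ᶠ y in 𝓝 z, φ y = 1)
    (η : EuclideanSpace ℝ (Fin r) →L[ℝ] ℝ) (a : TangentSpace (𝓡 m) z)
    (b : TangentSpace (𝓡 r) (C.q z)) :
    C.formDeriv D (A.constForm φ η) z a b =
      -η (A.base.christoffel D (A.middle z).1 (A.middle.d z a).1 (A.base.d _ b)) := by
  have h := C.formDeriv_eq D A.middle A.base (α := A.constForm φ η) (β := fun _ => η) hz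
    (A.q_mem z hz) (differentiableAt_const _) ?_ a b
  · rw [h, A.d_q hz, A.q_eq z hz]
    simp
  · filter_upwards [h1] with y hy b
    rw [constForm_apply, hy, one_mul]

/-- In an adapted chart, the metric is affine along the fibres of `p`, with the linear part given by
the Christoffel symbols of the base. This is the transformation law for a form that is the constant
covector `η` near the point, so that its translation is the one by `(0, η)`. -/
theorem gram_add {D : Connection S} (hD : IsTorsionFreeConnection D)
    {h : VerticalMetric (C.q : Q → S)} {g : PseudoRiemannianMetric M}
    (hg : IsRiemannPullbackExtension C D h g)
    {w : (EuclideanSpace ℝ (Fin r) × EuclideanSpace ℝ (Fin l)) × (EuclideanSpace ℝ (Fin r) →L[ℝ] ℝ)}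
    (hw : w ∈ A.top.target) (η : EuclideanSpace ℝ (Fin r) →L[ℝ] ℝ) :
    w + (0, η) ∈ A.top.target ∧ ∀ a b, A.top.gram g (w + (0, η)) a b =
      A.top.gram g w a b - 2 * η (A.base.christoffel D w.1.1 a.1.1 b.1.1) := by
  obtain ⟨x, hx, rfl⟩ : ∃ x ∈ A.top.source, A.top x = w :=
    ⟨A.top.symm w, A.top.map_target hw, A.top.right_inv hw⟩
  have hpx := A.p_mem x hx
  -- forms are global sections, hence the cut-off
  obtain ⟨φ, hφ, hφs, hφ1⟩ := exists_smooth_bump A.middle.open_source hpx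
  let α := A.constForm φ η
  have hcot : ∀ᶠ y in 𝓝 x, y ∈ A.top.source ∧ A.base.cot _ (α (C.p y)) = η := by
    filter_upwards [A.top.open_source.mem_nhds hx,
      C.p_smooth.continuous.continuousAt.eventually hφ1] with y hy hyφ
    refine ⟨hy, ?_⟩
    rw [A.cot_constForm φ η (A.p_mem y hy), hyφ, one_smul]
  have hmem : ∀ y ∈ A.top.source, C.translation α y ∈ A.top.source := fun y hy =>
    A.translate_mem y _ hy
  have heq : ∀ᶠ y in 𝓝 x, A.top (C.translation α y) = A.top y + (0, η) := by
    filter_upwards [hcot] with y hy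
    have := A.translate_eq y (α (C.p y)) hy.1
    refine this.trans ?_
    rw [hy.2]
    exact Prod.ext (add_zero _).symm rfl
  have hxη : A.top (C.translation α x) = A.top x + (0, η) := heq.self_of_nhds
  have hF : HasFDerivAt (fun w => w + ((0, η) :
      (EuclideanSpace ℝ (Fin r) × EuclideanSpace ℝ (Fin l)) × (EuclideanSpace ℝ (Fin r) →L[ℝ] ℝ)))
      (ContinuousLinearMap.id ℝ _) (A.top x) := (hasFDerivAt_id _).add_const _
  have hwη : A.top x + (0, η) ∈ A.top.target := by
    rw [← hxη]
    exact A.top.map_source (hmem x hx)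
  have hd : MDifferentiableAt (𝓡 n) (𝓡 n) (C.translation α) x := by
    have h1 : MDifferentiableAt (𝓡 n) (𝓡 n) (fun y => A.top.symm (A.top y + (0, η))) x :=
      MDifferentiableAt.comp x (g := A.top.symm) (SmoothChart.mdiffAt_symm hwη)
        (MDifferentiableAt.comp x hF.differentiableAt.mdifferentiableAt (SmoothChart.mdiffAt hx))
    refine h1.congr_of_eventuallyEq ?_
    filter_upwards [heq, hcot] with y hy hy'
    rw [← hy, A.top.left_inv (hmem y hy'.1)]
  have hdd : ∀ a, A.top.d (C.translation α x) (mfderiv (𝓡 n) (𝓡 n) (C.translation α) x a) =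
      A.top.d x a := fun a => A.top.d_mfderiv A.top hd hx (hmem x hx) hF heq a
  refine ⟨hwη, fun a b => ?_⟩
  obtain ⟨a, rfl⟩ := A.top.surjective_d hx a
  obtain ⟨b, rfl⟩ := A.top.surjective_d hx b
  have key := hg.transformation α (A.smoothForm_constForm hφ hφs η) x a b
  rw [← A.top.gram_d g (hmem x hx), ← A.top.gram_d g hx, hdd, hdd, hxη] at key
  rw [key]
  unfold killing
  rw [A.formDeriv_constForm D hpx hφ1, A.formDeriv_constForm D hpx hφ1, A.d_q hpx, A.d_q hpx,
    A.d_p hx, A.d_p hx, A.p_eq x hx, A.base.christoffel_symm hD.torsion_eq_zero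
      (a := (A.top.d x b).1.1)]
  · ring
  · rw [← A.proj_eq hx]
    exact A.base.map_source (A.proj_mem hx)

/-- The first condition on a pullback-extension in an adapted chart: the metric pairs the vectors
tangent to the fibres of `p` with the vectors of the base in the standard way. -/
theorem gram_vertical {D : Connection S}
    {h : VerticalMetric (C.q : Q → S)} {g : PseudoRiemannianMetric M}
    (hg : IsRiemannPullbackExtension C D h g)
    {w : (EuclideanSpace ℝ (Fin r) × EuclideanSpace ℝ (Fin l)) × (EuclideanSpace ℝ (Fin r) →L[ℝ] ℝ)}
    (hw : w ∈ A.top.target) (η : EuclideanSpace ℝ (Fin r) →L[ℝ] ℝ)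
    (b : (EuclideanSpace ℝ (Fin r) × EuclideanSpace ℝ (Fin l)) ×
      (EuclideanSpace ℝ (Fin r) →L[ℝ] ℝ)) :
    A.top.gram g w (0, η) b = η b.1.1 := by
  obtain ⟨x, hx, rfl⟩ : ∃ x ∈ A.top.source, A.top x = w :=
    ⟨A.top.symm w, A.top.map_target hw, A.top.right_inv hw⟩
  obtain ⟨b, rfl⟩ := A.top.surjective_d hx b
  have key := hg.standardType x (ContinuousLinearMap.comp (M₂ := EuclideanSpace ℝ (Fin r)) η
    (A.base.d _)) b
  rw [← A.top.gram_d g hx, A.d_fibreVector hx] at key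
  have h2 : A.base.cot (C.q (C.p x)) (ContinuousLinearMap.comp (M₂ := EuclideanSpace ℝ (Fin r)) η
      (A.base.d _)) = η := by
    refine ContinuousLinearMap.ext fun b => ?_
    show η (A.base.d _ (A.base.dsymm _ b)) = _
    rw [SmoothChart.d_dsymm (A.q_mem _ (A.p_mem x hx))]
  rw [h2] at key
  rw [key]
  show η (A.base.d _ (mfderiv (𝓡 n) (𝓡 r) C.proj x b)) = _
  exact congrArg η (A.d_proj hx b)

end AdaptedChart

end CotangentPrincipalBundle

end ConstantForms

/-! ### The Levi-Civita connection of a pullback-extension -/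

section FlatKoszul

theorem fderiv_eq_zero_of_line {E F : Type*} [NormedAddCommGroup E] [NormedSpace ℝ E]
    [NormedAddCommGroup F] [NormedSpace ℝ F] {f : E → F} {u c : E} (hf : DifferentiableAt ℝ f u)
    (h : ∀ᶠ t : ℝ in 𝓝 0, f (u + t • c) = f u) : fderiv ℝ f u c = 0 := by
  have h1 : HasDerivAt (fun t : ℝ => f (u + t • c)) (fderiv ℝ f u c) 0 :=
    hf.hasFDerivAt.hasLineDerivAt c
  have h2 : HasDerivAt (fun t : ℝ => f (u + t • c)) 0 0 :=
    (hasDerivAt_const (0 : ℝ) (f u)).congr_of_eventuallyEq h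
  exact h1.unique h2

theorem fderiv_clm_apply_apply {E F H G : Type*} [NormedAddCommGroup E] [NormedSpace ℝ E]
    [NormedAddCommGroup F] [NormedSpace ℝ F] [NormedAddCommGroup G] [NormedSpace ℝ G]
    [NormedAddCommGroup H] [NormedSpace ℝ H]
    {B : E → F →L[ℝ] H →L[ℝ] G} {w : E} (hB : DifferentiableAt ℝ B w) (c : E) (a : F) (b : H) :
    fderiv ℝ (fun w => B w a b) w c = fderiv ℝ B w c a b := by
  have h1 : HasFDerivAt (fun w => B w a) ((fderiv ℝ B w).flip a) w := by
    have := hB.hasFDerivAt.clm_apply (hasFDerivAt_const a w)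
    rwa [ContinuousLinearMap.comp_zero, zero_add] at this
  have h2 : HasFDerivAt (fun w => B w a b) (((fderiv ℝ B w).flip a).flip b) w := by
    have := h1.clm_apply (hasFDerivAt_const b w)
    rwa [ContinuousLinearMap.comp_zero, zero_add] at this
  rw [h2.fderiv]
  rfl

variable {n : ℕ} {M : Mfd.{u} n} {E : Type v} [NormedAddCommGroup E] [NormedSpace ℝ E]

/-- The Koszul formula for the Christoffel symbols. -/
theorem SmoothChart.koszul [FiniteDimensional ℝ E] (κ : SmoothChart M E)
    {g : PseudoRiemannianMetric M} {nabla : Connection M} (h : IsLeviCivita g nabla) {w : E}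
    (hw : w ∈ κ.target) (a b c : E) :
    2 * κ.gram g w (κ.christoffel nabla w a b) c = fderiv ℝ (κ.gram g) w a b c +
      fderiv ℝ (κ.gram g) w b a c - fderiv ℝ (κ.gram g) w c a b := by
  have hs := κ.christoffel_symm h.torsionFree.torsion_eq_zero hw
  rw [κ.fderiv_gram h hw, κ.fderiv_gram h hw, κ.fderiv_gram h hw, hs b a, hs c a, hs c b,
    κ.gram_symm g w a, κ.gram_symm g w b]
  ring

theorem SmoothChart.differentiableAt_gram [FiniteDimensional ℝ E] (κ : SmoothChart M E)
    (g : PseudoRiemannianMetric M) {w : E} (hw : w ∈ κ.target) :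
    DifferentiableAt ℝ (κ.gram g) w :=
  ((κ.contDiffOn_gram g).contDiffAt (κ.open_target.mem_nhds hw)).differentiableAt (by simp)

theorem SmoothChart.fderiv_gram_apply [FiniteDimensional ℝ E] (κ : SmoothChart M E)
    (g : PseudoRiemannianMetric M) {w : E} (hw : w ∈ κ.target) (c a b : E) :
    fderiv ℝ (fun w => κ.gram g w a b) w c = fderiv ℝ (κ.gram g) w c a b :=
  fderiv_clm_apply_apply (κ.differentiableAt_gram g hw) c a b

theorem SmoothChart.differentiableAt_christoffel [FiniteDimensional ℝ E] (κ : SmoothChart M E)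
    {nabla : Connection M} (h : IsTorsionFreeConnection nabla) {w : E} (hw : w ∈ κ.target) :
    DifferentiableAt ℝ (κ.christoffel nabla) w :=
  ((κ.contDiffOn_christoffel h.smooth).contDiffAt (κ.open_target.mem_nhds hw)).differentiableAt
    (by simp)

theorem SmoothChart.fderiv_christoffel_apply [FiniteDimensional ℝ E] (κ : SmoothChart M E)
    {nabla : Connection M} (h : IsTorsionFreeConnection nabla) {w : E} (hw : w ∈ κ.target)
    (c a b : E) :
    fderiv ℝ (fun w => κ.christoffel nabla w a b) w c =
      fderiv ℝ (κ.christoffel nabla) w c a b :=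
  fderiv_clm_apply_apply (κ.differentiableAt_christoffel h hw) c a b

end FlatKoszul

/-- The vectors tangent to the fibres of `p`, in an adapted chart. -/
def kerP (r l : ℕ) : Submodule ℝ ((EuclideanSpace ℝ (Fin r) × EuclideanSpace ℝ (Fin l)) ×
    (EuclideanSpace ℝ (Fin r) →L[ℝ] ℝ)) := LinearMap.ker (LinearMap.fst ℝ _ _)

/-- The vectors tangent to the fibres of `π`, in an adapted chart. -/
def kerProj (r l : ℕ) : Submodule ℝ ((EuclideanSpace ℝ (Fin r) × EuclideanSpace ℝ (Fin l)) ×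
    (EuclideanSpace ℝ (Fin r) →L[ℝ] ℝ)) :=
  LinearMap.ker ((LinearMap.fst ℝ _ _).comp (LinearMap.fst ℝ _ _))

theorem mem_kerP {a : (EuclideanSpace ℝ (Fin r) × EuclideanSpace ℝ (Fin l)) ×
    (EuclideanSpace ℝ (Fin r) →L[ℝ] ℝ)} : a ∈ kerP r l ↔ a.1 = 0 := Iff.rfl

theorem mem_kerProj {a : (EuclideanSpace ℝ (Fin r) × EuclideanSpace ℝ (Fin l)) ×
    (EuclideanSpace ℝ (Fin r) →L[ℝ] ℝ)} : a ∈ kerProj r l ↔ a.1.1 = 0 := Iff.rfl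

section LeviCivitaOfExtension

variable {n m r : ℕ} {M : Mfd.{u} n} {Q : Mfd.{v} m} {S : Mfd.{w} r}
  {C : CotangentPrincipalBundle M Q S}

namespace CotangentPrincipalBundle.AdaptedChart

variable {l : ℕ} (A : C.AdaptedChart l) {D : Connection S} (hD : IsTorsionFreeConnection D)
    {h : VerticalMetric (C.q : Q → S)} {g : PseudoRiemannianMetric M}
    (hg : IsRiemannPullbackExtension C D h g) {nabla : Connection M} (hn : IsLeviCivita g nabla)
    {w : (EuclideanSpace ℝ (Fin r) × EuclideanSpace ℝ (Fin l)) × (EuclideanSpace ℝ (Fin r) →L[ℝ] ℝ)}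
    (hw : w ∈ A.top.target)

theorem straightens_vertical_p : A.top.Straightens (vertical C.p) (kerP r l) := fun _ hx a =>
  A.mem_vertical_p hx a

theorem straightens_vertical_proj : A.top.Straightens (vertical C.proj) (kerProj r l) :=
  fun _ hx a => A.mem_vertical_proj hx a

include hg hw in
/-- The vectors orthogonal to `V` are tangent to the fibres of `p`. -/
theorem mem_kerP_of_gram {a : (EuclideanSpace ℝ (Fin r) × EuclideanSpace ℝ (Fin l)) ×
    (EuclideanSpace ℝ (Fin r) →L[ℝ] ℝ)}
    (ha : ∀ c ∈ kerProj r l, A.top.gram g w a c = 0) : a ∈ kerP r l := by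
  let ζ : EuclideanSpace ℝ (Fin r) →L[ℝ] ℝ := (A.top.gram g w a).comp
    ((ContinuousLinearMap.inl ℝ _ _).comp (ContinuousLinearMap.inl ℝ _ _))
  have h1 : a - (0, ζ) = 0 := A.top.gram_nondegenerate g hw fun b => by
    have hb : b = ((b.1.1, 0), 0) + ((0, b.1.2), b.2) := by simp
    rw [map_sub, _root_.sub_apply, A.gram_vertical hg hw]
    conv_lhs => rw [hb, map_add, ha ((0, b.1.2), b.2) (mem_kerProj.2 rfl), add_zero]
    simp [ζ]
  rw [sub_eq_zero] at h1
  rw [h1]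
  exact mem_kerP.2 rfl

include hg hw in
theorem fderiv_gram_const_right (c b : (EuclideanSpace ℝ (Fin r) × EuclideanSpace ℝ (Fin l)) ×
    (EuclideanSpace ℝ (Fin r) →L[ℝ] ℝ)) (η : EuclideanSpace ℝ (Fin r) →L[ℝ] ℝ) :
    fderiv ℝ (A.top.gram g) w c b (0, η) = 0 := by
  rw [← A.top.fderiv_gram_apply g hw]
  have h1 : (fun w => A.top.gram g w b (0, η)) =ᶠ[𝓝 w] fun _ => η b.1.1 := by
    filter_upwards [A.top.open_target.mem_nhds hw] with w hw
    rw [A.top.gram_symm, A.gram_vertical hg hw]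
  rw [h1.fderiv_eq]
  simp

include hg hw in
theorem fderiv_gram_const_left (c b : (EuclideanSpace ℝ (Fin r) × EuclideanSpace ℝ (Fin l)) ×
    (EuclideanSpace ℝ (Fin r) →L[ℝ] ℝ)) (η : EuclideanSpace ℝ (Fin r) →L[ℝ] ℝ) :
    fderiv ℝ (A.top.gram g) w c (0, η) b = 0 := by
  rw [← A.top.fderiv_gram_apply g hw]
  have h1 : (fun w => A.top.gram g w (0, η) b) =ᶠ[𝓝 w] fun _ => η b.1.1 := by
    filter_upwards [A.top.open_target.mem_nhds hw] with w hw
    rw [A.gram_vertical hg hw]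
  rw [h1.fderiv_eq]
  simp

include hD hg hw in
theorem fderiv_gram_vertical (a b : (EuclideanSpace ℝ (Fin r) × EuclideanSpace ℝ (Fin l)) ×
    (EuclideanSpace ℝ (Fin r) →L[ℝ] ℝ)) (η : EuclideanSpace ℝ (Fin r) →L[ℝ] ℝ) :
    fderiv ℝ (A.top.gram g) w (0, η) a b =
      -2 * η (A.base.christoffel D w.1.1 a.1.1 b.1.1) := by
  rw [← A.top.fderiv_gram_apply g hw]
  have hd : DifferentiableAt ℝ (fun w => A.top.gram g w a b) w :=
    ((A.top.differentiableAt_gram g hw).clm_apply (differentiableAt_const a)).clm_apply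
      (differentiableAt_const b)
  have h1 : HasDerivAt (fun t : ℝ => A.top.gram g (w + t • (0, η)) a b)
      (fderiv ℝ (fun w => A.top.gram g w a b) w (0, η)) 0 := hd.hasFDerivAt.hasLineDerivAt (0, η)
  have h2 : (fun t : ℝ => A.top.gram g (w + t • (0, η)) a b) = fun t : ℝ =>
      A.top.gram g w a b + t * (-2 * η (A.base.christoffel D w.1.1 a.1.1 b.1.1)) := by
    funext t
    rw [show t • ((0 : EuclideanSpace ℝ (Fin r) × EuclideanSpace ℝ (Fin l)), η) = (0, t • η) by
      simp, (A.gram_add hD hg hw (t • η)).2, _root_.smul_apply, smul_eq_mul]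
    ring
  rw [h2] at h1
  have h3 := ((hasDerivAt_id (0 : ℝ)).mul_const
    (-2 * η (A.base.christoffel D w.1.1 a.1.1 b.1.1))).const_add (A.top.gram g w a b)
  rw [one_mul] at h3
  exact h1.unique h3

include hD hg hn hw in
/-- The Levi-Civita connection has the Christoffel symbols of the base modulo `V`. -/
theorem christoffel_proj (a b : (EuclideanSpace ℝ (Fin r) × EuclideanSpace ℝ (Fin l)) ×
    (EuclideanSpace ℝ (Fin r) →L[ℝ] ℝ)) :
    (A.top.christoffel nabla w a b).1.1 = A.base.christoffel D w.1.1 a.1.1 b.1.1 := by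
  refine (SeparatingDual.eq_iff_forall_dual_eq (R := ℝ)).2 fun η => ?_
  have h1 := A.top.koszul hn hw a b (0, η)
  rw [A.top.gram_symm, A.gram_vertical hg hw, A.fderiv_gram_const_right hg hw,
    A.fderiv_gram_const_right hg hw, A.fderiv_gram_vertical hD hg hw] at h1
  linarith

include hD hg hn hw in
/-- The chart form of the statement that `Ker dp` is parallel. -/
theorem christoffel_vertical (η : EuclideanSpace ℝ (Fin r) →L[ℝ] ℝ)
    (a : (EuclideanSpace ℝ (Fin r) × EuclideanSpace ℝ (Fin l)) ×
      (EuclideanSpace ℝ (Fin r) →L[ℝ] ℝ)) :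
    A.top.christoffel nabla w (0, η) a ∈ kerP r l := by
  refine A.mem_kerP_of_gram hg hw fun c hc => ?_
  have h1 := A.top.koszul hn hw (0, η) a c
  rw [A.fderiv_gram_vertical hD hg hw, A.fderiv_gram_const_left hg hw,
    A.fderiv_gram_const_left hg hw, mem_kerProj.1 hc, map_zero, map_zero] at h1
  linarith

include hD hg hw in
/-- The derivatives of the metric that enter the Koszul formula for products with vectors tangent
to the fibres of `π` do not change along the fibres of `p`: the affine term of the metric depends
only on the coordinates and the components of the base, so one of `e` and `b` being vertical
suffices. -/
theorem fderiv_gram_add (η : EuclideanSpace ℝ (Fin r) →L[ℝ] ℝ)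
    (e a b : (EuclideanSpace ℝ (Fin r) × EuclideanSpace ℝ (Fin l)) ×
      (EuclideanSpace ℝ (Fin r) →L[ℝ] ℝ)) (h0 : e.1.1 = 0 ∨ b.1.1 = 0) :
    fderiv ℝ (A.top.gram g) (w + (0, η)) e a b = fderiv ℝ (A.top.gram g) w e a b := by
  have hwη := (A.gram_add hD hg hw η).1
  rw [← A.top.fderiv_gram_apply g hw, ← A.top.fderiv_gram_apply g hwη]
  have hd : ∀ w ∈ A.top.target, DifferentiableAt ℝ (fun w => A.top.gram g w a b) w := fun w hw =>
    ((A.top.differentiableAt_gram g hw).clm_apply (differentiableAt_const a)).clm_apply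
      (differentiableAt_const b)
  have hsub : HasFDerivAt (fun w => A.top.gram g (w + (0, η)) a b - A.top.gram g w a b)
      (fderiv ℝ (fun w => A.top.gram g w a b) (w + (0, η)) -
        fderiv ℝ (fun w => A.top.gram g w a b) w) w := by
    refine HasFDerivAt.sub ?_ (hd w hw).hasFDerivAt
    exact HasFDerivAt.comp w (g := fun w => A.top.gram g w a b) (hd _ hwη).hasFDerivAt
      ((hasFDerivAt_id w).add_const (0, η))
  have hz : fderiv ℝ (fun w => A.top.gram g (w + (0, η)) a b - A.top.gram g w a b) w e = 0 := by
    refine fderiv_eq_zero_of_line hsub.differentiableAt ?_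
    have hc : Filter.Tendsto (fun t : ℝ => w + t • e) (𝓝 0) (𝓝 w) := by
      have : Continuous fun t : ℝ => w + t • e := by fun_prop
      simpa using this.tendsto 0
    filter_upwards [hc (A.top.open_target.mem_nhds hw)] with t ht
    rw [(A.gram_add hD hg ht η).2, (A.gram_add hD hg hw η).2]
    rcases h0 with h0 | h0
    · simp [h0]
    · simp [h0]
  rw [hsub.fderiv, _root_.sub_apply, sub_eq_zero] at hz
  exact hz

include hD hg hn hw in
/-- Along the fibres of `p` the Christoffel symbols are constant modulo `Ker dp`. -/
theorem christoffel_add_sub (η : EuclideanSpace ℝ (Fin r) →L[ℝ] ℝ)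
    (a b : (EuclideanSpace ℝ (Fin r) × EuclideanSpace ℝ (Fin l)) ×
      (EuclideanSpace ℝ (Fin r) →L[ℝ] ℝ)) :
    A.top.christoffel nabla (w + (0, η)) a b - A.top.christoffel nabla w a b ∈ kerP r l := by
  have hwη := (A.gram_add hD hg hw η).1
  refine A.mem_kerP_of_gram hg hw fun c hc => ?_
  have h1 := A.top.koszul hn hw a b c
  have h2 := A.top.koszul hn hwη a b c
  rw [(A.gram_add hD hg hw η).2, mem_kerProj.1 hc, map_zero, map_zero,
    A.fderiv_gram_add hD hg hw η _ _ _ (Or.inr hc), A.fderiv_gram_add hD hg hw η _ _ _ (Or.inr hc),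
    A.fderiv_gram_add hD hg hw η _ _ _ (Or.inl hc)] at h2
  rw [map_sub, _root_.sub_apply]
  linarith

include hD hg hn in
theorem invariant_vertical_p : A.top.Invariant nabla (vertical C.p) (kerP r l) := by
  refine ⟨A.straightens_vertical_p, fun w hw v hv b => ?_, fun w hw v hv a b => ?_⟩
  · obtain ⟨v1, η⟩ := v
    obtain rfl : v1 = 0 := hv
    exact A.christoffel_vertical hD hg hn hw η b
  · obtain ⟨v1, η⟩ := v
    obtain rfl : v1 = 0 := hv
    rw [← A.top.fderiv_christoffel_apply hn.torsionFree hw, mem_kerP]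
    have hd : DifferentiableAt ℝ (fun w => A.top.christoffel nabla w a b) w :=
      ((A.top.differentiableAt_christoffel hn.torsionFree hw).clm_apply
        (differentiableAt_const a)).clm_apply (differentiableAt_const b)
    have h1 := (hasFDerivAt_fst (𝕜 := ℝ)).comp w hd.hasFDerivAt
    have h2 := fderiv_eq_zero_of_line (c := (0, η)) h1.differentiableAt
      (Filter.Eventually.of_forall fun t => ?_)
    · rwa [h1.fderiv] at h2
    · have h3 := A.christoffel_add_sub hD hg hn hw (t • η) a b
      rw [mem_kerP, Prod.fst_sub, sub_eq_zero] at h3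
      rw [show t • ((0 : EuclideanSpace ℝ (Fin r) × EuclideanSpace ℝ (Fin l)), η) = (0, t • η) by
        simp]
      exact h3

include hD hg hn in
theorem invariant_vertical_proj : A.top.Invariant nabla (vertical C.proj) (kerProj r l) := by
  refine ⟨A.straightens_vertical_proj, fun w hw v hv b => ?_, fun w hw v hv a b => ?_⟩
  · rw [mem_kerProj, A.christoffel_proj hD hg hn hw, mem_kerProj.1 hv, map_zero]
    rfl
  · rw [← A.top.fderiv_christoffel_apply hn.torsionFree hw, mem_kerProj]
    have hd : DifferentiableAt ℝ (fun w => A.top.christoffel nabla w a b) w :=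
      ((A.top.differentiableAt_christoffel hn.torsionFree hw).clm_apply
        (differentiableAt_const a)).clm_apply (differentiableAt_const b)
    have h1 := (hasFDerivAt_fst (𝕜 := ℝ)).comp w ((hasFDerivAt_fst (𝕜 := ℝ)).comp w hd.hasFDerivAt)
    have hc : Filter.Tendsto (fun t : ℝ => w + t • v) (𝓝 0) (𝓝 w) := by
      have : Continuous fun t : ℝ => w + t • v := by fun_prop
      simpa using this.tendsto 0
    have h2 := fderiv_eq_zero_of_line (c := v) h1.differentiableAt ?_
    · rwa [h1.fderiv] at h2
    · filter_upwards [hc (A.top.open_target.mem_nhds hw)] with t ht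
      show (A.top.christoffel nabla (w + t • v) a b).1.1 = (A.top.christoffel nabla w a b).1.1
      rw [A.christoffel_proj hD hg hn hw, A.christoffel_proj hD hg hn ht]
      have : (w + t • v).1.1 = w.1.1 := by
        simp [mem_kerProj.1 hv]
      rw [this]

end CotangentPrincipalBundle.AdaptedChart

end LeviCivitaOfExtension

section LeviCivitaConnection

variable {n m r k : ℕ} {M : Mfd.{u} n} {Q : Mfd.{v} m} {S : Mfd.{w} r}

theorem SmoothChart.differentiableAt_rep_of_smoothFieldOn {E : Type*} [NormedAddCommGroup E]
    [NormedSpace ℝ E] (κ : SmoothChart M E) {X : VField M} {U : Set M} (hU : IsOpen U)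
    (hX : SmoothFieldOn X U) {x : M} (hx : x ∈ κ.source) (hxU : x ∈ U) :
    DifferentiableAt ℝ (κ.rep X) (κ x) :=
  κ.differentiableAt_rep hx (hX.mdifferentiableAt hU hxU)

/-- Projectability onto a connection, tested in charts in which the projection is linear. -/
theorem projectsOnto_of_charts {nabla : Connection M} {U : Set M} {f : M → S} {D : Connection S}
    (hf : ∀ x ∈ U, MDifferentiableAt (𝓡 n) (𝓡 r) f x)
    (h : ∀ x ∈ U, ∃ (E : Type) (_ : NormedAddCommGroup E) (_ : NormedSpace ℝ E)
      (G : Type) (_ : NormedAddCommGroup G) (_ : NormedSpace ℝ G)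
      (κ : SmoothChart M E) (χ : SmoothChart S G) (ℓ : E →L[ℝ] G), x ∈ κ.source ∧
      (∀ y ∈ κ.source, f y ∈ χ.source ∧ χ (f y) = ℓ (κ y)) ∧
      ∀ a b, ℓ (κ.christoffel nabla (κ x) a b) = χ.christoffel D (ℓ (κ x)) (ℓ a) (ℓ b)) :
    ProjectsOnto nabla U f D := by
  intro U' O X Y X' Y' hU' hUU' hO hfO hX hY hX' hY' hXX' hYY' x hx
  obtain ⟨E, _, _, G, _, _, κ, χ, ℓ, hxκ, hκ, hΓ⟩ := h x (hUU' hx)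
  have hfx := (hκ x hxκ).1
  have hd : ∀ y ∈ κ.source, y ∈ U' → ∀ a,
      χ.d (f y) (mfderiv (𝓡 n) (𝓡 r) f y a) = ℓ (κ.d y a) := by
    intro y hy hyU a
    refine κ.d_mfderiv χ (hf y (hUU' hyU)) hy (hκ y hy).1 ℓ.hasFDerivAt ?_ a
    filter_upwards [κ.open_source.mem_nhds hy] with z hz using (hκ z hz).2
  refine χ.injective_d hfx ?_
  rw [hd x hxκ hx, κ.d_connection_apply nabla hxκ (hY.mdifferentiableAt hU' hx), map_add, hΓ,
    χ.d_connection_apply D hfx (hY'.mdifferentiableAt hO (hfO hx)), ← hXX' x hx, hd x hxκ hx,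
    SmoothChart.rep_apply hxκ, SmoothChart.rep_apply hfx, ← hYY' x hx, hd x hxκ hx,
    (hκ x hxκ).2]
  congr 1
  have hYd := κ.differentiableAt_rep_of_smoothFieldOn hU' hY hxκ hx
  have hYd' : DifferentiableAt ℝ (χ.rep Y') (ℓ (κ x)) := by
    rw [← (hκ x hxκ).2]
    exact χ.differentiableAt_rep_of_smoothFieldOn hO hY' hfx (hfO hx)
  have hmem : κ x ∈ κ.target ∩ κ.symm ⁻¹' U' := by
    refine ⟨κ.map_source hxκ, ?_⟩
    show κ.symm (κ x) ∈ U'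
    rwa [κ.left_inv hxκ]
  have e1 : (fun w => ℓ (κ.rep Y w)) =ᶠ[𝓝 (κ x)] fun w => χ.rep Y' (ℓ w) := by
    filter_upwards [(κ.isOpen_preimage hU').mem_nhds hmem] with w hw
    have hy := κ.map_target hw.1
    have h1 : κ.rep Y w = κ.d (κ.symm w) (Y (κ.symm w)) := rfl
    rw [h1, ← hd _ hy hw.2, hYY' _ hw.2, ← SmoothChart.rep_apply (hκ _ hy).1, (hκ _ hy).2,
      κ.right_inv hw.1]
  have h1 : HasFDerivAt (fun w => ℓ (κ.rep Y w)) (ℓ.comp (fderiv ℝ (κ.rep Y) (κ x))) (κ x) :=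
    ℓ.hasFDerivAt.comp (κ x) hYd.hasFDerivAt
  have h2 : HasFDerivAt (fun w => χ.rep Y' (ℓ w)) ((fderiv ℝ (χ.rep Y') (ℓ (κ x))).comp ℓ) (κ x) :=
    hYd'.hasFDerivAt.comp (κ x) ℓ.hasFDerivAt
  exact congrArg (fun T : E →L[ℝ] G => T (κ.d x (X x))) (h1.unique (h2.congr_of_eventuallyEq e1))

/-- Uniqueness of the fibre metric is automatic for submersions. -/
theorem arisesFrom_of_surjective {g : PseudoRiemannianMetric M} {U : Set M} {p : M → Q} {q : Q → S}
    {h : VerticalMetric q} (hr : RestrictsToPullback g U p q h.form)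
    (hs : ∀ x ∈ U, Function.Surjective (mfderiv (𝓡 n) (𝓡 m) p x)) : ArisesFrom g U p q h := by
  refine ⟨hr, fun h' hr' x hx => ?_⟩
  refine LinearMap.ext fun a => LinearMap.ext fun b => ?_
  obtain ⟨a, ha⟩ := a
  obtain ⟨b, hb⟩ := b
  obtain ⟨a, rfl⟩ := hs x hx a
  obtain ⟨b, rfl⟩ := hs x hx b
  exact (hr' x hx a b ha hb).symm.trans (hr x hx a b ha hb)

/-- The properties of the Levi-Civita connection of a Riemann pullback-extension, each of them
checked in adapted charts. -/
theorem levi_civita_of_pullback_extension (C : CotangentPrincipalBundle M Q S) (D : Connection S)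
    (h : VerticalMetric (C.q : Q → S)) (g : PseudoRiemannianMetric M) (nabla : Connection M)
    (hD : IsTorsionFreeConnection D) (hg : IsRiemannPullbackExtension C D h g)
    (hn : IsLeviCivita g nabla) :
    orthComplement g (vertical C.p) = vertical C.proj ∧
      orthComplement g (vertical C.proj) = vertical C.p ∧
      IsNull g (vertical C.p) ∧
      IsParallel nabla (vertical C.p) ∧
      IsProjectableAlong nabla (vertical C.p) ∧
      IsProjectableAlong nabla (vertical C.proj) ∧
      ProjectsOnto nabla univ C.proj D ∧
      ArisesFrom g univ C.p C.q h := by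
  have hpV : ∀ x, ∀ a ∈ vertical C.p x, a ∈ vertical C.proj x := by
    intro x a ha
    show mfderiv (𝓡 n) (𝓡 r) C.proj x a = 0
    rw [C.mfderiv_proj, show mfderiv (𝓡 n) (𝓡 m) C.p x a = 0 from ha, map_zero]
    rfl
  have horth : ∀ x, ∀ a ∈ vertical C.p x, ∀ b ∈ vertical C.proj x, g.form x a b = 0 := by
    intro x a ha b hb
    obtain ⟨l, A, hx⟩ := C.exists_adaptedChart x
    obtain ⟨ξ, rfl⟩ := A.exists_fibreVector hx ha
    rw [hg.standardType, show mfderiv (𝓡 n) (𝓡 r) C.proj x b = 0 from hb]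
    exact map_zero ξ
  refine ⟨?_, ?_, fun x a ha b hb => horth x a ha b (hpV x b hb), ?_, ?_, ?_, ?_, ?_⟩
  · funext x
    refine le_antisymm (fun a ha => ?_) fun a ha b hb => ?_
    · obtain ⟨l, A, hx⟩ := C.exists_adaptedChart x
      rw [A.mem_vertical_proj hx]
      refine (SeparatingDual.eq_iff_forall_dual_eq (R := ℝ)).2 fun η => ?_
      rw [map_zero, ← A.gram_vertical hg (A.top.map_source hx), ← SmoothChart.d_dsymm hx (0, η),
        A.top.gram_d g hx, g.symm]
      refine ha _ ?_
      rw [A.mem_vertical_p hx, SmoothChart.d_dsymm hx]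
    · rw [g.symm]
      exact horth x b hb a ha
  · funext x
    refine le_antisymm (fun a ha => ?_) fun a ha b hb => horth x a ha b hb
    obtain ⟨l, A, hx⟩ := C.exists_adaptedChart x
    rw [A.mem_vertical_p hx]
    refine A.mem_kerP_of_gram hg (A.top.map_source hx) fun c hc => ?_
    rw [← SmoothChart.d_dsymm hx c, A.top.gram_d g hx]
    refine ha _ ?_
    rw [A.mem_vertical_proj hx, SmoothChart.d_dsymm hx]
    exact hc
  · refine SmoothChart.isParallel_of_charts hn.torsionFree fun x => ?_
    obtain ⟨l, A, hx⟩ := C.exists_adaptedChart x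
    have hi := A.invariant_vertical_p hD hg hn
    exact ⟨_, _, _, inferInstance, A.top, _, hx, hi.straightens, hi.christoffel_mem⟩
  · refine SmoothChart.isProjectableAlong_of_charts hn.torsionFree fun x => ?_
    obtain ⟨l, A, hx⟩ := C.exists_adaptedChart x
    exact ⟨_, _, _, inferInstance, A.top, _, hx, A.invariant_vertical_p hD hg hn⟩
  · refine SmoothChart.isProjectableAlong_of_charts hn.torsionFree fun x => ?_
    obtain ⟨l, A, hx⟩ := C.exists_adaptedChart x
    exact ⟨_, _, _, inferInstance, A.top, _, hx, A.invariant_vertical_proj hD hg hn⟩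
  · refine projectsOnto_of_charts (fun x _ => C.contMDiff_proj.mdifferentiableAt (by simp))
      fun x _ => ?_
    obtain ⟨l, A, hx⟩ := C.exists_adaptedChart x
    exact ⟨_, _, _, _, _, _, A.top, A.base,
      (ContinuousLinearMap.fst ℝ _ _).comp (ContinuousLinearMap.fst ℝ _ _), hx,
      fun y hy => ⟨A.proj_mem hy, A.proj_eq hy⟩,
      fun a b => A.christoffel_proj hD hg hn (A.top.map_source hx) a b⟩
  · refine arisesFrom_of_surjective hg.restricts fun x _ => ?_
    obtain ⟨l, A, hx⟩ := C.exists_adaptedChart x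
    exact A.surjective_mfderiv_p hx

end LeviCivitaConnection

/-! ### Frobenius' theorem and null parallel distributions -/

section Frobenius

theorem isUnit_of_apply_eq {K : Type*} [NormedAddCommGroup K] [NormedSpace ℝ K] {T : K →L[ℝ] K}
    (hT : IsUnit T) (a b : K) : Ring.inverse T (T a) = a ∧ T (Ring.inverse T b) = b := by
  have h1 := Ring.inverse_mul_cancel T hT
  have h2 := Ring.mul_inverse_cancel T hT
  exact ⟨congrArg (fun A : K →L[ℝ] K => A a) h1, congrArg (fun A : K →L[ℝ] K => A b) h2⟩

theorem fderiv_symm_inverse {E F : Type*} [NormedAddCommGroup E] [NormedSpace ℝ E]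
    [NormedAddCommGroup F] [NormedSpace ℝ F] {θ : OpenPartialHomeomorph E F}
    (hθ : ContDiffOn ℝ ∞ θ θ.source) (hθ' : ContDiffOn ℝ ∞ θ.symm θ.target) {u : E}
    (hu : u ∈ θ.source) : (∀ a, fderiv ℝ θ.symm (θ u) (fderiv ℝ θ u a) = a) ∧
      ∀ b, fderiv ℝ θ u (fderiv ℝ θ.symm (θ u) b) = b := by
  have hd : HasFDerivAt θ (fderiv ℝ θ u) u :=
    ((hθ.contDiffAt (θ.open_source.mem_nhds hu)).differentiableAt (by simp)).hasFDerivAt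
  have hs : HasFDerivAt θ.symm (fderiv ℝ θ.symm (θ u)) (θ u) :=
    ((hθ'.contDiffAt (θ.open_target.mem_nhds (θ.map_source hu))).differentiableAt
      (by simp)).hasFDerivAt
  have h2 : HasFDerivAt (θ.symm ∘ θ) (ContinuousLinearMap.id ℝ E) u :=
    (hasFDerivAt_id u).congr_of_eventuallyEq (by
      filter_upwards [θ.open_source.mem_nhds hu] with w hw using θ.left_inv hw)
  refine ⟨fun a => congrArg (fun A : E →L[ℝ] E => A a) ((hs.comp u hd).unique h2), fun b => ?_⟩
  have h3 : HasFDerivAt θ (fderiv ℝ θ u) (θ.symm (θ u)) := by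
    rw [θ.left_inv hu]
    exact hd
  have h5 : HasFDerivAt (θ ∘ θ.symm) (ContinuousLinearMap.id ℝ F) (θ u) :=
    (hasFDerivAt_id _).congr_of_eventuallyEq (by
      filter_upwards [θ.open_target.mem_nhds (θ.map_source hu)] with w hw using θ.right_inv hw)
  exact congrArg (fun A : F →L[ℝ] F => A b) ((h3.comp (θ u) hs).unique h5)

/-- The Frobenius theorem for a kernel field: if the derivative of `Λ` is symmetric on `Ker Λ`,
then `Ker Λ` is the kernel of the derivative of a submersion. The fields in `Ker Λ` whose
components along the fixed subspace `Ker Λ_{u₀}` are constant commute, and `exists_straightening`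
applies to them. -/
theorem exists_submersion_of_involutive {E K : Type u} [NormedAddCommGroup E] [NormedSpace ℝ E]
    [FiniteDimensional ℝ E] [NormedAddCommGroup K] [NormedSpace ℝ K] [FiniteDimensional ℝ K]
    {Ω : Set E} (hΩ : IsOpen Ω) {u₀ : E} (hu₀ : u₀ ∈ Ω) {Λ : E → E →L[ℝ] K}
    (hΛ : ContDiffOn ℝ ∞ Λ Ω) (hsurj : Function.Surjective (Λ u₀))
    (hinv : ∀ u ∈ Ω, ∀ a b, Λ u a = 0 → Λ u b = 0 → fderiv ℝ Λ u a b = fderiv ℝ Λ u b a) :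
    ∃ (N : Set E) (y : E → K), IsOpen N ∧ u₀ ∈ N ∧ N ⊆ Ω ∧ ContDiffOn ℝ ∞ y N ∧
      ∀ u ∈ N, Function.Surjective (fderiv ℝ y u) ∧ ∀ a, fderiv ℝ y u a = 0 ↔ Λ u a = 0 := by
  have : CompleteSpace K := FiniteDimensional.complete ℝ K
  obtain ⟨R₀, hR₀⟩ := (Λ u₀).toLinearMap.exists_rightInverse_of_surjective
    (LinearMap.range_eq_top.2 hsurj)
  let R : K →L[ℝ] E := LinearMap.toContinuousLinearMap R₀
  have hR : ∀ c, Λ u₀ (R c) = c := fun c => congrArg (fun T : K →ₗ[ℝ] K => T c) hR₀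
  let V₀ : Submodule ℝ E := LinearMap.ker (Λ u₀).toLinearMap
  let T : E → K →L[ℝ] K := fun u => (Λ u).comp R
  have hTu₀ : T u₀ = 1 := ContinuousLinearMap.ext hR
  have hTs : ContDiffOn ℝ ∞ T Ω := hΛ.clm_comp contDiffOn_const
  let Ω' : Set E := Ω ∩ T ⁻¹' {A | IsUnit A}
  have hΩ' : IsOpen Ω' := hTs.continuousOn.isOpen_inter_preimage hΩ Units.isOpen
  have hu₀' : u₀ ∈ Ω' := ⟨hu₀, by
    show IsUnit (T u₀)
    rw [hTu₀]
    exact isUnit_one⟩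
  -- `L u v` is the vector of `Ker (Λ u)` that differs from `v` by a vector in the range of `R`
  let L : E → V₀ →L[ℝ] E := fun u =>
    V₀.subtypeL - (R.comp ((Ring.inverse (T u)).comp (Λ u))).comp V₀.subtypeL
  have hLapply : ∀ u (v : V₀), L u v = v - R (Ring.inverse (T u) (Λ u v)) := fun u v => rfl
  have hΛL : ∀ u ∈ Ω', ∀ v, Λ u (L u v) = 0 := by
    intro u hu v
    rw [hLapply, map_sub, sub_eq_zero]
    exact (isUnit_of_apply_eq hu.2 0 _).2.symm
  have hinvs : ContDiffOn ℝ ∞ (fun u => Ring.inverse (T u)) Ω' := by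
    intro u hu
    obtain ⟨t, ht⟩ := hu.2
    have h1 : ContDiffAt ℝ ∞ Ring.inverse (T u) := by
      have := contDiffAt_ringInverse ℝ (n := ∞) t
      rwa [ht] at this
    exact h1.comp_contDiffWithinAt u ((hTs.mono inter_subset_left) u hu)
  have hLs : ContDiffOn ℝ ∞ L Ω' := contDiffOn_const.sub
    ((contDiffOn_const.clm_comp (hinvs.clm_comp (hΛ.mono inter_subset_left))).clm_comp
      contDiffOn_const)
  -- a vector in the range of `R` and in `Ker Λ` vanishes
  have hRker : ∀ u ∈ Ω', ∀ c, Λ u (R c) = 0 → c = 0 := by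
    intro u hu c hc
    have h1 := (isUnit_of_apply_eq hu.2 c 0).1
    rw [show T u c = 0 from hc, map_zero] at h1
    exact h1.symm
  have hLd : ∀ u ∈ Ω', DifferentiableAt ℝ L u := fun u hu =>
    (hLs.contDiffAt (hΩ'.mem_nhds hu)).differentiableAt (by simp)
  have hΛd : ∀ u ∈ Ω', DifferentiableAt ℝ Λ u := fun u hu =>
    (hΛ.contDiffAt (hΩ.mem_nhds hu.1)).differentiableAt (by simp)
  have hLR : ∀ u ∈ Ω', ∀ a v, ∃ c, fderiv ℝ L u a v = R c := by
    intro u hu a v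
    let f : E → K := fun u => Ring.inverse (T u) (Λ u v)
    have hf : DifferentiableAt ℝ f u :=
      (((hinvs.contDiffAt (hΩ'.mem_nhds hu)).differentiableAt (by simp)).clm_apply
        ((hΛd u hu).clm_apply (differentiableAt_const _)))
    have h1 : HasFDerivAt (fun u => L u v) ((fderiv ℝ L u).flip v) u := by
      have := (hLd u hu).hasFDerivAt.clm_apply (hasFDerivAt_const v u)
      rwa [ContinuousLinearMap.comp_zero, zero_add] at this
    have h2 : HasFDerivAt (fun u => L u v) (-(R.comp (fderiv ℝ f u))) u :=
      (R.hasFDerivAt.comp u hf.hasFDerivAt).const_sub (v : E)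
    refine ⟨-(fderiv ℝ f u a), ?_⟩
    rw [map_neg]
    exact congrArg (fun A : E →L[ℝ] E => A a) (h1.unique h2)
  have hdL : ∀ u ∈ Ω', ∀ a v, Λ u (fderiv ℝ L u a v) = -fderiv ℝ Λ u a (L u v) := by
    intro u hu a v
    have h1 : HasFDerivAt (fun u => L u v) ((fderiv ℝ L u).flip v) u := by
      have := (hLd u hu).hasFDerivAt.clm_apply (hasFDerivAt_const v u)
      rwa [ContinuousLinearMap.comp_zero, zero_add] at this
    have h2 := (hΛd u hu).hasFDerivAt.clm_apply h1
    have h3 : (fun u => Λ u (L u v)) =ᶠ[𝓝 u] fun _ => 0 := by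
      filter_upwards [hΩ'.mem_nhds hu] with w hw using hΛL w hw v
    have h4 := h2.unique ((hasFDerivAt_const (0 : K) u).congr_of_eventuallyEq h3)
    have h5 := congrArg (fun A : E →L[ℝ] K => A a) h4
    exact eq_neg_of_add_eq_zero_left h5
  -- the commutator of `L v` and `L w` is in the range of `R`, and in `Ker Λ` by involutivity
  have hcomm : ∀ u ∈ Ω', ∀ v w, fderiv ℝ L u (L u v) w = fderiv ℝ L u (L u w) v := by
    intro u hu v w
    obtain ⟨c, hc⟩ := hLR u hu (L u v) w
    obtain ⟨c', hc'⟩ := hLR u hu (L u w) v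
    have h1 : Λ u (R (c - c')) = 0 := by
      rw [map_sub, ← hc, ← hc', map_sub, hdL u hu, hdL u hu,
        hinv u hu.1 _ _ (hΛL u hu v) (hΛL u hu w), sub_self]
    rw [hc, hc', sub_eq_zero.1 (hRker u hu _ h1)]
  let e : (K × V₀) ≃L[ℝ] E := ContinuousLinearEquiv.equivOfInverse
    (R.comp (ContinuousLinearMap.fst ℝ K V₀) + V₀.subtypeL.comp (ContinuousLinearMap.snd ℝ K V₀))
    ((Λ u₀).prod ((ContinuousLinearMap.id ℝ E - R.comp (Λ u₀)).codRestrict V₀ fun a => by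
      show Λ u₀ (a - R (Λ u₀ a)) = 0
      rw [map_sub, hR, sub_self]))
    (by
      rintro ⟨c, v⟩
      have hv : Λ u₀ v = 0 := v.2
      refine Prod.ext ?_ (Subtype.ext ?_)
      · show Λ u₀ (R c + v) = c
        rw [map_add, hR, hv, add_zero]
      · show R c + v - R (Λ u₀ (R c + v)) = v
        rw [map_add, hR, hv, add_zero]
        abel)
    (by
      intro a
      show R (Λ u₀ a) + (a - R (Λ u₀ a)) = a
      abel)
  obtain ⟨θ, hθ0, hθΩ, -, hθs, hθs', hθL⟩ := exists_straightening hΩ' hu₀' hLs hcomm e (fun v => by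
    show R 0 + v = L u₀ v
    have hv : Λ u₀ v = 0 := v.2
    rw [hLapply, hv, map_zero, map_zero, zero_add, map_zero, sub_zero])
  have hθd : ∀ u ∈ θ.source, HasFDerivAt θ (fderiv ℝ θ u) u := fun u hu =>
    ((hθs.contDiffAt (θ.open_source.mem_nhds hu)).differentiableAt (by simp)).hasFDerivAt
  have hy : ∀ u ∈ θ.source, HasFDerivAt (fun u => (θ u).1)
      ((ContinuousLinearMap.fst ℝ K V₀).comp (fderiv ℝ θ u)) u := fun u hu =>
    hasFDerivAt_fst.comp u (hθd u hu)
  have hθsymm : ∀ u ∈ θ.source, (∀ a, fderiv ℝ θ.symm (θ u) (fderiv ℝ θ u a) = a) ∧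
      ∀ b, fderiv ℝ θ u (fderiv ℝ θ.symm (θ u) b) = b := fun u hu =>
    fderiv_symm_inverse hθs hθs' hu
  refine ⟨θ.source, fun u => (θ u).1, θ.open_source, hθ0, fun u hu => (hθΩ hu).1, hθs.fst,
    fun u hu => ⟨fun c => ⟨fderiv ℝ θ.symm (θ u) (c, 0), ?_⟩, fun a => ?_⟩⟩
  · rw [(hy u hu).fderiv]
    show (fderiv ℝ θ u (fderiv ℝ θ.symm (θ u) (c, 0))).1 = c
    rw [(hθsymm u hu).2]
  · rw [(hy u hu).fderiv]
    show (fderiv ℝ θ u a).1 = 0 ↔ _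
    constructor
    · intro h
      have h1 : fderiv ℝ θ u a = fderiv ℝ θ u (L u (fderiv ℝ θ u a).2) := by
        rw [hθL u hu]
        exact Prod.ext h rfl
      have h2 := congrArg (fderiv ℝ θ.symm (θ u)) h1
      rw [(hθsymm u hu).1, (hθsymm u hu).1] at h2
      rw [h2]
      exact hΛL u (hθΩ hu) _
    · intro h
      -- a vector of `Ker Λ` is `L v`, with `v` its component in `Ker Λ_{u₀}`
      let v : V₀ := ⟨a - R (Λ u₀ a), by
        show Λ u₀ (a - R (Λ u₀ a)) = 0
        rw [map_sub, hR, sub_self]⟩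
      have h1 : a - L u v = R (Λ u₀ a + Ring.inverse (T u) (Λ u v)) := by
        rw [hLapply, map_add]
        show a - (a - R (Λ u₀ a) - _) = _
        abel
      have h2 : Λ u (R (Λ u₀ a + Ring.inverse (T u) (Λ u v))) = 0 := by
        rw [← h1, map_sub, h, hΛL u (hθΩ hu), sub_self]
      rw [hRker u (hθΩ hu) _ h2, map_zero, sub_eq_zero] at h1
      rw [h1, hθL u hu]

end Frobenius

section NullParallel

theorem exists_equiv_eq_of_nondegenerate {E : Type*} [NormedAddCommGroup E] [NormedSpace ℝ E]
    [FiniteDimensional ℝ E] {B : E →L[ℝ] E →L[ℝ] ℝ} (hB : ∀ a, (∀ b, B a b = 0) → a = 0) :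
    ∃ e : E ≃L[ℝ] (E →L[ℝ] ℝ), (e : E →L[ℝ] E →L[ℝ] ℝ) = B := by
  have hinj : Function.Injective B.toLinearMap := by
    rw [← LinearMap.ker_eq_bot, LinearMap.ker_eq_bot']
    intro a ha
    refine hB a fun b => ?_
    exact congrArg (fun T : E →L[ℝ] ℝ => T b) ha
  have hdim : Module.finrank ℝ E = Module.finrank ℝ (E →L[ℝ] ℝ) := by
    rw [← (LinearMap.toContinuousLinearMap (𝕜 := ℝ) (E := E) (F' := ℝ)).finrank_eq]
    exact (Subspace.dual_finrank_eq (K := ℝ) (V := E)).symm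
  exact ⟨(LinearMap.linearEquivOfInjective B.toLinearMap hinj hdim).toContinuousLinearEquiv,
    ContinuousLinearMap.ext fun a => rfl⟩

/-- A surjective linear map factors every functional that vanishes on its kernel. -/
theorem exists_factor_of_ker_le {E K : Type*} [NormedAddCommGroup E] [NormedSpace ℝ E]
    [FiniteDimensional ℝ E] [NormedAddCommGroup K] [NormedSpace ℝ K] [FiniteDimensional ℝ K]
    {A : E →L[ℝ] K} (hA : Function.Surjective A) {f : E →L[ℝ] ℝ} (h : ∀ b, A b = 0 → f b = 0) :
    ∃ μ : K →L[ℝ] ℝ, ∀ b, f b = μ (A b) := by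
  obtain ⟨R, hR⟩ := A.toLinearMap.exists_rightInverse_of_surjective (LinearMap.range_eq_top.2 hA)
  have hR' : ∀ c, A (R c) = c := fun c => congrArg (fun T : K →ₗ[ℝ] K => T c) hR
  refine ⟨f.comp (LinearMap.toContinuousLinearMap R), fun b => ?_⟩
  have h1 : f (b - R (A b)) = 0 := h _ (by rw [map_sub, hR', sub_self])
  rw [map_sub, sub_eq_zero] at h1
  exact h1

variable {E : Type} [NormedAddCommGroup E] [NormedSpace ℝ E] [FiniteDimensional ℝ E] {r : ℕ}
  {Ω : Set E} {G : E → E →L[ℝ] E →L[ℝ] ℝ} {Γ : E → E →L[ℝ] E →L[ℝ] E} {X : Fin r → E → E}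

/-- Around each point, a null parallel distribution `P` has a frame of commuting fields that is
dual to a submersion `y` whose fibres are tangent to the orthogonal complement of `P`. Here `G`
and `Γ` are the metric and the Christoffel symbols in a chart, and the `X i` span `P`. The
complement of `P` is involutive because the connection is torsion-free and metric; with `y` from
the Frobenius theorem, the frame consists of the metric duals `L η` of the differentials `η ∘ Dy`.
These commute because `∇_{L ζ} (L η) = 0`, the Hessian of `y` being symmetric and `P` being null.
-/
theorem exists_dual_frame (hΩ : IsOpen Ω) {u₀ : E} (hu₀ : u₀ ∈ Ω) (hG : ContDiffOn ℝ ∞ G Ω)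
    (hnd : ∀ u ∈ Ω, ∀ a, (∀ b, G u a b = 0) → a = 0)
    (hsymm : ∀ u ∈ Ω, ∀ a b, G u a b = G u b a)
    (hΓ : ∀ u ∈ Ω, ∀ a b, Γ u a b = Γ u b a)
    (hmet : ∀ u ∈ Ω, ∀ c a b, fderiv ℝ G u c a b = G u (Γ u c a) b + G u a (Γ u c b))
    (hX : ∀ i, ContDiffOn ℝ ∞ (X i) Ω) (hli : ∀ u ∈ Ω, LinearIndependent ℝ fun i => X i u)
    (hnull : ∀ u ∈ Ω, ∀ i j, G u (X i u) (X j u) = 0)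
    (hpar : ∀ (N : Set E) (Z : E → E), IsOpen N → N ⊆ Ω → ContDiffOn ℝ ∞ Z N →
      (∀ u ∈ N, Z u ∈ Submodule.span ℝ (range fun i => X i u)) → ∀ u ∈ N, ∀ a,
      fderiv ℝ Z u a + Γ u a (Z u) ∈ Submodule.span ℝ (range fun i => X i u)) :
    ∃ (N : Set E) (y : E → EuclideanSpace ℝ (Fin r))
      (L : E → (EuclideanSpace ℝ (Fin r) →L[ℝ] ℝ) →L[ℝ] E),
      IsOpen N ∧ u₀ ∈ N ∧ N ⊆ Ω ∧ ContDiffOn ℝ ∞ y N ∧ ContDiffOn ℝ ∞ L N ∧ ∀ u ∈ N,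
        Function.Surjective (fderiv ℝ y u) ∧ (∀ η b, G u (L u η) b = η (fderiv ℝ y u b)) ∧
        (∀ η, fderiv ℝ y u (L u η) = 0) ∧
        (∀ a, a ∈ Submodule.span ℝ (range fun i => X i u) ↔ ∃ η, a = L u η) ∧
        ∀ ζ η, fderiv ℝ L u (L u ζ) η = fderiv ℝ L u (L u η) ζ := by
  -- the kernel of `Λ` is the orthogonal complement of `P`
  let Λ : E → E →L[ℝ] EuclideanSpace ℝ (Fin r) := fun u =>
    ∑ i, (G u (X i u)).smulRight (EuclideanSpace.single i (1 : ℝ))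
  have hΛi : ∀ u b i, Λ u b i = G u (X i u) b := by
    intro u b i
    simp only [Λ, _root_.sum_apply, ContinuousLinearMap.smulRight_apply,
      WithLp.ofLp_sum, WithLp.ofLp_smul, Finset.sum_apply, Pi.smul_apply, smul_eq_mul]
    simp
  have hΛ0 : ∀ u b, Λ u b = 0 ↔ ∀ i, G u (X i u) b = 0 := by
    intro u b
    constructor
    · intro h i
      rw [← hΛi, h]
      rfl
    · intro h
      ext i
      rw [hΛi, h]
      rfl
  have hΛs : ContDiffOn ℝ ∞ Λ Ω := by
    refine ContDiffOn.sum fun i _ => ?_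
    exact (hG.clm_apply (hX i)).smulRight contDiffOn_const
  have hGd : ∀ u ∈ Ω, DifferentiableAt ℝ G u := fun u hu =>
    (hG.contDiffAt (hΩ.mem_nhds hu)).differentiableAt (by simp)
  -- the functional `μ ∘ Λ` is the product with a vector of the distribution
  have hΞ : ∀ u, ∀ μ : EuclideanSpace ℝ (Fin r) →L[ℝ] ℝ, ∀ b,
      G u (∑ i, μ (EuclideanSpace.single i 1) • X i u) b = μ (Λ u b) := by
    intro u μ b
    simp only [Λ, map_sum, _root_.sum_apply, ContinuousLinearMap.smulRight_apply,
      map_smul, _root_.smul_apply, smul_eq_mul]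
    exact Finset.sum_congr rfl fun i _ => mul_comm _ _
  have hΞmem : ∀ u, ∀ μ : EuclideanSpace ℝ (Fin r) →L[ℝ] ℝ,
      ∑ i, μ (EuclideanSpace.single i 1) • X i u ∈ Submodule.span ℝ (range fun i => X i u) :=
    fun u μ => Submodule.sum_mem _ fun i _ =>
      Submodule.smul_mem _ _ (Submodule.subset_span ⟨i, rfl⟩)
  have hΛsurj : ∀ u ∈ Ω, Function.Surjective (Λ u) := by
    intro u hu
    by_contra hns
    have hlt : LinearMap.range (Λ u).toLinearMap < ⊤ :=
      lt_top_iff_ne_top.2 fun h => hns (LinearMap.range_eq_top.1 h)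
    obtain ⟨f, hf0, hf⟩ := Submodule.exists_le_ker_of_lt_top _ hlt
    let μ : EuclideanSpace ℝ (Fin r) →L[ℝ] ℝ := LinearMap.toContinuousLinearMap f
    have h1 : ∑ i, μ (EuclideanSpace.single i 1) • X i u = 0 := by
      refine hnd u hu _ fun b => ?_
      rw [hΞ]
      exact hf ⟨b, rfl⟩
    have h2 := Fintype.linearIndependent_iff.1 (hli u hu) _ h1
    refine hf0 ((EuclideanSpace.basisFun (Fin r) ℝ).toBasis.ext fun i => ?_)
    simpa [μ] using h2 i
  have hperp : ∀ u b, Λ u b = 0 → ∀ p ∈ Submodule.span ℝ (range fun i => X i u), G u p b = 0 := by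
    intro u b hb p hp
    induction hp using Submodule.span_induction with
    | mem x hx => obtain ⟨i, rfl⟩ := hx; exact (hΛ0 u b).1 hb i
    | zero => simp
    | add x y _ _ hx hy => rw [map_add, _root_.add_apply, hx, hy, add_zero]
    | smul c x _ hx => rw [map_smul, _root_.smul_apply, hx, smul_zero]
  have hXd : ∀ u ∈ Ω, ∀ i, DifferentiableAt ℝ (X i) u := fun u hu i =>
    ((hX i).contDiffAt (hΩ.mem_nhds hu)).differentiableAt (by simp)
  have hΛd : ∀ u ∈ Ω, DifferentiableAt ℝ Λ u := fun u hu =>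
    (hΛs.contDiffAt (hΩ.mem_nhds hu)).differentiableAt (by simp)
  have hinv : ∀ u ∈ Ω, ∀ a b, Λ u a = 0 → Λ u b = 0 →
      fderiv ℝ Λ u a b = fderiv ℝ Λ u b a := by
    intro u hu a b ha hb
    have key : ∀ a b i, Λ u b = 0 → fderiv ℝ Λ u a b i = G u (X i u) (Γ u a b) := by
      intro a b i hb
      have h1 : HasFDerivAt (fun w => Λ w b) ((fderiv ℝ Λ u).flip b) u := by
        have := (hΛd u hu).hasFDerivAt.clm_apply (hasFDerivAt_const b u)
        rwa [ContinuousLinearMap.comp_zero, zero_add] at this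
      have h2 := (EuclideanSpace.proj (𝕜 := ℝ) i).hasFDerivAt.comp u h1
      have h3 : HasFDerivAt (fun w => G w (X i w) b) _ u :=
        (((hGd u hu).hasFDerivAt.clm_apply (hXd u hu i).hasFDerivAt).clm_apply
          (hasFDerivAt_const b u))
      have h4 : (EuclideanSpace.proj (𝕜 := ℝ) i) ∘ (fun w => Λ w b) =
        fun w => G w (X i w) b := funext fun w => hΛi w b i
      rw [h4] at h2
      have h5 := congrArg (fun T : E →L[ℝ] ℝ => T a) (h2.unique h3)
      have h6 : fderiv ℝ Λ u a b i = G u (fderiv ℝ (X i) u a) b + fderiv ℝ G u a (X i u) b := by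
        refine h5.trans ?_
        simp
      have h7 := hperp u b hb _ (hpar Ω (X i) hΩ subset_rfl (hX i)
        (fun w _ => Submodule.subset_span ⟨i, rfl⟩) u hu a)
      rw [map_add, _root_.add_apply] at h7
      rw [h6, hmet u hu]
      linarith
    ext i
    rw [key a b i hb, key b a i ha, hΓ u hu]
  obtain ⟨N, y, hN, hu₀N, hNΩ, hy, hyN⟩ :=
    exists_submersion_of_involutive hΩ hu₀ hΛs (hΛsurj u₀ hu₀) hinv
  have hDy : ContDiffOn ℝ ∞ (fderiv ℝ y) N := hy.fderiv_of_isOpen (m := ∞) hN (by simp)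
  let L : E → (EuclideanSpace ℝ (Fin r) →L[ℝ] ℝ) →L[ℝ] E := fun u =>
    (ContinuousLinearMap.inverse (G u)).comp
      ((ContinuousLinearMap.compL ℝ E (EuclideanSpace ℝ (Fin r)) ℝ).flip (fderiv ℝ y u))
  have hGL : ∀ u ∈ N, ∀ η b, G u (L u η) b = η (fderiv ℝ y u b) := by
    intro u hu η b
    obtain ⟨e, he⟩ := exists_equiv_eq_of_nondegenerate (hnd u (hNΩ hu))
    have h1 : L u η = e.symm (η.comp (fderiv ℝ y u)) := by
      show ContinuousLinearMap.inverse (G u) (η.comp (fderiv ℝ y u)) = _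
      rw [← he, ContinuousLinearMap.inverse_equiv]
      rfl
    rw [h1, ← he]
    show e (e.symm (η.comp (fderiv ℝ y u))) b = _
    rw [e.apply_symm_apply]
    rfl
  have hLs : ContDiffOn ℝ ∞ L N := by
    refine ContDiffOn.clm_comp ?_
      ((ContinuousLinearMap.contDiff _).comp_contDiffOn hDy)
    intro u hu
    obtain ⟨e, he⟩ := exists_equiv_eq_of_nondegenerate (hnd u (hNΩ hu))
    have h1 : ContDiffAt ℝ ∞ ContinuousLinearMap.inverse (G u) := by
      rw [← he]
      exact contDiffAt_map_inverse e
    exact h1.comp_contDiffWithinAt u ((hG.mono hNΩ) u hu)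
  have hLmem : ∀ u ∈ N, ∀ η, L u η ∈ Submodule.span ℝ (range fun i => X i u) := by
    intro u hu η
    obtain ⟨μ, hμ⟩ := exists_factor_of_ker_le (hΛsurj u (hNΩ hu))
      (f := η.comp (fderiv ℝ y u)) fun b hb => by
        rw [ContinuousLinearMap.comp_apply, ((hyN u hu).2 b).2 hb, map_zero]
    have h1 : L u η - ∑ i, μ (EuclideanSpace.single i 1) • X i u = 0 := by
      refine hnd u (hNΩ hu) _ fun b => ?_
      rw [map_sub, _root_.sub_apply, hGL u hu, hΞ, ← hμ]
      exact sub_self _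
    rw [sub_eq_zero.1 h1]
    exact hΞmem u μ
  have hP0 : ∀ u ∈ N, ∀ p ∈ Submodule.span ℝ (range fun i => X i u), fderiv ℝ y u p = 0 := by
    intro u hu p hp
    rw [(hyN u hu).2, hΛ0]
    intro i
    rw [hsymm u (hNΩ hu)]
    refine hperp u _ ?_ p hp
    rw [hΛ0]
    exact fun j => hnull u (hNΩ hu) j i
  have hLd : ∀ u ∈ N, DifferentiableAt ℝ L u := fun u hu =>
    (hLs.contDiffAt (hN.mem_nhds hu)).differentiableAt (by simp)
  -- the product with the covariant derivative of a field dual to `y`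
  have hcov : ∀ u ∈ N, ∀ a η b, G u (fderiv ℝ L u a η + Γ u a (L u η)) b =
      η (fderiv ℝ (fderiv ℝ y) u a b) - η (fderiv ℝ y u (Γ u a b)) := by
    intro u hu a η b
    have h1 : HasFDerivAt (fun w => L w η) ((fderiv ℝ L u).flip η) u := by
      have := (hLd u hu).hasFDerivAt.clm_apply (hasFDerivAt_const η u)
      rwa [ContinuousLinearMap.comp_zero, zero_add] at this
    have h2 : HasFDerivAt (fun w => G w (L w η) b) _ u :=
      ((hGd u (hNΩ hu)).hasFDerivAt.clm_apply h1).clm_apply (hasFDerivAt_const b u)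
    have h3 : HasFDerivAt (fun w => fderiv ℝ y w b) ((fderiv ℝ (fderiv ℝ y) u).flip b) u := by
      have := (differentiableAt_fderiv hN hy hu).hasFDerivAt.clm_apply (hasFDerivAt_const b u)
      rwa [ContinuousLinearMap.comp_zero, zero_add] at this
    have h4 := (η.hasFDerivAt.comp u h3).congr_of_eventuallyEq
      (f₁ := fun w => G w (L w η) b) (by
        filter_upwards [hN.mem_nhds hu] with w hw using hGL w hw η b)
    have h5 := congrArg (fun T : E →L[ℝ] ℝ => T a) (h2.unique h4)
    have h6 : G u (fderiv ℝ L u a η) b + fderiv ℝ G u a (L u η) b =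
        η (fderiv ℝ (fderiv ℝ y) u a b) := by
      refine Eq.trans ?_ h5
      simp
    rw [hmet u (hNΩ hu), hGL u hu η (Γ u a b)] at h6
    rw [map_add, _root_.add_apply]
    linarith
  have hLpar : ∀ u ∈ N, ∀ a η, fderiv ℝ L u a η + Γ u a (L u η) ∈
      Submodule.span ℝ (range fun i => X i u) := by
    intro u hu a η
    have h1 : HasFDerivAt (fun w => L w η) ((fderiv ℝ L u).flip η) u := by
      have := (hLd u hu).hasFDerivAt.clm_apply (hasFDerivAt_const η u)
      rwa [ContinuousLinearMap.comp_zero, zero_add] at this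
    have h2 := hpar N (fun w => L w η) hN hNΩ (hLs.clm_apply contDiffOn_const)
      (fun w hw => hLmem w hw η) u hu a
    rw [h1.fderiv] at h2
    exact h2
  have hHess : ∀ u ∈ N, ∀ a b, fderiv ℝ y u b = 0 →
      fderiv ℝ (fderiv ℝ y) u a b = fderiv ℝ y u (Γ u a b) := by
    intro u hu a b hb
    refine (SeparatingDual.eq_iff_forall_dual_eq (R := ℝ)).2 fun η => ?_
    have h1 := hcov u hu a η b
    rw [hperp u b (((hyN u hu).2 b).1 hb) _ (hLpar u hu a η)] at h1
    linarith
  -- the covariant derivative of `L η` in the direction of `L ζ` vanishes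
  have hzero : ∀ u ∈ N, ∀ ζ η, fderiv ℝ L u (L u ζ) η = -Γ u (L u ζ) (L u η) := by
    intro u hu ζ η
    refine eq_neg_of_add_eq_zero_left (hnd u (hNΩ hu) _ fun b => ?_)
    rw [hcov u hu, fderiv_fderiv_comm hN hy hu, hΓ u (hNΩ hu),
      hHess u hu b _ (hP0 u hu _ (hLmem u hu ζ)), sub_self]
  refine ⟨N, y, L, hN, hu₀N, hNΩ, hy, hLs, fun u hu => ⟨(hyN u hu).1, hGL u hu,
    fun η => hP0 u hu _ (hLmem u hu η), fun a => ⟨fun ha => ?_, ?_⟩, fun ζ η => ?_⟩⟩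
  · obtain ⟨η, hη⟩ := exists_factor_of_ker_le (hyN u hu).1 (f := G u a) fun b hb =>
      hperp u b (((hyN u hu).2 b).1 hb) a ha
    refine ⟨η, sub_eq_zero.1 (hnd u (hNΩ hu) _ fun b => ?_)⟩
    rw [map_sub, _root_.sub_apply, hη, hGL u hu, sub_self]
  · rintro ⟨η, rfl⟩
    exact hLmem u hu η
  · rw [hzero u hu, hzero u hu, hΓ u (hNΩ hu)]

end NullParallel

section AdaptedCoordinates

theorem ContDiffOn.hasFDerivAt_fderiv {E F : Type*} [NormedAddCommGroup E] [NormedSpace ℝ E]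
    [NormedAddCommGroup F] [NormedSpace ℝ F] {f : E → F} {U : Set E} (hf : ContDiffOn ℝ ∞ f U)
    (hU : IsOpen U) {u : E} (hu : u ∈ U) : HasFDerivAt f (fderiv ℝ f u) u :=
  ((hf.contDiffAt (hU.mem_nhds hu)).differentiableAt (by simp)).hasFDerivAt

/-- A surjective linear map is the first projection in suitable coordinates. -/
theorem exists_equiv_fst_eq {F K : Type} [NormedAddCommGroup F] [NormedSpace ℝ F]
    [FiniteDimensional ℝ F] [NormedAddCommGroup K] [NormedSpace ℝ K] [FiniteDimensional ℝ K]
    {A : F →L[ℝ] K} (hA : Function.Surjective A) :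
    ∃ (l : ℕ) (Z : F →L[ℝ] EuclideanSpace ℝ (Fin l)) (e : F ≃L[ℝ] K × EuclideanSpace ℝ (Fin l)),
      ∀ c, e c = (A c, Z c) := by
  obtain ⟨R₀, hR₀⟩ := A.toLinearMap.exists_rightInverse_of_surjective (LinearMap.range_eq_top.2 hA)
  let R : K →L[ℝ] F := LinearMap.toContinuousLinearMap R₀
  have hR : ∀ c, A (R c) = c := fun c => congrArg (fun T : K →ₗ[ℝ] K => T c) hR₀
  let V : Submodule ℝ F := LinearMap.ker A.toLinearMap
  let Z₀ : F →L[ℝ] V := (ContinuousLinearMap.id ℝ F - R.comp A).codRestrict V fun a => by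
    show A (a - R (A a)) = 0
    rw [map_sub, hR, sub_self]
  let ε : V ≃L[ℝ] EuclideanSpace ℝ (Fin (Module.finrank ℝ V)) := toEuclidean
  let e₁ : F ≃L[ℝ] K × V := ContinuousLinearEquiv.equivOfInverse (A.prod Z₀)
    (R.comp (ContinuousLinearMap.fst ℝ K V) + V.subtypeL.comp (ContinuousLinearMap.snd ℝ K V))
    (by
      intro a
      show R (A a) + (a - R (A a)) = a
      abel)
    (by
      rintro ⟨c, v⟩
      have hv : A v = 0 := v.2
      refine Prod.ext ?_ (Subtype.ext ?_)
      · show A (R c + v) = c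
        rw [map_add, hR, hv, add_zero]
      · show R c + v - R (A (R c + v)) = v
        rw [map_add, hR, hv, add_zero]
        abel)
  exact ⟨_, (ε : V →L[ℝ] _).comp Z₀,
    e₁.trans ((ContinuousLinearEquiv.refl ℝ K).prodCongr ε), fun c => rfl⟩

variable {E : Type} [NormedAddCommGroup E] [NormedSpace ℝ E] [FiniteDimensional ℝ E] {r : ℕ}

/-- Coordinates in which the submersion `y` is linear and the commuting fields `L η`, tangent to
the fibres of `y`, are constant: straighten the fields, then replace a part of the transversal
coordinates by the components of `y`, which do not depend on the coordinate along the fields. -/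
theorem exists_coordinates_of_dual_frame {N : Set E} (hN : IsOpen N) {u₀ : E} (hu₀ : u₀ ∈ N)
    {y : E → EuclideanSpace ℝ (Fin r)} {L : E → (EuclideanSpace ℝ (Fin r) →L[ℝ] ℝ) →L[ℝ] E}
    (hy : ContDiffOn ℝ ∞ y N) (hL : ContDiffOn ℝ ∞ L N)
    (hsurj : Function.Surjective (fderiv ℝ y u₀)) (hinj : Function.Injective (L u₀))
    (hyL : ∀ u ∈ N, ∀ η, fderiv ℝ y u (L u η) = 0)
    (hcomm : ∀ u ∈ N, ∀ ζ η, fderiv ℝ L u (L u ζ) η = fderiv ℝ L u (L u η) ζ) :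
    ∃ (l : ℕ) (θ : OpenPartialHomeomorph E ((EuclideanSpace ℝ (Fin r) × EuclideanSpace ℝ (Fin l)) ×
      (EuclideanSpace ℝ (Fin r) →L[ℝ] ℝ))), u₀ ∈ θ.source ∧ θ.source ⊆ N ∧
      ContDiffOn ℝ ∞ θ θ.source ∧ ContDiffOn ℝ ∞ θ.symm θ.target ∧
      ∀ u ∈ θ.source, (∀ η, fderiv ℝ θ u (L u η) = (0, η)) ∧
        ∀ a, (fderiv ℝ θ u a).1.1 = fderiv ℝ y u a := by
  have : CompleteSpace E := FiniteDimensional.complete ℝ E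
  let P : Submodule ℝ E := LinearMap.range (L u₀).toLinearMap
  obtain ⟨C₂, hC⟩ := P.exists_isCompl
  let e₀ : (C₂ × (EuclideanSpace ℝ (Fin r) →L[ℝ] ℝ)) ≃ₗ[ℝ] E :=
    ((LinearEquiv.refl ℝ C₂).prodCongr (LinearEquiv.ofInjective (L u₀).toLinearMap hinj)).trans
      (Submodule.prodEquivOfIsCompl C₂ P hC.symm)
  obtain ⟨θ, hθ0, hθN, -, hθs, hθs', hθL⟩ := exists_straightening hN hu₀ hL hcomm
    e₀.toContinuousLinearEquiv (fun η => by
      show ((0 : C₂) : E) + L u₀ η = L u₀ η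
      simp)
  have hθi : ∀ u ∈ θ.source, (∀ a, fderiv ℝ θ.symm (θ u) (fderiv ℝ θ u a) = a) ∧
      ∀ b, fderiv ℝ θ u (fderiv ℝ θ.symm (θ u) b) = b := fun u hu =>
    fderiv_symm_inverse hθs hθs' hu
  have hθd := fun u (hu : u ∈ θ.source) => hθs.hasFDerivAt_fderiv θ.open_source hu
  have hyd := fun u (hu : u ∈ θ.source) => hy.hasFDerivAt_fderiv hN (hθN hu)
  -- `y` factors through the first component of `θ`
  let Y : C₂ →L[ℝ] EuclideanSpace ℝ (Fin r) := (fderiv ℝ y u₀).comp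
    ((fderiv ℝ θ.symm (θ u₀)).comp (ContinuousLinearMap.inl ℝ _ _))
  have hY : ∀ a, fderiv ℝ y u₀ a = Y (fderiv ℝ θ u₀ a).1 := by
    intro a
    have h1 : a = fderiv ℝ θ.symm (θ u₀) ((fderiv ℝ θ u₀ a).1, 0) +
        L u₀ (fderiv ℝ θ u₀ a).2 := by
      rw [← (hθi u₀ hθ0).1 (L u₀ (fderiv ℝ θ u₀ a).2), hθL u₀ hθ0, ← map_add]
      simp [(hθi u₀ hθ0).1]
    conv_lhs => rw [h1]
    rw [map_add, hyL u₀ hu₀, add_zero]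
    rfl
  have hYs : Function.Surjective Y := fun c => by
    obtain ⟨a, rfl⟩ := hsurj c
    exact ⟨_, (hY a).symm⟩
  obtain ⟨l, Z, eC, heC⟩ := exists_equiv_fst_eq hYs
  -- the components of `y`, the remaining transversal coordinates, and the coordinate along the
  -- fields
  let f : E → (EuclideanSpace ℝ (Fin r) × EuclideanSpace ℝ (Fin l)) ×
      (EuclideanSpace ℝ (Fin r) →L[ℝ] ℝ) := fun u => ((y u, Z (θ u).1), (θ u).2)
  have hf : ContDiffOn ℝ ∞ f θ.source :=
    ((hy.mono hθN).prodMk (Z.contDiff.comp_contDiffOn hθs.fst)).prodMk hθs.snd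
  have hfd : ∀ u ∈ θ.source, ∀ a, fderiv ℝ f u a =
      ((fderiv ℝ y u a, Z (fderiv ℝ θ u a).1), (fderiv ℝ θ u a).2) := by
    intro u hu a
    have h1 : HasFDerivAt (fun u => (θ u).1) _ u := hasFDerivAt_fst.comp u (hθd u hu)
    have h2 : HasFDerivAt (fun u => (θ u).2) _ u := hasFDerivAt_snd.comp u (hθd u hu)
    have h3 : HasFDerivAt f _ u := ((hyd u hu).prodMk (Z.hasFDerivAt.comp u h1)).prodMk h2
    rw [h3.fderiv]
    rfl
  let eθ : E ≃L[ℝ] C₂ × (EuclideanSpace ℝ (Fin r) →L[ℝ] ℝ) :=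
    ContinuousLinearEquiv.equivOfInverse (fderiv ℝ θ u₀) (fderiv ℝ θ.symm (θ u₀))
      (hθi u₀ hθ0).1 (hθi u₀ hθ0).2
  let e := eθ.trans (eC.prodCongr (ContinuousLinearEquiv.refl ℝ _))
  obtain ⟨ψ, hψ0, hψθ, hψf, hψs, hψs'⟩ := exists_openPartialHomeomorph_of_contDiffOn
    θ.open_source hθ0 hf e (ContinuousLinearMap.ext fun a => by
      rw [hfd u₀ hθ0, hY]
      show _ = (eC (fderiv ℝ θ u₀ a).1, (fderiv ℝ θ u₀ a).2)
      rw [heC])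
  have hψe : (ψ : E → _) = f := funext hψf
  refine ⟨l, ψ, hψ0, hψθ.trans hθN, hψs, hψs', fun u hu => ⟨fun η => ?_, fun a => ?_⟩⟩
  · rw [hψe, hfd u (hψθ hu), hθL u (hψθ hu), hyL u (hθN (hψθ hu))]
    simp
  · rw [hψe, hfd u (hψθ hu)]

end AdaptedCoordinates

section ParallelCharts

variable {n : ℕ} {M : Mfd.{u} n} {E F : Type} [NormedAddCommGroup E] [NormedSpace ℝ E]
  [NormedAddCommGroup F] [NormedSpace ℝ F]

namespace SmoothChart

/-- A chart followed by a diffeomorphism between open subsets of normed spaces. -/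
def postcomp (κ : SmoothChart M E) (θ : OpenPartialHomeomorph E F)
    (hθ : ContDiffOn ℝ ∞ θ θ.source) (hθ' : ContDiffOn ℝ ∞ θ.symm θ.target) : SmoothChart M F where
  toOpenPartialHomeomorph := κ.toOpenPartialHomeomorph.trans θ
  contMDiffOn := by
    refine hθ.contMDiffOn.comp (κ.contMDiffOn.mono ?_) ?_
    · exact fun x hx => hx.1
    · exact fun x hx => hx.2
  contMDiffOn_symm := by
    refine κ.contMDiffOn_symm.comp (hθ'.contMDiffOn.mono ?_) ?_
    · exact fun x hx => hx.1
    · exact fun x hx => hx.2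

variable {κ : SmoothChart M E} {θ : OpenPartialHomeomorph E F}
  {hθ : ContDiffOn ℝ ∞ θ θ.source} {hθ' : ContDiffOn ℝ ∞ θ.symm θ.target}

theorem d_postcomp {x : M} (hx : x ∈ (κ.postcomp θ hθ hθ').source) (a : TangentSpace (𝓡 n) x) :
    (κ.postcomp θ hθ hθ').d x a = fderiv ℝ θ (κ x) (κ.d x a) := by
  have h1 := HasMFDerivAt.comp x
    (hθ.hasFDerivAt_fderiv θ.open_source hx.2).hasMFDerivAt (mdiffAt hx.1).hasMFDerivAt
  exact congrArg (fun T : EuclideanSpace ℝ (Fin n) →L[ℝ] F => T a) h1.mfderiv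

theorem gram_postcomp (g : PseudoRiemannianMetric M) {x : M}
    (hx : x ∈ (κ.postcomp θ hθ hθ').source) (a b : E) :
    (κ.postcomp θ hθ hθ').gram g (θ (κ x)) (fderiv ℝ θ (κ x) a) (fderiv ℝ θ (κ x) b) =
      κ.gram g (κ x) a b := by
  obtain ⟨a, rfl⟩ := κ.surjective_d hx.1 a
  obtain ⟨b, rfl⟩ := κ.surjective_d hx.1 b
  rw [← d_postcomp hx, ← d_postcomp hx, κ.gram_d g hx.1]
  exact (κ.postcomp θ hθ hθ').gram_d g hx a b

end SmoothChart

/-- Around every point there is a chart in which the null parallel distribution `P` is spanned by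
the last factor, paired by the metric with the first one. -/
theorem exists_chart_of_null_parallel {r : ℕ} {g : PseudoRiemannianMetric M} {nabla : Connection M}
    {P : SubspaceField M} (hn : IsLeviCivita g nabla) (hP : IsDistribution P r) (hnull : IsNull g P)
    (hpar : IsParallel nabla P) (x : M) :
    ∃ (l : ℕ) (κ : SmoothChart M ((EuclideanSpace ℝ (Fin r) × EuclideanSpace ℝ (Fin l)) ×
      (EuclideanSpace ℝ (Fin r) →L[ℝ] ℝ))), x ∈ κ.source ∧ κ.Straightens P (kerP r l) ∧
      ∀ w ∈ κ.target, ∀ η b, κ.gram g w (0, η) b = η b.1.1 := by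
  obtain ⟨U, hU, hxU, X, hX, hXP⟩ := hP x
  let κ := SmoothChart.at' x
  have hxκ : x ∈ κ.source := SmoothChart.mem_source_at' x
  let Ω : Set (EuclideanSpace ℝ (Fin n)) := κ.target ∩ κ.symm ⁻¹' U
  have hΩ : IsOpen Ω := κ.isOpen_preimage hU
  have hu₀ : κ x ∈ Ω := by
    refine ⟨κ.map_source hxκ, ?_⟩
    show κ.symm (κ x) ∈ U
    rwa [κ.left_inv hxκ]
  -- the distribution in the chart
  have hspan : ∀ u ∈ Ω, ∀ a : TangentSpace (𝓡 n) (κ.symm u), a ∈ P (κ.symm u) ↔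
      κ.d (κ.symm u) a ∈ Submodule.span ℝ (range fun i => κ.rep (X i) u) := by
    intro u hu a
    have h1 : (range fun i => κ.rep (X i) u) =
        (κ.d (κ.symm u)).toLinearMap '' (range fun i => X i (κ.symm u)) := by
      rw [← range_comp]
      rfl
    rw [h1, Submodule.span_image, (hXP _ hu.2).2]
    refine ⟨fun h => Submodule.mem_map_of_mem h, ?_⟩
    rintro ⟨b, hb, h⟩
    rwa [← κ.injective_d (κ.map_target hu.1) h]
  have hli : ∀ u ∈ Ω, LinearIndependent ℝ fun i => κ.rep (X i) u := fun u hu =>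
    (hXP _ hu.2).1.map' (κ.d (κ.symm u)).toLinearMap (LinearMap.ker_eq_bot.2
      fun a b h => κ.injective_d (κ.map_target hu.1) h)
  have hsub : Ω ⊆ κ.target := fun u hu => hu.1
  obtain ⟨N, y, L, hN, hu₀N, hNΩ, hy, hL, hyL⟩ := exists_dual_frame (G := κ.gram g)
    (Γ := κ.christoffel nabla) (X := fun i => κ.rep (X i)) hΩ hu₀
    ((κ.contDiffOn_gram g).mono hsub) (fun u hu a ha => κ.gram_nondegenerate g hu.1 ha)
    (fun u _ a b => κ.gram_symm g u a b)
    (fun u hu a b => κ.christoffel_symm hn.torsionFree.torsion_eq_zero hu.1 a b)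
    (fun u hu c a b => κ.fderiv_gram hn hu.1 c a b) (fun i => κ.contDiffOn_rep (hX i)) hli
    (fun u hu i j => by
      have hm : ∀ i, X i (κ.symm u) ∈ P (κ.symm u) := fun i => by
        rw [(hXP _ hu.2).2]
        exact Submodule.subset_span ⟨i, rfl⟩
      have h1 := κ.gram_d g (κ.map_target hu.1) (X i (κ.symm u)) (X j (κ.symm u))
      rw [κ.right_inv hu.1] at h1
      exact h1.trans (hnull _ _ (hm i) _ (hm j)))
    (by
      intro N Z hN hNΩ hZ hZP u hu a
      have hx' := κ.map_target (hNΩ hu).1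
      have hO : IsOpen (κ.source ∩ κ ⁻¹' N) := κ.isOpen_inter_preimage hN
      have hxO : κ.symm u ∈ κ.source ∩ κ ⁻¹' N := by
        refine ⟨hx', ?_⟩
        show κ (κ.symm u) ∈ N
        rwa [κ.right_inv (hNΩ hu).1]
      have hZs := κ.smoothFieldOn_ofRep hZ
      have hmem : ∀ z ∈ κ.source ∩ κ ⁻¹' N, κ.ofRep Z z ∈ P z := by
        intro z hz
        have h1 := (hspan (κ z) (hNΩ hz.2) (κ.dsymm (κ.symm (κ z)) (Z (κ z)))).2 (by
          rw [SmoothChart.d_dsymm (κ.map_target (hNΩ hz.2).1)]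
          exact hZP _ hz.2)
        rw [κ.left_inv hz.1] at h1
        exact h1
      have h1 := hpar _ _ hO hZs hmem (κ.symm u) hxO (κ.dsymm _ a)
      rw [hspan u (hNΩ hu), κ.d_connection_apply nabla hx' (hZs.mdifferentiableAt hO hxO),
        SmoothChart.d_dsymm hx', κ.right_inv (hNΩ hu).1, κ.rep_ofRep (hNΩ hu).1] at h1
      have h2 : κ.rep (κ.ofRep Z) =ᶠ[𝓝 u] Z := by
        filter_upwards [κ.open_target.mem_nhds (hNΩ hu).1] with w hw using κ.rep_ofRep hw
      rwa [h2.fderiv_eq] at h1)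
  have hinj : Function.Injective (L (κ x)) := by
    intro η ζ h
    refine ContinuousLinearMap.ext fun c => ?_
    obtain ⟨b, rfl⟩ := (hyL _ hu₀N).1 c
    rw [← (hyL _ hu₀N).2.1, ← (hyL _ hu₀N).2.1, h]
  obtain ⟨l, θ, hθ0, hθN, hθs, hθs', hθL⟩ := exists_coordinates_of_dual_frame hN hu₀N hy hL
    (hyL _ hu₀N).1 hinj (fun u hu => (hyL u hu).2.2.1) (fun u hu => (hyL u hu).2.2.2.2)
  refine ⟨l, κ.postcomp θ hθs hθs', ⟨hxκ, hθ0⟩, fun z hz a => ?_, fun w hw η b => ?_⟩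
  · have hz2 : κ z ∈ θ.source := hz.2
    have hzN : κ z ∈ N := hθN hz2
    have h1 := hspan (κ z) (hNΩ hzN)
    rw [κ.left_inv hz.1] at h1
    rw [h1, SmoothChart.d_postcomp hz, (hyL _ hzN).2.2.2.1, mem_kerP]
    constructor
    · rintro ⟨η, h⟩
      rw [h, (hθL _ hz2).1]
    · intro h
      refine ⟨(fderiv ℝ θ (κ z) (κ.d z a)).2, ?_⟩
      rw [← (fderiv_symm_inverse hθs hθs' hz2).1 (κ.d z a),
        ← (fderiv_symm_inverse hθs hθs' hz2).1 (L _ _), (hθL _ hz2).1]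
      congr 1
      rw [(fderiv_symm_inverse hθs hθs' hz2).1]
      exact Prod.ext h rfl
  · obtain ⟨z, hz, rfl⟩ : ∃ z ∈ (κ.postcomp θ hθs hθs').source, θ (κ z) = w :=
      ⟨(κ.postcomp θ hθs hθs').symm w, (κ.postcomp θ hθs hθs').map_target hw,
        (κ.postcomp θ hθs hθs').right_inv hw⟩
    have hz2 : κ z ∈ θ.source := hz.2
    have hzN : κ z ∈ N := hθN hz2
    rw [← (hθL _ hz2).1, ← (fderiv_symm_inverse hθs hθs' hz2).2 b,
      SmoothChart.gram_postcomp g hz, (hyL _ hzN).2.1, (hθL _ hz2).2]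

end ParallelCharts

/-! ### Coordinates filling out a bundle of dual spaces -/

section BoxCharts

variable {r l : ℕ}

theorem finrank_dual_euclideanSpace (r : ℕ) :
    Module.finrank ℝ (EuclideanSpace ℝ (Fin r) →L[ℝ] ℝ) = r := by
  rw [← (LinearMap.toContinuousLinearMap (𝕜 := ℝ) (E := EuclideanSpace ℝ (Fin r))
    (F' := ℝ)).finrank_eq]
  exact (Subspace.dual_finrank_eq (K := ℝ) (V := EuclideanSpace ℝ (Fin r))).trans
    finrank_euclideanSpace_fin

/-- A family of fibrewise rescalings that opens a neighbourhood of the zero section of a bundle of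
dual spaces out to the whole bundle. The neighbourhood consists of the covectors that the inverse
transpose of the derivative of `ψ` takes into a fixed ball. -/
theorem exists_fibre_rescaling
    {ψ : OpenPartialHomeomorph (EuclideanSpace ℝ (Fin r)) (EuclideanSpace ℝ (Fin r))}
    (hψ : ψ.source = univ) (hψs : ContDiffOn ℝ ∞ ψ ψ.source)
    (hψs' : ContDiffOn ℝ ∞ ψ.symm ψ.target)
    (J : (EuclideanSpace ℝ (Fin r) →L[ℝ] ℝ) ≃L[ℝ] EuclideanSpace ℝ (Fin r)) {ε : ℝ} (hε : 0 < ε) :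
    ∃ β : OpenPartialHomeomorph ((EuclideanSpace ℝ (Fin r) × EuclideanSpace ℝ (Fin l)) ×
      (EuclideanSpace ℝ (Fin r) →L[ℝ] ℝ)) ((EuclideanSpace ℝ (Fin r) × EuclideanSpace ℝ (Fin l)) ×
      EuclideanSpace ℝ (Fin r)),
      β.source = {w | J (w.2.comp (fderiv ℝ ψ.symm (ψ w.1.1))) ∈ Metric.ball 0 ε} ∧
      β.target = univ ∧ ContDiffOn ℝ ∞ β β.source ∧ ContDiffOn ℝ ∞ β.symm β.target ∧
      ∀ w ∈ β.source, (β w).1 = w.1 ∧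
        OpenPartialHomeomorph.univBall (0 : EuclideanSpace ℝ (Fin r)) ε (β w).2 =
          J (w.2.comp (fderiv ℝ ψ.symm (ψ w.1.1))) := by
  let ρ := OpenPartialHomeomorph.univBall (0 : EuclideanSpace ℝ (Fin r)) ε
  have hρt : ρ.target = Metric.ball 0 ε := OpenPartialHomeomorph.univBall_target _ hε
  have hρs : ρ.source = univ := OpenPartialHomeomorph.univBall_source _ _
  let A : EuclideanSpace ℝ (Fin r) → EuclideanSpace ℝ (Fin r) →L[ℝ] EuclideanSpace ℝ (Fin r) :=
    fun s => fderiv ℝ ψ.symm (ψ s)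
  let B : EuclideanSpace ℝ (Fin r) → EuclideanSpace ℝ (Fin r) →L[ℝ] EuclideanSpace ℝ (Fin r) :=
    fun s => fderiv ℝ ψ s
  have hψc : ContDiff ℝ ∞ ψ := by
    rw [← contDiffOn_univ, ← hψ]
    exact hψs
  have hAB : ∀ s, (∀ a, A s (B s a) = a) ∧ ∀ b, B s (A s b) = b := fun s =>
    fderiv_symm_inverse hψs hψs' (by rw [hψ]; trivial)
  have hB : ContDiff ℝ ∞ B := hψc.fderiv_right (m := ∞) (by simp)
  have hA : ContDiff ℝ ∞ A := by
    rw [← contDiffOn_univ]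
    exact (hψs'.fderiv_of_isOpen (m := ∞) ψ.open_target (by simp)).comp hψc.contDiffOn
      fun s _ => ψ.map_source (by rw [hψ]; trivial)
  have hm : ContDiff ℝ ∞ fun w : (EuclideanSpace ℝ (Fin r) × EuclideanSpace ℝ (Fin l)) ×
      (EuclideanSpace ℝ (Fin r) →L[ℝ] ℝ) => J (w.2.comp (A w.1.1)) :=
    J.contDiff.comp (contDiff_snd.clm_comp (hA.comp (contDiff_fst.comp contDiff_fst)))
  have hρ : ContDiff ℝ ∞ ρ := OpenPartialHomeomorph.contDiff_univBall
  have hρ' : ContDiffOn ℝ ∞ ρ.symm (Metric.ball 0 ε) :=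
    OpenPartialHomeomorph.contDiffOn_univBall_symm
  have hβ : ContDiffOn ℝ ∞ (fun w : (EuclideanSpace ℝ (Fin r) × EuclideanSpace ℝ (Fin l)) ×
      (EuclideanSpace ℝ (Fin r) →L[ℝ] ℝ) => (w.1, ρ.symm (J (w.2.comp (A w.1.1)))))
      {w | J (w.2.comp (A w.1.1)) ∈ Metric.ball 0 ε} :=
    contDiff_fst.contDiffOn.prodMk (hρ'.comp hm.contDiffOn fun w hw => hw)
  have hβ' : ContDiff ℝ ∞ (fun w : (EuclideanSpace ℝ (Fin r) × EuclideanSpace ℝ (Fin l)) ×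
      EuclideanSpace ℝ (Fin r) => (w.1, (J.symm (ρ w.2)).comp (B w.1.1))) :=
    contDiff_fst.prodMk ((J.symm.contDiff.comp (hρ.comp contDiff_snd)).clm_comp
      (hB.comp (contDiff_fst.comp contDiff_fst)))
  refine ⟨{
      toFun := fun w => (w.1, ρ.symm (J (w.2.comp (A w.1.1))))
      invFun := fun w => (w.1, (J.symm (ρ w.2)).comp (B w.1.1))
      source := {w | J (w.2.comp (A w.1.1)) ∈ Metric.ball 0 ε}
      target := univ
      map_source' := fun _ _ => trivial
      map_target' := fun w _ => ?_
      left_inv' := fun w hw => ?_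
      right_inv' := fun w _ => ?_
      open_source := Metric.isOpen_ball.preimage hm.continuous
      open_target := isOpen_univ
      continuousOn_toFun := hβ.continuousOn
      continuousOn_invFun := hβ'.continuous.continuousOn }, rfl, rfl, hβ, hβ'.contDiffOn,
      fun w hw => ⟨rfl, ?_⟩⟩
  · have h1 : ((J.symm (ρ w.2)).comp (B w.1.1)).comp (A w.1.1) = J.symm (ρ w.2) :=
      ContinuousLinearMap.ext fun b => by
        show J.symm (ρ w.2) (B w.1.1 (A w.1.1 b)) = _
        rw [(hAB _).2]
    show J (((J.symm (ρ w.2)).comp (B w.1.1)).comp (A w.1.1)) ∈ Metric.ball 0 ε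
    rw [h1, J.apply_symm_apply, ← hρt]
    exact ρ.map_source (by rw [hρs]; trivial)
  · refine Prod.ext rfl (ContinuousLinearMap.ext fun b => ?_)
    show J.symm (ρ (ρ.symm (J (w.2.comp (A w.1.1))))) (B w.1.1 b) = w.2 b
    rw [ρ.right_inv (by rw [hρt]; exact hw), J.symm_apply_apply]
    show w.2 (A w.1.1 (B w.1.1 b)) = _
    rw [(hAB _).1]
  · have h1 : ((J.symm (ρ w.2)).comp (B w.1.1)).comp (A w.1.1) = J.symm (ρ w.2) :=
      ContinuousLinearMap.ext fun b => by
        show J.symm (ρ w.2) (B w.1.1 (A w.1.1 b)) = _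
        rw [(hAB _).2]
    refine Prod.ext rfl ?_
    show ρ.symm (J (((J.symm (ρ w.2)).comp (B w.1.1)).comp (A w.1.1))) = w.2
    rw [h1, J.apply_symm_apply, ρ.left_inv (by rw [hρs]; trivial)]
  · show ρ (ρ.symm (J (w.2.comp (A w.1.1)))) = J (w.2.comp (A w.1.1))
    rw [ρ.right_inv (by rw [hρt]; exact hw)]

variable (r l) in
/-- Near every point there are coordinates filling out the total space of a bundle of open subsets
of dual spaces over a product of two vector spaces. The change of coordinates in the dual factor is
linear and is contragredient to the change in the first factor; hence it preserves the pairing of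
the last factor with the first one. -/
theorem exists_box_coordinates (w₀ : (EuclideanSpace ℝ (Fin r) × EuclideanSpace ℝ (Fin l)) ×
      (EuclideanSpace ℝ (Fin r) →L[ℝ] ℝ))
    {N : Set ((EuclideanSpace ℝ (Fin r) × EuclideanSpace ℝ (Fin l)) ×
      (EuclideanSpace ℝ (Fin r) →L[ℝ] ℝ))} (hN : N ∈ 𝓝 w₀) :
    ∃ θ : OpenPartialHomeomorph ((EuclideanSpace ℝ (Fin r) × EuclideanSpace ℝ (Fin l)) ×
      (EuclideanSpace ℝ (Fin r) →L[ℝ] ℝ)) ((EuclideanSpace ℝ (Fin r) × EuclideanSpace ℝ (Fin l)) ×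
      (EuclideanSpace ℝ (Fin r) →L[ℝ] ℝ)),
      w₀ ∈ θ.source ∧ θ.source ⊆ N ∧ ContDiffOn ℝ ∞ θ θ.source ∧
      ContDiffOn ℝ ∞ θ.symm θ.target ∧
      (∀ w ∈ θ.target, ∀ b, (fderiv ℝ θ.symm w b).1 = 0 ↔ b.1 = 0) ∧
      (∀ w ∈ θ.target, ∀ η, ∃ η' : EuclideanSpace ℝ (Fin r) →L[ℝ] ℝ,
        fderiv ℝ θ.symm w (0, η) = (0, η') ∧ ∀ b, η' (fderiv ℝ θ.symm w b).1.1 = η b.1.1) ∧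
      (∀ c, (c, 0) ∈ θ.target) ∧
      (∀ w ∈ θ.target, ∀ t ∈ Icc (0 : ℝ) 1, (w.1, t • w.2) ∈ θ.target) ∧
      ∃ β : OpenPartialHomeomorph ((EuclideanSpace ℝ (Fin r) × EuclideanSpace ℝ (Fin l)) ×
        (EuclideanSpace ℝ (Fin r) →L[ℝ] ℝ)) ((EuclideanSpace ℝ (Fin r) ×
        EuclideanSpace ℝ (Fin l)) × EuclideanSpace ℝ (Fin r)),
        β.source = θ.target ∧ β.target = univ ∧ ContDiffOn ℝ ∞ β β.source ∧
        ContDiffOn ℝ ∞ β.symm β.target ∧ ∀ w ∈ β.source, (β w).1 = w.1 := by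
  obtain ⟨⟨s₀, z₀⟩, ξ₀⟩ := w₀
  let J : (EuclideanSpace ℝ (Fin r) →L[ℝ] ℝ) ≃L[ℝ] EuclideanSpace ℝ (Fin r) :=
    ContinuousLinearEquiv.ofFinrankEq
      ((finrank_dual_euclideanSpace r).trans finrank_euclideanSpace_fin.symm)
  obtain ⟨ε, hε, hεN⟩ : ∃ ε > 0, ∀ w : (EuclideanSpace ℝ (Fin r) × EuclideanSpace ℝ (Fin l)) ×
      (EuclideanSpace ℝ (Fin r) →L[ℝ] ℝ), w.1.1 ∈ Metric.ball s₀ ε → w.1.2 ∈ Metric.ball z₀ ε →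
      J (w.2 - ξ₀) ∈ Metric.ball 0 ε → w ∈ N := by
    have hc : Continuous fun w : (EuclideanSpace ℝ (Fin r) × EuclideanSpace ℝ (Fin l)) ×
        EuclideanSpace ℝ (Fin r) => (w.1, ξ₀ + J.symm w.2) :=
      continuous_fst.prodMk (continuous_const.add (J.symm.continuous.comp continuous_snd))
    have hN' : N ∈ 𝓝 (((s₀, z₀) : EuclideanSpace ℝ (Fin r) × EuclideanSpace ℝ (Fin l)),
        ξ₀ + J.symm (0 : EuclideanSpace ℝ (Fin r))) := by
      rwa [map_zero, add_zero]
    obtain ⟨ε, hε, h⟩ := Metric.mem_nhds_iff.1 (hc.continuousAt (x := ((s₀, z₀), 0)) hN')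
    refine ⟨ε, hε, fun w h1 h2 h3 => ?_⟩
    have h4 : ((w.1, J (w.2 - ξ₀)) : (EuclideanSpace ℝ (Fin r) × EuclideanSpace ℝ (Fin l)) ×
        EuclideanSpace ℝ (Fin r)) ∈ Metric.ball ((s₀, z₀), 0) ε := by
      rw [← ball_prod_same, ← ball_prod_same]
      exact ⟨⟨h1, h2⟩, h3⟩
    have h5 : (w.1, ξ₀ + J.symm (J (w.2 - ξ₀))) ∈ N := h h4
    rwa [J.symm_apply_apply, add_sub_cancel] at h5
  -- `ψ` and `χ` blow the base balls up to vector spaces; the pairing forces the change of the dual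
  -- coordinate, which is opened out to all covectors only afterwards, by `β`
  let ψ := OpenPartialHomeomorph.univBall s₀ ε
  let χ := OpenPartialHomeomorph.univBall z₀ ε
  have hψs : ψ.source = univ := OpenPartialHomeomorph.univBall_source _ _
  have hψt : ψ.target = Metric.ball s₀ ε := OpenPartialHomeomorph.univBall_target _ hε
  have hχs : χ.source = univ := OpenPartialHomeomorph.univBall_source _ _
  have hχt : χ.target = Metric.ball z₀ ε := OpenPartialHomeomorph.univBall_target _ hε
  have hψ : ContDiff ℝ ∞ ψ := OpenPartialHomeomorph.contDiff_univBall
  have hχ : ContDiff ℝ ∞ χ := OpenPartialHomeomorph.contDiff_univBall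
  have hψ' : ContDiffOn ℝ ∞ ψ.symm ψ.target := by
    rw [hψt]
    exact OpenPartialHomeomorph.contDiffOn_univBall_symm
  have hχ' : ContDiffOn ℝ ∞ χ.symm χ.target := by
    rw [hχt]
    exact OpenPartialHomeomorph.contDiffOn_univBall_symm
  have hψm : ∀ s, s ∈ ψ.source := fun s => by rw [hψs]; trivial
  have hχm : ∀ s, s ∈ χ.source := fun s => by rw [hχs]; trivial
  obtain ⟨β, hβs, hβt, hβ, hβ', hβ1⟩ := exists_fibre_rescaling (l := l) hψs hψ.contDiffOn hψ' J hε
  let A : EuclideanSpace ℝ (Fin r) → EuclideanSpace ℝ (Fin r) →L[ℝ] EuclideanSpace ℝ (Fin r) :=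
    fun s => fderiv ℝ ψ.symm (ψ s)
  let B : EuclideanSpace ℝ (Fin r) → EuclideanSpace ℝ (Fin r) →L[ℝ] EuclideanSpace ℝ (Fin r) :=
    fun s => fderiv ℝ ψ s
  have hAB : ∀ s, (∀ a, A s (B s a) = a) ∧ ∀ b, B s (A s b) = b := fun s =>
    fderiv_symm_inverse hψ.contDiffOn hψ' (hψm s)
  have hχinj : ∀ s b, fderiv ℝ χ s b = 0 → b = 0 := fun s b h => by
    rw [← (fderiv_symm_inverse hχ.contDiffOn hχ' (hχm s)).1 b, h, map_zero]
  have hB : ContDiff ℝ ∞ B := hψ.fderiv_right (m := ∞) (by simp)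
  have hA : ContDiff ℝ ∞ A := by
    rw [← contDiffOn_univ]
    exact (hψ'.fderiv_of_isOpen (m := ∞) ψ.open_target (by simp)).comp hψ.contDiffOn
      fun s _ => ψ.map_source (hψm s)
  let f : (EuclideanSpace ℝ (Fin r) × EuclideanSpace ℝ (Fin l)) ×
      (EuclideanSpace ℝ (Fin r) →L[ℝ] ℝ) → (EuclideanSpace ℝ (Fin r) × EuclideanSpace ℝ (Fin l)) ×
      (EuclideanSpace ℝ (Fin r) →L[ℝ] ℝ) :=
    fun w => ((ψ.symm w.1.1, χ.symm w.1.2), (w.2 - ξ₀).comp (B (ψ.symm w.1.1)))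
  let f' : (EuclideanSpace ℝ (Fin r) × EuclideanSpace ℝ (Fin l)) ×
      (EuclideanSpace ℝ (Fin r) →L[ℝ] ℝ) → (EuclideanSpace ℝ (Fin r) × EuclideanSpace ℝ (Fin l)) ×
      (EuclideanSpace ℝ (Fin r) →L[ℝ] ℝ) :=
    fun w => ((ψ w.1.1, χ w.1.2), ξ₀ + w.2.comp (A w.1.1))
  let T : Set ((EuclideanSpace ℝ (Fin r) × EuclideanSpace ℝ (Fin l)) ×
      (EuclideanSpace ℝ (Fin r) →L[ℝ] ℝ)) :=
    {w | (w.1.1 ∈ ψ.target ∧ w.1.2 ∈ χ.target) ∧ J (w.2 - ξ₀) ∈ Metric.ball 0 ε}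
  have hfs : ContDiffOn ℝ ∞ f T := by
    have h1 : ContDiffOn ℝ ∞ (fun w : (EuclideanSpace ℝ (Fin r) × EuclideanSpace ℝ (Fin l)) ×
        (EuclideanSpace ℝ (Fin r) →L[ℝ] ℝ) => ψ.symm w.1.1) T :=
      hψ'.comp (contDiff_fst.comp contDiff_fst).contDiffOn fun w hw => hw.1.1
    have h2 : ContDiffOn ℝ ∞ (fun w : (EuclideanSpace ℝ (Fin r) × EuclideanSpace ℝ (Fin l)) ×
        (EuclideanSpace ℝ (Fin r) →L[ℝ] ℝ) => χ.symm w.1.2) T :=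
      hχ'.comp (contDiff_snd.comp contDiff_fst).contDiffOn fun w hw => hw.1.2
    exact (h1.prodMk h2).prodMk ((contDiff_snd.sub contDiff_const).contDiffOn.clm_comp
      (hB.comp_contDiffOn h1))
  have hf's : ContDiff ℝ ∞ f' :=
    ((hψ.comp (contDiff_fst.comp contDiff_fst)).prodMk
      (hχ.comp (contDiff_snd.comp contDiff_fst))).prodMk (contDiff_const.add
        (contDiff_snd.clm_comp (hA.comp (contDiff_fst.comp contDiff_fst))))
  have hTo : IsOpen T :=
    ((ψ.open_target.preimage (continuous_fst.comp continuous_fst)).inter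
      (χ.open_target.preimage (continuous_snd.comp continuous_fst))).inter
      (Metric.isOpen_ball.preimage (J.continuous.comp (continuous_snd.sub continuous_const)))
  have hd : ∀ w b, (fderiv ℝ f' w b).1 = (B w.1.1 b.1.1, fderiv ℝ χ w.1.2 b.1.2) := by
    intro w b
    have h0 : HasFDerivAt f' (fderiv ℝ f' w) w := (hf's.differentiable (by simp) w).hasFDerivAt
    have h1 := h0.fst
    have h2 : HasFDerivAt (fun w : (EuclideanSpace ℝ (Fin r) × EuclideanSpace ℝ (Fin l)) ×
        (EuclideanSpace ℝ (Fin r) →L[ℝ] ℝ) => ψ w.1.1) _ w :=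
      (hψ.differentiable (by simp) w.1.1).hasFDerivAt.comp w
        (hasFDerivAt_fst.comp w hasFDerivAt_fst)
    have h3 : HasFDerivAt (fun w : (EuclideanSpace ℝ (Fin r) × EuclideanSpace ℝ (Fin l)) ×
        (EuclideanSpace ℝ (Fin r) →L[ℝ] ℝ) => χ w.1.2) _ w :=
      (hχ.differentiable (by simp) w.1.2).hasFDerivAt.comp w
        (hasFDerivAt_snd.comp w hasFDerivAt_fst)
    exact congrArg (fun T => T b) (h1.unique (h2.prodMk h3))
  have hd' : ∀ w η, fderiv ℝ f' w (0, η) = (0, η.comp (A w.1.1)) := by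
    intro w η
    have h0 : HasFDerivAt f' (fderiv ℝ f' w) w := (hf's.differentiable (by simp) w).hasFDerivAt
    have h1 := h0.hasLineDerivAt ((0 : EuclideanSpace ℝ (Fin r) × EuclideanSpace ℝ (Fin l)), η)
    have h2 : HasLineDerivAt ℝ f' ((0 : EuclideanSpace ℝ (Fin r) × EuclideanSpace ℝ (Fin l)),
        η.comp (A w.1.1)) w (0, η) := by
      have h3 : ∀ t : ℝ, f' (w + t • (0, η)) = f' w + t • (0, η.comp (A w.1.1)) := by
        intro t
        refine Prod.ext (Prod.ext ?_ ?_) ?_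
        · show ψ (w.1.1 + t • 0) = ψ w.1.1 + t • 0
          simp
        · show χ (w.1.2 + t • 0) = χ w.1.2 + t • 0
          simp
        · show ξ₀ + (w.2 + t • η).comp (A (w.1.1 + t • 0)) =
            ξ₀ + w.2.comp (A w.1.1) + t • η.comp (A w.1.1)
          rw [smul_zero, add_zero, ContinuousLinearMap.add_comp, ContinuousLinearMap.smul_comp,
            add_assoc]
      have h4 : HasDerivAt (fun t : ℝ => f' w + t • ((0 : EuclideanSpace ℝ (Fin r) ×
          EuclideanSpace ℝ (Fin l)), η.comp (A w.1.1))) _ 0 :=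
        ((hasDerivAt_id (0 : ℝ)).smul_const _).const_add _
      rw [one_smul] at h4
      exact h4.congr_of_eventuallyEq (Filter.Eventually.of_forall h3)
    exact h1.unique h2
  have hAB' : ∀ (ξ : EuclideanSpace ℝ (Fin r) →L[ℝ] ℝ) s, (ξ.comp (B s)).comp (A s) = ξ :=
    fun ξ s => ContinuousLinearMap.ext fun b => by
      show ξ (B s (A s b)) = _
      rw [(hAB _).2]
  have hBA' : ∀ (ξ : EuclideanSpace ℝ (Fin r) →L[ℝ] ℝ) s, (ξ.comp (A s)).comp (B s) = ξ :=
    fun ξ s => ContinuousLinearMap.ext fun b => by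
      show ξ (A s (B s b)) = _
      rw [(hAB _).1]
  refine ⟨{
      toFun := f
      invFun := f'
      source := T
      target := β.source
      map_source' := fun w hw => ?_
      map_target' := fun w hw => ?_
      left_inv' := fun w hw => ?_
      right_inv' := fun w _ => ?_
      open_source := hTo
      open_target := β.open_source
      continuousOn_toFun := hfs.continuousOn
      continuousOn_invFun := hf's.continuous.continuousOn }, ?_, ?_, hfs, hf's.contDiffOn,
      fun w _ b => ?_, fun w _ η => ⟨η.comp (A w.1.1), hd' w η, fun b => ?_⟩, fun c => ?_,
      fun w hw t ht => ?_, β, rfl, hβt, hβ, hβ', fun w hw => (hβ1 w hw).1⟩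
  · rw [hβs]
    show J (((w.2 - ξ₀).comp (B (ψ.symm w.1.1))).comp (A (ψ.symm w.1.1))) ∈ Metric.ball 0 ε
    rw [hAB']
    exact hw.2
  · rw [hβs] at hw
    refine ⟨⟨ψ.map_source (hψm _), χ.map_source (hχm _)⟩, ?_⟩
    show J (ξ₀ + w.2.comp (A w.1.1) - ξ₀) ∈ Metric.ball 0 ε
    rw [add_sub_cancel_left]
    exact hw
  · refine Prod.ext (Prod.ext (ψ.right_inv hw.1.1) (χ.right_inv hw.1.2)) ?_
    show ξ₀ + ((w.2 - ξ₀).comp (B (ψ.symm w.1.1))).comp (A (ψ.symm w.1.1)) = w.2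
    rw [hAB', add_sub_cancel]
  · refine Prod.ext (Prod.ext (ψ.left_inv (hψm _)) (χ.left_inv (hχm _))) ?_
    show (ξ₀ + w.2.comp (A w.1.1) - ξ₀).comp (B (ψ.symm (ψ w.1.1))) = w.2
    rw [ψ.left_inv (hψm _), add_sub_cancel_left, hBA']
  · refine ⟨⟨?_, ?_⟩, ?_⟩
    · rw [hψt]
      exact Metric.mem_ball_self hε
    · rw [hχt]
      exact Metric.mem_ball_self hε
    · show J (ξ₀ - ξ₀) ∈ Metric.ball 0 ε
      rw [sub_self, map_zero]
      exact Metric.mem_ball_self hε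
  · intro w hw
    exact hεN w (by rw [← hψt]; exact hw.1.1) (by rw [← hχt]; exact hw.1.2) hw.2
  · show (fderiv ℝ f' w b).1 = 0 ↔ b.1 = 0
    rw [hd]
    refine ⟨fun h => ?_, fun h => ?_⟩
    · refine Prod.ext ?_ (hχinj _ _ (congrArg Prod.snd h))
      rw [← (hAB w.1.1).1 b.1.1]
      exact (congrArg (A w.1.1) (congrArg Prod.fst h)).trans (map_zero _)
    · rw [h]
      exact Prod.ext (map_zero _) (map_zero _)
  · show η (A w.1.1 (fderiv ℝ f' w b).1.1) = η b.1.1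
    rw [hd, (hAB _).1]
  · show (c, (0 : EuclideanSpace ℝ (Fin r) →L[ℝ] ℝ)) ∈ β.source
    rw [hβs]
    show J ((0 : EuclideanSpace ℝ (Fin r) →L[ℝ] ℝ).comp _) ∈ Metric.ball 0 ε
    rw [ContinuousLinearMap.zero_comp, map_zero]
    exact Metric.mem_ball_self hε
  · show (w.1, t • w.2) ∈ β.source
    have hw' : w ∈ β.source := hw
    rw [hβs] at hw' ⊢
    have h1 : J (w.2.comp (A w.1.1)) ∈ Metric.ball 0 ε := hw'
    show J ((t • w.2).comp (A w.1.1)) ∈ Metric.ball 0 ε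
    rw [ContinuousLinearMap.smul_comp, map_smul, mem_ball_zero_iff, norm_smul,
      Real.norm_of_nonneg ht.1]
    exact (mul_le_of_le_one_left (norm_nonneg _) ht.2).trans_lt (mem_ball_zero_iff.1 h1)

end BoxCharts

/-! ### Euclidean models and local leaf spaces -/

section ModelManifolds

/-- Euclidean space as a manifold. -/
abbrev euclideanMfd (k : ℕ) : Mfd.{0} k where
  carrier := EuclideanSpace ℝ (Fin k)

variable {k : ℕ} {E : Type} [NormedAddCommGroup E] [NormedSpace ℝ E]

/-- The global chart of Euclidean space given by a linear isomorphism. -/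
def SmoothChart.ofEquiv (ι : EuclideanSpace ℝ (Fin k) ≃L[ℝ] E) :
    SmoothChart (euclideanMfd k) E where
  toOpenPartialHomeomorph := ι.toHomeomorph.toOpenPartialHomeomorph
  contMDiffOn := ι.contDiff.contMDiff.contMDiffOn
  contMDiffOn_symm := ι.symm.contDiff.contMDiff.contMDiffOn

variable (ι : EuclideanSpace ℝ (Fin k) ≃L[ℝ] E)

theorem SmoothChart.d_ofEquiv (x : euclideanMfd k) (a : TangentSpace (𝓡 k) x) :
    (SmoothChart.ofEquiv ι).d x a = ι a :=
  congrArg (fun T : EuclideanSpace ℝ (Fin k) →L[ℝ] E => T a)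
    ((mfderiv_eq_fderiv (f := ι) (x := (x : EuclideanSpace ℝ (Fin k)))).trans ι.fderiv)

theorem SmoothChart.dsymm_ofEquiv (x : euclideanMfd k) (b : E) :
    (SmoothChart.ofEquiv ι).dsymm x b = ι.symm b := by
  refine (SmoothChart.ofEquiv ι).injective_d (x := x) (by trivial) ?_
  rw [SmoothChart.d_dsymm (by trivial)]
  exact ((SmoothChart.d_ofEquiv ι x (ι.symm b)).trans (ι.apply_symm_apply b)).symm

end ModelManifolds

section LeafSpaces

variable {n k : ℕ} {M : Mfd.{u} n} {E F H : Type} [NormedAddCommGroup E] [NormedSpace ℝ E]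
  [NormedAddCommGroup F] [NormedSpace ℝ F] [NormedAddCommGroup H] [NormedSpace ℝ H]
  [FiniteDimensional ℝ H]

/-- A chart whose image is diffeomorphic to a product of vector spaces defines a trivial bundle
over the first factor. -/
theorem isBundleProjectionOn_of_chart (κ : SmoothChart M E) (β : OpenPartialHomeomorph E (F × H))
    (hs : β.source = κ.target) (ht : β.target = univ) (hβ : ContDiffOn ℝ ∞ β β.source)
    (hβ' : ContDiffOn ℝ ∞ β.symm β.target) (ι : EuclideanSpace ℝ (Fin k) ≃L[ℝ] F)
    {f : M → euclideanMfd k} (hf : ∀ x ∈ κ.source, ι (f x) = (β (κ x)).1) :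
    IsBundleProjectionOn f κ.source := by
  let ε : H ≃L[ℝ] EuclideanSpace ℝ (Fin (Module.finrank ℝ H)) := toEuclidean
  have hm : ∀ x ∈ κ.source, κ x ∈ β.source := fun x hx => by
    rw [hs]
    exact κ.map_source hx
  have hm' : ∀ y : F × H, β.symm y ∈ κ.target := fun y => by
    rw [← hs]
    exact β.map_target (by rw [ht]; trivial)
  have hf' : ∀ x ∈ κ.source, f x = ι.symm (β (κ x)).1 := fun x hx => by
    rw [← hf x hx]
    exact (ι.symm_apply_apply _).symm
  have hκβ : ContMDiffOn (𝓡 n) 𝓘(ℝ, F × H) ∞ (fun x => β (κ x)) κ.source :=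
    hβ.contMDiffOn.comp κ.contMDiffOn hm
  have hfs : ContMDiffOn (𝓡 n) (𝓡 k) ∞ f κ.source :=
    ContMDiffOn.congr ((ι.symm.contDiff.comp contDiff_fst).contMDiff.comp_contMDiffOn hκβ) hf'
  have hκβs : ContMDiff 𝓘(ℝ, F × H) (𝓡 n) ∞ fun y => κ.symm (β.symm y) := by
    rw [← contMDiffOn_univ, ← ht]
    exact κ.contMDiffOn_symm.comp hβ'.contMDiffOn fun y _ => hm' y
  refine ⟨κ.open_source, hfs, fun b _ => ?_, fun b => ⟨univ, isOpen_univ, mem_univ _,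
    Module.finrank ℝ H, EuclideanSpace ℝ (Fin (Module.finrank ℝ H)), inferInstance, inferInstance,
    inferInstance, (κ.toOpenPartialHomeomorph.trans β).trans
      (ι.symm.toHomeomorph.prodCongr ε.toHomeomorph).toOpenPartialHomeomorph, ?_, ?_, ?_, ?_, ?_⟩⟩
  · refine ⟨κ.symm (β.symm (ι b, 0)), κ.map_target (hm' _), ?_⟩
    rw [hf' _ (κ.map_target (hm' _)), κ.right_inv (hm' _), β.right_inv (by rw [ht]; trivial)]
    exact ι.symm_apply_apply b
  · ext x
    refine ⟨fun hx => ⟨hx.1.1, trivial⟩, fun hx => ⟨⟨hx.1, hm x hx.1⟩, trivial⟩⟩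
  · ext y
    refine ⟨fun hx => ⟨trivial, trivial⟩, fun hx => ⟨trivial, ?_, ?_⟩⟩
    · show _ ∈ β.target
      rw [ht]
      trivial
    · exact hm' _
  · intro x hx
    exact (hf' x hx.1.1).symm
  · have h1 : ContMDiff 𝓘(ℝ, F × H) (𝓡 k) ∞ fun y : F × H => ι.symm y.1 :=
      (ι.symm.contDiff.comp contDiff_fst).contMDiff
    have h2 : ContMDiff 𝓘(ℝ, F × H) (𝓡 (Module.finrank ℝ H)) ∞ fun y : F × H => ε y.2 :=
      (ε.contDiff.comp contDiff_snd).contMDiff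
    exact (h1.prodMk h2).comp_contMDiffOn (hκβ.mono fun x hx => hx.1.1)
  · have h1 : ContMDiff ((𝓡 k).prod (𝓡 (Module.finrank ℝ H))) 𝓘(ℝ, F × H) ∞
        fun y : EuclideanSpace ℝ (Fin k) × EuclideanSpace ℝ (Fin (Module.finrank ℝ H)) =>
          (ι y.1, ε.symm y.2) :=
      (ι.contDiff.contMDiff.comp contMDiff_fst).prodMk_space
        (ε.symm.contDiff.contMDiff.comp contMDiff_snd)
    exact (hκβs.comp h1).contMDiffOn

/-- If moreover the distribution `V` is, in this chart, the kernel of the projection onto the first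
factor, then the bundle is a local leaf space of `V`. -/
theorem isLocalLeafSpace_of_chart (κ : SmoothChart M E) (β : OpenPartialHomeomorph E (F × H))
    (hs : β.source = κ.target) (ht : β.target = univ) (hβ : ContDiffOn ℝ ∞ β β.source)
    (hβ' : ContDiffOn ℝ ∞ β.symm β.target) (ι : EuclideanSpace ℝ (Fin k) ≃L[ℝ] F)
    {f : M → euclideanMfd k} {ℓ : E →L[ℝ] F} (hf : ∀ x ∈ κ.source, ι (f x) = ℓ (κ x))
    (hℓ : ∀ w ∈ β.source, (β w).1 = ℓ w)
    {V : SubspaceField M} (hV : ∀ x ∈ κ.source, ∀ a, a ∈ V x ↔ ℓ (κ.d x a) = 0) :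
    IsLocalLeafSpace V κ.source f := by
  have hf0 : ∀ x ∈ κ.source, ι (f x) = (β (κ x)).1 := fun x hx => by
    rw [hf x hx, hℓ _ (by rw [hs]; exact κ.map_source hx)]
  have hb := isBundleProjectionOn_of_chart κ β hs ht hβ hβ' ι hf0
  have hm' : ∀ y : F × H, β.symm y ∈ κ.target := fun y => by
    rw [← hs]
    exact β.map_target (by rw [ht]; trivial)
  refine ⟨hb, fun x hx => ?_, fun b => ?_⟩
  · ext a
    rw [hV x hx]
    have h1 := κ.d_mfderiv (SmoothChart.ofEquiv ι)
      ((hb.contMDiffOn.contMDiffAt (κ.open_source.mem_nhds hx)).mdifferentiableAt (by simp)) hx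
      (by trivial) (F := ℓ) ℓ.hasFDerivAt (by
        filter_upwards [κ.open_source.mem_nhds hx] with y hy using hf y hy) a
    rw [← h1]
    refine ⟨fun h => ?_, fun h => ?_⟩
    · rw [show mfderiv (𝓡 n) (𝓡 k) f x a = 0 from h, map_zero]
    · exact (SmoothChart.ofEquiv ι).injective_d (x := f x) (by trivial) (h.trans (map_zero _).symm)
  · have h1 : κ.source ∩ f ⁻¹' {b} = (fun t : H => κ.symm (β.symm (ι b, t))) '' univ := by
      ext x
      constructor
      · rintro ⟨hx, hxb⟩
        refine ⟨(β (κ x)).2, trivial, ?_⟩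
        have h2 : (ι b, (β (κ x)).2) = β (κ x) := by
          rw [← show f x = b from hxb]
          exact Prod.ext (hf0 x hx) rfl
        show κ.symm (β.symm (ι b, (β (κ x)).2)) = x
        rw [h2, β.left_inv (by rw [hs]; exact κ.map_source hx), κ.left_inv hx]
      · rintro ⟨t, -, rfl⟩
        have hx := κ.map_target (hm' (ι b, t))
        refine ⟨hx, ?_⟩
        refine ι.injective ((hf0 _ hx).trans ?_)
        rw [κ.right_inv (hm' _), β.right_inv (by rw [ht]; trivial)]
    rw [h1]
    refine isConnected_univ.image _ (Continuous.continuousOn ?_)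
    have h2 : Continuous β.symm := by
      rw [← continuousOn_univ, ← ht]
      exact hβ'.continuousOn
    exact (κ.continuousOn_symm.comp_continuous h2 fun y => hm' y).comp
      (continuous_const.prodMk continuous_id)

end LeafSpaces

/-! ### The metric along the leaves of a null parallel distribution -/

section DifferentiatedKoszul

/-- A function is equal at the ends of a segment along which its derivative vanishes. -/
theorem eq_of_fderiv_segment {E F : Type*} [NormedAddCommGroup E] [NormedSpace ℝ E]
    [NormedAddCommGroup F] [NormedSpace ℝ F] {f : E → F} {u c : E}
    (hf : ∀ t ∈ Icc (0 : ℝ) 1, DifferentiableAt ℝ f (u + t • c))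
    (h : ∀ t ∈ Icc (0 : ℝ) 1, fderiv ℝ f (u + t • c) c = 0) : f (u + c) = f u := by
  have hd : ∀ t ∈ Icc (0 : ℝ) 1, HasDerivAt (fun t : ℝ => f (u + t • c)) 0 t := by
    intro t ht
    have h1 : HasDerivAt (fun t : ℝ => u + t • c) c t := by
      simpa using ((hasDerivAt_id t).smul_const c).const_add u
    have h2 := (hf t ht).hasFDerivAt.comp_hasDerivAt t h1
    rwa [h t ht] at h2
  have h1 := constant_of_derivWithin_zero (f := fun t : ℝ => f (u + t • c))
    (fun t ht => (hd t ht).differentiableAt.differentiableWithinAt)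
    (fun t ht => (hd t ⟨ht.1, ht.2.le⟩).hasDerivWithinAt.derivWithin
      (uniqueDiffOn_Icc zero_lt_one t ⟨ht.1, ht.2.le⟩)) 1 ⟨zero_le_one, le_rfl⟩
  simpa using h1

variable {n : ℕ} {M : Mfd.{u} n} {E : Type v} [NormedAddCommGroup E] [NormedSpace ℝ E]
  [FiniteDimensional ℝ E]

namespace SmoothChart

variable (κ : SmoothChart M E) (g : PseudoRiemannianMetric M)

theorem contDiffOn_gram_apply (b c : E) : ContDiffOn ℝ ∞ (fun w => κ.gram g w b c) κ.target :=
  ((κ.contDiffOn_gram g).clm_apply contDiffOn_const).clm_apply contDiffOn_const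

theorem fderiv_gram_eventuallyEq {w : E} (hw : w ∈ κ.target) (a b c : E) :
    (fun w => fderiv ℝ (κ.gram g) w a b c) =ᶠ[𝓝 w]
      fun w => fderiv ℝ (fun w => κ.gram g w b c) w a := by
  filter_upwards [κ.open_target.mem_nhds hw] with z hz
  exact (κ.fderiv_gram_apply g hz a b c).symm

theorem differentiableAt_fderiv_gram {w : E} (hw : w ∈ κ.target) (a b c : E) :
    DifferentiableAt ℝ (fun w => fderiv ℝ (κ.gram g) w a b c) w := by
  refine DifferentiableAt.congr_of_eventuallyEq ?_ (κ.fderiv_gram_eventuallyEq g hw a b c)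
  exact (differentiableAt_fderiv κ.open_target (κ.contDiffOn_gram_apply g b c) hw).clm_apply
    (differentiableAt_const a)

theorem fderiv_fderiv_gram_comm {w : E} (hw : w ∈ κ.target) (e a b c : E) :
    fderiv ℝ (fun w => fderiv ℝ (κ.gram g) w a b c) w e =
      fderiv ℝ (fun w => fderiv ℝ (κ.gram g) w e b c) w a := by
  rw [(κ.fderiv_gram_eventuallyEq g hw a b c).fderiv_eq,
    (κ.fderiv_gram_eventuallyEq g hw e b c).fderiv_eq,
    fderiv_fderiv_apply κ.open_target (κ.contDiffOn_gram_apply g b c) hw,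
    fderiv_fderiv_apply κ.open_target (κ.contDiffOn_gram_apply g b c) hw,
    fderiv_fderiv_comm κ.open_target (κ.contDiffOn_gram_apply g b c) hw]

variable {g} {nabla : Connection M}

theorem hasFDerivAt_christoffel_apply (h : IsTorsionFreeConnection nabla) {w : E}
    (hw : w ∈ κ.target) (a b : E) : HasFDerivAt (fun w => κ.christoffel nabla w a b)
      (((fderiv ℝ (κ.christoffel nabla) w).flip a).flip b) w := by
  have h1 : DifferentiableAt ℝ (fun w => κ.christoffel nabla w a b) w :=
    ((κ.differentiableAt_christoffel h hw).clm_apply (differentiableAt_const a)).clm_apply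
      (differentiableAt_const b)
  convert h1.hasFDerivAt using 1
  ext e
  exact (κ.fderiv_christoffel_apply h hw e a b).symm

theorem fderiv_gram_christoffel (h : IsTorsionFreeConnection nabla) {w : E} (hw : w ∈ κ.target)
    (a b c e : E) : DifferentiableAt ℝ (fun w => κ.gram g w (κ.christoffel nabla w a b) c) w ∧
    fderiv ℝ (fun w => κ.gram g w (κ.christoffel nabla w a b) c) w e =
      fderiv ℝ (κ.gram g) w e (κ.christoffel nabla w a b) c +
        κ.gram g w (fderiv ℝ (κ.christoffel nabla) w e a b) c := by
  have h1 := (κ.differentiableAt_gram g hw).hasFDerivAt.clm_apply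
    (κ.hasFDerivAt_christoffel_apply h hw a b)
  have h2 := h1.clm_apply (hasFDerivAt_const c w)
  rw [ContinuousLinearMap.comp_zero, zero_add] at h2
  refine ⟨h2.differentiableAt, ?_⟩
  rw [h2.fderiv]
  exact add_comm _ _

/-- The Koszul formula, differentiated in the direction of `e`. -/
theorem fderiv_koszul (h : IsLeviCivita g nabla) {w : E} (hw : w ∈ κ.target) (a b c e : E) :
    2 * (fderiv ℝ (κ.gram g) w e (κ.christoffel nabla w a b) c +
        κ.gram g w (fderiv ℝ (κ.christoffel nabla) w e a b) c) =
      fderiv ℝ (fun w => fderiv ℝ (κ.gram g) w e b c) w a +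
        fderiv ℝ (fun w => fderiv ℝ (κ.gram g) w e a c) w b -
          fderiv ℝ (fun w => fderiv ℝ (κ.gram g) w e a b) w c := by
  have h1 : (fun w => 2 * κ.gram g w (κ.christoffel nabla w a b) c) =ᶠ[𝓝 w] fun w =>
      fderiv ℝ (κ.gram g) w a b c + fderiv ℝ (κ.gram g) w b a c - fderiv ℝ (κ.gram g) w c a b := by
    filter_upwards [κ.open_target.mem_nhds hw] with z hz using κ.koszul h hz a b c
  have hΓ := κ.fderiv_gram_christoffel (g := g) h.torsionFree hw a b c e
  have h2 := (hΓ.1.hasFDerivAt.const_mul (2 : ℝ)).congr_of_eventuallyEq h1.symm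
  have h3 := h2.unique (((κ.differentiableAt_fderiv_gram g hw a b c).hasFDerivAt.add
    (κ.differentiableAt_fderiv_gram g hw b a c).hasFDerivAt).sub
      (κ.differentiableAt_fderiv_gram g hw c a b).hasFDerivAt)
  have h4 := congrArg (fun T : E →L[ℝ] ℝ => T e) h3
  rw [← hΓ.2, ← κ.fderiv_fderiv_gram_comm g hw e a b c, ← κ.fderiv_fderiv_gram_comm g hw e b a c,
    ← κ.fderiv_fderiv_gram_comm g hw e c a b]
  exact h4

end SmoothChart
end DifferentiatedKoszul

section NullBoxes

variable {n : ℕ} {M : Mfd.{u} n} {r l : ℕ}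

/-- The chart `κ` takes the null distribution `P` to the last factor `(ℝʳ)*`, which the metric pairs
with the first factor `ℝʳ` in the standard way; the image of `κ` is star-shaped in the direction of
the last factor and is diffeomorphic, over `ℝʳ × ℝˡ`, to a product. -/
structure SmoothChart.IsNullBox (κ : SmoothChart M ((EuclideanSpace ℝ (Fin r) ×
    EuclideanSpace ℝ (Fin l)) × (EuclideanSpace ℝ (Fin r) →L[ℝ] ℝ))) (g : PseudoRiemannianMetric M)
    (P : SubspaceField M) : Prop where
  straightens : κ.Straightens P (kerP r l)
  gram_vertical : ∀ w ∈ κ.target, ∀ η b, κ.gram g w (0, η) b = η b.1.1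
  zero_mem : ∀ c, (c, 0) ∈ κ.target
  smul_mem : ∀ w ∈ κ.target, ∀ t ∈ Icc (0 : ℝ) 1, (w.1, t • w.2) ∈ κ.target
  exists_product : ∃ β : OpenPartialHomeomorph ((EuclideanSpace ℝ (Fin r) ×
      EuclideanSpace ℝ (Fin l)) × (EuclideanSpace ℝ (Fin r) →L[ℝ] ℝ)) ((EuclideanSpace ℝ (Fin r) ×
        EuclideanSpace ℝ (Fin l)) × EuclideanSpace ℝ (Fin r)),
    β.source = κ.target ∧ β.target = univ ∧ ContDiffOn ℝ ∞ β β.source ∧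
    ContDiffOn ℝ ∞ β.symm β.target ∧ ∀ w ∈ β.source, (β w).1 = w.1

/-- A null parallel distribution has null boxes around every point: coordinates from
`exists_chart_of_null_parallel`, changed by `exists_box_coordinates`. -/
theorem exists_nullBox {g : PseudoRiemannianMetric M} {nabla : Connection M}
    {P : SubspaceField M} (hn : IsLeviCivita g nabla) (hP : IsDistribution P r) (hnull : IsNull g P)
    (hpar : IsParallel nabla P) (x : M) :
    ∃ (l : ℕ) (κ : SmoothChart M ((EuclideanSpace ℝ (Fin r) × EuclideanSpace ℝ (Fin l)) ×
      (EuclideanSpace ℝ (Fin r) →L[ℝ] ℝ))), x ∈ κ.source ∧ κ.IsNullBox g P := by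
  obtain ⟨l, κ, hx, hκ, hv⟩ := exists_chart_of_null_parallel hn hP hnull hpar x
  obtain ⟨θ, hθ0, hθN, hθ, hθ', hθP, hθv, hz, hs, β, hβs, hβ⟩ := exists_box_coordinates r l (κ x)
    (κ.open_target.mem_nhds (κ.map_source hx))
  have hmem : ∀ w, w ∈ (κ.postcomp θ hθ hθ').target ↔ w ∈ θ.target := fun w =>
    ⟨fun h => h.1, fun h => ⟨h, hθN (θ.map_target h)⟩⟩
  refine ⟨l, κ.postcomp θ hθ hθ', ⟨hx, hθ0⟩, fun z hzs a => ?_, fun w hw η b => ?_,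
    fun c => (hmem _).2 (hz c), fun w hw t ht => (hmem _).2 (hs w ((hmem _).1 hw) t ht), β,
    hβs.trans (Set.ext fun w => (hmem w).symm), hβ⟩
  · have hz2 : κ z ∈ θ.source := hzs.2
    have h1 := hθP _ (θ.map_source hz2) (fderiv ℝ θ (κ z) (κ.d z a))
    rw [(fderiv_symm_inverse hθ hθ' hz2).1] at h1
    rw [hκ z hzs.1, mem_kerP, mem_kerP, SmoothChart.d_postcomp hzs]
    exact h1
  · obtain ⟨z, hz, rfl⟩ : ∃ z ∈ (κ.postcomp θ hθ hθ').source, θ (κ z) = w :=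
      ⟨(κ.postcomp θ hθ hθ').symm w, (κ.postcomp θ hθ hθ').map_target hw,
        (κ.postcomp θ hθ hθ').right_inv hw⟩
    have hz2 : κ z ∈ θ.source := hz.2
    obtain ⟨η', h1, h2⟩ := hθv _ (θ.map_source hz2) η
    rw [← h2 b, ← hv _ (κ.map_source hz.1) η', ← h1, ← SmoothChart.gram_postcomp g hz,
      (fderiv_symm_inverse hθ hθ' hz2).2, (fderiv_symm_inverse hθ hθ' hz2).2]

theorem fderiv_mul_comp_fst_fst {E A B C : Type*} [NormedAddCommGroup E] [NormedSpace ℝ E]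
    [NormedAddCommGroup A] [NormedSpace ℝ A] [NormedAddCommGroup B] [NormedSpace ℝ B]
    [NormedAddCommGroup C] [NormedSpace ℝ C] {f : E → (A × B) × C} {f' : E →L[ℝ] (A × B) × C}
    {w : E}     (hf : HasFDerivAt f f' w) (t : ℝ) (η : A →L[ℝ] ℝ) (c : E) :
    fderiv ℝ (fun w => t * η (f w).1.1) w c = t * η (f' c).1.1 := by
  have h : HasFDerivAt (fun w => t * η (f w).1.1) _ w :=
    (η.hasFDerivAt.comp w hf.fst.fst).const_mul t
  rw [h.fderiv]
  rfl

namespace SmoothChart.IsNullBox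

variable {κ : SmoothChart M ((EuclideanSpace ℝ (Fin r) ×
    EuclideanSpace ℝ (Fin l)) × (EuclideanSpace ℝ (Fin r) →L[ℝ] ℝ))} {g : PseudoRiemannianMetric M}
    {P : SubspaceField M} {nabla : Connection M}
  {w : (EuclideanSpace ℝ (Fin r) × EuclideanSpace ℝ (Fin l)) × (EuclideanSpace ℝ (Fin r) →L[ℝ] ℝ)}

theorem gram_vertical_right (hκ : κ.IsNullBox g P) (hw : w ∈ κ.target)
    (η : EuclideanSpace ℝ (Fin r) →L[ℝ] ℝ) (b) : κ.gram g w b (0, η) = η b.1.1 := by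
  rw [κ.gram_symm, hκ.gram_vertical w hw]

theorem fderiv_gram_vertical (hκ : κ.IsNullBox g P) (hw : w ∈ κ.target) (e b)
    (η : EuclideanSpace ℝ (Fin r) →L[ℝ] ℝ) : fderiv ℝ (κ.gram g) w e b (0, η) = 0 := by
  rw [← κ.fderiv_gram_apply g hw]
  have : (fun w => κ.gram g w b (0, η)) =ᶠ[𝓝 w] fun _ => η b.1.1 := by
    filter_upwards [κ.open_target.mem_nhds hw] with z hz using hκ.gram_vertical_right hz η b
  rw [this.fderiv_eq, fderiv_const_apply]
  rfl

/-- The first components of the Christoffel symbols are given by the derivatives of the metric along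
the null distribution. -/
theorem fderiv_gram_eq (hκ : κ.IsNullBox g P) (hn : IsLeviCivita g nabla) (hw : w ∈ κ.target)
    (η : EuclideanSpace ℝ (Fin r) →L[ℝ] ℝ) (a b) :
    fderiv ℝ (κ.gram g) w (0, η) a b = -2 * η (κ.christoffel nabla w a b).1.1 := by
  have h1 := κ.koszul hn hw a b (0, η)
  rw [hκ.fderiv_gram_vertical hw, hκ.fderiv_gram_vertical hw, hκ.gram_vertical_right hw] at h1
  linarith

/-- The null distribution is parallel. -/
theorem christoffel_kerP (hκ : κ.IsNullBox g P) (hpar : IsParallel nabla P) (hw : w ∈ κ.target)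
    (η : EuclideanSpace ℝ (Fin r) →L[ℝ] ℝ) (a) : (κ.christoffel nabla w a (0, η)).1 = 0 := by
  obtain ⟨x, hx, rfl⟩ : ∃ x ∈ κ.source, κ x = w := ⟨κ.symm w, κ.map_target hw, κ.right_inv hw⟩
  rw [κ.christoffel_eq nabla hx, ← mem_kerP, ← hκ.straightens x hx]
  refine hpar _ _ κ.open_source (κ.smoothFieldOn_ofRep_const _) (fun z hz => ?_) x hx _
  rw [hκ.straightens z hz, mem_kerP]
  show (κ.d z (κ.dsymm z (0, η))).1 = 0
  rw [d_dsymm hz]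

/-- The orthogonal complement of the null distribution is parallel too. -/
theorem christoffel_kerProj (hκ : κ.IsNullBox g P) (hn : IsLeviCivita g nabla)
    (hpar : IsParallel nabla P) (hw : w ∈ κ.target)
    {v : (EuclideanSpace ℝ (Fin r) × EuclideanSpace ℝ (Fin l)) × (EuclideanSpace ℝ (Fin r) →L[ℝ] ℝ)}
    (hv : v.1.1 = 0) (a) : (κ.christoffel nabla w a v).1.1 = 0 := by
  refine (SeparatingDual.eq_iff_forall_dual_eq (R := ℝ)).2 fun η => ?_
  have h1 := κ.fderiv_gram hn hw a v (0, η)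
  have h2 : κ.christoffel nabla w a (0, η) = (0, (κ.christoffel nabla w a (0, η)).2) :=
    Prod.ext (hκ.christoffel_kerP hpar hw η a) rfl
  rw [hκ.fderiv_gram_vertical hw, hκ.gram_vertical_right hw, h2, hκ.gram_vertical_right hw, hv,
    map_zero, add_zero] at h1
  rw [map_zero]
  exact h1.symm

/-- The bundle over `ℝʳ × ℝˡ` that a null box defines is a local leaf space of the null
distribution. -/
theorem isLocalLeafSpace (hκ : κ.IsNullBox g P) {k : ℕ} (ι : EuclideanSpace ℝ (Fin k) ≃L[ℝ]
    EuclideanSpace ℝ (Fin r) × EuclideanSpace ℝ (Fin l)) {f : M → euclideanMfd k}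
    (hf : ∀ x ∈ κ.source, ι (f x) = (κ x).1) : IsLocalLeafSpace P κ.source f := by
  obtain ⟨β, hs, ht, hβ, hβ', hβ1⟩ := hκ.exists_product
  exact isLocalLeafSpace_of_chart κ β hs ht hβ hβ' ι (ℓ := ContinuousLinearMap.fst ℝ _ _) hf hβ1
    fun x hx a => by
      rw [hκ.straightens x hx, mem_kerP]
      rfl

/-- Projectability along the null distribution, applied to the constant fields of the chart over the
whole box: modulo the null distribution, the Christoffel symbols are constant along it. -/
theorem fderiv_christoffel_kerP (hκ : κ.IsNullBox g P) (hn : IsLeviCivita g nabla)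
    (hproj : IsProjectableAlong nabla P) (hw : w ∈ κ.target)
    (η : EuclideanSpace ℝ (Fin r) →L[ℝ] ℝ) (a b) :
    (fderiv ℝ (κ.christoffel nabla) w (0, η) a b).1 = 0 := by
  let ι := (toEuclidean (E := EuclideanSpace ℝ (Fin r) × EuclideanSpace ℝ (Fin l))).symm
  have hleaf := hκ.isLocalLeafSpace ι (f := fun x => ι.symm (κ x).1)
    fun x _ => ι.apply_symm_apply _
  have hfield : ∀ a, IsProjectableField P κ.source (κ.ofRep fun _ => a) := by
    intro a k B U f hU hf
    refine exists_projects_of_charts hf ((κ.smoothFieldOn_ofRep_const a).mono hU)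
      fun x hx => ⟨_, _, _, inferInstance, κ, kerP r l, hU hx, hκ.straightens, fun u hu v _ => ?_⟩
    rw [κ.fderiv_rep_ofRep_const a hu.1]
    exact (kerP r l).zero_mem
  obtain ⟨Y, hY, hYX⟩ := hproj.projectable κ.source _ _ κ.open_source
    (κ.smoothFieldOn_ofRep_const a) (κ.smoothFieldOn_ofRep_const b) (hfield a) (hfield b) _ _ _ _
    Subset.rfl hleaf
  have hu : w ∈ κ.target ∩ κ.symm ⁻¹' κ.source := ⟨hw, κ.map_target hw⟩
  have h1 := fderiv_rep_mem_of_projects hκ.straightens κ.open_source hleaf.bundle.contMDiffOn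
    hleaf.ker_eq (SmoothFieldOn.connection hn.torsionFree.smooth κ.open_source
      (κ.smoothFieldOn_ofRep_const a) (κ.smoothFieldOn_ofRep_const b)) hY hYX hu
    (v := (0, η)) (mem_kerP.2 rfl)
  have h2 : κ.rep (fun x => nabla (κ.ofRep fun _ => b) x (κ.ofRep (fun _ => a) x)) =ᶠ[𝓝 w]
      fun w => κ.christoffel nabla w a b := by
    filter_upwards [κ.open_target.mem_nhds hw] with z hz
    rw [κ.rep_connection nabla κ.open_source (κ.smoothFieldOn_ofRep_const b)
      ⟨hz, κ.map_target hz⟩, κ.fderiv_rep_ofRep_const b hz, κ.rep_ofRep hz, κ.rep_ofRep hz]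
    exact zero_add _
  rw [h2.fderiv_eq, κ.fderiv_christoffel_apply hn.torsionFree hw] at h1
  exact mem_kerP.1 h1

theorem fderiv_fderiv_gram (hκ : κ.IsNullBox g P) (hn : IsLeviCivita g nabla) (hw : w ∈ κ.target)
    (η : EuclideanSpace ℝ (Fin r) →L[ℝ] ℝ) (a b c) :
    fderiv ℝ (fun w => fderiv ℝ (κ.gram g) w (0, η) a b) w c =
      -2 * η (fderiv ℝ (κ.christoffel nabla) w c a b).1.1 := by
  have h5 : (fun w => fderiv ℝ (κ.gram g) w (0, η) a b) =ᶠ[𝓝 w]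
      fun w => -2 * η (κ.christoffel nabla w a b).1.1 := by
    filter_upwards [κ.open_target.mem_nhds hw] with z hz using hκ.fderiv_gram_eq hn hz η a b
  rw [h5.fderiv_eq]
  exact fderiv_mul_comp_fst_fst (κ.hasFDerivAt_christoffel_apply hn.torsionFree hw a b) (-2) η c

theorem fderiv_fderiv_gram_kerProj (hκ : κ.IsNullBox g P) (hn : IsLeviCivita g nabla)
    (hpar : IsParallel nabla P) (hw : w ∈ κ.target) (η : EuclideanSpace ℝ (Fin r) →L[ℝ] ℝ)
    {c : (EuclideanSpace ℝ (Fin r) × EuclideanSpace ℝ (Fin l)) × (EuclideanSpace ℝ (Fin r) →L[ℝ] ℝ)}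
    (hc : c.1.1 = 0) (a e) :
    fderiv ℝ (fun w => fderiv ℝ (κ.gram g) w (0, η) a c) w e = 0 := by
  have : (fun w => fderiv ℝ (κ.gram g) w (0, η) a c) =ᶠ[𝓝 w] fun _ => 0 := by
    filter_upwards [κ.open_target.mem_nhds hw] with z hz
    rw [hκ.fderiv_gram_eq hn hz, hκ.christoffel_kerProj hn hpar hz hc, map_zero, mul_zero]
  rw [this.fderiv_eq, fderiv_const_apply]
  rfl

/-- Modulo the null distribution the Christoffel symbols are constant along it; differentiating the
Koszul formula turns this into their constancy, modulo the orthogonal complement of the null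
distribution, along that complement. -/
theorem fderiv_christoffel_kerProj (hκ : κ.IsNullBox g P) (hn : IsLeviCivita g nabla)
    (hpar : IsParallel nabla P) (hproj : IsProjectableAlong nabla P) (hw : w ∈ κ.target)
    {c : (EuclideanSpace ℝ (Fin r) × EuclideanSpace ℝ (Fin l)) × (EuclideanSpace ℝ (Fin r) →L[ℝ] ℝ)}
    (hc : c.1.1 = 0) (a b) : (fderiv ℝ (κ.christoffel nabla) w c a b).1.1 = 0 := by
  refine (SeparatingDual.eq_iff_forall_dual_eq (R := ℝ)).2 fun η => ?_
  have h1 := κ.fderiv_koszul hn hw a b c (0, η)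
  have h2 : fderiv ℝ (κ.christoffel nabla) w (0, η) a b =
      (0, (fderiv ℝ (κ.christoffel nabla) w (0, η) a b).2) :=
    Prod.ext (hκ.fderiv_christoffel_kerP hn hproj hw η a b) rfl
  have h6 : κ.gram g w (fderiv ℝ (κ.christoffel nabla) w (0, η) a b) c = 0 := by
    rw [h2, hκ.gram_vertical w hw, hc, map_zero]
  have h7 : fderiv ℝ (κ.gram g) w (0, η) (κ.christoffel nabla w a b) c = 0 := by
    rw [hκ.fderiv_gram_eq hn hw, hκ.christoffel_kerProj hn hpar hw hc, map_zero, mul_zero]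
  rw [h6, h7, hκ.fderiv_fderiv_gram_kerProj hn hpar hw η hc,
    hκ.fderiv_fderiv_gram_kerProj hn hpar hw η hc, hκ.fderiv_fderiv_gram hn hw] at h1
  have h8 : η (fderiv ℝ (κ.christoffel nabla) w c a b).1.1 = 0 := by linarith
  exact h8.trans (map_zero η).symm

/-- The first components of the Christoffel symbols depend only on the first components of their
arguments. -/
theorem christoffel_eq_base (hκ : κ.IsNullBox g P) (hn : IsLeviCivita g nabla)
    (hpar : IsParallel nabla P) (hproj : IsProjectableAlong nabla P) (hw : w ∈ κ.target) (a b) :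
    (κ.christoffel nabla w a b).1.1 =
      (κ.christoffel nabla ((w.1.1, 0), 0) ((a.1.1, 0), 0) ((b.1.1, 0), 0)).1.1 := by
  have hs := fun a b => κ.christoffel_symm hn.torsionFree.torsion_eq_zero hw a b
  -- the vectors with vanishing first component may be dropped from the arguments
  have h1 : (κ.christoffel nabla w a b).1.1 =
      (κ.christoffel nabla w ((a.1.1, 0), 0) ((b.1.1, 0), 0)).1.1 := by
    have h2 : ∀ a b, (κ.christoffel nabla w a b).1.1 =
        (κ.christoffel nabla w a ((b.1.1, 0), 0)).1.1 := by
      intro a b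
      have h3 := hκ.christoffel_kerProj hn hpar hw (v := b - ((b.1.1, 0), 0)) (sub_self _) a
      rw [map_sub] at h3
      exact sub_eq_zero.1 h3
    rw [h2, hs, h2, hs]
  rw [h1]
  generalize (((a.1.1, 0), 0) : (EuclideanSpace ℝ (Fin r) × EuclideanSpace ℝ (Fin l)) ×
    (EuclideanSpace ℝ (Fin r) →L[ℝ] ℝ)) = a
  generalize (((b.1.1, 0), 0) : (EuclideanSpace ℝ (Fin r) × EuclideanSpace ℝ (Fin l)) ×
    (EuclideanSpace ℝ (Fin r) →L[ℝ] ℝ)) = b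
  -- the base point moves along segments in directions with vanishing first component, first to the
  -- zero section, then inside it
  have hmove : ∀ u c : (EuclideanSpace ℝ (Fin r) × EuclideanSpace ℝ (Fin l)) ×
      (EuclideanSpace ℝ (Fin r) →L[ℝ] ℝ), c.1.1 = 0 →
      (∀ t ∈ Icc (0 : ℝ) 1, u + t • c ∈ κ.target) →
      (κ.christoffel nabla (u + c) a b).1.1 = (κ.christoffel nabla u a b).1.1 := by
    intro u c hc hm
    have hd : ∀ w ∈ κ.target, HasFDerivAt (fun w => (κ.christoffel nabla w a b).1.1) _ w :=
      fun w hw => (κ.hasFDerivAt_christoffel_apply hn.torsionFree hw a b).fst.fst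
    refine eq_of_fderiv_segment (f := fun w => (κ.christoffel nabla w a b).1.1)
      (fun t ht => (hd _ (hm t ht)).differentiableAt) fun t ht => ?_
    rw [(hd _ (hm t ht)).fderiv]
    exact hκ.fderiv_christoffel_kerProj hn hpar hproj (hm t ht) hc a b
  have h2 := hmove (w.1, 0) (0, w.2) rfl fun t ht => by
    convert hκ.smul_mem w hw t ht using 1
    refine Prod.ext ?_ ?_
    · show w.1 + t • 0 = w.1
      rw [smul_zero, add_zero]
    · exact zero_add _
  have h3 := hmove ((w.1.1, 0), 0) ((0, w.1.2), 0) rfl fun t ht => by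
    convert hκ.zero_mem (w.1.1, t • w.1.2) using 1
    refine Prod.ext (Prod.ext ?_ ?_) ?_
    · show w.1.1 + t • 0 = w.1.1
      rw [smul_zero, add_zero]
    · exact zero_add _
    · show (0 : EuclideanSpace ℝ (Fin r) →L[ℝ] ℝ) + t • 0 = 0
      rw [smul_zero, add_zero]
  have e2 : ((w.1, 0) + (0, w.2) : (EuclideanSpace ℝ (Fin r) × EuclideanSpace ℝ (Fin l)) ×
      (EuclideanSpace ℝ (Fin r) →L[ℝ] ℝ)) = w := by
    simp
  have e3 : (((w.1.1, 0), 0) + ((0, w.1.2), 0) : (EuclideanSpace ℝ (Fin r) ×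
      EuclideanSpace ℝ (Fin l)) × (EuclideanSpace ℝ (Fin r) →L[ℝ] ℝ)) = (w.1, 0) := by
    simp
  rw [e2] at h2
  rw [e3] at h3
  rw [h2, h3]

/-- The metric is affine along the leaves of the null distribution, with the slope given by the
connection that `nabla` induces on the leaf space of the orthogonal complement. -/
theorem gram_eq_base (hκ : κ.IsNullBox g P) (hn : IsLeviCivita g nabla)
    (hpar : IsParallel nabla P) (hproj : IsProjectableAlong nabla P) (hw : w ∈ κ.target) (a b) :
    κ.gram g w a b = κ.gram g (w.1, 0) a b - 2 * w.2
      (κ.christoffel nabla ((w.1.1, 0), 0) ((a.1.1, 0), 0) ((b.1.1, 0), 0)).1.1 := by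
  let K : EuclideanSpace ℝ (Fin r) :=
    (κ.christoffel nabla ((w.1.1, 0), 0) ((a.1.1, 0), 0) ((b.1.1, 0), 0)).1.1
  let e : (EuclideanSpace ℝ (Fin r) →L[ℝ] ℝ) →L[ℝ] ℝ := ContinuousLinearMap.apply ℝ ℝ K
  have hm : ∀ t ∈ Icc (0 : ℝ) 1, ((w.1, 0) + t • (0, w.2) : (EuclideanSpace ℝ (Fin r) ×
      EuclideanSpace ℝ (Fin l)) × (EuclideanSpace ℝ (Fin r) →L[ℝ] ℝ)) ∈ κ.target := fun t ht => by
    convert hκ.smul_mem w hw t ht using 1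
    refine Prod.ext ?_ ?_
    · show w.1 + t • 0 = w.1
      rw [smul_zero, add_zero]
    · exact zero_add _
  have hd : ∀ z ∈ κ.target, DifferentiableAt ℝ (fun z => κ.gram g z a b) z := fun z hz =>
    ((κ.contDiffOn_gram_apply g a b).contDiffAt (κ.open_target.mem_nhds hz)).differentiableAt
      (by simp)
  have hd' : ∀ z ∈ κ.target, HasFDerivAt (fun z : (EuclideanSpace ℝ (Fin r) ×
      EuclideanSpace ℝ (Fin l)) × (EuclideanSpace ℝ (Fin r) →L[ℝ] ℝ) =>
      κ.gram g z a b + 2 * e z.2) _ z := fun z hz =>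
    (hd z hz).hasFDerivAt.add ((e.hasFDerivAt.comp z hasFDerivAt_snd).const_mul (2 : ℝ))
  have h1 := eq_of_fderiv_segment (u := ((w.1, 0) : (EuclideanSpace ℝ (Fin r) ×
      EuclideanSpace ℝ (Fin l)) × (EuclideanSpace ℝ (Fin r) →L[ℝ] ℝ))) (c := (0, w.2))
      (fun t ht => (hd' _ (hm t ht)).differentiableAt) fun t ht => by
    rw [(hd' _ (hm t ht)).fderiv]
    show fderiv ℝ (fun z => κ.gram g z a b) _ (0, w.2) + 2 * w.2 K = 0
    rw [κ.fderiv_gram_apply g (hm t ht), hκ.fderiv_gram_eq hn (hm t ht),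
      hκ.christoffel_eq_base hn hpar hproj (hm t ht)]
    have e1 : ((w.1, 0) + t • (0, w.2) : (EuclideanSpace ℝ (Fin r) ×
      EuclideanSpace ℝ (Fin l)) × (EuclideanSpace ℝ (Fin r) →L[ℝ] ℝ)).1.1 = w.1.1 := by
      simp
    rw [e1]
    show -2 * w.2 K + 2 * w.2 K = 0
    ring
  have e2 : ((w.1, 0) + (0, w.2) : (EuclideanSpace ℝ (Fin r) × EuclideanSpace ℝ (Fin l)) ×
      (EuclideanSpace ℝ (Fin r) →L[ℝ] ℝ)) = w := by
    simp
  rw [e2] at h1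
  have h2 : κ.gram g w a b + 2 * w.2 K = κ.gram g (w.1, 0) a b + 2 * (0 : ℝ) := h1
  show _ = _ - 2 * w.2 K
  linarith

end SmoothChart.IsNullBox
end NullBoxes

/-! ### The linear model of a pullback-extension -/

section HomBundles

variable {n : ℕ} {M : Mfd.{u} n}

/-- The trivialization of the bundle of endomorphisms is conjugation by the derivative of the
chart. -/
theorem trivializationAt_endomorphism (y₀ : M) {y : M} (hy : y ∈ (SmoothChart.at' y₀).source)
    (T : TangentSpace (𝓡 n) y →L[ℝ] TangentSpace (𝓡 n) y) (b : EuclideanSpace ℝ (Fin n)) :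
    (trivializationAt (EuclideanSpace ℝ (Fin n) →L[ℝ] EuclideanSpace ℝ (Fin n))
      (fun y : M => TangentSpace (𝓡 n) y →L[ℝ] TangentSpace (𝓡 n) y) y₀ ⟨y, T⟩).2 b =
      (SmoothChart.at' y₀).d y (T ((SmoothChart.at' y₀).dsymm y b)) := by
  rw [hom_trivializationAt_apply]
  show (trivializationAt (EuclideanSpace ℝ (Fin n))
    (TangentSpace (𝓡 n)) y₀).continuousLinearMapAt ℝ y
    (T ((trivializationAt (EuclideanSpace ℝ (Fin n)) (TangentSpace (𝓡 n)) y₀).symmL ℝ y b)) = _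
  rw [TangentBundle.symmL_trivializationAt hy,
    TangentBundle.continuousLinearMapAt_trivializationAt hy]
  have h1 : mfderivWithin 𝓘(ℝ, EuclideanSpace ℝ (Fin n)) (𝓡 n) (extChartAt (𝓡 n) y₀).symm
      (range (𝓡 n)) (extChartAt (𝓡 n) y₀ y) = (SmoothChart.at' y₀).dsymm y := by
    rw [ModelWithCorners.Boundaryless.range_eq_univ, mfderivWithin_univ]
    rfl
  rw [h1]
  rfl

theorem trivializationAt_bilin (y₀ : M) {y : M} (hy : y ∈ (SmoothChart.at' y₀).source)
    (T : TangentSpace (𝓡 n) y →L[ℝ] TangentSpace (𝓡 n) y →L[ℝ] ℝ) (a b : EuclideanSpace ℝ (Fin n)) :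
    (trivializationAt (EuclideanSpace ℝ (Fin n) →L[ℝ] EuclideanSpace ℝ (Fin n) →L[ℝ] ℝ)
      (fun y : M => TangentSpace (𝓡 n) y →L[ℝ] TangentSpace (𝓡 n) y →L[ℝ] ℝ) y₀ ⟨y, T⟩).2 a b =
      T ((SmoothChart.at' y₀).dsymm y a) ((SmoothChart.at' y₀).dsymm y b) := by
  rw [hom_trivializationAt_apply]
  show (trivializationAt (EuclideanSpace ℝ (Fin n) →L[ℝ] ℝ)
      (fun y : M => TangentSpace (𝓡 n) y →L[ℝ] ℝ) y₀).continuousLinearMapAt ℝ y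
    (T ((trivializationAt (EuclideanSpace ℝ (Fin n)) (TangentSpace (𝓡 n)) y₀).symmL ℝ y a)) b = _
  rw [TangentBundle.symmL_trivializationAt hy]
  have h1 : mfderivWithin 𝓘(ℝ, EuclideanSpace ℝ (Fin n)) (𝓡 n) (extChartAt (𝓡 n) y₀).symm
      (range (𝓡 n)) (extChartAt (𝓡 n) y₀ y) = (SmoothChart.at' y₀).dsymm y := by
    rw [ModelWithCorners.Boundaryless.range_eq_univ, mfderivWithin_univ]
    rfl
  rw [h1, Trivialization.continuousLinearMapAt_apply_of_mem]
  · exact congrArg (fun L => L b) (trivializationAt_cotangent y₀ hy _)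
  · exact ⟨hy, trivial⟩

/-- Smoothness of a field of endomorphisms, in the preferred chart. -/
theorem contMDiffOn_endomorphism (y₀ : M)
    {T : Π y : M, TangentSpace (𝓡 n) y →L[ℝ] TangentSpace (𝓡 n) y}
    {A : M → EuclideanSpace ℝ (Fin n) →L[ℝ] EuclideanSpace ℝ (Fin n)} {U : Set M}
    (hU : U ⊆ (SmoothChart.at' y₀).source)
    (hA : ContMDiffOn (𝓡 n) 𝓘(ℝ, EuclideanSpace ℝ (Fin n) →L[ℝ] EuclideanSpace ℝ (Fin n)) ∞ A U)
    (hT : ∀ y ∈ U, ∀ b, A y b = (SmoothChart.at' y₀).d y (T y ((SmoothChart.at' y₀).dsymm y b))) :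
    ContMDiffOn (𝓡 n) ((𝓡 n).prod 𝓘(ℝ, EuclideanSpace ℝ (Fin n) →L[ℝ] EuclideanSpace ℝ (Fin n))) ∞
      (fun y => (TotalSpace.mk' (EuclideanSpace ℝ (Fin n) →L[ℝ] EuclideanSpace ℝ (Fin n)) y (T y) :
        TotalSpace (EuclideanSpace ℝ (Fin n) →L[ℝ] EuclideanSpace ℝ (Fin n))
          (fun y : M => TangentSpace (𝓡 n) y →L[ℝ] TangentSpace (𝓡 n) y))) U := by
  rw [(trivializationAt (EuclideanSpace ℝ (Fin n) →L[ℝ] EuclideanSpace ℝ (Fin n))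
      (fun y : M => TangentSpace (𝓡 n) y →L[ℝ] TangentSpace (𝓡 n) y) y₀).contMDiffOn_iff]
  · refine ⟨contMDiffOn_id, hA.congr fun y hy => ?_⟩
    refine ContinuousLinearMap.ext fun b => ?_
    rw [hT y hy b]
    exact trivializationAt_endomorphism y₀ (hU hy) _ b
  · intro x hx
    rw [Trivialization.mem_source]
    exact ⟨hU hx, hU hx⟩

set_option synthInstance.maxHeartbeats 200000 in
/-- Smoothness of a field of bilinear forms, in the preferred chart. -/
theorem contMDiffOn_bilin (y₀ : M)
    {T : Π y : M, TangentSpace (𝓡 n) y →L[ℝ] TangentSpace (𝓡 n) y →L[ℝ] ℝ}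
    {A : M → EuclideanSpace ℝ (Fin n) →L[ℝ] EuclideanSpace ℝ (Fin n) →L[ℝ] ℝ} {U : Set M}
    (hU : U ⊆ (SmoothChart.at' y₀).source)
    (hA : ContMDiffOn (𝓡 n)
      𝓘(ℝ, EuclideanSpace ℝ (Fin n) →L[ℝ] EuclideanSpace ℝ (Fin n) →L[ℝ] ℝ) ∞ A U)
    (hT : ∀ y ∈ U, ∀ a b, A y a b =
      T y ((SmoothChart.at' y₀).dsymm y a) ((SmoothChart.at' y₀).dsymm y b)) :
    ContMDiffOn (𝓡 n)
      ((𝓡 n).prod 𝓘(ℝ, EuclideanSpace ℝ (Fin n) →L[ℝ] EuclideanSpace ℝ (Fin n) →L[ℝ] ℝ)) ∞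
      (fun y => (TotalSpace.mk'
        (EuclideanSpace ℝ (Fin n) →L[ℝ] EuclideanSpace ℝ (Fin n) →L[ℝ] ℝ) y (T y) :
        TotalSpace (EuclideanSpace ℝ (Fin n) →L[ℝ] EuclideanSpace ℝ (Fin n) →L[ℝ] ℝ)
          (fun y : M => TangentSpace (𝓡 n) y →L[ℝ] TangentSpace (𝓡 n) y →L[ℝ] ℝ))) U := by
  rw [(trivializationAt (EuclideanSpace ℝ (Fin n) →L[ℝ] EuclideanSpace ℝ (Fin n) →L[ℝ] ℝ)
      (fun y : M => TangentSpace (𝓡 n) y →L[ℝ] TangentSpace (𝓡 n) y →L[ℝ] ℝ) y₀).contMDiffOn_iff]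
  · refine ⟨contMDiffOn_id, hA.congr fun y hy => ?_⟩
    refine ContinuousLinearMap.ext fun a => ContinuousLinearMap.ext fun b => ?_
    rw [hT y hy a b]
    exact trivializationAt_bilin y₀ (hU hy) _ a b
  · intro x hx
    rw [Trivialization.mem_source]
    exact ⟨hU hx, hU hx, trivial⟩

end HomBundles

section ModelTensors

variable {k : ℕ} {E : Type} [NormedAddCommGroup E] [NormedSpace ℝ E]

theorem SmoothChart.at'_euclideanMfd (y₀ : euclideanMfd k) :
    SmoothChart.at' y₀ = SmoothChart.ofEquiv (ContinuousLinearEquiv.refl ℝ _) := rfl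

/-- A metric on Euclidean space with a given expression in a linear chart. -/
def metricOfGram (ι : EuclideanSpace ℝ (Fin k) ≃L[ℝ] E) (G : E → E →L[ℝ] E →L[ℝ] ℝ)
    (hG : ∀ a b, ContDiff ℝ ∞ fun u => G u a b) (hs : ∀ u a b, G u a b = G u b a)
    (hnd : ∀ u a, (∀ b, G u a b = 0) → a = 0) : PseudoRiemannianMetric (euclideanMfd k) where
  form x := pullBilin (E := EuclideanSpace ℝ (Fin k))
    (ι : EuclideanSpace ℝ (Fin k) →L[ℝ] E) (G (ι x))
  symm x a b := hs (ι x) (ι a) (ι b)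
  nondegenerate x a h := by
    have h1 : ι a = 0 := hnd (ι x) (ι a) fun b => by
      have h2 : G (ι x) (ι a) (ι (ι.symm b)) = 0 := h (ι.symm b)
      rwa [ι.apply_symm_apply] at h2
    exact ι.injective (h1.trans (map_zero ι).symm)
  contMDiff := by
    have h1 : ContDiff ℝ ∞ fun x : EuclideanSpace ℝ (Fin k) =>
        pullBilin (ι : EuclideanSpace ℝ (Fin k) →L[ℝ] E) (G (ι x)) := by
      rw [contDiff_clm_apply_iff]
      intro a
      rw [contDiff_clm_apply_iff]
      intro b
      exact (hG (ι a) (ι b)).comp ι.contDiff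
    rw [← contMDiffOn_univ]
    refine contMDiffOn_bilin (M := euclideanMfd k) (0 : EuclideanSpace ℝ (Fin k))
      (fun _ _ => trivial) h1.contMDiff.contMDiffOn fun y _ a b => ?_
    rw [SmoothChart.at'_euclideanMfd, SmoothChart.dsymm_ofEquiv, SmoothChart.dsymm_ofEquiv]
    rfl

/-- The connection on Euclidean space with given Christoffel symbols; the second argument of `K` is
the direction of differentiation. -/
def connectionOfChristoffel (K : EuclideanSpace ℝ (Fin k) →
      EuclideanSpace ℝ (Fin k) →L[ℝ] EuclideanSpace ℝ (Fin k) →L[ℝ] EuclideanSpace ℝ (Fin k)) :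
    Connection (euclideanMfd k) where
  toFun X x := (SmoothChart.ofEquiv (ContinuousLinearEquiv.refl ℝ _)).flat X x +
    (show TangentSpace (𝓡 k) x →L[ℝ] TangentSpace (𝓡 k) x from K x (X x))
  isCovariantDerivativeOnUniv := IsCovariantDerivativeOn.add_one_form
    (SmoothChart.ofEquiv (ContinuousLinearEquiv.refl ℝ _)).isCovariantDerivativeOn_flat K

variable {K : EuclideanSpace ℝ (Fin k) →
      EuclideanSpace ℝ (Fin k) →L[ℝ] EuclideanSpace ℝ (Fin k) →L[ℝ] EuclideanSpace ℝ (Fin k)}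

theorem connectionOfChristoffel_apply (X : VField (euclideanMfd k)) (x : euclideanMfd k)
    (a : TangentSpace (𝓡 k) x) : connectionOfChristoffel K X x a =
      fderiv ℝ ((SmoothChart.ofEquiv (ContinuousLinearEquiv.refl ℝ _)).rep X) x a +
        K x (X x) a := by
  have h1 : (SmoothChart.ofEquiv (ContinuousLinearEquiv.refl ℝ _)).flat X x a =
      fderiv ℝ ((SmoothChart.ofEquiv (ContinuousLinearEquiv.refl ℝ _)).rep X) x a := by
    refine (SmoothChart.dsymm_ofEquiv (ContinuousLinearEquiv.refl ℝ _) x _).trans ?_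
    exact congrArg (fun a : EuclideanSpace ℝ (Fin k) => fderiv ℝ
      ((SmoothChart.ofEquiv (ContinuousLinearEquiv.refl ℝ _)).rep X) x a)
      (SmoothChart.d_ofEquiv (ContinuousLinearEquiv.refl ℝ _) x a)
  exact congrArg (fun v : EuclideanSpace ℝ (Fin k) => v + K x (X x) a) h1

theorem christoffel_connectionOfChristoffel (x a b : EuclideanSpace ℝ (Fin k)) :
    (SmoothChart.ofEquiv (ContinuousLinearEquiv.refl ℝ _)).christoffel
      (connectionOfChristoffel K) x a b = K x b a := by
  have h := (SmoothChart.ofEquiv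
    (ContinuousLinearEquiv.refl ℝ (EuclideanSpace ℝ (Fin k)))).christoffel_eq
    (connectionOfChristoffel K) (x := x) (by trivial) a b
  refine h.trans ((SmoothChart.d_ofEquiv _ _ _).trans ?_)
  refine (connectionOfChristoffel_apply _ _ _).trans ?_
  rw [SmoothChart.fderiv_rep_ofRep_const _ _ (by trivial)]
  refine (zero_add _).trans ?_
  have h1 := SmoothChart.dsymm_ofEquiv (ContinuousLinearEquiv.refl ℝ (EuclideanSpace ℝ (Fin k))) x
  exact congrArg₂ (fun a b : EuclideanSpace ℝ (Fin k) => K x b a) (h1 a) (h1 b)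

theorem isTorsionFreeConnection_connectionOfChristoffel (hK : ContDiff ℝ ∞ K)
    (hs : ∀ x a b, K x a b = K x b a) :
    IsTorsionFreeConnection (connectionOfChristoffel K) := by
  let χ := SmoothChart.ofEquiv (ContinuousLinearEquiv.refl ℝ (EuclideanSpace ℝ (Fin k)))
  have hrep : ∀ (X : VField (euclideanMfd k)) x, χ.rep X x = X x := fun X x =>
    SmoothChart.d_ofEquiv _ x (X x)
  refine ⟨⟨⟨fun {X} hX => ?_⟩⟩, ?_⟩
  · have hX' : ContDiff ℝ ∞ (χ.rep X) := by
      have h1 := χ.contDiffOn_rep (X := X) (U := univ) hX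
      rw [← contDiffOn_univ]
      exact h1.mono fun u _ => ⟨trivial, trivial⟩
    have hA : ContDiff ℝ ∞ fun x => fderiv ℝ (χ.rep X) x + K x (χ.rep X x) :=
      (hX'.fderiv_right (m := ∞) (by simp)).add (hK.clm_apply hX')
    refine contMDiffOn_endomorphism (M := euclideanMfd k) (0 : EuclideanSpace ℝ (Fin k))
      (fun _ _ => trivial) hA.contMDiff.contMDiffOn fun y _ b => ?_
    rw [SmoothChart.at'_euclideanMfd]
    refine Eq.trans ?_ (SmoothChart.d_ofEquiv _ _ _).symm
    refine Eq.trans ?_ (connectionOfChristoffel_apply _ _ _).symm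
    rw [show (SmoothChart.ofEquiv (ContinuousLinearEquiv.refl ℝ _)).dsymm y b = b from
      SmoothChart.dsymm_ofEquiv _ _ _]
    show fderiv ℝ (χ.rep X) y b + K y (χ.rep X y) b = _
    rw [hrep]
  · rw [CovariantDerivative.torsion_eq_zero_iff]
    intro X Y x hX hY
    refine χ.injective_d (x := x) (by trivial) ?_
    rw [χ.d_mlieBracket (by trivial) hX hY]
    refine (SmoothChart.d_ofEquiv _ _ _).trans ?_
    rw [VectorField.lieBracket]
    have h1 := connectionOfChristoffel_apply (K := K) Y x (X x)
    have h2 := connectionOfChristoffel_apply (K := K) X x (Y x)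
    have h3 := hs x (X x) (Y x)
    refine (congrArg₂ (fun a b : EuclideanSpace ℝ (Fin k) => a - b) h1 h2).trans ?_
    show fderiv ℝ (χ.rep Y) x (X x) + K x (Y x) (X x) -
      (fderiv ℝ (χ.rep X) x (Y x) + K x (X x) (Y x)) =
      fderiv ℝ (χ.rep Y) x (χ.rep X x) - fderiv ℝ (χ.rep X) x (χ.rep Y x)
    rw [hrep, hrep, h3]
    exact add_sub_add_right_eq_sub _ _ _

end ModelTensors

section ModelBundle

variable {r l m n : ℕ} (ιQ : EuclideanSpace ℝ (Fin m) ≃L[ℝ]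
    EuclideanSpace ℝ (Fin r) × EuclideanSpace ℝ (Fin l))
  (ιM : EuclideanSpace ℝ (Fin n) ≃L[ℝ] (EuclideanSpace ℝ (Fin r) × EuclideanSpace ℝ (Fin l)) ×
    (EuclideanSpace ℝ (Fin r) →L[ℝ] ℝ))

/-- The covector space of Euclidean space. -/
def cotangentEquiv (y : euclideanMfd r) : Cotangent (euclideanMfd r) y ≃ₗ[ℝ]
    (EuclideanSpace ℝ (Fin r) →L[ℝ] ℝ) :=
  LinearEquiv.refl ℝ (EuclideanSpace ℝ (Fin r) →L[ℝ] ℝ)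

theorem cot_at'_euclideanMfd (y₀ y : euclideanMfd r) (ξ : Cotangent (euclideanMfd r) y) :
    (SmoothChart.at' y₀).cot y ξ = cotangentEquiv y ξ := by
  refine ContinuousLinearMap.ext fun b => ?_
  rw [SmoothChart.at'_euclideanMfd]
  exact congrArg (fun b : EuclideanSpace ℝ (Fin r) => ξ b)
    (SmoothChart.dsymm_ofEquiv (ContinuousLinearEquiv.refl ℝ (EuclideanSpace ℝ (Fin r))) y b)

/-- The linear model of the projection `M → Q`. -/
def modelP (x : euclideanMfd n) : euclideanMfd m := ιQ.symm (ιM x).1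

theorem modelP_eq (x : euclideanMfd n) : ιQ (modelP ιQ ιM x) = (ιM x).1 := ιQ.apply_symm_apply _

/-- The linear model of the projection `Q → Σ`. -/
def modelQ : C^∞⟮𝓡 m, euclideanMfd m; 𝓡 r, euclideanMfd r⟯ :=
  ⟨fun z => (ιQ z).1, (contDiff_fst.comp ιQ.contDiff).contMDiff⟩

/-- The point of the fibre over `z` with a given covector coordinate. -/
def modelPoint (z : euclideanMfd m) (ξ : EuclideanSpace ℝ (Fin r) →L[ℝ] ℝ) :
    modelP ιQ ιM ⁻¹' {z} :=
  ⟨ιM.symm (ιQ z, ξ), by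
    show ιQ.symm (ιM (ιM.symm (ιQ z, ξ))).1 = z
    rw [ιM.apply_symm_apply]
    exact ιQ.symm_apply_apply z⟩

variable {ιQ ιM} in
theorem modelPoint_snd (z : euclideanMfd m) (ξ : EuclideanSpace ℝ (Fin r) →L[ℝ] ℝ) :
    (ιM (modelPoint ιQ ιM z ξ).1).2 = ξ := by
  show (ιM (ιM.symm (ιQ z, ξ))).2 = ξ
  rw [ιM.apply_symm_apply]

variable {ιQ ιM} in
theorem modelPoint_of_eq {z : euclideanMfd m} (x : modelP ιQ ιM ⁻¹' {z})
    {ξ : EuclideanSpace ℝ (Fin r) →L[ℝ] ℝ} (h : (ιM x.1).2 = ξ) : modelPoint ιQ ιM z ξ = x := by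
  obtain ⟨x, rfl⟩ := x
  subst h
  refine Subtype.ext ?_
  show ιM.symm (ιQ (modelP ιQ ιM x), (ιM x).2) = x
  rw [modelP_eq]
  exact ιM.symm_apply_apply x

/-- The fibres of the linear model are affine spaces: covectors are added to the last component. -/
abbrev modelAffine (z : euclideanMfd m) :
    AddTorsor (Cotangent (euclideanMfd r) (modelQ ιQ z)) (modelP ιQ ιM ⁻¹' {z}) where
  vadd ξ x := modelPoint ιQ ιM z (cotangentEquiv _ ξ + (ιM x.1).2)
  zero_vadd x := modelPoint_of_eq x (by rw [map_zero, zero_add])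
  add_vadd ξ η x := modelPoint_of_eq (modelPoint ιQ ιM z _) (by
    rw [modelPoint_snd, map_add, add_assoc]
    congr 2
    exact modelPoint_snd _ _)
  vsub x y := (cotangentEquiv _).symm ((ιM x.1).2 - (ιM y.1).2)
  nonempty := ⟨modelPoint ιQ ιM z 0⟩
  vsub_vadd' x y := modelPoint_of_eq x (by
    show _ = cotangentEquiv _ ((cotangentEquiv _).symm ((ιM x.1).2 - (ιM y.1).2)) + (ιM y.1).2
    rw [LinearEquiv.apply_symm_apply, sub_add_cancel])
  vadd_vsub' ξ x := by
    show (cotangentEquiv _).symm ((ιM (modelPoint ιQ ιM z _).1).2 - (ιM x.1).2) = ξ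
    rw [modelPoint_snd, add_sub_cancel_right, LinearEquiv.symm_apply_apply]

/-- The linear model of a bundle of cotangent-principal bundles: `(y, z, ξ) ↦ (y, z) ↦ y`. -/
def modelBundle : CotangentPrincipalBundle (euclideanMfd n) (euclideanMfd m) (euclideanMfd r) where
  p := modelP ιQ ιM
  q := modelQ ιQ
  p_smooth := (ιQ.symm.contDiff.comp (contDiff_fst.comp ιM.contDiff)).contMDiff
  q_bundle := isBundleProjectionOn_of_chart (SmoothChart.ofEquiv ιQ)
    (OpenPartialHomeomorph.refl _) rfl rfl contDiff_id.contDiffOn contDiff_id.contDiffOn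
    (ContinuousLinearEquiv.refl ℝ _) fun _ _ => rfl
  affine z := modelAffine ιQ ιM z
  locallyTrivial z₀ := by
    refine ⟨univ, isOpen_univ, trivial, fun z => modelPoint ιQ ιM z 0, ?_, ?_⟩
    · have h1 := (contMDiffOn_pullback_cotangent_iff (modelQ ιQ) z₀
        (IN := (𝓡 m).prod 𝓘(ℝ, EuclideanSpace ℝ (Fin r) →L[ℝ] ℝ))
        (f := fun ζ : TotalSpace (EuclideanSpace ℝ (Fin r) →L[ℝ] ℝ) ((modelQ ιQ : euclideanMfd m →
          euclideanMfd r) *ᵖ (fun y : euclideanMfd r => TangentSpace (𝓡 r) y →L[ℝ] ℝ)) => ζ.1)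
        (ξ := fun ζ => ζ.2) (U := univ) fun _ _ => trivial).1 contMDiffOn_id
      have h2 : ContMDiff 𝓘(ℝ, (EuclideanSpace ℝ (Fin r) × EuclideanSpace ℝ (Fin l)) ×
          (EuclideanSpace ℝ (Fin r) →L[ℝ] ℝ)) (𝓡 n) ∞ ιM.symm := ιM.symm.contDiff.contMDiff
      have h3 : ContMDiff (𝓡 m) 𝓘(ℝ, EuclideanSpace ℝ (Fin r) × EuclideanSpace ℝ (Fin l)) ∞ ιQ :=
        ιQ.contDiff.contMDiff
      refine ContMDiffOn.congr (h2.comp_contMDiffOn ((h3.comp_contMDiffOn h1.1).prodMk_space h1.2))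
        fun ζ _ => ?_
      have h4 : (ιM (modelPoint ιQ ιM ζ.1 0).1).2 = 0 := modelPoint_snd _ _
      show ιM.symm (ιQ ζ.1, cotangentEquiv _ ζ.2 + (ιM (modelPoint ιQ ιM ζ.1 0).1).2) =
        ιM.symm (ιQ ζ.1, (SmoothChart.at' (modelQ ιQ z₀)).cot _ ζ.2)
      rw [h4, add_zero]
      exact congrArg (fun η => ιM.symm (ιQ ζ.1, η)) (cot_at'_euclideanMfd _ _ _).symm
    · refine (contMDiffOn_pullback_cotangent_iff (modelQ ιQ) z₀ (f := modelP ιQ ιM)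
        (ξ := fun x => (cotangentEquiv _).symm ((ιM x).2 - (ιM (modelPoint ιQ ιM
          (modelP ιQ ιM x) 0).1).2)) fun _ _ => trivial).2
        ⟨(ιQ.symm.contDiff.comp (contDiff_fst.comp ιM.contDiff)).contMDiff.contMDiffOn, ?_⟩
      have h1 : ContMDiff (𝓡 n) 𝓘(ℝ, EuclideanSpace ℝ (Fin r) →L[ℝ] ℝ) ∞
          fun x : EuclideanSpace ℝ (Fin n) => (ιM x).2 := (contDiff_snd.comp ιM.contDiff).contMDiff
      refine ContMDiffOn.congr h1.contMDiffOn fun x _ => ?_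
      rw [cot_at'_euclideanMfd, modelPoint_snd, LinearEquiv.apply_symm_apply, sub_zero]

theorem modelBundle_translate (x : euclideanMfd n)
    (ξ : Cotangent (euclideanMfd r) ((modelBundle ιQ ιM).q ((modelBundle ιQ ιM).p x))) :
    ιM ((modelBundle ιQ ιM).translate x ξ) = ((ιM x).1, cotangentEquiv _ ξ + (ιM x).2) := by
  show ιM (ιM.symm (ιQ (modelP ιQ ιM x), cotangentEquiv _ ξ + (ιM x).2)) = _
  rw [ιM.apply_symm_apply, modelP_eq]

end ModelBundle

section FlatExtensions

/-- The bilinear form `(a, b) ↦ B₀ a b - 2 B (p a) (p b)`. -/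
def subTwoPullBilin {F A : Type*} [NormedAddCommGroup F] [NormedSpace ℝ F] [NormedAddCommGroup A]
    [NormedSpace ℝ A] (B₀ : F →L[ℝ] F →L[ℝ] ℝ) (p : F →L[ℝ] A) (B : A →L[ℝ] A →L[ℝ] ℝ) :
    F →L[ℝ] F →L[ℝ] ℝ := B₀ - (2 : ℝ) • pullBilin p B

variable (r l : ℕ)

/-- The data of a Riemann pullback-extension over vector spaces: the Christoffel symbols `chr` of
the connection on `ℝʳ`, and the restriction `base` of the metric to the zero section. -/
structure FlatExtension where
  chr : EuclideanSpace ℝ (Fin r) →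
    EuclideanSpace ℝ (Fin r) →L[ℝ] EuclideanSpace ℝ (Fin r) →L[ℝ] EuclideanSpace ℝ (Fin r)
  base : EuclideanSpace ℝ (Fin r) × EuclideanSpace ℝ (Fin l) →
    ((EuclideanSpace ℝ (Fin r) × EuclideanSpace ℝ (Fin l)) ×
      (EuclideanSpace ℝ (Fin r) →L[ℝ] ℝ)) →L[ℝ]
    ((EuclideanSpace ℝ (Fin r) × EuclideanSpace ℝ (Fin l)) ×
      (EuclideanSpace ℝ (Fin r) →L[ℝ] ℝ)) →L[ℝ] ℝ
  contDiff_chr : ContDiff ℝ ∞ chr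
  chr_symm : ∀ s a b, chr s a b = chr s b a
  contDiff_base : ∀ a b, ContDiff ℝ ∞ fun c => base c a b
  base_symm : ∀ c a b, base c a b = base c b a
  base_nondegenerate : ∀ c a, (∀ b, base c a b = 0) → a = 0
  base_vertical : ∀ c η b, base c (0, η) b = η b.1.1

namespace FlatExtension

variable {r l} (T : FlatExtension r l)

/-- The metric of the extension; it is affine in the covector variable, with the slope given by the
Christoffel symbols. -/
def gram (w : (EuclideanSpace ℝ (Fin r) × EuclideanSpace ℝ (Fin l)) ×
      (EuclideanSpace ℝ (Fin r) →L[ℝ] ℝ)) :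
    ((EuclideanSpace ℝ (Fin r) × EuclideanSpace ℝ (Fin l)) ×
      (EuclideanSpace ℝ (Fin r) →L[ℝ] ℝ)) →L[ℝ]
    ((EuclideanSpace ℝ (Fin r) × EuclideanSpace ℝ (Fin l)) ×
      (EuclideanSpace ℝ (Fin r) →L[ℝ] ℝ)) →L[ℝ] ℝ :=
  subTwoPullBilin (T.base w.1) ((ContinuousLinearMap.fst ℝ (EuclideanSpace ℝ (Fin r))
      (EuclideanSpace ℝ (Fin l))).comp (ContinuousLinearMap.fst ℝ (EuclideanSpace ℝ (Fin r) ×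
      EuclideanSpace ℝ (Fin l)) (EuclideanSpace ℝ (Fin r) →L[ℝ] ℝ)))
    ((ContinuousLinearMap.compL ℝ (EuclideanSpace ℝ (Fin r)) (EuclideanSpace ℝ (Fin r)) ℝ w.2).comp
      (T.chr w.1.1))

variable (w a b : (EuclideanSpace ℝ (Fin r) × EuclideanSpace ℝ (Fin l)) ×
      (EuclideanSpace ℝ (Fin r) →L[ℝ] ℝ))

theorem gram_apply : T.gram w a b = T.base w.1 a b - 2 * w.2 (T.chr w.1.1 a.1.1 b.1.1) := rfl

theorem gram_symm : T.gram w a b = T.gram w b a := by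
  rw [gram_apply, gram_apply, T.base_symm, T.chr_symm]

theorem gram_vertical (η : EuclideanSpace ℝ (Fin r) →L[ℝ] ℝ) : T.gram w (0, η) b = η b.1.1 := by
  have h : T.chr w.1.1 ((0, η) : (EuclideanSpace ℝ (Fin r) × EuclideanSpace ℝ (Fin l)) ×
      (EuclideanSpace ℝ (Fin r) →L[ℝ] ℝ)).1.1 b.1.1 = 0 := by
    show T.chr w.1.1 0 b.1.1 = 0
    rw [map_zero]
    rfl
  rw [gram_apply, h, map_zero, mul_zero, sub_zero, T.base_vertical]

theorem base_add (c : EuclideanSpace ℝ (Fin r) × EuclideanSpace ℝ (Fin l))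
    (η ζ : EuclideanSpace ℝ (Fin r) →L[ℝ] ℝ) :
    T.base c (a + (0, η)) (b + (0, ζ)) = T.base c a b + ζ a.1.1 + η b.1.1 := by
  have h1 : T.base c a (0, ζ) = ζ a.1.1 := by rw [T.base_symm, T.base_vertical]
  have h2 : T.base c (0, η) (0, ζ) = 0 := by
    rw [T.base_vertical]
    exact map_zero η
  rw [ContinuousLinearMap.map_add₂, map_add, map_add, h1, h2, T.base_vertical, add_zero]

theorem base_eq_of_kerProj (c : EuclideanSpace ℝ (Fin r) × EuclideanSpace ℝ (Fin l))
    (ha : a.1.1 = 0) (hb : b.1.1 = 0) : T.base c a b = T.base c (a.1, 0) (b.1, 0) := by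
  have h1 : ∀ a : (EuclideanSpace ℝ (Fin r) × EuclideanSpace ℝ (Fin l)) ×
      (EuclideanSpace ℝ (Fin r) →L[ℝ] ℝ), a = (a.1, 0) + (0, a.2) := fun a => by simp
  have h2 := T.base_add (a.1, 0) (b.1, 0) c a.2 b.2
  rw [← h1, ← h1, ha, hb, map_zero, map_zero, add_zero, add_zero] at h2
  exact h2

theorem gram_nondegenerate (h : ∀ b, T.gram w a b = 0) : a = 0 := by
  have h1 : a.1.1 = 0 := by
    refine (SeparatingDual.eq_iff_forall_dual_eq (R := ℝ)).2 fun η => ?_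
    have := h (0, η)
    rw [gram_symm, gram_vertical] at this
    exact this.trans (map_zero η).symm
  refine T.base_nondegenerate w.1 a fun b => ?_
  have h2 := h b
  have h3 : T.chr w.1.1 0 b.1.1 = 0 := by
    rw [map_zero]
    rfl
  rwa [gram_apply, h1, h3, map_zero, mul_zero, sub_zero] at h2

theorem contDiff_gram_apply : ContDiff ℝ ∞ fun w => T.gram w a b := by
  have h1 : ContDiff ℝ ∞ fun w : (EuclideanSpace ℝ (Fin r) × EuclideanSpace ℝ (Fin l)) ×
      (EuclideanSpace ℝ (Fin r) →L[ℝ] ℝ) => T.base w.1 a b :=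
    (T.contDiff_base a b).comp contDiff_fst
  have h2 : ContDiff ℝ ∞ fun w : (EuclideanSpace ℝ (Fin r) × EuclideanSpace ℝ (Fin l)) ×
      (EuclideanSpace ℝ (Fin r) →L[ℝ] ℝ) => w.2 (T.chr w.1.1 a.1.1 b.1.1) :=
    contDiff_snd.clm_apply (((T.contDiff_chr.comp (contDiff_fst.comp contDiff_fst)).clm_apply
      contDiff_const).clm_apply contDiff_const)
  exact h1.sub (contDiff_const.mul h2)

theorem base_nondegenerate_vertical (c : EuclideanSpace ℝ (Fin r) × EuclideanSpace ℝ (Fin l))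
    {a : EuclideanSpace ℝ (Fin r) × EuclideanSpace ℝ (Fin l)} (ha : a.1 = 0)
    (h : ∀ b : EuclideanSpace ℝ (Fin r) × EuclideanSpace ℝ (Fin l), b.1 = 0 →
      T.base c (a, 0) (b, 0) = 0) : a = 0 := by
  -- a covector that makes `a` orthogonal to everything
  let η : EuclideanSpace ℝ (Fin r) →L[ℝ] ℝ := -(T.base c (a, 0)).comp
    ((ContinuousLinearMap.inl ℝ _ _).comp (ContinuousLinearMap.inl ℝ _ _))
  have h1 : ((a, η) : (EuclideanSpace ℝ (Fin r) × EuclideanSpace ℝ (Fin l)) ×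
      (EuclideanSpace ℝ (Fin r) →L[ℝ] ℝ)) = 0 := by
    refine T.base_nondegenerate c _ fun b => ?_
    have e1 : ((a, η) : (EuclideanSpace ℝ (Fin r) × EuclideanSpace ℝ (Fin l)) ×
      (EuclideanSpace ℝ (Fin r) →L[ℝ] ℝ)) = (a, 0) + (0, η) := by simp
    have e2 : b = (((b.1.1, 0), 0) + ((0, b.1.2), 0)) + (0, b.2) := by
      refine Prod.ext (Prod.ext ?_ ?_) ?_ <;> simp
    have h2 := T.base_add (a, 0) (((b.1.1, 0), 0) + ((0, b.1.2), 0)) c η b.2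
    rw [← e2, ← e1] at h2
    have h3 : T.base c (a, 0) (((b.1.1, 0), 0) + ((0, b.1.2), 0)) =
        T.base c (a, 0) ((b.1.1, 0), 0) + T.base c (a, 0) ((0, b.1.2), 0) := map_add _ _ _
    have h4 : η ((((b.1.1, 0), 0) + ((0, b.1.2), 0) : (EuclideanSpace ℝ (Fin r) ×
      EuclideanSpace ℝ (Fin l)) × (EuclideanSpace ℝ (Fin r) →L[ℝ] ℝ))).1.1 =
        -T.base c (a, 0) ((b.1.1, 0), 0) := by
      show -T.base c (a, 0) ((b.1.1 + 0, 0), 0) = _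
      rw [add_zero]
    have h5 : b.2 ((a, (0 : EuclideanSpace ℝ (Fin r) →L[ℝ] ℝ)) : (EuclideanSpace ℝ (Fin r) ×
      EuclideanSpace ℝ (Fin l)) × (EuclideanSpace ℝ (Fin r) →L[ℝ] ℝ)).1.1 = 0 := by
      show b.2 a.1 = 0
      rw [ha, map_zero]
    rw [h2, h3, h4, h5, h (0, b.1.2) rfl]
    ring
  exact congrArg Prod.fst h1

end FlatExtension
end FlatExtensions

section ModelExtension

theorem contDiffOn_bilin_apply {N C F : Type*} [NormedAddCommGroup N] [NormedSpace ℝ N]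
    [NormedAddCommGroup C] [NormedSpace ℝ C] [NormedAddCommGroup F] [NormedSpace ℝ F]
    [FiniteDimensional ℝ F] {B : C → F →L[ℝ] F →L[ℝ] ℝ}
    (hB : ∀ a b, ContDiff ℝ ∞ fun c => B c a b) {U : Set N} {f : N → C} {a b : N → F}
    (hf : ContDiffOn ℝ ∞ f U) (ha : ContDiffOn ℝ ∞ a U) (hb : ContDiffOn ℝ ∞ b U) :
    ContDiffOn ℝ ∞ (fun u => B (f u) (a u) (b u)) U := by
  have hB' : ContDiff ℝ ∞ B := by
    rw [contDiff_clm_apply_iff]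
    intro a
    rw [contDiff_clm_apply_iff]
    exact hB a
  exact ((hB'.comp_contDiffOn hf).clm_apply ha).clm_apply hb

variable {r l m n : ℕ} (ιQ : EuclideanSpace ℝ (Fin m) ≃L[ℝ]
    EuclideanSpace ℝ (Fin r) × EuclideanSpace ℝ (Fin l))
  (ιM : EuclideanSpace ℝ (Fin n) ≃L[ℝ] (EuclideanSpace ℝ (Fin r) × EuclideanSpace ℝ (Fin l)) ×
    (EuclideanSpace ℝ (Fin r) →L[ℝ] ℝ))

/-- The global adapted chart of the linear model. -/
def modelChart : (modelBundle ιQ ιM).AdaptedChart l where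
  center := (0 : EuclideanSpace ℝ (Fin r))
  middle := SmoothChart.ofEquiv ιQ
  top := SmoothChart.ofEquiv ιM
  q_mem _ _ := trivial
  q_eq _ _ := rfl
  p_mem _ _ := trivial
  p_eq x _ := modelP_eq ιQ ιM x
  translate_mem _ _ _ := trivial
  translate_eq x ξ _ := by
    rw [cot_at'_euclideanMfd, add_comm]
    exact modelBundle_translate ιQ ιM x ξ

theorem mem_vertical_modelQ (z : euclideanMfd m) (b : TangentSpace (𝓡 m) z) :
    b ∈ vertical ((modelBundle ιQ ιM).q : euclideanMfd m → euclideanMfd r) z ↔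
      ((SmoothChart.ofEquiv ιQ).d z b).1 = 0 := by
  have h1 := (modelChart ιQ ιM).d_q (z := z) trivial b
  refine Iff.trans ?_ (Eq.congr_left h1)
  constructor
  · intro h
    rw [show mfderiv (𝓡 m) (𝓡 r) (modelBundle ιQ ιM).q z b = 0 from h, map_zero]
  · intro h
    exact (modelChart ιQ ιM).base.injective_d (x := (modelBundle ιQ ιM).q z) trivial
      (h.trans (map_zero _).symm)

variable (T : FlatExtension r l)

/-- The vertical metric of the linear model. -/
def modelVerticalMetric :
    VerticalMetric ((modelBundle ιQ ιM).q : euclideanMfd m → euclideanMfd r) where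
  form z := LinearMap.mk₂ ℝ
    (fun a b => T.base (SmoothChart.ofEquiv ιQ z) ((SmoothChart.ofEquiv ιQ).d z a.1, 0)
      ((SmoothChart.ofEquiv ιQ).d z b.1, 0))
    (fun a a' b => by
      have h : (((SmoothChart.ofEquiv ιQ).d z (a + a').1, 0) : (EuclideanSpace ℝ (Fin r) ×
          EuclideanSpace ℝ (Fin l)) × (EuclideanSpace ℝ (Fin r) →L[ℝ] ℝ)) =
          ((SmoothChart.ofEquiv ιQ).d z a.1, 0) + ((SmoothChart.ofEquiv ιQ).d z a'.1, 0) :=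
        Prod.ext (map_add _ _ _) (add_zero _).symm
      rw [h, ContinuousLinearMap.map_add₂])
    (fun c a b => by
      have h : (((SmoothChart.ofEquiv ιQ).d z (c • a).1, 0) : (EuclideanSpace ℝ (Fin r) ×
          EuclideanSpace ℝ (Fin l)) × (EuclideanSpace ℝ (Fin r) →L[ℝ] ℝ)) =
          c • ((SmoothChart.ofEquiv ιQ).d z a.1, 0) :=
        Prod.ext (map_smul _ _ _) (smul_zero _).symm
      rw [h, ContinuousLinearMap.map_smul₂])
    (fun a b b' => by
      have h : (((SmoothChart.ofEquiv ιQ).d z (b + b').1, 0) : (EuclideanSpace ℝ (Fin r) ×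
          EuclideanSpace ℝ (Fin l)) × (EuclideanSpace ℝ (Fin r) →L[ℝ] ℝ)) =
          ((SmoothChart.ofEquiv ιQ).d z b.1, 0) + ((SmoothChart.ofEquiv ιQ).d z b'.1, 0) :=
        Prod.ext (map_add _ _ _) (add_zero _).symm
      rw [h, map_add])
    (fun c a b => by
      have h : (((SmoothChart.ofEquiv ιQ).d z (c • b).1, 0) : (EuclideanSpace ℝ (Fin r) ×
          EuclideanSpace ℝ (Fin l)) × (EuclideanSpace ℝ (Fin r) →L[ℝ] ℝ)) =
          c • ((SmoothChart.ofEquiv ιQ).d z b.1, 0) :=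
        Prod.ext (map_smul _ _ _) (smul_zero _).symm
      rw [h, map_smul])
  symm z a b := T.base_symm _ _ _
  nondegenerate z a h := by
    have h1 := T.base_nondegenerate_vertical (SmoothChart.ofEquiv ιQ z)
      ((mem_vertical_modelQ ιQ ιM z a.1).1 a.2) fun b hb => by
        have h2 : (SmoothChart.ofEquiv ιQ).d z ((SmoothChart.ofEquiv ιQ).dsymm z b) = b :=
          SmoothChart.d_dsymm (show z ∈ (SmoothChart.ofEquiv ιQ).source from trivial) b
        have h3 : T.base (SmoothChart.ofEquiv ιQ z) ((SmoothChart.ofEquiv ιQ).d z a.1, 0)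
          ((SmoothChart.ofEquiv ιQ).d z ((SmoothChart.ofEquiv ιQ).dsymm z b), 0) = 0 :=
            h ⟨(SmoothChart.ofEquiv ιQ).dsymm z b, by rwa [mem_vertical_modelQ, h2]⟩
        rwa [h2] at h3
    exact Subtype.ext ((SmoothChart.ofEquiv ιQ).injective_d (x := z) trivial
      (h1.trans (map_zero _).symm))
  smooth O X Y hO hX hY := by
    have hX' := (SmoothChart.ofEquiv ιQ).contDiffOn_rep hX
    have hY' := (SmoothChart.ofEquiv ιQ).contDiffOn_rep hY
    have h1 := contDiffOn_bilin_apply T.contDiff_base contDiffOn_id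
      (hX'.prodMk (contDiffOn_const (c := (0 : EuclideanSpace ℝ (Fin r) →L[ℝ] ℝ))))
      (hY'.prodMk (contDiffOn_const (c := (0 : EuclideanSpace ℝ (Fin r) →L[ℝ] ℝ))))
    have hm : ∀ z ∈ O, SmoothChart.ofEquiv ιQ z ∈
        (SmoothChart.ofEquiv ιQ).target ∩ (SmoothChart.ofEquiv ιQ).symm ⁻¹' O := fun z hz =>
      ⟨trivial, by
        show (SmoothChart.ofEquiv ιQ).symm (SmoothChart.ofEquiv ιQ z) ∈ O
        rwa [(SmoothChart.ofEquiv ιQ).left_inv trivial]⟩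
    refine ContMDiffOn.congr (h1.contMDiffOn.comp ((SmoothChart.ofEquiv ιQ).contMDiffOn.mono
      fun _ _ => trivial) hm) fun z hz => ?_
    have h2 : ∀ X : VField (euclideanMfd m), (SmoothChart.ofEquiv ιQ).rep X
        (SmoothChart.ofEquiv ιQ z) = (SmoothChart.ofEquiv ιQ).d z (X z) := fun X =>
      SmoothChart.rep_apply (show z ∈ (SmoothChart.ofEquiv ιQ).source from trivial)
    show _ = T.base (SmoothChart.ofEquiv ιQ z)
      ((SmoothChart.ofEquiv ιQ).rep _ (SmoothChart.ofEquiv ιQ z), 0)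
      ((SmoothChart.ofEquiv ιQ).rep _ (SmoothChart.ofEquiv ιQ z), 0)
    rw [h2, h2]
    rfl

theorem modelVerticalMetric_form (z : euclideanMfd m)
    (a b : vertical ((modelBundle ιQ ιM).q : euclideanMfd m → euclideanMfd r) z) :
    (modelVerticalMetric ιQ ιM T).form z a b = T.base (SmoothChart.ofEquiv ιQ z)
      ((SmoothChart.ofEquiv ιQ).d z a.1, 0) ((SmoothChart.ofEquiv ιQ).d z b.1, 0) := rfl

/-- The metric of the linear model. -/
def modelMetric : PseudoRiemannianMetric (euclideanMfd n) :=
  metricOfGram ιM T.gram T.contDiff_gram_apply T.gram_symm fun u a => T.gram_nondegenerate u a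

theorem modelMetric_form (x : euclideanMfd n) (a b : TangentSpace (𝓡 n) x) :
    (modelMetric ιM T).form x a b = T.gram (SmoothChart.ofEquiv ιM x)
      ((SmoothChart.ofEquiv ιM).d x a) ((SmoothChart.ofEquiv ιM).d x b) := by
  rw [SmoothChart.d_ofEquiv, SmoothChart.d_ofEquiv]
  rfl

theorem restrictsToPullback_modelMetric : RestrictsToPullback (modelMetric ιM T) univ
    (modelBundle ιQ ιM).p (modelBundle ιQ ιM).q (modelVerticalMetric ιQ ιM T).form := by
  intro x _ a b ha hb
  have hp : ∀ a, (SmoothChart.ofEquiv ιQ).d _ (mfderiv (𝓡 n) (𝓡 m) (modelBundle ιQ ιM).p x a) =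
      ((SmoothChart.ofEquiv ιM).d x a).1 := (modelChart ιQ ιM).d_p (x := x) trivial
  have hz : SmoothChart.ofEquiv ιQ ((modelBundle ιQ ιM).p x) = (SmoothChart.ofEquiv ιM x).1 :=
    modelP_eq ιQ ιM x
  rw [modelVerticalMetric_form, modelMetric_form, hp, hp, hz]
  rw [mem_vertical_modelQ, hp] at ha hb
  have h1 : T.chr (SmoothChart.ofEquiv ιM x).1.1 0 0 = 0 := map_zero _
  rw [FlatExtension.gram_apply, ha, hb, h1, map_zero, mul_zero, sub_zero,
    T.base_eq_of_kerProj _ _ _ ha hb]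

theorem modelMetric_fibreVector (x : euclideanMfd n)
    (ξ : Cotangent (euclideanMfd r) ((modelBundle ιQ ιM).q ((modelBundle ιQ ιM).p x)))
    (a : TangentSpace (𝓡 n) x) :
    (modelMetric ιM T).form x ((modelBundle ιQ ιM).fibreVector x ξ) a =
      ξ (mfderiv (𝓡 n) (𝓡 r) (modelBundle ιQ ιM).proj x a) := by
  have h1 : (SmoothChart.ofEquiv ιM).d x ((modelBundle ιQ ιM).fibreVector x ξ) =
      (0, (modelChart ιQ ιM).base.cot _ ξ) := (modelChart ιQ ιM).d_fibreVector (x := x) trivial ξ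
  have h2 : (modelChart ιQ ιM).base.d _ (mfderiv (𝓡 n) (𝓡 r) (modelBundle ιQ ιM).proj x a) =
      ((SmoothChart.ofEquiv ιM).d x a).1.1 := (modelChart ιQ ιM).d_proj (x := x) trivial a
  rw [modelMetric_form, h1, FlatExtension.gram_vertical, ← h2, SmoothChart.cot_apply]
  exact congrArg (fun v => ξ v) (SmoothChart.dsymm_d (show (modelBundle ιQ ιM).proj x ∈
    (modelChart ιQ ιM).base.source from trivial) _)

/-- The connection of the linear model. -/
def modelConnection : Connection (euclideanMfd r) := connectionOfChristoffel T.chr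

/-- The Killing operator of the linear model, for a form given by the map `β` in the linear
coordinates. -/
theorem killing_modelConnection {α : (modelBundle ιQ ιM).PullbackForm}
    (hα : (modelBundle ιQ ιM).SmoothForm α) :
    ∃ β : EuclideanSpace ℝ (Fin r) × EuclideanSpace ℝ (Fin l) → EuclideanSpace ℝ (Fin r) →L[ℝ] ℝ,
      ContDiff ℝ ∞ β ∧ (∀ z, cotangentEquiv _ (α z) = β (SmoothChart.ofEquiv ιQ z)) ∧
      ∀ z a b, (modelBundle ιQ ιM).killing (modelConnection T) α z a b =
        fderiv ℝ β (SmoothChart.ofEquiv ιQ z) ((SmoothChart.ofEquiv ιQ).d z a)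
            ((SmoothChart.ofEquiv ιQ).d z b).1 +
          fderiv ℝ β (SmoothChart.ofEquiv ιQ z) ((SmoothChart.ofEquiv ιQ).d z b)
            ((SmoothChart.ofEquiv ιQ).d z a).1 -
          2 * β (SmoothChart.ofEquiv ιQ z) (T.chr (SmoothChart.ofEquiv ιQ z).1
            ((SmoothChart.ofEquiv ιQ).d z a).1 ((SmoothChart.ofEquiv ιQ).d z b).1) := by
  let C := modelBundle ιQ ιM
  let γ : EuclideanSpace ℝ (Fin m) → EuclideanSpace ℝ (Fin r) →L[ℝ] ℝ := fun z =>
    cotangentEquiv (C.q z) (α z)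
  have hγ : ContDiff ℝ ∞ γ := by
    have h1 := ((contMDiffOn_cotangent_iff (S := euclideanMfd r) (0 : EuclideanSpace ℝ (Fin r))
      (f := C.q) (ξ := α) (U := univ) fun _ _ => trivial).1 hα.contMDiffOn).2
    rw [← contDiffOn_univ]
    refine ContDiffOn.congr (contMDiffOn_iff_contDiffOn.1 h1) fun z _ => ?_
    exact (cot_at'_euclideanMfd _ _ _).symm
  let β : EuclideanSpace ℝ (Fin r) × EuclideanSpace ℝ (Fin l) → EuclideanSpace ℝ (Fin r) →L[ℝ] ℝ :=
    fun c => γ (ιQ.symm c)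
  have hβ : ContDiff ℝ ∞ β := hγ.comp ιQ.symm.contDiff
  have hγβ : ∀ z, γ z = β (SmoothChart.ofEquiv ιQ z) := fun z =>
    congrArg γ (ιQ.symm_apply_apply z).symm
  refine ⟨β, hβ, hγβ, fun z a b => ?_⟩
  have hform : ∀ a b, C.formDeriv (modelConnection T) α z a b =
      fderiv ℝ β (SmoothChart.ofEquiv ιQ z) ((SmoothChart.ofEquiv ιQ).d z a)
        ((modelChart ιQ ιM).base.d (C.q z) b) -
      β (SmoothChart.ofEquiv ιQ z) (T.chr (SmoothChart.ofEquiv ιQ z).1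
        ((SmoothChart.ofEquiv ιQ).d z a).1 ((modelChart ιQ ιM).base.d (C.q z) b)) := by
    intro a b
    have h1 := C.formDeriv_eq (modelConnection T) (SmoothChart.ofEquiv ιQ)
      (modelChart ιQ ιM).base (α := α) (β := β) (z := z) trivial trivial
      (hβ.differentiable (by simp) _) (Filter.Eventually.of_forall fun y b => by
        rw [← hγβ]
        exact congrArg (fun b : EuclideanSpace ℝ (Fin r) => γ y b)
          (SmoothChart.d_ofEquiv (ContinuousLinearEquiv.refl ℝ _) (C.q y) b).symm) a b
    have h2 : (modelChart ιQ ιM).base.d (C.q z) (mfderiv (𝓡 m) (𝓡 r) C.q z a) =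
      ((SmoothChart.ofEquiv ιQ).d z a).1 := (modelChart ιQ ιM).d_q (z := z) trivial a
    have h3 : ∀ y v w, (modelChart ιQ ιM).base.christoffel (modelConnection T) y v w =
        T.chr y v w := fun y v w =>
      (christoffel_connectionOfChristoffel (K := T.chr) y v w).trans (T.chr_symm y w v)
    rw [h2, h3] at h1
    exact h1
  have hq : ∀ b, (modelChart ιQ ιM).base.d (C.q z) (mfderiv (𝓡 m) (𝓡 r) C.q z b) =
      ((SmoothChart.ofEquiv ιQ).d z b).1 := (modelChart ιQ ιM).d_q (z := z) trivial
  unfold CotangentPrincipalBundle.killing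
  rw [hform, hform, hq, hq, T.chr_symm _ ((SmoothChart.ofEquiv ιQ).d z b).1]
  ring

/-- The transformation law of the linear model: a translation adds `β` to the covector variable,
so the metric changes by twice the symmetrized `Dβ`, from the pairing of the new components, and
by `-2 β Γ`, from the affine term. Together they are the Killing operator. -/
theorem modelMetric_translation {α : (modelBundle ιQ ιM).PullbackForm}
    (hα : (modelBundle ιQ ιM).SmoothForm α) (x : euclideanMfd n) (a b : TangentSpace (𝓡 n) x) :
    (modelMetric ιM T).form ((modelBundle ιQ ιM).translation α x)
        (mfderiv (𝓡 n) (𝓡 n) ((modelBundle ιQ ιM).translation α) x a)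
        (mfderiv (𝓡 n) (𝓡 n) ((modelBundle ιQ ιM).translation α) x b) =
      (modelMetric ιM T).form x a b + (modelBundle ιQ ιM).killing (modelConnection T) α
        ((modelBundle ιQ ιM).p x) (mfderiv (𝓡 n) (𝓡 m) (modelBundle ιQ ιM).p x a)
        (mfderiv (𝓡 n) (𝓡 m) (modelBundle ιQ ιM).p x b) := by
  obtain ⟨β, hβ, hβα, hkill⟩ := killing_modelConnection ιQ ιM T hα
  let C := modelBundle ιQ ιM
  let κ := SmoothChart.ofEquiv ιM
  have hp : ∀ a, (SmoothChart.ofEquiv ιQ).d (C.p x) (mfderiv (𝓡 n) (𝓡 m) C.p x a) = (κ.d x a).1 :=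
    (modelChart ιQ ιM).d_p (x := x) trivial
  have hz : ∀ x, SmoothChart.ofEquiv ιQ (C.p x) = (κ x).1 := modelP_eq ιQ ιM
  let F : (EuclideanSpace ℝ (Fin r) × EuclideanSpace ℝ (Fin l)) ×
      (EuclideanSpace ℝ (Fin r) →L[ℝ] ℝ) →
      (EuclideanSpace ℝ (Fin r) × EuclideanSpace ℝ (Fin l)) × (EuclideanSpace ℝ (Fin r) →L[ℝ] ℝ) :=
    fun w => (w.1, β w.1 + w.2)
  have hF : ContDiff ℝ ∞ F := contDiff_fst.prodMk ((hβ.comp contDiff_fst).add contDiff_snd)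
  have hT : ∀ y, κ (C.translation α y) = F (κ y) := by
    intro y
    refine (modelBundle_translate ιQ ιM y (α (C.p y))).trans ?_
    rw [hβα, hz]
    rfl
  have hTm : MDifferentiableAt (𝓡 n) (𝓡 n) (C.translation α) x := by
    have h1 : ContMDiff (𝓡 n) (𝓡 n) ∞ (fun y : EuclideanSpace ℝ (Fin n) => ιM.symm (F (ιM y))) :=
      (ιM.symm.contDiff.comp (hF.comp ιM.contDiff)).contMDiff
    have h2 : C.translation α = fun y : EuclideanSpace ℝ (Fin n) => ιM.symm (F (ιM y)) := by
      funext y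
      refine ιM.injective ((hT y).trans ?_)
      exact (ιM.apply_symm_apply _).symm
    rw [h2]
    exact h1.mdifferentiableAt (by simp)
  have hF' : HasFDerivAt F _ (κ x) := hasFDerivAt_fst.prodMk
    (((hβ.differentiable (by simp) (κ x).1).hasFDerivAt.comp (κ x) hasFDerivAt_fst).add
      hasFDerivAt_snd)
  have hd : ∀ a, κ.d (C.translation α x) (mfderiv (𝓡 n) (𝓡 n) (C.translation α) x a) =
      κ.d x a + (0, fderiv ℝ β (κ x).1 (κ.d x a).1) := by
    intro a
    refine (κ.d_mfderiv κ hTm trivial trivial hF' (Filter.Eventually.of_forall hT) a).trans ?_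
    refine Prod.ext (add_zero _).symm ?_
    exact add_comm _ _
  have hβ0 : ∀ v : EuclideanSpace ℝ (Fin r), ((β (κ x).1 + (κ x).2) v) = β (κ x).1 v + (κ x).2 v :=
    fun v => rfl
  rw [hkill, modelMetric_form, modelMetric_form, hp, hp, hz]
  show T.gram (κ (C.translation α x)) (κ.d _ _) (κ.d _ _) = T.gram (κ x) (κ.d x a) (κ.d x b) + _
  rw [hd, hd, hT, FlatExtension.gram_apply, FlatExtension.gram_apply, FlatExtension.base_add]
  have e : ∀ (v : (EuclideanSpace ℝ (Fin r) × EuclideanSpace ℝ (Fin l)) ×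
      (EuclideanSpace ℝ (Fin r) →L[ℝ] ℝ)) (η : EuclideanSpace ℝ (Fin r) →L[ℝ] ℝ),
      (v + (0, η)).1.1 = v.1.1 := fun v η => add_zero _
  rw [e, e]
  show T.base (κ x).1 (κ.d x a) (κ.d x b) + _ + _ - 2 * ((β (κ x).1 + (κ x).2)
    (T.chr (κ x).1.1 (κ.d x a).1.1 (κ.d x b).1.1)) = _
  rw [hβ0]
  ring

theorem isRiemannPullbackExtension_modelMetric :
    IsRiemannPullbackExtension (modelBundle ιQ ιM) (modelConnection T)
      (modelVerticalMetric ιQ ιM T) (modelMetric ιM T) where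
  standardType := modelMetric_fibreVector ιQ ιM T
  transformation _ hα := modelMetric_translation ιQ ιM T hα
  restricts := restrictsToPullback_modelMetric ιQ ιM T

end ModelExtension

/-! ### Null boxes are pullback-extensions -/

section LocalModel

variable {n : ℕ} {M : Mfd.{u} n} {r l : ℕ}

namespace SmoothChart.IsNullBox

variable {κ : SmoothChart M ((EuclideanSpace ℝ (Fin r) ×
    EuclideanSpace ℝ (Fin l)) × (EuclideanSpace ℝ (Fin r) →L[ℝ] ℝ))} {g : PseudoRiemannianMetric M}
    {P : SubspaceField M} {nabla : Connection M}

theorem _root_.SmoothChart.contDiffOn_christoffel_apply {E : Type*} [NormedAddCommGroup E]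
    [NormedSpace ℝ E] [FiniteDimensional ℝ E] (κ : SmoothChart M E) {nabla : Connection M}
    (h : IsTorsionFreeConnection nabla) (a b : E) :
    ContDiffOn ℝ ∞ (fun w => κ.christoffel nabla w a b) κ.target :=
  ((κ.contDiffOn_christoffel h.smooth).clm_apply contDiffOn_const).clm_apply contDiffOn_const

/-- The connection and the metric of a null box along the zero section. -/
def flatExtension (hκ : κ.IsNullBox g P) (hn : IsLeviCivita g nabla) : FlatExtension r l where
  chr s := conjBilin
    ((ContinuousLinearMap.fst ℝ (EuclideanSpace ℝ (Fin r))
      (EuclideanSpace ℝ (Fin l))).comp (ContinuousLinearMap.fst ℝ (EuclideanSpace ℝ (Fin r) ×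
      EuclideanSpace ℝ (Fin l)) (EuclideanSpace ℝ (Fin r) →L[ℝ] ℝ)))
    ((ContinuousLinearMap.inl ℝ (EuclideanSpace ℝ (Fin r) × EuclideanSpace ℝ (Fin l))
      (EuclideanSpace ℝ (Fin r) →L[ℝ] ℝ)).comp (ContinuousLinearMap.inl ℝ (EuclideanSpace ℝ (Fin r))
      (EuclideanSpace ℝ (Fin l)))) (κ.christoffel nabla ((s, 0), 0))
  base c := κ.gram g (c, 0)
  contDiff_chr := by
    rw [contDiff_clm_apply_iff]
    intro a
    rw [contDiff_clm_apply_iff]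
    intro b
    rw [← contDiffOn_univ]
    have h1 : ContDiff ℝ ∞ fun s : EuclideanSpace ℝ (Fin r) =>
        (((s, 0), 0) : (EuclideanSpace ℝ (Fin r) × EuclideanSpace ℝ (Fin l)) ×
          (EuclideanSpace ℝ (Fin r) →L[ℝ] ℝ)) :=
      (contDiff_id.prodMk contDiff_const).prodMk contDiff_const
    exact (contDiff_fst.comp contDiff_fst).comp_contDiffOn ((κ.contDiffOn_christoffel_apply
      hn.torsionFree ((b, 0), 0) ((a, 0), 0)).comp h1.contDiffOn fun s _ => hκ.zero_mem (s, 0))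
  chr_symm s a b := congrArg (fun v => v.1.1)
    (κ.christoffel_symm hn.torsionFree.torsion_eq_zero (hκ.zero_mem (s, 0)) ((b, 0), 0) ((a, 0), 0))
  contDiff_base a b := by
    rw [← contDiffOn_univ]
    exact (κ.contDiffOn_gram_apply g a b).comp (contDiff_id.prodMk contDiff_const).contDiffOn
      fun c _ => hκ.zero_mem c
  base_symm c a b := κ.gram_symm g (c, 0) a b
  base_nondegenerate c a h := κ.gram_nondegenerate g (hκ.zero_mem c) h
  base_vertical c η b := hκ.gram_vertical _ (hκ.zero_mem c) η b

theorem flatExtension_chr (hκ : κ.IsNullBox g P) (hn : IsLeviCivita g nabla)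
    (s a b : EuclideanSpace ℝ (Fin r)) : (hκ.flatExtension hn).chr s a b =
      (κ.christoffel nabla ((s, 0), 0) ((b, 0), 0) ((a, 0), 0)).1.1 := rfl

theorem gram_flatExtension (hκ : κ.IsNullBox g P) (hn : IsLeviCivita g nabla)
    (hpar : IsParallel nabla P) (hproj : IsProjectableAlong nabla P) {w} (hw : w ∈ κ.target) (a b) :
    (hκ.flatExtension hn).gram w a b = κ.gram g w a b := by
  rw [FlatExtension.gram_apply, (hκ.flatExtension hn).chr_symm, hκ.flatExtension_chr,
    hκ.gram_eq_base hn hpar hproj hw]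
  rfl

/-- The orthogonal complement of the null distribution is the kernel of the projection onto the
first factor. -/
theorem mem_orthComplement (hκ : κ.IsNullBox g P) {x : M} (hx : x ∈ κ.source)
    (a : TangentSpace (𝓡 n) x) : a ∈ orthComplement g P x ↔ (κ.d x a).1.1 = 0 := by
  constructor
  · intro h
    refine (SeparatingDual.eq_iff_forall_dual_eq (R := ℝ)).2 fun η => ?_
    have h1 : g.form x a (κ.dsymm x (0, η)) = 0 := h _ (by
      rw [hκ.straightens x hx, mem_kerP, d_dsymm hx])
    rw [← κ.gram_d g hx, d_dsymm hx, hκ.gram_vertical_right (κ.map_source hx)] at h1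
    exact h1.trans (map_zero η).symm
  · intro h b hb
    rw [hκ.straightens x hx, mem_kerP] at hb
    have h1 : κ.d x b = (0, (κ.d x b).2) := Prod.ext hb rfl
    rw [← κ.gram_d g hx, h1, hκ.gram_vertical_right (κ.map_source hx), h, map_zero]

theorem isLocalLeafSpace_orthComplement (hκ : κ.IsNullBox g P) {f : M → euclideanMfd r}
    (hf : ∀ x ∈ κ.source, f x = (κ x).1.1) :
    IsLocalLeafSpace (orthComplement g P) κ.source f := by
  obtain ⟨β, hs, ht, hβ, hβ', hβ1⟩ := hκ.exists_product
  let σ := ContinuousLinearEquiv.prodAssoc ℝ (EuclideanSpace ℝ (Fin r)) (EuclideanSpace ℝ (Fin l))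
    (EuclideanSpace ℝ (Fin r))
  refine isLocalLeafSpace_of_chart κ (β.transHomeomorph σ.toHomeomorph) hs ?_
    (σ.contDiff.comp_contDiffOn hβ) (hβ'.comp σ.symm.contDiff.contDiffOn fun y hy => ?_)
    (ContinuousLinearEquiv.refl ℝ _) (ℓ := (ContinuousLinearMap.fst ℝ _ _).comp
      (ContinuousLinearMap.fst ℝ _ _)) hf (fun w hw => ?_) fun x hx a => hκ.mem_orthComplement hx a
  · show σ.symm ⁻¹' β.target = univ
    rw [ht]
    rfl
  · rw [ht]
    trivial
  · show (β w).1.1 = w.1.1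
    rw [hβ1 w hw]

theorem finrank_eq {x : M} (hx : x ∈ κ.source) : n = (r + l) + r := by
  have e : EuclideanSpace ℝ (Fin n) ≃ₗ[ℝ] (EuclideanSpace ℝ (Fin r) × EuclideanSpace ℝ (Fin l)) ×
      (EuclideanSpace ℝ (Fin r) →L[ℝ] ℝ) :=
    LinearEquiv.ofBijective (κ.d x).toLinearMap ⟨fun a b h => κ.injective_d hx h, κ.surjective_d hx⟩
  have h1 := e.finrank_eq
  rw [Module.finrank_prod, Module.finrank_prod, finrank_dual_euclideanSpace] at h1
  simpa using h1

/-- A null box identifies the metric with a Riemann pullback-extension over vector spaces. -/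
theorem exists_pullback_extension (hκ : κ.IsNullBox g P) (hn : IsLeviCivita g nabla)
    (hpar : IsParallel nabla P) (hproj : IsProjectableAlong nabla P) {m : ℕ}
    (ιQ : EuclideanSpace ℝ (Fin m) ≃L[ℝ] EuclideanSpace ℝ (Fin r) × EuclideanSpace ℝ (Fin l))
    (ιM : EuclideanSpace ℝ (Fin n) ≃L[ℝ] (EuclideanSpace ℝ (Fin r) × EuclideanSpace ℝ (Fin l)) ×
      (EuclideanSpace ℝ (Fin r) →L[ℝ] ℝ)) :
    ∃ (C : CotangentPrincipalBundle (euclideanMfd n) (euclideanMfd m) (euclideanMfd r))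
      (D : Connection (euclideanMfd r)) (h : VerticalMetric (C.q : euclideanMfd m → euclideanMfd r))
      (g' : PseudoRiemannianMetric (euclideanMfd n)) (Φ : OpenPartialHomeomorph M (euclideanMfd n)),
      IsTorsionFreeConnection D ∧
      IsRiemannPullbackExtension C D h g' ∧
      Φ.source = κ.source ∧
      ContMDiffOn (𝓡 n) (𝓡 n) ∞ Φ Φ.source ∧
      ContMDiffOn (𝓡 n) (𝓡 n) ∞ Φ.symm Φ.target ∧
      (∀ y ∈ Φ.source, ∀ a b : TangentSpace (𝓡 n) y,
        g.form y a b =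
          g'.form (Φ y) (mfderiv (𝓡 n) (𝓡 n) Φ y a) (mfderiv (𝓡 n) (𝓡 n) Φ y b)) ∧
      (∀ y ∈ Φ.source, ∀ a : TangentSpace (𝓡 n) y,
        a ∈ P y ↔ mfderiv (𝓡 n) (𝓡 n) Φ y a ∈ vertical C.p (Φ y)) ∧
      IsLocalLeafSpace P Φ.source (fun y => C.p (Φ y)) ∧
      IsLocalLeafSpace (orthComplement g P) Φ.source (fun y => C.proj (Φ y)) ∧
      ProjectsOnto nabla Φ.source (fun y => C.proj (Φ y)) D ∧
      ArisesFrom g Φ.source (fun y => C.p (Φ y)) C.q h := by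
  let T := hκ.flatExtension hn
  let C := modelBundle ιQ ιM
  let A := modelChart ιQ ιM
  let Φ : OpenPartialHomeomorph M (euclideanMfd n) :=
    κ.toOpenPartialHomeomorph.transHomeomorph ιM.symm.toHomeomorph
  have hΦκ : ∀ y, SmoothChart.ofEquiv ιM (Φ y) = κ y := fun y => ιM.apply_symm_apply (κ y)
  have hΦ : ContMDiffOn (𝓡 n) (𝓡 n) ∞ Φ Φ.source :=
    (ιM.symm.contDiff.contMDiff).comp_contMDiffOn κ.contMDiffOn
  have hΦ' : ContMDiffOn (𝓡 n) (𝓡 n) ∞ Φ.symm Φ.target :=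
    κ.contMDiffOn_symm.comp (ιM.contDiff.contMDiff).contMDiffOn fun y hy => hy
  have hmd : ∀ y ∈ κ.source, MDifferentiableAt (𝓡 n) (𝓡 n) Φ y := fun y hy =>
    (hΦ.contMDiffAt (κ.open_source.mem_nhds hy)).mdifferentiableAt (by simp)
  have hd : ∀ y ∈ κ.source, ∀ a, (SmoothChart.ofEquiv ιM).d (Φ y) (mfderiv (𝓡 n) (𝓡 n) Φ y a) =
      κ.d y a := fun y hy a =>
    κ.d_mfderiv (SmoothChart.ofEquiv ιM) (hmd y hy) hy trivial (hasFDerivAt_id (κ y))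
      (Filter.Eventually.of_forall hΦκ) a
  have hpΦ : ∀ y, SmoothChart.ofEquiv ιQ (C.p (Φ y)) = (κ y).1 := fun y =>
    (modelP_eq ιQ ιM (Φ y)).trans (congrArg Prod.fst (hΦκ y))
  have hprojΦ : ∀ y, A.base (C.proj (Φ y)) = (κ y).1.1 := fun y => congrArg Prod.fst (hpΦ y)
  have hleaf : IsLocalLeafSpace P κ.source (fun y => C.p (Φ y)) :=
    hκ.isLocalLeafSpace ιQ fun x _ => hpΦ x
  have hleaf' : IsLocalLeafSpace (orthComplement g P) κ.source (fun y => C.proj (Φ y)) :=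
    hκ.isLocalLeafSpace_orthComplement fun x _ => hprojΦ x
  have hdp : ∀ y ∈ κ.source, ∀ a, (SmoothChart.ofEquiv ιQ).d (C.p (Φ y))
      (mfderiv (𝓡 n) (𝓡 m) (fun y => C.p (Φ y)) y a) = (κ.d y a).1 := fun y hy a =>
    κ.d_mfderiv (SmoothChart.ofEquiv ιQ) (F := fun w => w.1)
      ((hleaf.bundle.contMDiffOn.contMDiffAt (κ.open_source.mem_nhds hy)).mdifferentiableAt
        (by simp)) hy trivial hasFDerivAt_fst (Filter.Eventually.of_forall hpΦ) a
  refine ⟨C, modelConnection T, modelVerticalMetric ιQ ιM T, modelMetric ιM T, Φ,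
    isTorsionFreeConnection_connectionOfChristoffel T.contDiff_chr T.chr_symm,
    isRiemannPullbackExtension_modelMetric ιQ ιM T, rfl, hΦ, hΦ', fun y hy a b => ?_,
    fun y hy a => ?_, hleaf, hleaf', ?_, ?_⟩
  · rw [modelMetric_form, hd y hy, hd y hy, hΦκ,
      hκ.gram_flatExtension hn hpar hproj (κ.map_source hy), κ.gram_d g hy]
  · rw [A.mem_vertical_p (x := Φ y) trivial, hκ.straightens y hy, mem_kerP]
    exact Eq.congr_left (congrArg Prod.fst (hd y hy a).symm)
  · refine projectsOnto_of_charts (fun x hx => (hleaf'.bundle.contMDiffOn.contMDiffAt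
      (κ.open_source.mem_nhds hx)).mdifferentiableAt (by simp)) fun x hx => ⟨_, _, _, _, _, _, κ,
        A.base, (ContinuousLinearMap.fst ℝ _ _).comp (ContinuousLinearMap.fst ℝ _ _), hx,
        fun y _ => ⟨trivial, hprojΦ y⟩, fun a b => ?_⟩
    refine (hκ.christoffel_eq_base hn hpar hproj (κ.map_source hx) a b).trans ?_
    exact (christoffel_connectionOfChristoffel (K := T.chr) (κ x).1.1 a.1.1 b.1.1).symm
  · refine arisesFrom_of_surjective (fun x hx a b ha hb => ?_) fun x hx b => ?_
    · have hx' : x ∈ κ.source := hx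
      rw [modelVerticalMetric_form, hdp x hx', hdp x hx', hpΦ]
      rw [mem_vertical_modelQ, hdp x hx'] at ha hb
      have h1 : T.chr (κ x).1.1 0 0 = 0 := map_zero _
      rw [← κ.gram_d g hx', ← hκ.gram_flatExtension hn hpar hproj (κ.map_source hx'),
        FlatExtension.gram_apply, ha, hb, h1, map_zero, mul_zero, sub_zero,
        T.base_eq_of_kerProj _ _ _ ha hb]
    · have hx' : x ∈ κ.source := hx
      refine ⟨κ.dsymm x ((SmoothChart.ofEquiv ιQ).d _ b, 0),
        (SmoothChart.ofEquiv ιQ).injective_d (x := C.p (Φ x)) trivial ?_⟩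
      rw [hdp x hx', d_dsymm hx']

end SmoothChart.IsNullBox

/-- Around every point, a metric whose Levi-Civita connection is projectable along a null parallel
distribution is a Riemann pullback-extension. -/
theorem exists_local_pullback_extension {g : PseudoRiemannianMetric M} {nabla : Connection M}
    {P : SubspaceField M} (hn : IsLeviCivita g nabla) (hP : IsDistribution P r) (hnull : IsNull g P)
    (hpar : IsParallel nabla P) (hproj : IsProjectableAlong nabla P) (x : M) :
    ∃ (C : CotangentPrincipalBundle (euclideanMfd n) (euclideanMfd (n - r)) (euclideanMfd r))
      (D : Connection (euclideanMfd r))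
      (h : VerticalMetric (C.q : euclideanMfd (n - r) → euclideanMfd r))
      (g' : PseudoRiemannianMetric (euclideanMfd n)) (Φ : OpenPartialHomeomorph M (euclideanMfd n)),
      IsTorsionFreeConnection D ∧
      IsRiemannPullbackExtension C D h g' ∧
      x ∈ Φ.source ∧
      ContMDiffOn (𝓡 n) (𝓡 n) ∞ Φ Φ.source ∧
      ContMDiffOn (𝓡 n) (𝓡 n) ∞ Φ.symm Φ.target ∧
      (∀ y ∈ Φ.source, ∀ a b : TangentSpace (𝓡 n) y,
        g.form y a b =
          g'.form (Φ y) (mfderiv (𝓡 n) (𝓡 n) Φ y a) (mfderiv (𝓡 n) (𝓡 n) Φ y b)) ∧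
      (∀ y ∈ Φ.source, ∀ a : TangentSpace (𝓡 n) y,
        a ∈ P y ↔ mfderiv (𝓡 n) (𝓡 n) Φ y a ∈ vertical C.p (Φ y)) ∧
      IsLocalLeafSpace P Φ.source (fun y => C.p (Φ y)) ∧
      IsLocalLeafSpace (orthComplement g P) Φ.source (fun y => C.proj (Φ y)) ∧
      ProjectsOnto nabla Φ.source (fun y => C.proj (Φ y)) D ∧
      ArisesFrom g Φ.source (fun y => C.p (Φ y)) C.q h := by
  obtain ⟨l, κ, hx, hκ⟩ := exists_nullBox hn hP hnull hpar x
  have hdim := SmoothChart.IsNullBox.finrank_eq (κ := κ) hx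
  obtain ⟨C, D, h, g', Φ, h1, h2, h3, h4⟩ := hκ.exists_pullback_extension hn hpar hproj (m := n - r)
    (ContinuousLinearEquiv.ofFinrankEq (by
      rw [Module.finrank_prod, finrank_euclideanSpace_fin, finrank_euclideanSpace_fin,
        finrank_euclideanSpace_fin]
      omega))
    (ContinuousLinearEquiv.ofFinrankEq (by
      rw [Module.finrank_prod, Module.finrank_prod, finrank_dual_euclideanSpace,
        finrank_euclideanSpace_fin, finrank_euclideanSpace_fin, finrank_euclideanSpace_fin]
      exact hdim))
  exact ⟨C, D, h, g', Φ, h1, h2, by rw [h3]; exact hx, h4⟩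

end LocalModel

end

theorem theorem8p2 :
    (∀ (n m r : ℕ) (M : Mfd.{u} n) (Q : Mfd.{v} m) (S : Mfd.{w} r)
      (C : CotangentPrincipalBundle M Q S) (D : Connection S)
      (h : VerticalMetric (C.q : Q → S)) (g : PseudoRiemannianMetric M) (nabla : Connection M),
      IsTorsionFreeConnection D → IsRiemannPullbackExtension C D h g → IsLeviCivita g nabla →
        orthComplement g (vertical C.p) = vertical C.proj ∧
        orthComplement g (vertical C.proj) = vertical C.p ∧
        IsNull g (vertical C.p) ∧
        IsParallel nabla (vertical C.p) ∧
        IsProjectableAlong nabla (vertical C.p) ∧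
        IsProjectableAlong nabla (vertical C.proj) ∧
        ProjectsOnto nabla univ C.proj D ∧
        ArisesFrom g univ C.p C.q h) ∧
    (∀ (n r : ℕ) (M : Mfd.{u} n) (g : PseudoRiemannianMetric M) (nabla : Connection M)
      (P : SubspaceField M),
      IsLeviCivita g nabla → IsDistribution P r → IsNull g P → IsParallel nabla P →
      IsProjectableAlong nabla P →
      ∀ x : M, ∃ (M' : Mfd.{0} n) (Q : Mfd.{0} (n - r)) (S : Mfd.{0} r)
        (C : CotangentPrincipalBundle M' Q S) (D : Connection S)
        (h : VerticalMetric (C.q : Q → S)) (g' : PseudoRiemannianMetric M')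
        (Φ : OpenPartialHomeomorph M M'),
        IsTorsionFreeConnection D ∧
        IsRiemannPullbackExtension C D h g' ∧
        x ∈ Φ.source ∧
        ContMDiffOn (𝓡 n) (𝓡 n) ∞ Φ Φ.source ∧
        ContMDiffOn (𝓡 n) (𝓡 n) ∞ Φ.symm Φ.target ∧
        (∀ y ∈ Φ.source, ∀ a b : TangentSpace (𝓡 n) y,
          g.form y a b =
            g'.form (Φ y) (mfderiv (𝓡 n) (𝓡 n) Φ y a) (mfderiv (𝓡 n) (𝓡 n) Φ y b)) ∧
        (∀ y ∈ Φ.source, ∀ a : TangentSpace (𝓡 n) y,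
          a ∈ P y ↔ mfderiv (𝓡 n) (𝓡 n) Φ y a ∈ vertical C.p (Φ y)) ∧
        IsLocalLeafSpace P Φ.source (fun y => C.p (Φ y)) ∧
        IsLocalLeafSpace (orthComplement g P) Φ.source (fun y => C.proj (Φ y)) ∧
        ProjectsOnto nabla Φ.source (fun y => C.proj (Φ y)) D ∧
        ArisesFrom g Φ.source (fun y => C.p (Φ y)) C.q h) := by
  refine ⟨fun n m r M Q S C D h g nabla hD hg hn =>
    levi_civita_of_pullback_extension C D h g nabla hD hg hn,
    fun n r M g nabla P hn hP hnull hpar hproj x => ?_⟩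
  obtain ⟨C, D, h, g', Φ, H⟩ := exists_local_pullback_extension hn hP hnull hpar hproj x
  exact ⟨euclideanMfd n, euclideanMfd (n - r), euclideanMfd r, C, D, h, g', Φ, H⟩
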